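/- **Setting.** All algebras are over $\mathbb{C}$. Consider the orthogonal case and the symplectic case; the upper sign in $\pm$ refers to the orthogonal case and the lower one to the symplectic case. Rows and columns of $N\times N$ matrices are numbered by $-n,\dots,n$ with $0$ included if $N=2n+1$ and excluded if $N=2n$; in the symplectic case $N$ is always even. Put $\theta_{ij}=1$ in the orthogonal case and $\theta_{ij}=\operatorname{sgn} i\,\operatorname{sgn} j$ in the symplectic case, and $F_{ij}=E_{ij}-\theta_{ij}E_{-j,-i}\in\mathfrak{gl}_N$. Let $\mathfrak{g}_N=\mathfrak{o}_N$ or $\mathfrak{sp}_N$ be the Lie subalgebra of $\mathfrak{gl}_N$ spanned by the $F_{ij}$. *Twisted Yangian.* $\mathrm{Y}(\mathfrak{g}_N)$ is the associative algebra with generators $s_{ij}^{(r)}$, $r\ge1$, and the following defining relations for the series $s_{ij}(u)=\delta_{ij}+\sum_{r\ge1}s_{ij}^{(r)}u^{-r}$: $$\begin{aligned}(u^2-v^2)[s_{ij}(u),s_{kl}(v)]={}&(u+v)\big(s_{kj}(u)s_{il}(v)-s_{kj}(v)s_{il}(u)\big)\\&-(u-v)\big(\theta_{k,-j}s_{i,-k}(u)s_{-j,l}(v)-\theta_{i,-l}s_{k,-i}(v)s_{-l,j}(u)\big)\\&+\theta_{i,-j}\big(s_{k,-i}(u)s_{-j,l}(v)-s_{k,-i}(v)s_{-j,l}(u)\big),\end{aligned}$$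 $$\theta_{ij}s_{-j,-i}(-u)=s_{ij}(u)\pm\frac{s_{ij}(u)-s_{ij}(-u)}{2u}.$$ *Sklyanin minors.* For an $N\times N$ matrix $S(u)=(s_{ij}(u))$ of series in $u^{-1}$ over an algebra, put $u_i=u-i+1$, let $S_i$ be $S(u_i)$ acting in the $i$-th factor of $(\operatorname{End}\mathbb{C}^N)^{\otimes k}$, and let $R^t_{ij}=1+\frac{1}{u_i+u_j}Q_{ij}$ with $Q=\sum_{i,j}\theta_{ij}\,e_{-j,-i}\otimes e_{ji}$, where the $e_{ij}$ are the matrix units and rational functions of $u$ are expanded in $u^{-1}$. Let $A_k=\sum_{\sigma\in\mathfrak{S}_k}\operatorname{sgn}\sigma\,P_\sigma$ be the antisymmetrizer on $(\mathbb{C}^N)^{\otimes k}$. The Sklyanin minor $s^{a_1\cdots a_k}_{b_1\cdots b_k}(u)$ is the coefficient at $e_{a_1b_1}\otimes\cdots\otimes e_{a_kb_k}$ of $$A_k\,S_1(R^t_{12}\cdots R^t_{1k})\,S_2(R^t_{23}\cdots R^t_{2k})\cdots S_k .$$ Let $f^{a_1\cdots a_k}_{b_1\cdots b_k}(u)$ be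 the Sklyanin minors of the matrix with entries $f_{ij}(u)=\delta_{ij}+F_{ij}(u\pm\frac12)^{-1}$ over $\mathrm{U}(\mathfrak{g}_N)$. Set $\alpha_p(u)=1$ in the orthogonal case and $\alpha_p(u)=\dfrac{u+1/2}{u-p+1/2}$ in the symplectic case. *Centralizers.* Fix an integer $M\ge0$, even in the symplectic case, and put $m=\lfloor M/2\rfloor$. For $N=M+2k$, $k\ge0$, put $n=m+k$ and let $\mathrm{A}_M(N)$ be the centralizer in $\mathrm{U}(\mathfrak{g}_N)$ of the $F_{ij}$ with $m+1\le|i|,|j|\le n$. Let $\mathrm{I}(N)$ be the left ideal of $\mathrm{U}(\mathfrak{g}_N)$ generated by the $F_{in}$, $-n\le i\le n$, and consider the canonical map $\mathrm{U}(\mathfrak{g}_{N-2})\to\mathrm{U}(\mathfrak{g}_N)$, $F_{ij}\mapsto F_{ij}$. **Proposition 5.1.** 1. For every $N=M+2k$ with $k\ge1$ there is a unique algebra homomorphism $\pi_N:\mathrm{A}_M(N)\to\mathrm{A}_M(N-2)$ such that $x-\pi_N(x)\in\mathrm{I}(N)$ for all $x\in\mathrm{A}_M(N)$, where $\pi_N(x)$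 is regarded as an element of $\mathrm{U}(\mathfrak{g}_N)$. 2. For every $N=M+2k$ with $k\ge0$ there is a unique algebra homomorphism $\psi_N:\mathrm{Y}(\mathfrak{g}_M)\to\mathrm{A}_M(N)$ which takes $s_{ij}(u)$ to $$\alpha_{m-n}(u)\cdot f^{-n\cdots-m-1,\,i,\,m+1\cdots n}_{-n\cdots-m-1,\,j,\,m+1\cdots n}(u+n-m),\qquad -m\le i,j\le m.$$ 3. These homomorphisms are compatible with the projections: $\pi_N\circ\psi_N=\psi_{N-2}$ for all $N=M+2k$, $k\ge1$. 4. Consequently there is an algebra homomorphism $\psi:\mathrm{Y}(\mathfrak{g}_M)\to\mathrm{A}_M$, $y\mapsto(\psi_M(y),\psi_{M+2}(y),\psi_{M+4}(y),\dots)$. Here $\mathrm{A}_M$ is the projective limit of the algebras $\mathrm{A}_M(N)$ with respect to the $\pi_N$ in the category of filtered algebras, that is, the algebra of sequences $(a_N)_{N=M,M+2,\dots}$ with $a_N\in\mathrm{A}_M(N)$ and $\pi_N(a_N)=a_{N-2}$ for $N>M$, such that the degrees of the $a_N$ in the canonical filtrations of the $\mathrm{U}(\mathfrak{g}_N)$ are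 bounded. -/

import Mathlib

namespace TwistedYangian

/-- The two series of classical Lie algebras `𝔬_N` and `𝔰𝔭_N`. -/
inductive Kind : Type
  | orthogonal : Kind
  | symplectic : Kind

/-- The index set of `N × N` matrices: `{-n,…,-1,0,1,…,n}` if `N = 2n+1` and
`{-n,…,-1,1,…,n}` if `N = 2n`. -/
abbrev Idx (N : ℕ) : Type :=
  {i : ℤ // i ∈ (Finset.Icc (-((N / 2 : ℕ) : ℤ)) ((N / 2 : ℕ) : ℤ)).filter
    (fun i => i = 0 → N % 2 = 1)}

theorem mem_idx {N : ℕ} {i : ℤ} :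
    i ∈ (Finset.Icc (-((N / 2 : ℕ) : ℤ)) ((N / 2 : ℕ) : ℤ)).filter
      (fun i => i = 0 → N % 2 = 1) ↔
    (-((N / 2 : ℕ) : ℤ) ≤ i ∧ i ≤ ((N / 2 : ℕ) : ℤ)) ∧ (i = 0 → N % 2 = 1) := by
  rw [Finset.mem_filter, Finset.mem_Icc]

/-- The index `-i`. -/
def Idx.neg {N : ℕ} (i : Idx N) : Idx N :=
  ⟨-(i : ℤ), by
    have h := mem_idx.1 i.2
    rw [mem_idx]
    exact ⟨⟨by omega, by omega⟩, fun h0 => h.2 (by omega)⟩⟩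

/-- The symbol `θ_{ij}`: `1` in the orthogonal case, `sgn i · sgn j` in the symplectic case. -/
def theta {N : ℕ} : Kind → Idx N → Idx N → ℤ
  | .orthogonal, _, _ => 1
  | .symplectic, i, j => Int.sign (i : ℤ) * Int.sign (j : ℤ)

/-- The double sign `±`: upper sign in the orthogonal case, lower sign in the symplectic case. -/
def pm : Kind → ℂ
  | .orthogonal => 1
  | .symplectic => -1

/-! ### The Lie algebras `𝔤_N` -/

section LieAlgebra

attribute [local instance 100] LieRing.ofAssociativeRing

/-- `F_{ij} = E_{ij} - θ_{ij} E_{-j,-i}` as an element of `𝔤𝔩_N`. -/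
noncomputable def Fmat (t : Kind) {N : ℕ} (i j : Idx N) : Matrix (Idx N) (Idx N) ℂ :=
  Matrix.single i j 1 - (theta t i j : ℂ) • Matrix.single j.neg i.neg 1

/-- `𝔤_N`: the Lie subalgebra of `𝔤𝔩_N` generated by the `F_{ij}`. (In the orthogonal case, and in
the symplectic case with `N` even, the linear span of the `F_{ij}` is closed under the bracket, so
this is the subalgebra spanned by the `F_{ij}`.) -/
noncomputable def g (t : Kind) (N : ℕ) : LieSubalgebra ℂ (Matrix (Idx N) (Idx N) ℂ) :=
  LieSubalgebra.lieSpan ℂ _ (Set.range fun p : Idx N × Idx N => Fmat t p.1 p.2)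

/-- `F_{ij}` as an element of `𝔤_N`. -/
noncomputable def F (t : Kind) {N : ℕ} (i j : Idx N) : g t N :=
  ⟨Fmat t i j, LieSubalgebra.subset_lieSpan ⟨(i, j), rfl⟩⟩

/-- The index set of `N × N` matrices is contained in that of `(N+2) × (N+2)` matrices. -/
def Idx.incl {N : ℕ} (i : Idx N) : Idx (N + 2) :=
  ⟨(i : ℤ), by
    have h := mem_idx.1 i.2
    rw [mem_idx]
    exact ⟨⟨by omega, by omega⟩, fun h0 => by have := h.2 h0; omega⟩⟩

theorem Idx.incl_neg {N : ℕ} (i : Idx N) : i.neg.incl = i.incl.neg := rfl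

theorem Idx.incl_injective {N : ℕ} : Function.Injective (Idx.incl (N := N)) := fun i j h =>
  Subtype.ext (by simpa only [Idx.incl, Subtype.mk.injEq] using h)

theorem theta_incl (t : Kind) {N : ℕ} (i j : Idx N) : theta t i.incl j.incl = theta t i j := by
  cases t <;> rfl

/-- The matrix of the inclusion `ℂ^N → ℂ^{N+2}` of coordinate subspaces. -/
def inclMatrix (N : ℕ) : Matrix (Idx (N + 2)) (Idx N) ℂ :=
  Matrix.of fun a i => if a = i.incl then 1 else 0

theorem inclMatrix_transpose_mul (N : ℕ) : (inclMatrix N).transpose * inclMatrix N = 1 := by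
  ext i j
  simp [Matrix.mul_apply, inclMatrix, Matrix.one_apply, Idx.incl_injective.eq_iff, eq_comm]

theorem inclMatrix_single {N : ℕ} (i j : Idx N) :
    inclMatrix N * Matrix.single i j (1 : ℂ) * (inclMatrix N).transpose
      = Matrix.single i.incl j.incl 1 := by
  ext a b
  rw [Matrix.mul_apply, Finset.sum_eq_single j]
  · rw [Matrix.mul_apply, Finset.sum_eq_single i]
    · simp only [inclMatrix, Matrix.of_apply, Matrix.transpose_apply, Matrix.single_apply, true_and,
        if_true, mul_one, ite_and, @eq_comm _ i.incl a, @eq_comm _ j.incl b]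
      split_ifs <;> simp
    · intro c _ hc
      simp [hc.symm]
    · simp
  · intro c _ hc
    rw [Matrix.mul_apply, Finset.sum_eq_zero, zero_mul]
    intro d _
    simp [hc.symm]
  · simp

/-- The inclusion `𝔤𝔩_N ⊂ 𝔤𝔩_{N+2}`, `E_{ij} ↦ E_{ij}` (extension of matrices by zero). -/
noncomputable def glIncl (N : ℕ) :
    Matrix (Idx N) (Idx N) ℂ →ₗ⁅ℂ⁆ Matrix (Idx (N + 2)) (Idx (N + 2)) ℂ where
  toFun X := inclMatrix N * X * (inclMatrix N).transpose
  map_add' X Y := by rw [Matrix.mul_add, Matrix.add_mul]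
  map_smul' c X := by simp
  map_lie' := by
    intro X Y
    have key : ∀ X Y : Matrix (Idx N) (Idx N) ℂ,
        inclMatrix N * X * (inclMatrix N).transpose * (inclMatrix N * Y * (inclMatrix N).transpose)
          = inclMatrix N * (X * Y) * (inclMatrix N).transpose := by
      intro X Y
      calc _ = inclMatrix N * X * ((inclMatrix N).transpose * inclMatrix N) * Y
              * (inclMatrix N).transpose := by simp only [Matrix.mul_assoc]
        _ = _ := by rw [inclMatrix_transpose_mul]; simp only [Matrix.mul_assoc, Matrix.one_mul]
    simp only [LieRing.of_associative_ring_bracket, Matrix.mul_sub, Matrix.sub_mul, key]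

theorem glIncl_Fmat (t : Kind) {N : ℕ} (i j : Idx N) :
    glIncl N (Fmat t i j) = Fmat t i.incl j.incl := by
  have h : ∀ i j : Idx N, glIncl N (Matrix.single i j 1) = Matrix.single i.incl j.incl 1 :=
    inclMatrix_single
  simp only [Fmat, map_sub, map_smul, h, theta_incl, Idx.incl_neg]

theorem glIncl_mem (t : Kind) {N : ℕ} (X : g t N) :
    glIncl N (X : Matrix (Idx N) (Idx N) ℂ) ∈ g t (N + 2) := by
  have h : g t N ≤ (g t (N + 2)).comap (glIncl N) := by
    refine LieSubalgebra.lieSpan_le.2 ?_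
    rintro _ ⟨⟨i, j⟩, rfl⟩
    change glIncl N (Fmat t i j) ∈ g t (N + 2)
    rw [glIncl_Fmat]
    exact (F t i.incl j.incl).2
  exact h X.2

/-- The inclusion `𝔤_N ⊂ 𝔤_{N+2}`, `F_{ij} ↦ F_{ij}`. -/
noncomputable def gIncl (t : Kind) (N : ℕ) : g t N →ₗ⁅ℂ⁆ g t (N + 2) where
  toFun X := ⟨glIncl N X, glIncl_mem t X⟩
  map_add' X Y := Subtype.ext (map_add (glIncl N) _ _)
  map_smul' c X := Subtype.ext (map_smul (glIncl N) _ _)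
  map_lie' := by
    intro X Y
    exact Subtype.ext (LieHom.map_lie (glIncl N) _ _)

/-- The universal enveloping algebra `U(𝔤_N)`. -/
abbrev U (t : Kind) (N : ℕ) : Type := UniversalEnvelopingAlgebra ℂ (g t N)

/-- `F_{ij}` as an element of `U(𝔤_N)`. -/
noncomputable def FU (t : Kind) {N : ℕ} (i j : Idx N) : U t N :=
  UniversalEnvelopingAlgebra.ι ℂ (F t i j)

/-- The canonical homomorphism `U(𝔤_N) → U(𝔤_{N+2})`, `F_{ij} ↦ F_{ij}`. -/
noncomputable def UIncl (t : Kind) (N : ℕ) : U t N →ₐ[ℂ] U t (N + 2) :=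
  UniversalEnvelopingAlgebra.lift ℂ ((UniversalEnvelopingAlgebra.ι ℂ).comp (gIncl t N))

/-- The canonical filtration of `U(𝔤_N)`: the span of the products of at most `d` elements
of `𝔤_N`. -/
noncomputable def UFil (t : Kind) (N d : ℕ) : Submodule ℂ (U t N) :=
  (1 ⊔ LinearMap.range (UniversalEnvelopingAlgebra.ι ℂ : g t N →ₗ⁅ℂ⁆ U t N).toLinearMap) ^ d

theorem UFil_mono (t : Kind) (N : ℕ) : Monotone (UFil t N) := fun _ _ h =>
  pow_le_pow_right' le_sup_left h

theorem UFil_mul (t : Kind) (N : ℕ) {d e : ℕ} {x y : U t N} (hx : x ∈ UFil t N d)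
    (hy : y ∈ UFil t N e) : x * y ∈ UFil t N (d + e) := by
  rw [UFil, pow_add]
  exact Submodule.mul_mem_mul hx hy

end LieAlgebra

/-! ### Formal series in `u⁻¹`

A series `∑ a_r u^{-r}` with coefficients in an algebra `A` is the power series `∑ a_r X^r`, so that
`X` stands for `u⁻¹`. -/

section Series

open PowerSeries

/-- The expansion `u⁻¹ - c u⁻² + c² u⁻³ - ⋯` of `(u + c)⁻¹`. -/
noncomputable def invShift (c : ℂ) : ℂ⟦X⟧ := X * PowerSeries.mk fun j => (-c) ^ j

/-- The series with complex coefficients, viewed as a series with coefficients in `A`. -/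
noncomputable def toSeries (A : Type*) [Ring A] [Algebra ℂ A] : ℂ⟦X⟧ →+* A⟦X⟧ :=
  PowerSeries.map (algebraMap ℂ A)

/-- `a(u + c) = ∑ a_r (u + c)^{-r}`, re-expanded in powers of `u⁻¹`. -/
noncomputable def shift {A : Type*} [Ring A] [Algebra ℂ A] (c : ℂ) (a : A⟦X⟧) : A⟦X⟧ :=
  PowerSeries.mk fun p => ∑ r ∈ Finset.range (p + 1), coeff p (invShift c ^ r) • coeff r a

/-- `a(-u) = ∑ a_r (-u)^{-r}`. -/
noncomputable def reflect {A : Type*} [Ring A] (a : A⟦X⟧) : A⟦X⟧ :=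
  PowerSeries.mk fun r => (-1) ^ r * coeff r a

/-- The series `α_p(u)`: `1` in the orthogonal case and
`(u + 1/2) / (u - p + 1/2) = (1 + u⁻¹/2) · u · (u - p + 1/2)⁻¹` in the symplectic case. -/
noncomputable def alpha : Kind → ℤ → ℂ⟦X⟧
  | .orthogonal, _ => 1
  | .symplectic, p => (1 + C (1 / 2) * X) * PowerSeries.mk fun j => ((p : ℂ) - 1 / 2) ^ j

end Series

/-! ### Sklyanin minors -/

section Minors

open PowerSeries

variable {A : Type*} [Ring A] [Algebra ℂ A]

/-- The matrix `S_p(u_p)`, `u_p = u - p` for `p = 0, 1, …, k-1`, in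
`A⟦u⁻¹⟧ ⊗ (End ℂ^N)^{⊗k}`: the matrix `S(u - p)` acting in the `p`-th tensor factor. The algebra
`A⟦u⁻¹⟧ ⊗ (End ℂ^N)^{⊗k}` is the algebra of matrices with rows and columns numbered by `k`-tuples
of indices; `x ⊗ e_{a₁b₁} ⊗ ⋯ ⊗ e_{a_kb_k}` has the entry `x` at the place `(a, b)`. -/
noncomputable def tensorS {N : ℕ} (S : Matrix (Idx N) (Idx N) A⟦X⟧) {k : ℕ} (p : Fin k) :
    Matrix (Fin k → Idx N) (Fin k → Idx N) A⟦X⟧ :=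
  Matrix.of fun a b =>
    if ∀ q, q ≠ p → a q = b q then shift (-((p : ℕ) : ℂ)) (S (a p) (b p)) else 0

/-- The operator `Q_{pq}`, where `Q = ∑ θ_{ij} e_{-j,-i} ⊗ e_{ji}`. -/
noncomputable def tensorQ (A : Type*) [Ring A] (t : Kind) {N k : ℕ} (p q : Fin k) :
    Matrix (Fin k → Idx N) (Fin k → Idx N) A⟦X⟧ :=
  Matrix.of fun a b =>
    if (∀ r, r ≠ p → r ≠ q → a r = b r) ∧ a p = (a q).neg ∧ b p = (b q).neg then
      (theta t (b q) (a q) : A⟦X⟧) else 0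

/-- `R^t_{pq}(-u_p - u_q) = 1 + Q_{pq} (u_p + u_q)⁻¹` at `u_p = u - p`, `u_q = u - q`, where
`(u_p + u_q)⁻¹ = (2u - p - q)⁻¹ = 1/2 · (u - (p + q)/2)⁻¹`. -/
noncomputable def tensorR (A : Type*) [Ring A] [Algebra ℂ A] (t : Kind) {N k : ℕ} (p q : Fin k) :
    Matrix (Fin k → Idx N) (Fin k → Idx N) A⟦X⟧ :=
  1 + toSeries A (C (1 / 2) * invShift (-((((p : ℕ) : ℂ) + ((q : ℕ) : ℂ)) / 2))) •
    tensorQ A t p q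

/-- `⟨S_1,…,S_k⟩ = S_1 (R^t_{12} ⋯ R^t_{1k}) S_2 (R^t_{23} ⋯ R^t_{2k}) ⋯ S_k`. -/
noncomputable def bracketS (t : Kind) {N : ℕ} (S : Matrix (Idx N) (Idx N) A⟦X⟧) (k : ℕ) :
    Matrix (Fin k → Idx N) (Fin k → Idx N) A⟦X⟧ :=
  ((List.finRange k).map fun p =>
    tensorS S p * (((List.finRange k).filter fun q => p < q).map fun q =>
      tensorR A t p q).prod).prod

/-- The anti-symmetrization operator `A_k = ∑_σ sgn σ · P_σ` on `(ℂ^N)^{⊗k}`. -/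
noncomputable def antiSymmetrizer (A : Type*) [Ring A] (N k : ℕ) :
    Matrix (Fin k → Idx N) (Fin k → Idx N) A⟦X⟧ :=
  ∑ σ : Equiv.Perm (Fin k), Matrix.of fun a b =>
    if a ∘ σ = b then ((Equiv.Perm.sign σ : ℤ) : A⟦X⟧) else 0

/-- The Sklyanin minor `s^{a_1⋯a_k}_{b_1⋯b_k}(u)` of the matrix `S(u)`: the matrix element of
`A_k ⟨S_1,…,S_k⟩` at `e_{a_1b_1} ⊗ ⋯ ⊗ e_{a_kb_k}`. -/
noncomputable def sklyaninMinor (t : Kind) {N : ℕ} (S : Matrix (Idx N) (Idx N) A⟦X⟧) {k : ℕ}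
    (a b : Fin k → Idx N) : A⟦X⟧ :=
  (antiSymmetrizer A N k * bracketS t S k) a b

end Minors

/-! ### The twisted Yangian -/

section Yangian

open PowerSeries

/-- The generators `s_{ij}^{(r+1)}`, `r = 0, 1, 2, …`. -/
abbrev Gen (N : ℕ) : Type := Idx N × Idx N × ℕ

/-- The series `δ_{ij} + s_{ij}^{(1)} u⁻¹ + s_{ij}^{(2)} u⁻² + ⋯` over the free algebra. -/
noncomputable def freeS {N : ℕ} (i j : Idx N) : (FreeAlgebra ℂ (Gen N))⟦X⟧ :=
  PowerSeries.mk fun r => match r with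
    | 0 => if i = j then 1 else 0
    | r + 1 => FreeAlgebra.ι ℂ (i, j, r)

/-- `a(u)` as a series in `u⁻¹` and `v⁻¹`; elements of `A⟦X⟧⟦X⟧` are read as power series in
`v⁻¹` (the outer variable) with coefficients in `A⟦u⁻¹⟧`. -/
noncomputable def inU {A : Type*} [Ring A] (a : A⟦X⟧) : A⟦X⟧⟦X⟧ := C a

/-- `a(v)` as a series in `u⁻¹` and `v⁻¹`. -/
noncomputable def inV {A : Type*} [Ring A] (a : A⟦X⟧) : A⟦X⟧⟦X⟧ := PowerSeries.map C a

/-- The left-hand side `(u² - v²)[s_{ij}(u), s_{kl}(v)]` of the defining relation, multiplied by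
`u⁻² v⁻²` so that it is a power series in `x = u⁻¹` and `y = v⁻¹`:
`u² - v²` becomes `y² - x²`. -/
noncomputable def quadLHS {N : ℕ} {A : Type*} [Ring A] (S : Idx N → Idx N → A⟦X⟧)
    (i j k l : Idx N) : A⟦X⟧⟦X⟧ :=
  let x : A⟦X⟧⟦X⟧ := inU X
  let y : A⟦X⟧⟦X⟧ := inV X
  (y ^ 2 - x ^ 2) * (inU (S i j) * inV (S k l) - inV (S k l) * inU (S i j))

/-- The right-hand side
`(u+v)(s_{kj}(u)s_{il}(v) - s_{kj}(v)s_{il}(u))`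
`- (u-v)(θ_{k,-j} s_{i,-k}(u)s_{-j,l}(v) - θ_{i,-l} s_{k,-i}(v)s_{-l,j}(u))`
`+ θ_{i,-j}(s_{k,-i}(u)s_{-j,l}(v) - s_{k,-i}(v)s_{-j,l}(u))`
of the defining relation, multiplied by `u⁻² v⁻²`: with `x = u⁻¹` and `y = v⁻¹`, the factors
`u + v`, `u - v`, `1` become `xy(x + y)`, `xy(y - x)`, `x²y²`. -/
noncomputable def quadRHS (t : Kind) {N : ℕ} {A : Type*} [Ring A] (S : Idx N → Idx N → A⟦X⟧)
    (i j k l : Idx N) : A⟦X⟧⟦X⟧ :=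
  let x : A⟦X⟧⟦X⟧ := inU X
  let y : A⟦X⟧⟦X⟧ := inV X
  x * y * (x + y) * (inU (S k j) * inV (S i l) - inV (S k j) * inU (S i l))
  - x * y * (y - x) *
    ((theta t k j.neg : A⟦X⟧⟦X⟧) * (inU (S i k.neg) * inV (S j.neg l))
      - (theta t i l.neg : A⟦X⟧⟦X⟧) * (inV (S k i.neg) * inU (S l.neg j)))
  + x ^ 2 * y ^ 2 * (theta t i j.neg : A⟦X⟧⟦X⟧) *
    (inU (S k i.neg) * inV (S j.neg l) - inV (S k i.neg) * inU (S j.neg l))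

/-- The left-hand side `θ_{ij} s_{-j,-i}(-u)` of the symmetry relation. -/
noncomputable def symmLHS (t : Kind) {N : ℕ} {A : Type*} [Ring A]
    (S : Idx N → Idx N → A⟦X⟧) (i j : Idx N) : A⟦X⟧ :=
  (theta t i j : A⟦X⟧) * reflect (S j.neg i.neg)

/-- The right-hand side `s_{ij}(u) ± (s_{ij}(u) - s_{ij}(-u)) / (2u)` of the symmetry relation. -/
noncomputable def symmRHS (t : Kind) {N : ℕ} {A : Type*} [Ring A] [Algebra ℂ A]
    (S : Idx N → Idx N → A⟦X⟧) (i j : Idx N) : A⟦X⟧ :=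
  S i j + toSeries A (C (pm t / 2) * X) * (S i j - reflect (S i j))

/-- The defining relations of the twisted Yangian, coefficient by coefficient. -/
inductive YRel (t : Kind) (N : ℕ) : FreeAlgebra ℂ (Gen N) → FreeAlgebra ℂ (Gen N) → Prop
  | quad (i j k l : Idx N) (p q : ℕ) :
      YRel t N (coeff p (coeff q (quadLHS freeS i j k l)))
        (coeff p (coeff q (quadRHS t freeS i j k l)))
  | symm (i j : Idx N) (p : ℕ) :
      YRel t N (coeff p (symmLHS t freeS i j)) (coeff p (symmRHS t freeS i j))

/-- The twisted Yangian `Y(𝔤_N)`. -/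
abbrev Y (t : Kind) (N : ℕ) : Type := RingQuot (YRel t N)

/-- The generating series `s_{ij}(u)` with coefficients in `Y(𝔤_N)`. -/
noncomputable def sSeries (t : Kind) {N : ℕ} (i j : Idx N) : (Y t N)⟦X⟧ :=
  PowerSeries.map (RingQuot.mkAlgHom ℂ (YRel t N)).toRingHom (freeS i j)

end Yangian

/-! ### The centralizers, the projections and the Olshanski algebra -/

section Centralizer

/-- `A_M(N)`: the centralizer in `U(𝔤_N)` of the subalgebra `𝔤'_{N-M}` spanned by the `F_{ij}`
with `m + 1 ≤ |i|, |j| ≤ n`, where `m = ⌊M/2⌋`. -/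
noncomputable def centralizerAlg (t : Kind) (M N : ℕ) : Subalgebra ℂ (U t N) :=
  Subalgebra.centralizer ℂ
    {x | ∃ i j : Idx N, M / 2 + 1 ≤ (i : ℤ).natAbs ∧ M / 2 + 1 ≤ (j : ℤ).natAbs ∧ x = FU t i j}

/-- `I(N)`: the left ideal of `U(𝔤_N)` generated by the elements `F_{in}`, `n = ⌊N/2⌋`. -/
noncomputable def leftIdeal (t : Kind) (N : ℕ) : Ideal (U t N) :=
  Ideal.span {x | ∃ i j : Idx N, (j : ℤ) = ((N / 2 : ℕ) : ℤ) ∧ x = FU t i j}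

/-- `p` is the projection `π_{N+2} : A_M(N+2) → A_M(N)` along the ideal `I(N+2)`: every
`x ∈ A_M(N+2)` is congruent modulo `I(N+2)` to its image `p x ∈ A_M(N) ⊂ U(𝔤_N) ⊂ U(𝔤_{N+2})`. -/
def IsProjection (t : Kind) (M N : ℕ)
    (p : centralizerAlg t M (N + 2) →ₐ[ℂ] centralizerAlg t M N) : Prop :=
  ∀ x : centralizerAlg t M (N + 2),
    (x : U t (N + 2)) - UIncl t N (p x : U t N) ∈ leftIdeal t (N + 2)

/-- The Olshanski algebra `A_M`: the projective limit, in the category of filtered algebras, of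
the algebras `A_M(M + 2k)`, `k = 0, 1, 2, …`, with respect to the homomorphisms
`p k : A_M(M + 2k + 2) → A_M(M + 2k)`. Its elements are the compatible sequences of bounded
degree. -/
noncomputable def olshanskiAlg (t : Kind) (M : ℕ)
    (p : ∀ k : ℕ, centralizerAlg t M (M + 2 * k + 2) →ₐ[ℂ] centralizerAlg t M (M + 2 * k)) :
    Subalgebra ℂ (∀ k : ℕ, centralizerAlg t M (M + 2 * k)) where
  carrier := {a | (∀ k, p k (a (k + 1)) = a k) ∧ ∃ d, ∀ k, (a k : U t (M + 2 * k)) ∈ UFil t _ d}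
  mul_mem' := by
    rintro a b ⟨ha, d, hd⟩ ⟨hb, e, he⟩
    refine ⟨fun k => ?_, d + e, fun k => UFil_mul t _ (hd k) (he k)⟩
    exact (map_mul (p k) (a (k + 1)) (b (k + 1))).trans (by rw [ha, hb]; rfl)
  add_mem' := by
    rintro a b ⟨ha, d, hd⟩ ⟨hb, e, he⟩
    refine ⟨fun k => ?_, max d e, fun k => Submodule.add_mem _
      (UFil_mono t _ (le_max_left d e) (hd k)) (UFil_mono t _ (le_max_right d e) (he k))⟩
    exact (map_add (p k) (a (k + 1)) (b (k + 1))).trans (by rw [ha, hb]; rfl)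
  algebraMap_mem' := by
    intro c
    refine ⟨fun k => (p k).commutes c, 0, fun k => ?_⟩
    rw [UFil, pow_zero]
    exact Submodule.algebraMap_mem c

end Centralizer

/-! ### The homomorphisms `ψ_N` -/

section Psi

open PowerSeries

/-- The matrix `F(u)` with the entries `f_{ij}(u) = δ_{ij} + F_{ij} (u ± 1/2)⁻¹`. -/
noncomputable def fMatrix (t : Kind) (N : ℕ) : Matrix (Idx N) (Idx N) (U t N)⟦X⟧ :=
  Matrix.of fun i j =>
    (if i = j then 1 else 0) + C (FU t i j) * toSeries (U t N) (invShift (pm t / 2))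

/-- The sequence of indices `(-n, …, -m-1, i, m+1, …, n)`, where `m = ⌊M/2⌋`, `n = m + k` and
`-m ≤ i ≤ m`. -/
def indexSeq {M : ℕ} (k : ℕ) (i : Idx M) (p : Fin (2 * k + 1)) : Idx (M + 2 * k) :=
  ⟨if (p : ℕ) < k then -((M / 2 : ℕ) : ℤ) - k + (p : ℕ)
    else if (p : ℕ) = k then (i : ℤ) else ((M / 2 : ℕ) : ℤ) + (p : ℕ) - k, by
    have h := mem_idx.1 i.2
    have hp := p.2
    rw [mem_idx]
    split_ifs with h1 h2
    · exact ⟨⟨by omega, by omega⟩, fun h0 => by omega⟩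
    · exact ⟨⟨by omega, by omega⟩, fun h0 => by have := h.2 h0; omega⟩
    · exact ⟨⟨by omega, by omega⟩, fun h0 => by omega⟩⟩

/-- The series
`α_{m-n}(u) · f^{-n⋯-m-1, i, m+1⋯n}_{-n⋯-m-1, j, m+1⋯n}(u + n - m)` with coefficients in
`U(𝔤_N)`, where `N = M + 2k`, so that `n - m = k`. -/
noncomputable def psiSeries (t : Kind) (M k : ℕ) (i j : Idx M) : (U t (M + 2 * k))⟦X⟧ :=
  toSeries _ (alpha t (-(k : ℤ))) *
    shift (k : ℂ) (sklyaninMinor t (fMatrix t (M + 2 * k)) (indexSeq k i) (indexSeq k j))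

/-- `ψ` is the homomorphism `ψ_N : Y(𝔤_M) → A_M(N)`, `N = M + 2k`: it takes each `s_{ij}(u)` to
the series `psiSeries`. -/
def IsPsi (t : Kind) (M k : ℕ) (ψ : Y t M →ₐ[ℂ] centralizerAlg t M (M + 2 * k)) : Prop :=
  ∀ i j : Idx M,
    PowerSeries.map ((centralizerAlg t M (M + 2 * k)).val.comp ψ).toRingHom (sSeries t i j)
      = psiSeries t M k i j

end Psi

end TwistedYangian

set_option linter.unusedSectionVars false

namespace TwistedYangian

open Finset (sum_congr smul_sum mul_sum sum_mul mem_univ sum_eq_single sum_comm sum_sub_distrib sum_ite_eq sum_ite_eq' sum_eq_zero sum_add_distrib sum_const_zero piecewise_eq_of_notMem mem_range)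
open Matrix (of_apply mul_apply map_apply one_apply diagonal diagonal_mul mul_diagonal submatrix_apply toBlocks₂₂ toBlocks₁₁ toBlocks₁₂ toBlocks₂₁)
open Function (update update_of_ne update_self)
open Fin (snoc snoc_last snoc_castSucc lastCases sum_univ_castSucc castSucc_ne_last)
open Equiv (swap swap_apply_of_ne_of_ne swap_apply_right)
open Finset.HasAntidiagonal (antidiagonal mem_antidiagonal)

/-! ### Formal series with coefficients in a noncommutative algebra -/

section SeriesAlgebra

open PowerSeries

/-- Series with scalar coefficients act on series with coefficients in an algebra. -/
@[reducible] noncomputable def seriesAlgebra (R B : Type*) [CommRing R] [Ring B] [Algebra R B] :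
    Algebra R⟦X⟧ B⟦X⟧ :=
  RingHom.toAlgebra' (PowerSeries.map (algebraMap R B)) fun f a => by
    ext n
    rw [coeff_mul, coeff_mul]
    refine Finset.sum_equiv (Equiv.prodComm ℕ ℕ) (fun p => ?_) fun p _ => ?_
    · simp [add_comm]
    · simp [Algebra.commutes]

attribute [local instance 50] seriesAlgebra

lemma series_smul_def {R B : Type*} [CommRing R] [Ring B] [Algebra R B] (f : R⟦X⟧) (a : B⟦X⟧) :
    f • a = PowerSeries.map (algebraMap R B) f * a := rfl

lemma coeff_series_smul {R B : Type*} [CommRing R] [Ring B] [Algebra R B] (f : R⟦X⟧)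
    (a : B⟦X⟧) (n : ℕ) :
    coeff n (f • a) = ∑ p ∈ antidiagonal n, coeff p.1 f • coeff p.2 a := by
  rw [series_smul_def, coeff_mul]
  exact sum_congr rfl fun p _ => by rw [coeff_map, Algebra.smul_def]

lemma toSeries_mul {A : Type*} [Ring A] [Algebra ℂ A] (f : ℂ⟦X⟧) (a : A⟦X⟧) :
    toSeries A f * a = f • a := rfl

lemma toSeries_eq_smul {A : Type*} [Ring A] [Algebra ℂ A] (f : ℂ⟦X⟧) :
    toSeries A f = f • (1 : A⟦X⟧) := by
  rw [← toSeries_mul, mul_one]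

lemma series_torsionFree (R B : Type*) [CommRing R] [IsDomain R] [Ring B] [Algebra R B]
    [Module.IsTorsionFree R B] : Module.IsTorsionFree R⟦X⟧ B⟦X⟧ := by
  refine ⟨fun f hf => ?_⟩
  have hf0 : f ≠ 0 := hf.ne_zero
  rw [isSMulRegular_iff_right_eq_zero_of_smul]
  intro b hb
  by_contra hb0
  obtain ⟨m, hm⟩ : ∃ m, coeff m b ≠ 0 := by
    by_contra! h
    exact hb0 (PowerSeries.ext fun n => by simpa using h n)
  obtain ⟨k, hk⟩ : ∃ k, coeff k f ≠ 0 := by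
    by_contra! h
    exact hf0 (PowerSeries.ext fun n => by simpa using h n)
  classical
  have hm' : ∃ m, coeff m b ≠ 0 := ⟨m, hm⟩
  have hk' : ∃ k, coeff k f ≠ 0 := ⟨k, hk⟩
  have h := coeff_series_smul f b (Nat.find hk' + Nat.find hm')
  rw [hb, map_zero, sum_eq_single (Nat.find hk', Nat.find hm')] at h
  · rcases smul_eq_zero.1 h.symm with h | h
    · exact Nat.find_spec hk' h
    · exact Nat.find_spec hm' h
  · rintro ⟨p, q⟩ hp hne
    rw [mem_antidiagonal] at hp
    simp only at hp
    by_cases h1 : p < Nat.find hk'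
    · have := Nat.find_min hk' h1
      simp only [ne_eq, not_not] at this
      simp [this]
    · by_cases h2 : q < Nat.find hm'
      · have := Nat.find_min hm' h2
        simp only [ne_eq, not_not] at this
        simp [this]
      · exact absurd (Prod.ext (by simp only; omega) (by simp only; omega)) hne
  · intro h
    simp at h

instance complexSeries_torsionFree (A : Type*) [Ring A] [Algebra ℂ A] :
    Module.IsTorsionFree ℂ⟦X⟧ A⟦X⟧ := series_torsionFree ℂ A

instance complexSeries_two_torsionFree (A : Type*) [Ring A] [Algebra ℂ A] :
    Module.IsTorsionFree ℂ⟦X⟧⟦X⟧ A⟦X⟧⟦X⟧ := series_torsionFree ℂ⟦X⟧ A⟦X⟧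

/-- A homomorphism of rings of series that is compatible with the adic topology is determined by
its values at constants and at the variable. -/
lemma series_ringHom_ext {B B' : Type*} [Ring B] [Ring B'] {φ ψ : B⟦X⟧ →+* B'⟦X⟧}
    (hC : ∀ b, φ (C b) = ψ (C b)) (hX : φ X = ψ X) (hd : X ∣ φ X) : φ = ψ := by
  obtain ⟨c, hc⟩ := hd
  have key : ∀ (χ : B⟦X⟧ →+* B'⟦X⟧), χ X = X * c → ∀ (n : ℕ) (a : B⟦X⟧),
      coeff n (χ a) = coeff n (χ (trunc (n + 1) a : Polynomial B)) := by
    intro χ hχ n a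
    conv_lhs => rw [eq_X_pow_mul_shift_add_trunc (n + 1) a]
    rw [map_add, map_add, map_mul, map_pow, hχ, (PowerSeries.commute_X c).symm.mul_pow, mul_assoc,
      coeff_X_pow_mul']
    simp
  ext a n
  rw [key φ hc n a, key ψ (hX ▸ hc) n a]
  congr 1
  have : ∀ p : Polynomial B, φ (p : B⟦X⟧) = ψ (p : B⟦X⟧) := by
    intro p
    induction p using Polynomial.induction_on' with
    | add p q hp hq => rw [Polynomial.coe_add, map_add, map_add, hp, hq]
    | monomial k b =>
      rw [← Polynomial.C_mul_X_pow_eq_monomial, Polynomial.coe_mul, Polynomial.coe_pow,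
        Polynomial.coe_X, Polynomial.coe_C, map_mul, map_mul, map_pow, map_pow, hC, hX]
  exact this _

variable {A : Type*} [Ring A] [Algebra ℂ A]

lemma coeff_pow_smul_eq_zero {τ : ℂ⟦X⟧} (hτ : X ∣ τ) {p r : ℕ} (h : p < r) (b : A⟦X⟧) :
    coeff p (τ ^ r • b) = 0 := by
  obtain ⟨σ, rfl⟩ := hτ
  rw [coeff_series_smul]
  refine sum_eq_zero fun q hq => ?_
  rw [mem_antidiagonal] at hq
  rw [mul_pow, coeff_X_pow_mul', if_neg (by omega), zero_smul]

/-- The function `f(u, v) ↦ f(u, 1 / τ(u))`. -/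
noncomputable def evFun (τ : ℂ⟦X⟧) (f : A⟦X⟧⟦X⟧) : A⟦X⟧ :=
  PowerSeries.mk fun p => ∑ r ∈ Finset.range (p + 1), coeff p (τ ^ r • coeff r f)

lemma coeff_evFun {τ : ℂ⟦X⟧} (hτ : X ∣ τ) (f : A⟦X⟧⟦X⟧) {p n : ℕ} (h : p < n) :
    coeff p (evFun τ f) = coeff p (∑ r ∈ Finset.range n, τ ^ r • coeff r f) := by
  rw [evFun, coeff_mk, map_sum]
  refine Finset.sum_subset (fun r hr => ?_) fun r _ hr => ?_
  · rw [mem_range] at *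
    omega
  · rw [mem_range] at hr
    exact coeff_pow_smul_eq_zero hτ (by omega) _

/-- The substitution of `τ(u)` for `v⁻¹`. -/
noncomputable def ev (τ : ℂ⟦X⟧) (hτ : X ∣ τ) : A⟦X⟧⟦X⟧ →+* A⟦X⟧ where
  toFun := evFun τ
  map_one' := by
    ext p
    rw [coeff_evFun hτ _ (Nat.lt_succ_self p), sum_eq_single 0]
    · simp
    · intro r _ hr
      rw [coeff_one, if_neg hr, smul_zero]
    · simp
  map_zero' := by
    ext p
    simp [evFun]
  map_add' f g := by
    ext p
    simp [evFun, sum_add_distrib]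
  map_mul' f g := by
    ext p
    have h : ∀ i ∈ antidiagonal p, coeff i.1 (evFun τ f) * coeff i.2 (evFun τ g) =
        coeff i.1 (∑ r ∈ Finset.range (p + 1), τ ^ r • coeff r f) *
          coeff i.2 (∑ r ∈ Finset.range (p + 1), τ ^ r • coeff r g) := by
      intro i hi
      rw [mem_antidiagonal] at hi
      rw [coeff_evFun hτ f (n := p + 1) (by omega), coeff_evFun hτ g (n := p + 1) (by omega)]
    rw [coeff_mul, sum_congr rfl h, ← coeff_mul, coeff_evFun hτ _ (Nat.lt_succ_self p),
      Finset.sum_mul_sum]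
    simp only [PowerSeries.coeff_mul (R := A⟦X⟧), smul_sum, smul_mul_smul_comm, ← pow_add,
      map_sum]
    rw [← Finset.sum_product', Finset.sum_sigma']
    refine Finset.sum_of_injOn (fun x => (x.2.1, x.2.2)) ?_ ?_ ?_ ?_
    · rintro ⟨a, b, c⟩ _ ⟨a', b', c'⟩ _ hh
      simp only [Finset.coe_sigma, Set.mem_sigma_iff, Finset.mem_coe, mem_antidiagonal] at *
      simp_all
    · rintro ⟨a, b, c⟩ hh
      simp only [Finset.coe_sigma, Set.mem_sigma_iff, Finset.mem_coe, mem_antidiagonal,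
        mem_range, Finset.coe_product, Set.mem_prod] at *
      omega
    · rintro ⟨b, c⟩ _ hh
      refine coeff_pow_smul_eq_zero hτ ?_ _
      by_contra hlt
      refine hh ⟨⟨b + c, (b, c)⟩, ?_, rfl⟩
      simp only [Finset.coe_sigma, Set.mem_sigma_iff, Finset.mem_coe, mem_antidiagonal,
        mem_range, and_true]
      omega
    · rintro ⟨a, b, c⟩ hh
      simp only [Finset.mem_sigma, mem_antidiagonal] at hh
      simp only [hh.2]

lemma ev_C (τ : ℂ⟦X⟧) (hτ : X ∣ τ) (a : A⟦X⟧) : ev τ hτ (C a) = a := by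
  ext p
  change coeff p (evFun τ (C a)) = _
  rw [coeff_evFun hτ _ (Nat.lt_succ_self p), sum_eq_single 0]
  · simp
  · intro r _ hr
    rw [coeff_C, if_neg hr, smul_zero]
  · simp

lemma ev_X (τ : ℂ⟦X⟧) (hτ : X ∣ τ) : ev τ hτ (X : A⟦X⟧⟦X⟧) = toSeries A τ := by
  rw [toSeries_eq_smul]
  ext p
  change coeff p (evFun τ X) = _
  rw [coeff_evFun hτ _ (show p < p + 2 by omega), sum_eq_single 1]
  · simp
  · intro r _ hr
    rw [coeff_X, if_neg hr, smul_zero]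
  · simp

lemma one_add_mul_invShift (c : ℂ) : (1 + C c * X) * invShift c = X := by
  have h : (1 + C c * X) * PowerSeries.mk (fun j => (-c) ^ j) = 1 := by
    ext n
    rcases n with _ | n
    · simp [add_mul, mul_assoc]
    · simp [add_mul, mul_assoc, coeff_succ_X_mul, pow_succ, coeff_one]
      ring
  rw [invShift, mul_left_comm, h, mul_one]

lemma X_dvd_invShift (c : ℂ) : X ∣ invShift c := ⟨_, rfl⟩

lemma shift_eq_ev (c : ℂ) (a : A⟦X⟧) :
    shift c a = ev (invShift c) (X_dvd_invShift c) (PowerSeries.map C a) := by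
  ext p
  change _ = coeff p (evFun _ _)
  rw [shift, evFun, coeff_mk, coeff_mk]
  refine sum_congr rfl fun r _ => ?_
  rw [coeff_map, coeff_series_smul, sum_eq_single (p, 0)]
  · simp
  · rintro ⟨x, y⟩ hp hne
    rw [mem_antidiagonal] at hp
    simp only at hp
    rw [coeff_C, if_neg, smul_zero]
    rintro rfl
    exact hne (by simp_all)
  · simp

/-- The translation `a(u) ↦ a(u + c)`. -/
noncomputable def shiftHom (A : Type*) [Ring A] [Algebra ℂ A] (c : ℂ) : A⟦X⟧ →+* A⟦X⟧ :=
  (ev (invShift c) (X_dvd_invShift c)).comp (PowerSeries.map C)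

lemma shiftHom_apply (c : ℂ) (a : A⟦X⟧) : shiftHom A c a = shift c a := (shift_eq_ev c a).symm

lemma shiftHom_C (c : ℂ) (a : A) : shiftHom A c (C a) = C a := by
  rw [shiftHom, RingHom.comp_apply, map_C, ev_C]

lemma shiftHom_X (c : ℂ) : shiftHom A c X = toSeries A (invShift c) := by
  rw [shiftHom, RingHom.comp_apply, map_X, ev_X]

lemma X_dvd_shiftHom_X (c : ℂ) : X ∣ shiftHom A c X := by
  rw [shiftHom_X, invShift, map_mul]
  exact ⟨_, by rw [toSeries, PowerSeries.map_X]⟩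

/-- The reflection `a(u) ↦ a(-u)`. -/
noncomputable def reflectHom (A : Type*) [Ring A] : A⟦X⟧ →+* A⟦X⟧ where
  toFun := reflect
  map_one' := by
    ext n
    rcases n with _ | n <;> simp [reflect, coeff_one]
  map_zero' := by
    ext n
    simp [reflect]
  map_add' a b := by
    ext n
    simp [reflect, mul_add]
  map_mul' a b := by
    ext n
    simp only [reflect, coeff_mk, coeff_mul, mul_sum]
    refine sum_congr rfl fun p hp => ?_
    rw [mem_antidiagonal] at hp
    rw [← hp, pow_add]
    have h : Commute ((-1 : A) ^ p.2) (coeff p.1 a) := (Commute.neg_one_left _).pow_left _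
    rw [mul_assoc, mul_assoc, ← mul_assoc _ (coeff p.1 a), h.eq, mul_assoc]

lemma reflectHom_apply {A : Type*} [Ring A] (a : A⟦X⟧) : reflectHom A a = reflect a := rfl

lemma reflectHom_C {A : Type*} [Ring A] (a : A) : reflectHom A (C a) = C a := by
  ext n
  rw [reflectHom_apply, reflect, coeff_mk, coeff_C]
  split_ifs with h <;> simp [h]

lemma reflectHom_X {A : Type*} [Ring A] : reflectHom A X = -X := by
  ext n
  rw [reflectHom_apply, reflect, coeff_mk, map_neg, coeff_X]
  split_ifs with h <;> simp [h]

lemma toSeries_C (c : ℂ) : toSeries A (C c) = C (algebraMap ℂ A c) := by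
  rw [toSeries, map_C]

lemma toSeries_X : toSeries A X = X := by rw [toSeries, map_X]

/-- Substitutions are compatible with the inclusion of scalar series. -/
lemma shiftHom_toSeries (c : ℂ) (f : ℂ⟦X⟧) :
    shiftHom A c (toSeries A f) = toSeries A (shiftHom ℂ c f) := by
  have h : (shiftHom A c).comp (toSeries A) = (toSeries A).comp (shiftHom ℂ c) := by
    refine series_ringHom_ext (fun b => ?_) ?_ ?_
    · simp only [RingHom.comp_apply, toSeries_C, shiftHom_C]
    · rw [RingHom.comp_apply, RingHom.comp_apply, toSeries_X, shiftHom_X, shiftHom_X]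
      congr 1
    · rw [RingHom.comp_apply, toSeries_X]
      exact X_dvd_shiftHom_X c
  exact RingHom.congr_fun h f

lemma reflectHom_toSeries (f : ℂ⟦X⟧) :
    reflectHom A (toSeries A f) = toSeries A (reflectHom ℂ f) := by
  ext n
  simp [reflectHom_apply, reflect, toSeries]

lemma shiftHom_smul (c : ℂ) (f : ℂ⟦X⟧) (a : A⟦X⟧) :
    shiftHom A c (f • a) = shiftHom ℂ c f • shiftHom A c a := by
  rw [← toSeries_mul, map_mul, shiftHom_toSeries, toSeries_mul]

lemma reflectHom_smul (f : ℂ⟦X⟧) (a : A⟦X⟧) :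
    reflectHom A (f • a) = reflectHom ℂ f • reflectHom A a := by
  rw [← toSeries_mul, map_mul, reflectHom_toSeries, toSeries_mul]

lemma one_add_mul_ne_zero (c : ℂ) : (1 + C c * X : ℂ⟦X⟧) ≠ 0 := fun h => by
  have := congrArg (coeff 0) h
  simp at this

lemma shiftHom_complex_X (c : ℂ) : shiftHom ℂ c X = invShift c := by
  rw [shiftHom_X]
  ext n
  simp [toSeries]

lemma one_add_mul_shiftHom_X (c : ℂ) : (1 + C c * X) * shiftHom ℂ c X = X := by
  rw [shiftHom_complex_X, one_add_mul_invShift]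

lemma shiftHom_shiftHom_X (b c : ℂ) :
    shiftHom ℂ b (shiftHom ℂ c X) = shiftHom ℂ (b + c) X := by
  have h := congrArg (shiftHom ℂ b) (one_add_mul_shiftHom_X c)
  rw [map_mul, map_add, map_one, map_mul, shiftHom_C] at h
  have hb := one_add_mul_shiftHom_X b
  have hbc := one_add_mul_shiftHom_X (b + c)
  rw [map_add] at hbc
  refine mul_left_cancel₀ (one_add_mul_ne_zero (b + c)) ?_
  rw [map_add, hbc]
  set s := shiftHom ℂ b X
  set r := shiftHom ℂ b (shiftHom ℂ c X)
  have h1 : (1 + C b * X) * ((1 + C c * s) * r) = (1 + C b * X) * s := by rw [h]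
  rw [hb] at h1
  calc _ = (1 + C b * X) * ((1 + C c * s) * r) + C c * r * (X - (1 + C b * X) * s) := by ring
    _ = X := by rw [h1, hb, sub_self, mul_zero, add_zero]

lemma shiftHom_shiftHom (b c : ℂ) (a : A⟦X⟧) :
    shiftHom A b (shiftHom A c a) = shiftHom A (b + c) a := by
  have h : (shiftHom A b).comp (shiftHom A c) = shiftHom A (b + c) := by
    have hX : (shiftHom A b).comp (shiftHom A c) X = shiftHom A (b + c) X := by
      rw [RingHom.comp_apply, ← toSeries_X (A := A), shiftHom_toSeries, shiftHom_toSeries,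
        shiftHom_toSeries, shiftHom_shiftHom_X]
    refine series_ringHom_ext (fun b => ?_) hX (hX ▸ X_dvd_shiftHom_X _)
    simp only [RingHom.comp_apply, shiftHom_C]
  exact RingHom.congr_fun h a

lemma shiftHom_zero (a : A⟦X⟧) : shiftHom A 0 a = a := by
  have h : shiftHom A 0 = RingHom.id _ := by
    refine series_ringHom_ext (fun b => shiftHom_C _ _) ?_ (X_dvd_shiftHom_X _)
    have := one_add_mul_invShift 0
    rw [map_zero, zero_mul, add_zero, one_mul] at this
    rw [shiftHom_X, this, toSeries_X, RingHom.id_apply]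
  exact RingHom.congr_fun h a

lemma reflectHom_invShift (c : ℂ) : reflectHom ℂ (invShift c) = -invShift (-c) := by
  have h := congrArg (reflectHom ℂ) (one_add_mul_invShift c)
  rw [map_mul, map_add, map_one, map_mul, reflectHom_C, reflectHom_X] at h
  have h' := one_add_mul_invShift (-c)
  rw [map_neg] at h'
  refine mul_left_cancel₀ (one_add_mul_ne_zero (-c)) ?_
  rw [map_neg]
  linear_combination h + h'

lemma reflectHom_shiftHom (c : ℂ) (a : A⟦X⟧) :
    reflectHom A (shiftHom A c a) = shiftHom A (-c) (reflectHom A a) := by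
  have h : (reflectHom A).comp (shiftHom A c) = (shiftHom A (-c)).comp (reflectHom A) := by
    refine series_ringHom_ext (fun b => ?_) ?_ ?_
    · simp only [RingHom.comp_apply, shiftHom_C, reflectHom_C]
    · simp only [RingHom.comp_apply, reflectHom_X, map_neg, shiftHom_X, reflectHom_toSeries,
        reflectHom_invShift]
    · rw [RingHom.comp_apply, shiftHom_X, reflectHom_toSeries, reflectHom_invShift, map_neg]
      rw [← shiftHom_X]
      exact (dvd_neg).2 (X_dvd_shiftHom_X _)
  exact RingHom.congr_fun h a

lemma reflectHom_reflectHom {A : Type*} [Ring A] (a : A⟦X⟧) : reflectHom A (reflectHom A a) = a := by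
  ext n
  rw [reflectHom_apply, reflectHom_apply, reflect, reflect, coeff_mk, coeff_mk, ← mul_assoc,
    ← pow_add, Even.neg_one_pow ⟨n, rfl⟩, one_mul]

/-- The substitution `v = -u - c`. -/
noncomputable def evReflect (A : Type*) [Ring A] [Algebra ℂ A] (c : ℂ) : A⟦X⟧⟦X⟧ →+* A⟦X⟧ :=
  ev (-invShift c) ((dvd_neg).2 (X_dvd_invShift c))

lemma evReflect_inU (c : ℂ) (a : A⟦X⟧) : evReflect A c (inU a) = a := ev_C _ _ _

lemma evReflect_inV (c : ℂ) (a : A⟦X⟧) :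
    evReflect A c (inV a) = shiftHom A c (reflectHom A a) := by
  have h : (evReflect A c).comp (PowerSeries.map C) = (shiftHom A c).comp (reflectHom A) := by
    refine (series_ringHom_ext (fun b => ?_) ?_ ?_).symm
    · simp only [RingHom.comp_apply, shiftHom_C, reflectHom_C, map_C]
      exact (ev_C _ _ _).symm
    · simp only [RingHom.comp_apply, reflectHom_X, map_X, map_neg, shiftHom_X]
      rw [evReflect, ev_X, map_neg]
    · rw [RingHom.comp_apply, reflectHom_X, map_neg]
      exact (dvd_neg).2 (X_dvd_shiftHom_X _)
  exact RingHom.congr_fun h a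

/-- The translation `a(u, v) ↦ a(u + c, v + c)`. -/
noncomputable def shiftTwo (A : Type*) [Ring A] [Algebra ℂ A] (c : ℂ) : A⟦X⟧⟦X⟧ →+* A⟦X⟧⟦X⟧ :=
  (shiftHom A⟦X⟧ c).comp (PowerSeries.map (shiftHom A c))

lemma map_shiftHom {B : Type*} [Ring B] [Algebra ℂ B] (φ : A →+* B)
    (hφ : ∀ z : ℂ, φ (algebraMap ℂ A z) = algebraMap ℂ B z) (c : ℂ) (a : A⟦X⟧) :
    PowerSeries.map φ (shiftHom A c a) = shiftHom B c (PowerSeries.map φ a) := by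
  have hs : ∀ f, PowerSeries.map φ (toSeries A f) = toSeries B f := fun f => by
    ext n
    simp [toSeries, hφ]
  have h : (PowerSeries.map φ).comp (shiftHom A c) = (shiftHom B c).comp (PowerSeries.map φ) := by
    refine (series_ringHom_ext (fun b => ?_) ?_ ?_).symm
    · simp only [RingHom.comp_apply, shiftHom_C, map_C]
    · simp only [RingHom.comp_apply, map_X, shiftHom_X, hs]
    · rw [RingHom.comp_apply, map_X]
      exact X_dvd_shiftHom_X _
  exact RingHom.congr_fun h a

lemma map_reflectHom {A : Type*} [Ring A] {B : Type*} [Ring B] (φ : A →+* B) (a : A⟦X⟧) :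
    PowerSeries.map φ (reflectHom A a) = reflectHom B (PowerSeries.map φ a) := by
  ext n
  simp [reflectHom_apply, reflect]

lemma map_series_smul {B : Type*} [Ring B] [Algebra ℂ B] (φ : A →+* B)
    (hφ : ∀ z : ℂ, φ (algebraMap ℂ A z) = algebraMap ℂ B z) (f : ℂ⟦X⟧) (a : A⟦X⟧) :
    PowerSeries.map φ (f • a) = f • PowerSeries.map φ a := by
  have hs : PowerSeries.map φ (toSeries A f) = toSeries B f := by
    ext n
    simp [toSeries, hφ]
  rw [← toSeries_mul, map_mul, hs, toSeries_mul]

lemma shiftTwo_inU (c : ℂ) (a : A⟦X⟧) : shiftTwo A c (inU a) = inU (shiftHom A c a) := by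
  simp only [shiftTwo, RingHom.comp_apply, inU, map_C, shiftHom_C]

lemma shiftTwo_inV (c : ℂ) (a : A⟦X⟧) : shiftTwo A c (inV a) = inV (shiftHom A c a) := by
  have h : PowerSeries.map (shiftHom A c) (inV a) = inV a := by
    ext n
    simp only [inV, coeff_map, shiftHom_C]
  rw [shiftTwo, RingHom.comp_apply, h, inV, inV]
  exact (map_shiftHom (A := A) (B := A⟦X⟧) C (fun z => by rw [PowerSeries.algebraMap_apply]) c a).symm

end SeriesAlgebra

/-! ### The quadratic relation in matrix form -/

section QuadraticRelation

/-- An index set with an involution `i ↦ -i` and signs `e i` such that `e i * e (-i) = ε`. -/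
structure SignedIndex (ε : ℤ) (ι : Type*) where
  /-- The involution. -/
  ν : ι → ι
  /-- The signs. -/
  e : ι → ℤ
  ν_ν : ∀ i, ν (ν i) = i
  e_mul : ∀ i, e i * e i = 1
  e_ν : ∀ i, e i * e (ν i) = ε

namespace SignedIndex

variable {ε : ℤ} {ι : Type*} (σ : SignedIndex ε ι)

lemma e_ν_eq (i : ι) : σ.e (σ.ν i) = ε * σ.e i := by
  linear_combination (-σ.e (σ.ν i)) * σ.e_mul i + σ.e i * σ.e_ν i

lemma ε_mul (σ : SignedIndex ε ι) (i : ι) : ε * ε = 1 := by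
  have h := σ.e_mul (σ.ν i)
  rw [σ.e_ν_eq] at h
  linear_combination h - ε * ε * σ.e_mul i

lemma eq_ν_iff {i j : ι} : i = σ.ν j ↔ j = σ.ν i := by
  constructor <;> rintro rfl <;> rw [σ.ν_ν]

lemma ν_inj {i j : ι} : σ.ν i = σ.ν j ↔ i = j := by
  rw [← σ.eq_ν_iff, σ.ν_ν]
  exact eq_comm

/-- The disjoint union of two signed index sets. -/
def sum {κ : Type*} (τ : SignedIndex ε κ) : SignedIndex ε (ι ⊕ κ) where
  ν := Sum.map σ.ν τ.ν
  e := Sum.elim σ.e τ.e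
  ν_ν := by rintro (i | i) <;> simp [σ.ν_ν, τ.ν_ν]
  e_mul := by rintro (i | i) <;> simp [σ.e_mul, τ.e_mul]
  e_ν := by rintro (i | i) <;> simp [σ.e_ν, τ.e_ν]

lemma sum_ν [Fintype ι] {M : Type*} [AddCommMonoid M] (f : ι → M) :
    ∑ i, f (σ.ν i) = ∑ i, f i :=
  Equiv.sum_comp ⟨σ.ν, σ.ν, σ.ν_ν, σ.ν_ν⟩ f

end SignedIndex

variable {K B : Type*} [CommRing K] [Ring B] [Algebra K B]
variable {ε : ℤ} {ι : Type*} (σ : SignedIndex ε ι)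

/-- The quadratic relation `R S₁ Rᵗ S'₂ = S'₂ Rᵗ S₁ R` with `R = d - t P` and `Rᵗ = f + s Q`, written
out in matrix elements. -/
def QuadRel (d t f s : K) (S S' : Matrix ι ι B) : Prop :=
  ∀ i j k l,
    (d * f) • (S i j * S' k l - S' k l * S i j) =
      (t * f) • (S k j * S' i l - S' k j * S i l)
      - (d * s) • ((σ.e k * σ.e (σ.ν j)) • (S i (σ.ν k) * S' (σ.ν j) l)
        - (σ.e i * σ.e (σ.ν l)) • (S' k (σ.ν i) * S (σ.ν l) j))
      + (t * s) • ((σ.e i * σ.e (σ.ν j)) • (S k (σ.ν i) * S' (σ.ν j) l - S' k (σ.ν i) * S (σ.ν j) l))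

lemma QuadRel.submatrix {σ : SignedIndex ε ι} {κ : Type*} {τ : SignedIndex ε κ} {d t f s : K} {S S' : Matrix ι ι B}
    (h : QuadRel σ d t f s S S') (φ : κ → ι) (hν : ∀ i, φ (τ.ν i) = σ.ν (φ i))
    (he : ∀ i, τ.e i = σ.e (φ i)) :
    QuadRel τ d t f s (S.submatrix φ φ) (S'.submatrix φ φ) := by
  intro i j k l
  simpa only [submatrix_apply, hν, he] using h (φ i) (φ j) (φ k) (φ l)

/-- The quadratic relation is preserved by ring homomorphisms. -/
lemma QuadRel.map {σ : SignedIndex ε ι} {K' B' : Type*} [CommRing K'] [Ring B'] [Algebra K' B'] {d t f s : K}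
    {S S' : Matrix ι ι B} (h : QuadRel σ d t f s S S') (φ : B →+* B') (φ₀ : K → K')
    (hφ : ∀ k b, φ (k • b) = φ₀ k • φ b) (hm : ∀ k k', φ₀ (k * k') = φ₀ k * φ₀ k') :
    QuadRel σ (φ₀ d) (φ₀ t) (φ₀ f) (φ₀ s) (S.map φ) (S'.map φ) := by
  intro i j k l
  simpa only [map_sub, map_add, hφ, map_mul, hm, map_zsmul, map_apply] using
    congrArg φ (h i j k l)

/-- Proportional parameters give equivalent relations. -/
lemma QuadRel.rescale {σ : SignedIndex ε ι} [Module.IsTorsionFree K B] [IsDomain K] {d t f s d' t' f' s' : K}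
    {S S' : Matrix ι ι B}
    (h : QuadRel σ d t f s S S') (a b a' b' : K) (ha : a' ≠ 0) (hb : b' ≠ 0) (hd : a * d = a' * d')
    (ht : a * t = a' * t') (hf : b * f = b' * f') (hs : b * s = b' * s') :
    QuadRel σ d' t' f' s' S S' := by
  intro i j k l
  have h1 := congrArg (fun x => (a * b) • x) (h i j k l)
  simp only [smul_sub, smul_add, smul_smul] at h1
  refine smul_right_injective B (mul_ne_zero ha hb) ?_
  simp only [smul_sub, smul_add, smul_smul]
  rw [show a' * b' * (d' * f') = a * b * (d * f) by linear_combination (-b' * f') * hd - a * d * hf,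
    show a' * b' * (t' * f') = a * b * (t * f) by linear_combination (-b' * f') * ht - a * t * hf,
    show a' * b' * (d' * s') = a * b * (d * s) by linear_combination (-b' * s') * hd - a * d * hs,
    show a' * b' * (t' * s') = a * b * (t * s) by linear_combination (-b' * s') * ht - a * t * hs]
  exact h1

variable [DecidableEq ι]

/-- `S ⊗ 1`. -/
def onFirst (S : Matrix ι ι B) : Matrix (ι × ι) (ι × ι) B :=
  Matrix.of fun a b => if a.2 = b.2 then S a.1 b.1 else 0

/-- `1 ⊗ S`. -/
def onSecond (S : Matrix ι ι B) : Matrix (ι × ι) (ι × ι) B :=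
  Matrix.of fun a b => if a.1 = b.1 then S a.2 b.2 else 0

/-- The permutation operator. -/
def flipP (ι B : Type*) [DecidableEq ι] [Ring B] : Matrix (ι × ι) (ι × ι) B :=
  Matrix.of fun a b => if a.1 = b.2 ∧ a.2 = b.1 then 1 else 0

/-- The partial transpose of the permutation operator. -/
def transQ (B : Type*) [Ring B] : Matrix (ι × ι) (ι × ι) B :=
  Matrix.of fun a b => if a.1 = σ.ν a.2 ∧ b.1 = σ.ν b.2 then ((σ.e a.2 * σ.e b.2 : ℤ) : B) else 0

variable [Fintype ι]

section Entries

variable (X : Matrix (ι × ι) (ι × ι) B) (S : Matrix ι ι B) (i j k l : ι) (a : ι × ι)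

lemma mul_onFirst_apply : (X * onFirst S) a (j, l) = ∑ x, X a (x, l) * S x j := by
  simp [mul_apply, onFirst, Fintype.sum_prod_type]

lemma onFirst_mul_apply : (onFirst S * X) (i, k) a = ∑ x, S i x * X (x, k) a := by
  simp [mul_apply, onFirst, Fintype.sum_prod_type]

lemma mul_onSecond_apply : (X * onSecond S) a (j, l) = ∑ y, X a (j, y) * S y l := by
  simp only [mul_apply, onSecond, Fintype.sum_prod_type, of_apply, mul_ite, mul_zero]
  rw [sum_comm]
  simp

lemma onSecond_mul_apply : (onSecond S * X) (i, k) a = ∑ y, S k y * X (i, y) a := by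
  simp only [mul_apply, onSecond, Fintype.sum_prod_type, of_apply, ite_mul, zero_mul]
  rw [sum_comm]
  simp

lemma mul_flipP_apply : (X * flipP ι B) a (j, l) = X a (l, j) := by
  simp only [mul_apply, flipP, Fintype.sum_prod_type, of_apply, mul_ite, mul_zero,
    ite_and, mul_one]
  simp

lemma flipP_mul_apply : (flipP ι B * X) (i, k) a = X (k, i) a := by
  simp only [mul_apply, flipP, Fintype.sum_prod_type, of_apply, ite_mul, zero_mul,
    ite_and, one_mul]
  simp

lemma mul_transQ_apply : (X * transQ σ B) a (j, l) =
    if j = σ.ν l then ∑ y, (σ.e y * σ.e l) • X a (σ.ν y, y) else 0 := by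
  simp only [mul_apply, transQ, Fintype.sum_prod_type, of_apply, mul_ite, mul_zero,
    ite_and]
  rw [sum_comm]
  split_ifs with h
  · refine sum_congr rfl fun y _ => ?_
    simp only [sum_ite_eq', mem_univ, if_true]
    rw [zsmul_eq_mul, (Int.cast_commute _ _).eq]
  · simp

lemma transQ_mul_apply : (transQ σ B * X) (i, k) a =
    if i = σ.ν k then ∑ y, (σ.e k * σ.e y) • X (σ.ν y, y) a else 0 := by
  simp only [mul_apply, transQ, Fintype.sum_prod_type, of_apply, ite_mul, zero_mul,
    ite_and]
  split_ifs with h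
  · rw [sum_comm]
    refine sum_congr rfl fun y _ => ?_
    simp only [sum_ite_eq', mem_univ, if_true]
    rw [zsmul_eq_mul]
  · simp

lemma onFirst_apply (b : ι × ι) : onFirst S a b = if a.2 = b.2 then S a.1 b.1 else 0 := rfl

lemma onSecond_apply (b : ι × ι) : onSecond S a b = if a.1 = b.1 then S a.2 b.2 else 0 := rfl

end Entries

lemma onFirst_mul (S T : Matrix ι ι B) : onFirst (S * T) = onFirst S * onFirst T := by
  ext ⟨i, k⟩ ⟨j, l⟩
  rw [onFirst_mul_apply]
  simp only [onFirst_apply, mul_apply]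
  split_ifs <;> simp

lemma onSecond_mul (S T : Matrix ι ι B) : onSecond (S * T) = onSecond S * onSecond T := by
  ext ⟨i, k⟩ ⟨j, l⟩
  rw [onSecond_mul_apply]
  simp only [onSecond_apply, mul_apply]
  split_ifs <;> simp

lemma onFirst_one : onFirst (1 : Matrix ι ι B) = 1 := by
  ext ⟨i, k⟩ ⟨j, l⟩
  simp only [onFirst_apply, one_apply, Prod.mk.injEq]
  split_ifs <;> simp_all

lemma onSecond_one : onSecond (1 : Matrix ι ι B) = 1 := by
  ext ⟨i, k⟩ ⟨j, l⟩
  simp only [onSecond_apply, one_apply, Prod.mk.injEq]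
  split_ifs <;> simp_all

lemma flipP_mul_flipP : flipP ι B * flipP ι B = 1 := by
  ext ⟨i, k⟩ ⟨j, l⟩
  rw [flipP_mul_apply]
  simp only [flipP, of_apply, one_apply, Prod.mk.injEq]
  congr 1
  exact propext and_comm

lemma transQ_mul_transQ : transQ σ B * transQ σ B = (Fintype.card ι : K) • transQ σ B := by
  ext ⟨i, k⟩ ⟨j, l⟩
  rw [transQ_mul_apply]
  simp only [transQ, of_apply, Matrix.smul_apply]
  by_cases hi : i = σ.ν k
  · by_cases hj : j = σ.ν l
    · have h : ∀ y, (σ.e k * σ.e y) • (((σ.e y * σ.e l : ℤ) : B)) = ((σ.e k * σ.e l : ℤ) : B) := by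
        intro y
        rw [← Int.cast_smul_eq_zsmul B, smul_eq_mul, ← Int.cast_mul]
        congr 1
        linear_combination σ.e k * σ.e l * σ.e_mul y
      simp only [hi, hj, and_self, if_true, h, Finset.sum_const, Finset.card_univ]
      rw [Nat.cast_smul_eq_nsmul]
    · simp [hj]
  · simp [hi]

/-- The quadratic relation in matrix form. -/
lemma quadRel_iff {d t f s : K} {S S' : Matrix ι ι B} :
    QuadRel σ d t f s S S' ↔
      (d • 1 - t • flipP ι B) * onFirst S * (f • 1 + s • transQ σ B) * onSecond S' =
        onSecond S' * (f • 1 + s • transQ σ B) * onFirst S * (d • 1 - t • flipP ι B) := by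
  have e12 : ∀ i j k l, (onFirst S * onSecond S') (i, k) (j, l) = S i j * S' k l := by
    intro i j k l
    rw [mul_onSecond_apply]
    simp [onFirst_apply]
  have e21 : ∀ i j k l, (onSecond S' * onFirst S) (i, k) (j, l) = S' k l * S i j := by
    intro i j k l
    rw [mul_onFirst_apply]
    simp [onSecond_apply]
  have q12 : ∀ i j k l, (onFirst S * transQ σ B * onSecond S') (i, k) (j, l) =
      (σ.e k * σ.e (σ.ν j)) • (S i (σ.ν k) * S' (σ.ν j) l) := by
    intro i j k l
    rw [mul_onSecond_apply, sum_eq_single (σ.ν j)]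
    · rw [mul_transQ_apply, if_pos (σ.ν_ν j).symm, sum_eq_single k]
      · simp [onFirst_apply, mul_assoc]
      · intro b _ hb
        simp [onFirst_apply, hb.symm]
      · simp
    · intro b _ hb
      rw [mul_transQ_apply, if_neg, zero_mul]
      rwa [σ.eq_ν_iff]
    · simp
  have q21 : ∀ i j k l, (onSecond S' * transQ σ B * onFirst S) (i, k) (j, l) =
      (σ.e i * σ.e (σ.ν l)) • (S' k (σ.ν i) * S (σ.ν l) j) := by
    intro i j k l
    rw [mul_onFirst_apply, sum_eq_single (σ.ν l)]
    · rw [mul_transQ_apply, if_pos rfl, sum_eq_single (σ.ν i)]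
      · simp only [onSecond_apply, σ.ν_ν, if_true, smul_mul_assoc]
        rw [σ.e_ν_eq i, σ.e_ν_eq l]
        congr 1
        ring
      · intro b _ hb
        rw [onSecond_apply, if_neg, smul_zero]
        simp only
        rwa [σ.eq_ν_iff]
      · simp
    · intro b _ hb
      rw [mul_transQ_apply, if_neg hb, zero_mul]
    · simp
  have hL : (d • 1 - t • flipP ι B) * onFirst S * (f • 1 + s • transQ σ B) * onSecond S' =
      (d * f) • (onFirst S * onSecond S') + (d * s) • (onFirst S * transQ σ B * onSecond S')
      - (t * f) • (flipP ι B * (onFirst S * onSecond S'))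
      - (t * s) • (flipP ι B * (onFirst S * transQ σ B * onSecond S')) := by
    simp only [sub_mul, mul_add, smul_mul_assoc, mul_smul_comm, one_mul, mul_one, mul_assoc, add_mul,
      smul_smul, smul_sub, smul_add]
    module
  have hR : onSecond S' * (f • 1 + s • transQ σ B) * onFirst S * (d • 1 - t • flipP ι B) =
      (d * f) • (onSecond S' * onFirst S) + (d * s) • (onSecond S' * transQ σ B * onFirst S)
      - (t * f) • ((onSecond S' * onFirst S) * flipP ι B)
      - (t * s) • ((onSecond S' * transQ σ B * onFirst S) * flipP ι B) := by
    simp only [mul_sub, mul_add, smul_mul_assoc, mul_smul_comm, one_mul, mul_one, mul_assoc, add_mul,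
      smul_smul, smul_sub, smul_add]
    module
  rw [hL, hR, ← Matrix.ext_iff]
  simp only [Prod.forall]
  constructor
  · intro h i k j l
    have := h i j k l
    simp only [Matrix.add_apply, Matrix.sub_apply, Matrix.smul_apply, flipP_mul_apply,
      mul_flipP_apply, e12, e21, q12, q21]
    linear_combination (norm := module) this
  · intro h i j k l
    have := h i k j l
    simp only [Matrix.add_apply, Matrix.sub_apply, Matrix.smul_apply, flipP_mul_apply,
      mul_flipP_apply, e12, e21, q12, q21] at this
    linear_combination (norm := module) this

/-- Inversion of a reflection equation in an abstract algebra. -/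
lemma inverse_reflection {M : Type*} [Ring M] [Algebra K M] [Module.IsTorsionFree K M] [IsDomain K]
    {R R' T T' S H S' G : M} {ρ κ : K} (hρ : ρ ≠ 0) (hκ : κ ≠ 0) (hR : R' * R = ρ • 1)
    (hR' : R * R' = ρ • 1) (hT : T' * T = κ • 1) (hT' : T * T' = κ • 1) (hS : S * H = 1)
    (hH : H * S = 1) (hS' : S' * G = 1) (hG : G * S' = 1)
    (h : R * S * T * S' = S' * T * S * R) :
    R' * H * T' * G = G * T' * H * R' := by
  have h1 : (G * T' * H * R') * (R * S * T * S') = (κ * ρ) • 1 := by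
    calc _ = G * T' * H * (R' * R) * S * T * S' := by simp only [mul_assoc]
      _ = ρ • (G * T' * (H * S) * T * S') := by
        simp only [hR, mul_smul_comm, smul_mul_assoc, mul_one, mul_assoc]
      _ = ρ • (G * (T' * T) * S') := by simp only [hH, mul_one, mul_assoc]
      _ = _ := by
        rw [hT, mul_smul_comm, mul_one, smul_mul_assoc, hG, smul_smul, mul_comm]
  have h2 : (S' * T * S * R) * (R' * H * T' * G) = (κ * ρ) • 1 := by
    calc _ = S' * T * S * (R * R') * H * T' * G := by simp only [mul_assoc]
      _ = ρ • (S' * T * (S * H) * T' * G) := by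
        simp only [hR', mul_smul_comm, smul_mul_assoc, mul_one, mul_assoc]
      _ = ρ • (S' * (T * T') * G) := by simp only [hS, mul_one, mul_assoc]
      _ = _ := by
        rw [hT', mul_smul_comm, mul_one, smul_mul_assoc, hS', smul_smul, mul_comm]
  refine smul_right_injective M (mul_ne_zero hκ hρ) ?_
  calc _ = ((κ * ρ) • 1) * (R' * H * T' * G) := by rw [smul_mul_assoc, one_mul]
    _ = (G * T' * H * R') * ((S' * T * S * R) * (R' * H * T' * G)) := by
      rw [← h1, h]
      simp only [mul_assoc]
    _ = _ := by rw [h2, mul_smul_comm, mul_one]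

lemma QuadRel.inverse {σ : SignedIndex ε ι} [Module.IsTorsionFree K B] [IsDomain K] {d t f s : K}
    {S S' H G : Matrix ι ι B} (h : QuadRel σ d t f s S S') (hρ : d * d - t * t ≠ 0)
    (hκ : f * (f + Fintype.card ι * s) ≠ 0) (hS : S * H = 1)
    (hH : H * S = 1) (hS' : S' * G = 1) (hG : G * S' = 1) :
    QuadRel σ d (-t) (f + Fintype.card ι * s) (-s) H G := by
  rw [quadRel_iff] at h ⊢
  have : Module.IsTorsionFree K (Matrix (ι × ι) (ι × ι) B) := by
    refine ⟨fun r hr => ?_⟩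
    rw [isSMulRegular_iff_right_eq_zero_of_smul]
    intro M hM
    ext a b
    have := congrFun (congrFun hM a) b
    rw [Matrix.smul_apply, Matrix.zero_apply, smul_eq_zero] at this
    exact this.resolve_left hr.ne_zero
  have hP := flipP_mul_flipP (ι := ι) (B := B)
  have hQ := transQ_mul_transQ (K := K) (B := B) σ
  refine inverse_reflection (K := K) hρ hκ ?_ ?_ ?_ ?_ (S := onFirst S) (S' := onSecond S') ?_ ?_ ?_ ?_
    h
  · simp only [neg_smul, sub_neg_eq_add, mul_sub, add_mul, smul_mul_assoc, mul_smul_comm, one_mul,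
      mul_one, hP]
    module
  · simp only [neg_smul, sub_neg_eq_add, mul_add, sub_mul, smul_mul_assoc, mul_smul_comm, one_mul,
      mul_one, hP]
    module
  · simp only [neg_smul, mul_add, add_mul, smul_mul_assoc, mul_smul_comm, one_mul, mul_one,
      hQ, neg_mul]
    module
  · simp only [neg_smul, mul_add, add_mul, smul_mul_assoc, mul_smul_comm, one_mul, mul_one,
      hQ, mul_neg]
    module
  · rw [← onFirst_mul, hS, onFirst_one]
  · rw [← onFirst_mul, hH, onFirst_one]
  · rw [← onSecond_mul, hS', onSecond_one]
  · rw [← onSecond_mul, hG, onSecond_one]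

end QuadraticRelation

/-! ### Block decompositions -/

section Blocks

variable {K B : Type*} [CommRing K] [Ring B] [Algebra K B]

section MixedRelation

variable {ε : ℤ} {ι : Type*} (σ : SignedIndex ε ι) [DecidableEq ι] [Fintype ι]

/-- The left contraction occurring in the relation between `S(u)` and the inverse of `S(v)`. -/
def contractL (d t : K) (S G : Matrix ι ι B) (k i : ι) : B :=
  d • ∑ y, σ.e y • (G k y * S i (σ.ν y)) - t • σ.e i • (G * S) k (σ.ν i)

/-- The right contraction occurring in the relation between `S(u)` and the inverse of `S(v)`. -/
def contractR (d t : K) (S G : Matrix ι ι B) (j l : ι) : B :=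
  d • ∑ y, σ.e y • (S (σ.ν y) j * G y l) - t • σ.e j • (S * G) (σ.ν j) l

lemma QuadRel.mixed {σ : SignedIndex ε ι} {d t f s : K} {S S' G : Matrix ι ι B}
    (h : QuadRel σ d t f s S S') (hS' : S' * G = 1) (hG : G * S' = 1) (i j k l : ι) :
    (d * f) • (G k l * S i j) + (if j = σ.ν l then s • σ.e l • contractL σ d t S G k i else 0)
        - (t * f) • (if i = l then (G * S) k j else 0) =
      (d * f) • (S i j * G k l) + (if i = σ.ν k then s • σ.e k • contractR σ d t S G j l else 0)
        - (t * f) • (if k = j then (S * G) i l else 0) := by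
  rw [quadRel_iff] at h
  have h1 : onSecond G * (d • 1 - t • flipP ι B) * onFirst S * (f • 1 + s • transQ σ B) =
      (f • 1 + s • transQ σ B) * onFirst S * (d • 1 - t • flipP ι B) * onSecond G := by
    have e1 : onSecond S' * onSecond G = 1 := by rw [← onSecond_mul, hS', onSecond_one]
    have e2 : onSecond G * onSecond S' = 1 := by rw [← onSecond_mul, hG, onSecond_one]
    calc _ = onSecond G * ((d • 1 - t • flipP ι B) * onFirst S * (f • 1 + s • transQ σ B)
              * onSecond S') * onSecond G := by
            simp only [mul_assoc, e1, mul_one]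
      _ = (onSecond G * onSecond S') * (f • 1 + s • transQ σ B) * onFirst S
            * (d • 1 - t • flipP ι B) * onSecond G := by
            rw [h]
            simp only [mul_assoc]
      _ = _ := by rw [e2, one_mul]
  have hL : onSecond G * (d • 1 - t • flipP ι B) * onFirst S * (f • 1 + s • transQ σ B) =
      (d * f) • (onSecond G * onFirst S) + (d * s) • ((onSecond G * onFirst S) * transQ σ B)
      - (t * f) • (onSecond G * (flipP ι B * onFirst S))
      - (t * s) • ((onSecond G * (flipP ι B * onFirst S)) * transQ σ B) := by
    simp only [mul_sub, sub_mul, mul_add, smul_mul_assoc, mul_smul_comm, mul_one, mul_assoc,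
      smul_smul, smul_sub]
    module
  have hR : (f • 1 + s • transQ σ B) * onFirst S * (d • 1 - t • flipP ι B) * onSecond G =
      (d * f) • (onFirst S * onSecond G) + (d * s) • (transQ σ B * (onFirst S * onSecond G))
      - (t * f) • ((onFirst S * flipP ι B) * onSecond G)
      - (t * s) • (transQ σ B * ((onFirst S * flipP ι B) * onSecond G)) := by
    simp only [mul_sub, sub_mul, add_mul, smul_mul_assoc, mul_smul_comm, one_mul, mul_one, mul_assoc,
      smul_smul, smul_sub]
    module
  rw [hL, hR] at h1
  have e21 : ∀ i j k l, (onSecond G * onFirst S) (i, k) (j, l) = G k l * S i j := by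
    intro i j k l
    rw [mul_onFirst_apply]
    simp [onSecond_apply]
  have e12 : ∀ i j k l, (onFirst S * onSecond G) (i, k) (j, l) = S i j * G k l := by
    intro i j k l
    rw [mul_onSecond_apply]
    simp [onFirst_apply]
  have p21 : ∀ i j k l, (onSecond G * (flipP ι B * onFirst S)) (i, k) (j, l) =
      if i = l then (G * S) k j else 0 := by
    intro i j k l
    rw [onSecond_mul_apply]
    by_cases hil : i = l
    · rw [if_pos hil, mul_apply]
      simp [flipP_mul_apply, onFirst_apply, hil]
    · simp [flipP_mul_apply, onFirst_apply, hil]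
  have p12 : ∀ i j k l, ((onFirst S * flipP ι B) * onSecond G) (i, k) (j, l) =
      if k = j then (S * G) i l else 0 := by
    intro i j k l
    rw [mul_onSecond_apply]
    by_cases hkj : k = j
    · rw [if_pos hkj, mul_apply]
      simp [mul_flipP_apply, onFirst_apply, hkj]
    · simp [mul_flipP_apply, onFirst_apply, hkj]
  have h2 := congrFun (congrFun h1 (i, k)) (j, l)
  simp only [Matrix.add_apply, Matrix.sub_apply, Matrix.smul_apply, mul_transQ_apply,
    transQ_mul_apply, e12, e21, p12, p21, smul_ite, smul_zero, sum_ite_eq, mem_univ,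
    if_true, sum_ite_eq'] at h2
  have hL2 : (if j = σ.ν l then s • σ.e l • contractL σ d t S G k i else 0) =
      (if j = σ.ν l then (d * s) • ∑ y, (σ.e y * σ.e l) • (G k y * S i (σ.ν y)) else 0) -
      (if j = σ.ν l then (t * s) • (σ.e i * σ.e l) • (G * S) k (σ.ν i) else 0) := by
    split_ifs
    · simp only [contractL, smul_sub, smul_sum]
      congr 1
      · exact sum_congr rfl fun y _ => by module
      · module
    · simp
  have hR2 : (if i = σ.ν k then s • σ.e k • contractR σ d t S G j l else 0) =
      (if i = σ.ν k then (d * s) • ∑ y, (σ.e k * σ.e y) • (S (σ.ν y) j * G y l) else 0) -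
      (if i = σ.ν k then (t * s) • (σ.e k * σ.e j) • (S * G) (σ.ν j) l else 0) := by
    split_ifs
    · simp only [contractR, smul_sub, smul_sum]
      congr 1
      · exact sum_congr rfl fun y _ => by module
      · module
    · simp
  rw [hL2, hR2]
  simp only [smul_ite, smul_zero, smul_sum] at h2 ⊢
  linear_combination (norm := module) h2

end MixedRelation

section Schur

variable {I O : Type*} [Fintype I] [Fintype O] [DecidableEq I] [DecidableEq O]

/-- The Schur complement of the block `S_{OO}` with the inverse `b`. -/
def schur (S : Matrix (I ⊕ O) (I ⊕ O) B) (b : Matrix O O B) : Matrix I I B :=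
  S.toBlocks₁₁ - S.toBlocks₁₂ * b * S.toBlocks₂₁

variable {S G : Matrix (I ⊕ O) (I ⊕ O) B} {b : Matrix O O B}

lemma toBlocks_mul (S G : Matrix (I ⊕ O) (I ⊕ O) B) :
    (S * G).toBlocks₁₁ = S.toBlocks₁₁ * G.toBlocks₁₁ + S.toBlocks₁₂ * G.toBlocks₂₁ ∧
    (S * G).toBlocks₁₂ = S.toBlocks₁₁ * G.toBlocks₁₂ + S.toBlocks₁₂ * G.toBlocks₂₂ ∧
    (S * G).toBlocks₂₁ = S.toBlocks₂₁ * G.toBlocks₁₁ + S.toBlocks₂₂ * G.toBlocks₂₁ ∧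
    (S * G).toBlocks₂₂ = S.toBlocks₂₁ * G.toBlocks₁₂ + S.toBlocks₂₂ * G.toBlocks₂₂ := by
  have h : S * G = Matrix.fromBlocks _ _ _ _ * Matrix.fromBlocks _ _ _ _ :=
    congrArg₂ (· * ·) (Matrix.fromBlocks_toBlocks S).symm (Matrix.fromBlocks_toBlocks G).symm
  rw [Matrix.fromBlocks_multiply] at h
  rw [h]
  simp

lemma toBlocks_one : (1 : Matrix (I ⊕ O) (I ⊕ O) B).toBlocks₁₁ = 1 ∧
    (1 : Matrix (I ⊕ O) (I ⊕ O) B).toBlocks₁₂ = 0 ∧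
    (1 : Matrix (I ⊕ O) (I ⊕ O) B).toBlocks₂₁ = 0 ∧
    (1 : Matrix (I ⊕ O) (I ⊕ O) B).toBlocks₂₂ = 1 := by
  refine ⟨?_, ?_, ?_, ?_⟩ <;> ext i j <;>
    simp [toBlocks₁₁, toBlocks₁₂, toBlocks₂₁, toBlocks₂₂,
      one_apply]

lemma schur_toBlocks₂₁ (hSG : S * G = 1) (hb : b * S.toBlocks₂₂ = 1) :
    G.toBlocks₂₁ = -(b * S.toBlocks₂₁ * G.toBlocks₁₁) := by
  have h := (toBlocks_mul S G).2.2.1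
  rw [hSG, toBlocks_one.2.2.1] at h
  have h1 := congrArg (b * ·) h
  simp only [Matrix.mul_zero, Matrix.mul_add, ← Matrix.mul_assoc, hb, Matrix.one_mul] at h1
  exact (neg_eq_of_add_eq_zero_right h1.symm).symm

lemma schur_toBlocks₂₂ (hSG : S * G = 1) (hb : b * S.toBlocks₂₂ = 1) :
    G.toBlocks₂₂ = b - b * S.toBlocks₂₁ * G.toBlocks₁₂ := by
  have h := (toBlocks_mul S G).2.2.2
  rw [hSG, toBlocks_one.2.2.2] at h
  have h1 := congrArg (b * ·) h
  simp only [Matrix.mul_one, Matrix.mul_add, ← Matrix.mul_assoc, hb, Matrix.one_mul] at h1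
  rw [eq_sub_iff_add_eq']
  exact h1.symm

lemma schur_toBlocks₁₂ (hGS : G * S = 1) (hb : S.toBlocks₂₂ * b = 1) :
    G.toBlocks₁₂ = -(G.toBlocks₁₁ * (S.toBlocks₁₂ * b)) := by
  have h := (toBlocks_mul G S).2.1
  rw [hGS, toBlocks_one.2.1] at h
  have h1 := congrArg (· * b) h
  simp only [Matrix.zero_mul, Matrix.add_mul, Matrix.mul_assoc, hb, Matrix.mul_one] at h1
  exact (neg_eq_of_add_eq_zero_right h1.symm).symm

lemma schur_mul (hSG : S * G = 1) (hb : b * S.toBlocks₂₂ = 1) :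
    schur S b * G.toBlocks₁₁ = 1 := by
  have h := (toBlocks_mul S G).1
  rw [hSG, toBlocks_one.1, schur_toBlocks₂₁ hSG hb] at h
  rw [h, schur, Matrix.sub_mul]
  simp only [Matrix.mul_assoc, Matrix.mul_neg, sub_eq_add_neg]

lemma mul_schur (hGS : G * S = 1) (hb : S.toBlocks₂₂ * b = 1) :
    G.toBlocks₁₁ * schur S b = 1 := by
  have h := (toBlocks_mul G S).1
  rw [hGS, toBlocks_one.1, schur_toBlocks₁₂ hGS hb] at h
  rw [h, schur, Matrix.mul_sub]
  simp only [Matrix.mul_assoc, Matrix.neg_mul, sub_eq_add_neg]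

lemma commute_inverse {κ : Type*} [Fintype κ] [DecidableEq κ] {M N : Matrix κ κ B} (h1 : M * N = 1)
    (h2 : N * M = 1) {x : B} (hx : ∀ i j, M i j * x = x * M i j) (i j : κ) :
    N i j * x = x * N i j := by
  have hM : M * diagonal (fun _ => x) = diagonal (fun _ => x) * M := by
    ext i j
    rw [mul_diagonal, diagonal_mul, hx]
  have hN : N * diagonal (fun _ => x) = diagonal (fun _ => x) * N := by
    calc _ = N * (diagonal (fun _ => x) * M) * N := by
          rw [mul_assoc, mul_assoc, h1, mul_one]
      _ = _ := by rw [← hM, ← mul_assoc N, h2, one_mul]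
  have := congrFun (congrFun hN i) j
  rwa [mul_diagonal, diagonal_mul] at this

variable {ε : ℤ} (τ : SignedIndex ε I) (ω : SignedIndex ε O)

lemma QuadRel.commute_blocks {τ : SignedIndex ε I} {ω : SignedIndex ε O} [IsDomain K]
    [Module.IsTorsionFree K B] {d t f s : K} {S' : Matrix (I ⊕ O) (I ⊕ O) B}
    (h : QuadRel (τ.sum ω) d t f s S S') (hS' : S' * G = 1) (hG : G * S' = 1) (hdf : d * f ≠ 0)
    (i j : I) (o p : O) :
    G (.inl i) (.inl j) * S (.inr o) (.inr p) = S (.inr o) (.inr p) * G (.inl i) (.inl j) := by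
  have := h.mixed hS' hG (.inr o) (.inr p) (.inl i) (.inl j)
  simp only [SignedIndex.sum, Sum.map_inl, reduceCtorEq, if_false, smul_zero, add_zero, sub_zero]
    at this
  exact smul_right_injective B hdf this

lemma QuadRel.schur_commute {τ : SignedIndex ε I} {ω : SignedIndex ε O} [IsDomain K]
    [Module.IsTorsionFree K B] {d t f s : K} {S' : Matrix (I ⊕ O) (I ⊕ O) B} {b' : Matrix O O B}
    (h : QuadRel (τ.sum ω) d t f s S S') (hS' : S' * G = 1) (hG : G * S' = 1)
    (hb : S'.toBlocks₂₂ * b' = 1) (hb' : b' * S'.toBlocks₂₂ = 1) (hdf : d * f ≠ 0)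
    (i j : I) (o p : O) :
    schur S' b' i j * S (.inr o) (.inr p) = S (.inr o) (.inr p) * schur S' b' i j :=
  commute_inverse (mul_schur hG hb) (schur_mul hS' hb')
    (fun i j => h.commute_blocks hS' hG hdf i j o p) i j

/-- The Schur complements satisfy the quadratic relation with a shifted parameter. -/
lemma QuadRel.schur {τ : SignedIndex ε I} {ω : SignedIndex ε O} [IsDomain K]
    [Module.IsTorsionFree K B] {d t f s : K} {S' H : Matrix (I ⊕ O) (I ⊕ O) B} {b b' : Matrix O O B}
    (h : QuadRel (τ.sum ω) d t f s S S')
    (hS : S * H = 1) (hH : H * S = 1) (hS' : S' * G = 1) (hG : G * S' = 1)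
    (hb : S.toBlocks₂₂ * b = 1) (hb' : b * S.toBlocks₂₂ = 1)
    (hc : S'.toBlocks₂₂ * b' = 1) (hc' : b' * S'.toBlocks₂₂ = 1) (hρ : d * d - t * t ≠ 0)
    (hf : f ≠ 0) (hfN : f + (Fintype.card I + Fintype.card O) * s ≠ 0)
    (hfO : f + Fintype.card O * s ≠ 0) :
    QuadRel τ d t (f + Fintype.card O * s) s (schur S b) (schur S' b') := by
  have hcard : (Fintype.card (I ⊕ O) : K) = Fintype.card I + Fintype.card O := by
    rw [Fintype.card_sum, Nat.cast_add]
  have h1 := h.inverse hρ (by rw [hcard]; exact mul_ne_zero hf hfN) hS hH hS' hG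
  have h2 := (h1.submatrix (τ := τ) Sum.inl (fun _ => rfl) fun _ => rfl).inverse
    (H := TwistedYangian.schur S b) (G := TwistedYangian.schur S' b')
    (by rwa [neg_mul_neg]) ?_ (mul_schur hH hb) (schur_mul hS hb') (mul_schur hG hc)
    (schur_mul hS' hc')
  · have e1 : f + Fintype.card (I ⊕ O) * s + Fintype.card I * -s = f + Fintype.card O * s := by
      rw [hcard]
      ring
    rwa [neg_neg, neg_neg, e1] at h2
  · have e1 : f + Fintype.card (I ⊕ O) * s + Fintype.card I * -s = f + Fintype.card O * s := by
      rw [hcard]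
      ring
    rw [e1, hcard]
    exact mul_ne_zero hfN hfO

end Schur

end Blocks

/-! ### The symmetry relation for Schur complements -/

section SchurSymmetry

variable {K B : Type*} [CommRing K] [Ring B] [Algebra K B] [IsDomain K] [Module.IsTorsionFree K B]
variable {I O : Type*} {ε : ℤ} {τ : SignedIndex ε I} {ω : SignedIndex ε O}

lemma SignedIndex.ν_inl (i : I) : (τ.sum ω).ν (.inl i) = .inl (τ.ν i) := rfl

lemma SignedIndex.ν_inr (i : O) : (τ.sum ω).ν (.inr i) = .inr (ω.ν i) := rfl

lemma SignedIndex.e_inl (i : I) : (τ.sum ω).e (.inl i) = τ.e i := rfl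

lemma SignedIndex.e_inr (i : O) : (τ.sum ω).e (.inr i) = ω.e i := rfl

variable [Fintype I] [Fintype O] [DecidableEq I] [DecidableEq O]
variable {S S' G : Matrix (I ⊕ O) (I ⊕ O) B} {d t r s : K}

lemma contracted_mixed (hS : QuadRel (τ.sum ω) d t (-(r * s)) s S S') (hS' : S' * G = 1)
    (hG : G * S' = 1) (hr : r = Fintype.card O) {r' : K} (hrr : r * r' = 1) (hs : s ≠ 0)
    (j l : I ⊕ O) :
    d • ∑ k : O, ω.e k • (G (.inr k) l * S (.inr (ω.ν k)) j)
      + d • ∑ a : I, τ.e a • (S (.inl (τ.ν a)) j * G (.inl a) l) =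
    (if j = (τ.sum ω).ν l then (τ.sum ω).e l •
      (r' • ∑ k : O, ω.e k • contractL (τ.sum ω) d t S G (.inr k) (.inr (ω.ν k))) else 0)
      + t • (∑ k : O, if Sum.inr (ω.ν k) = l then ω.e k • (G * S) (.inr k) j else 0)
      + t • (τ.sum ω).e j • (S * G) ((τ.sum ω).ν j) l
      - t • (∑ k : O, if Sum.inr k = j then ω.e k • (S * G) (.inr (ω.ν k)) l else 0) := by
  have key : ∀ k : O, (r * s) • ω.e k • (d • (G (.inr k) l * S (.inr (ω.ν k)) j)
      - (if j = (τ.sum ω).ν l then (τ.sum ω).e l • r' • contractL (τ.sum ω) d t S G (.inr k)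
          (.inr (ω.ν k)) else 0)
      - t • (if Sum.inr (ω.ν k) = l then (G * S) (.inr k) j else 0)
      - d • (S (.inr (ω.ν k)) j * G (.inr k) l)
      + t • (if Sum.inr k = j then (S * G) (.inr (ω.ν k)) l else 0)) =
      -(s • contractR (τ.sum ω) d t S G j l) := by
    intro k
    have h := hS.mixed hS' hG (.inr (ω.ν k)) j (.inr k) l
    have hk : (Sum.inr (ω.ν k) : I ⊕ O) = (τ.sum ω).ν (.inr k) := rfl
    have hek : (τ.sum ω).e (.inr k) = ω.e k := rfl
    rw [if_pos hk, hek] at h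
    have hsq : ω.e k • ω.e k • contractR (τ.sum ω) d t S G j l =
        contractR (τ.sum ω) d t S G j l := by
      rw [smul_smul, ω.e_mul, one_smul]
    have h1 := congrArg (fun x => ω.e k • x) h
    have hif : (s • if j = (τ.sum ω).ν l then (τ.sum ω).e l • contractL (τ.sum ω) d t S G (.inr k)
          (.inr (ω.ν k)) else 0) = (r * s) • (if j = (τ.sum ω).ν l then (τ.sum ω).e l • r' •
          contractL (τ.sum ω) d t S G (.inr k) (.inr (ω.ν k)) else 0) := by
      split_ifs
      · rw [smul_comm _ r', smul_smul, show r * s * r' = s by linear_combination s * hrr]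
      · simp
    rw [← smul_ite_zero] at h1
    rw [hif] at h1
    simp only [smul_add, smul_sub] at h1 ⊢
    rw [smul_comm (ω.e k) s, hsq] at h1
    linear_combination (norm := module) (-1 : ℤ) • h1
  have hsum := sum_congr (rfl : (Finset.univ : Finset O) = _) fun k _ => key k
  rw [Finset.sum_const, Finset.card_univ, ← smul_sum, ← Nat.cast_smul_eq_nsmul K, ← hr,
    ← neg_smul, smul_smul] at hsum
  have hr0 : r ≠ 0 := left_ne_zero_of_mul_eq_one hrr
  have h2 : ∑ k : O, ω.e k • (d • (G (.inr k) l * S (.inr (ω.ν k)) j)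
      - (if j = (τ.sum ω).ν l then (τ.sum ω).e l • r' • contractL (τ.sum ω) d t S G (.inr k)
          (.inr (ω.ν k)) else 0)
      - t • (if Sum.inr (ω.ν k) = l then (G * S) (.inr k) j else 0)
      - d • (S (.inr (ω.ν k)) j * G (.inr k) l)
      + t • (if Sum.inr k = j then (S * G) (.inr (ω.ν k)) l else 0)) =
      -contractR (τ.sum ω) d t S G j l := by
    refine smul_right_injective B (mul_ne_zero hr0 hs) ?_
    simp only
    rw [hsum]
    module
  have hR : contractR (τ.sum ω) d t S G j l =
      d • ∑ a : I, τ.e a • (S (.inl (τ.ν a)) j * G (.inl a) l)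
      + d • ∑ k : O, ω.e k • (S (.inr (ω.ν k)) j * G (.inr k) l)
      - t • (τ.sum ω).e j • (S * G) ((τ.sum ω).ν j) l := by
    rw [contractR, Fintype.sum_sum_type, smul_add]
    rfl
  rw [hR] at h2
  have hif : ∀ (p : Prop) [Decidable p] (x : O → B) (n : ℤ),
      ∑ k, ω.e k • (if p then n • r' • x k else 0) =
        if p then n • (r' • ∑ k, ω.e k • x k) else 0 := by
    intro p _ x n
    split_ifs
    · simp only [smul_sum]
      exact sum_congr rfl fun k _ => by module
    · simp
  simp only [smul_add, smul_sub, sum_add_distrib, sum_sub_distrib, hif] at h2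
  have hif' : ∀ (p : O → Prop) [DecidablePred p] (x : O → B),
      ∑ k, ω.e k • t • (if p k then x k else 0) = t • ∑ k, if p k then ω.e k • x k else 0 := by
    intro p _ x
    rw [smul_sum]
    refine sum_congr rfl fun k _ => ?_
    split_ifs
    · module
    · simp
  simp only [smul_comm (ω.e _) d, hif', ← smul_sum] at h2
  linear_combination (norm := module) h2

lemma mixed_commutator (hS : QuadRel (τ.sum ω) d t (-(r * s)) s S S') (hSG : S' * G = 1)
    (hGS : G * S' = 1) {r' : K} (hrr : r * r' = 1) (hs : s ≠ 0) (j l : I ⊕ O) (m : I) (k : O) :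
    d • (S (.inr (ω.ν k)) j * G (.inl m) l) - d • (G (.inl m) l * S (.inr (ω.ν k)) j) =
      -(if j = (τ.sum ω).ν l then (τ.sum ω).e l • r' •
          contractL (τ.sum ω) d t S G (.inl m) (.inr (ω.ν k)) else 0)
      + t • (if Sum.inl m = j then (S * G) (.inr (ω.ν k)) l else 0)
      - t • (if Sum.inr (ω.ν k) = l then (G * S) (.inl m) j else 0) := by
  have hr0 : r * s ≠ 0 := mul_ne_zero (left_ne_zero_of_mul_eq_one hrr) hs
  have h := hS.mixed hSG hGS (.inr (ω.ν k)) j (.inl m) l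
  rw [if_neg (by simp [SignedIndex.sum] : ¬ (Sum.inr (ω.ν k) : I ⊕ O) = (τ.sum ω).ν (.inl m))] at h
  have hif : (if j = (τ.sum ω).ν l then s • (τ.sum ω).e l •
      contractL (τ.sum ω) d t S G (.inl m) (.inr (ω.ν k)) else 0) =
      (r * s) • (if j = (τ.sum ω).ν l then (τ.sum ω).e l • r' •
          contractL (τ.sum ω) d t S G (.inl m) (.inr (ω.ν k)) else 0) := by
    split_ifs
    · rw [smul_comm _ r', smul_smul, show r * s * r' = s by linear_combination s * hrr]
    · simp
  rw [hif] at h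
  refine smul_right_injective B hr0 ?_
  simp only [smul_add, smul_sub, smul_neg]
  linear_combination (norm := module) h

variable {b b' : Matrix O O B}

section

variable (hS : QuadRel (τ.sum ω) d t (-(r * s)) s S S') (hSG : S' * G = 1)
  (hGS : G * S' = 1) (hr : r = Fintype.card O) {r' : K} (hrr : r * r' = 1) (hs : s ≠ 0) (hd : d ≠ 0)
  (hb : S.toBlocks₂₂ * b = 1) (hb' : b * S.toBlocks₂₂ = 1)
  (hc : S'.toBlocks₂₂ * b' = 1) (hc' : b' * S'.toBlocks₂₂ = 1)

include hS hSG hGS hr hrr hs hd hb hc hc'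

/-- The coefficients `S_{IO} S_{OO}⁻¹` and `S_{OO}⁻¹ S_{OI}` at opposite points are transposes of
each other. -/
lemma border_transpose (m : I) (k : O) :
    ω.e k • (b' * S'.toBlocks₂₁) k m = τ.e m • (S.toBlocks₁₂ * b) (τ.ν m) (ω.ν k) := by
  have hdf : d * (-(r * s)) ≠ 0 :=
    mul_ne_zero hd (neg_ne_zero.2 (mul_ne_zero (left_ne_zero_of_mul_eq_one hrr) hs))
  have h1 : ∀ (l : I) (o : O), ∑ k : O, ω.e k • (G (.inr k) (.inl l) * S (.inr (ω.ν k)) (.inr o))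
      = -∑ a : I, τ.e a • (S (.inl (τ.ν a)) (.inr o) * G (.inl a) (.inl l)) := by
    intro l o
    have h := contracted_mixed hS hSG hGS hr hrr hs (.inr o) (.inl l)
    have e1 : ∀ k : O, (Sum.inr k : I ⊕ O) = Sum.inr o ↔ k = o := fun k => Sum.inr_injective.eq_iff
    simp only [SignedIndex.sum, Sum.map_inl, Sum.map_inr, reduceCtorEq, if_false, e1,
      sum_const_zero, smul_zero, zero_add, sum_ite_eq', mem_univ, if_true,
      Sum.elim_inr, sub_self] at h
    refine smul_right_injective B hd ?_
    simp only
    rw [smul_neg]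
    exact eq_neg_of_add_eq_zero_left h
  have hG21 : ∀ (k : O) (m : I), ∑ l : I, G (.inr k) (.inl l) * schur S' b' l m
      = -(b' * S'.toBlocks₂₁) k m := by
    intro k m
    have h2 : G.toBlocks₂₁ * schur S' b' = -(b' * S'.toBlocks₂₁) := by
      rw [schur_toBlocks₂₁ hSG hc', Matrix.neg_mul, Matrix.mul_assoc, mul_schur hGS hc,
        Matrix.mul_one]
    exact congrFun (congrFun h2 k) m
  have h3 : ∀ o : O, ∑ k : O, ω.e k • ((b' * S'.toBlocks₂₁) k m * S (.inr (ω.ν k)) (.inr o)) =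
      τ.e m • S (.inl (τ.ν m)) (.inr o) := by
    intro o
    have h4 := sum_congr (rfl : (Finset.univ : Finset I) = _) fun l _ =>
      congrArg (fun x => x * schur S' b' l m) (h1 l o)
    simp only [sum_mul, neg_mul, smul_mul_assoc, mul_assoc] at h4
    rw [sum_comm] at h4
    have h5 : ∀ k : O, ∑ l : I, ω.e k • (G (.inr k) (.inl l) * (S (.inr (ω.ν k)) (.inr o)
        * schur S' b' l m)) = -(ω.e k • ((b' * S'.toBlocks₂₁) k m * S (.inr (ω.ν k)) (.inr o))) := by
      intro k
      rw [← smul_neg, ← neg_mul, ← hG21, sum_mul, smul_sum]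
      refine sum_congr rfl fun l _ => ?_
      rw [mul_assoc, hS.schur_commute hSG hGS hc hc' hdf]
    rw [sum_congr rfl fun k _ => h5 k, Finset.sum_neg_distrib, Finset.sum_neg_distrib,
      neg_inj, sum_comm] at h4
    rw [h4]
    have h6 : ∀ a : I, ∑ l : I, τ.e a • (S (.inl (τ.ν a)) (.inr o) * (G (.inl a) (.inl l)
        * schur S' b' l m)) = if a = m then τ.e a • S (.inl (τ.ν a)) (.inr o) else 0 := by
      intro a
      rw [← smul_sum, ← mul_sum]
      have h7 := congrFun (congrFun (mul_schur hGS hc) a) m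
      rw [mul_apply, one_apply] at h7
      simp only [toBlocks₁₁, of_apply] at h7
      rw [h7]
      split_ifs <;> simp
    rw [sum_congr rfl fun a _ => h6 a]
    simp
  have h8 := sum_congr (rfl : (Finset.univ : Finset O) = _) fun o _ =>
    congrArg (fun x => x * b o (ω.ν k)) (h3 o)
  simp only [sum_mul, smul_mul_assoc] at h8
  rw [← smul_sum, sum_comm] at h8
  have h9 : ∀ k' : O, ∑ o : O, ω.e k' • ((b' * S'.toBlocks₂₁) k' m * S (.inr (ω.ν k')) (.inr o)
      * b o (ω.ν k)) = if k' = k then ω.e k' • (b' * S'.toBlocks₂₁) k' m else 0 := by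
    intro k'
    simp only [mul_assoc]
    rw [← smul_sum, ← mul_sum]
    have h7 := congrFun (congrFun hb (ω.ν k')) (ω.ν k)
    rw [mul_apply, one_apply] at h7
    simp only [toBlocks₂₂, of_apply, ω.ν_inj] at h7
    rw [h7]
    split_ifs <;> simp
  rw [sum_congr rfl fun k' _ => h9 k'] at h8
  simpa [mul_apply, toBlocks₁₂] using h8


/-- The contraction common to all blocks. -/
lemma contracted_schur (j l : I ⊕ O) (β : O → B) (ρ : I → B)
    (hβ : ∀ k, G (.inr k) l = β k - ∑ m, (b' * S'.toBlocks₂₁) k m * G (.inl m) l)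
    (hρ : ∀ a, S (.inl (τ.ν a)) j =
      ρ a + ∑ k, (S.toBlocks₁₂ * b) (τ.ν a) (ω.ν k) * S (.inr (ω.ν k)) j) :
    d • ∑ k, ω.e k • (β k * S (.inr (ω.ν k)) j) + d • ∑ a, τ.e a • (ρ a * G (.inl a) l) =
      (if j = (τ.sum ω).ν l then (τ.sum ω).e l •
        (r' • ∑ k : O, ω.e k • contractL (τ.sum ω) d t S G (.inr k) (.inr (ω.ν k))
          + r' • ∑ m : I, ∑ k : O, τ.e m • ((S.toBlocks₁₂ * b) (τ.ν m) (ω.ν k) *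
            contractL (τ.sum ω) d t S G (.inl m) (.inr (ω.ν k)))) else 0)
      - t • ∑ m : I, (if Sum.inl m = j then
          τ.e m • ∑ k : O, (S.toBlocks₁₂ * b) (τ.ν m) (ω.ν k) * (S * G) (.inr (ω.ν k)) l else 0)
      + t • ∑ k : O, (if Sum.inr (ω.ν k) = l then
          ω.e k • ∑ m : I, (b' * S'.toBlocks₂₁) k m * (G * S) (.inl m) j else 0)
      + t • (∑ k : O, if Sum.inr (ω.ν k) = l then ω.e k • (G * S) (.inr k) j else 0)
      + t • (τ.sum ω).e j • (S * G) ((τ.sum ω).ν j) l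
      - t • (∑ k : O, if Sum.inr k = j then ω.e k • (S * G) (.inr (ω.ν k)) l else 0) := by
  have hbt := border_transpose hS hSG hGS hr hrr hs hd hb hc hc'
  have h1 := contracted_mixed hS hSG hGS hr hrr hs j l
  set W := S.toBlocks₁₂ * b
  set V := b' * S'.toBlocks₂₁
  have hm := mixed_commutator hS hSG hGS hrr hs j l
  have e1 : ∑ k : O, ω.e k • (G (.inr k) l * S (.inr (ω.ν k)) j) =
      ∑ k, ω.e k • (β k * S (.inr (ω.ν k)) j)
      - ∑ m : I, ∑ k : O, τ.e m • (W (τ.ν m) (ω.ν k) * (G (.inl m) l * S (.inr (ω.ν k)) j)) := by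
    rw [sum_comm, ← sum_sub_distrib]
    refine sum_congr rfl fun k _ => ?_
    rw [hβ k, sub_mul, smul_sub, sum_mul, smul_sum]
    congr 1
    refine sum_congr rfl fun m _ => ?_
    rw [mul_assoc, ← smul_mul_assoc, hbt, smul_mul_assoc]
  have e2 : ∑ a : I, τ.e a • (S (.inl (τ.ν a)) j * G (.inl a) l) =
      ∑ a, τ.e a • (ρ a * G (.inl a) l)
      + ∑ m : I, ∑ k : O, τ.e m • (W (τ.ν m) (ω.ν k) * (S (.inr (ω.ν k)) j * G (.inl m) l)) := by
    rw [← sum_add_distrib]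
    refine sum_congr rfl fun a _ => ?_
    rw [hρ a, add_mul, smul_add, sum_mul, smul_sum]
    simp only [mul_assoc]
  have e3 : d • ∑ m : I, ∑ k : O, τ.e m • (W (τ.ν m) (ω.ν k) * (S (.inr (ω.ν k)) j * G (.inl m) l))
      - d • ∑ m : I, ∑ k : O, τ.e m • (W (τ.ν m) (ω.ν k) * (G (.inl m) l * S (.inr (ω.ν k)) j)) =
      -(if j = (τ.sum ω).ν l then (τ.sum ω).e l •
        (r' • ∑ m : I, ∑ k : O, τ.e m • (W (τ.ν m) (ω.ν k) *
            contractL (τ.sum ω) d t S G (.inl m) (.inr (ω.ν k)))) else 0)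
      + t • ∑ m : I, (if Sum.inl m = j then
          τ.e m • ∑ k : O, W (τ.ν m) (ω.ν k) * (S * G) (.inr (ω.ν k)) l else 0)
      - t • ∑ k : O, (if Sum.inr (ω.ν k) = l then
          ω.e k • ∑ m : I, V k m * (G * S) (.inl m) j else 0) := by
    have f1 : ∑ k : O, (if Sum.inr (ω.ν k) = l then
          ω.e k • ∑ m : I, V k m * (G * S) (.inl m) j else 0) =
        ∑ m : I, ∑ k : O, (if Sum.inr (ω.ν k) = l then
          τ.e m • (W (τ.ν m) (ω.ν k) * (G * S) (.inl m) j) else 0) := by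
      rw [sum_comm]
      refine sum_congr rfl fun k _ => ?_
      split_ifs
      · rw [smul_sum]
        exact sum_congr rfl fun m _ => by rw [← smul_mul_assoc, hbt, smul_mul_assoc]
      · simp
    have f2 : ∑ m : I, (if Sum.inl m = j then
          τ.e m • ∑ k : O, W (τ.ν m) (ω.ν k) * (S * G) (.inr (ω.ν k)) l else 0) =
        ∑ m : I, ∑ k : O, (if Sum.inl m = j then
          τ.e m • (W (τ.ν m) (ω.ν k) * (S * G) (.inr (ω.ν k)) l) else 0) := by
      refine sum_congr rfl fun m _ => ?_
      split_ifs
      · rw [smul_sum]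
      · simp
    have f3 : (if j = (τ.sum ω).ν l then (τ.sum ω).e l •
        (r' • ∑ m : I, ∑ k : O, τ.e m • (W (τ.ν m) (ω.ν k) *
            contractL (τ.sum ω) d t S G (.inl m) (.inr (ω.ν k)))) else 0) =
        ∑ m : I, ∑ k : O, if j = (τ.sum ω).ν l then (τ.sum ω).e l • r' • τ.e m •
          (W (τ.ν m) (ω.ν k) * contractL (τ.sum ω) d t S G (.inl m) (.inr (ω.ν k))) else 0 := by
      split_ifs
      · simp only [smul_sum]
      · simp
    rw [f1, f2, f3]
    simp only [smul_sum, ← Finset.sum_neg_distrib, ← sum_add_distrib,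
      ← sum_sub_distrib]
    refine sum_congr rfl fun m _ => sum_congr rfl fun k _ => ?_
    have h2 := congrArg (fun x => τ.e m • (W (τ.ν m) (ω.ν k) * x)) (hm m k)
    simp only [mul_sub, mul_add, mul_neg, mul_smul_comm, mul_ite, mul_zero] at h2
    have g1 : ∀ (p : Prop) [Decidable p] (x : B) (n : ℤ), n • t • (if p then x else 0) =
        t • (if p then n • x else 0) := by
      intro p _ x n
      split_ifs
      · module
      · simp
    have g2 : ∀ (p : Prop) [Decidable p] (x : B) (n n' : ℤ),
        n • (if p then n' • r' • x else 0) = if p then n' • r' • n • x else 0 := by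
      intro p _ x n n'
      split_ifs
      · module
      · simp
    simp only [smul_sub, smul_add, smul_neg, g1, g2] at h2
    linear_combination (norm := module) h2
  have e4 : ∀ (p : Prop) [Decidable p] (x y : B) (n : ℤ), (if p then n • (x + y) else 0) =
      (if p then n • x else 0) + if p then n • y else 0 := by
    intro p _ x y n
    split_ifs
    · rw [smul_add]
    · simp
  rw [e1, e2] at h1
  rw [e4]
  simp only [smul_sub, smul_add] at h1
  linear_combination (norm := module) h1 - e3

include hb'

/-- The symmetry of the Schur complement and of the complementary block at opposite points, up to
a common factor `z`. -/
lemma schur_symmetry : ∃ z : B,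
    (∀ j m : I, d • τ.e m • schur S b (τ.ν m) j - t • τ.e j • schur S b (τ.ν j) m =
      τ.e (τ.ν j) • (z * schur S' b' (τ.ν j) m)) ∧
    ∀ j l : O, d • ∑ k, ω.e k • (b' k l * S (.inr (ω.ν k)) (.inr j))
      - t • ω.e (ω.ν l) • (b' * S.toBlocks₂₂) (ω.ν l) j =
      if j = ω.ν l then ω.e l • z else 0 := by
  have key := contracted_schur hS hSG hGS hr hrr hs hd hb hc hc'
  obtain ⟨z, hz⟩ : ∃ z, z =
      r' • ∑ k : O, ω.e k • contractL (τ.sum ω) d t S G (.inr k) (.inr (ω.ν k))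
          + r' • ∑ m : I, ∑ k : O, τ.e m • ((S.toBlocks₁₂ * b) (τ.ν m) (ω.ν k) *
            contractL (τ.sum ω) d t S G (.inl m) (.inr (ω.ν k))) := ⟨_, rfl⟩
  simp only [← hz] at key
  refine ⟨z, ?_, ?_⟩
  · have h1 : ∀ j l : I, d • ∑ a, τ.e a • (schur S b (τ.ν a) j * G (.inl a) (.inl l))
        - t • τ.e j • (schur S b * G.toBlocks₁₁) (τ.ν j) l =
        if j = τ.ν l then τ.e l • z else 0 := by
      intro j l
      have h2 := key (.inl j) (.inl l) (fun _ => 0) (fun a => schur S b (τ.ν a) j) ?_ ?_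
      · have e1 : ∀ k, (Sum.inl k : I ⊕ O) = Sum.inl j ↔ k = j := fun k => Sum.inl_injective.eq_iff
        simp only [zero_mul, smul_zero, sum_const_zero, zero_add, SignedIndex.ν_inl,
          SignedIndex.e_inl, e1, reduceCtorEq, if_false, add_zero, sub_zero,
          Sum.inl.injEq, sum_ite_eq', mem_univ, if_true] at h2
        have h3 : (schur S b * G.toBlocks₁₁) (τ.ν j) l = (S * G) (.inl (τ.ν j)) (.inl l)
            - ∑ k, (S.toBlocks₁₂ * b) (τ.ν j) (ω.ν k) * (S * G) (.inr (ω.ν k)) (.inl l) := by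
          rw [ω.sum_ν fun k => (S.toBlocks₁₂ * b) (τ.ν j) k * (S * G) (.inr k) (.inl l)]
          have h4 : schur S b * G.toBlocks₁₁ =
              (S * G).toBlocks₁₁ - S.toBlocks₁₂ * b * (S * G).toBlocks₂₁ := by
            rw [(toBlocks_mul S G).1, (toBlocks_mul S G).2.2.1, schur,
              Matrix.sub_mul, Matrix.mul_add, Matrix.mul_assoc _ b (_ * _),
              Matrix.mul_assoc _ b (_ * _), ← Matrix.mul_assoc b S.toBlocks₂₂, hb', Matrix.one_mul]
            simp only [Matrix.mul_assoc]
            abel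
          exact congrFun (congrFun h4 _) _
        rw [h3]
        linear_combination (norm := module) h2
      · intro k
        rw [zero_sub]
        have := congrFun (congrFun (schur_toBlocks₂₁ hSG hc') k) l
        rwa [Matrix.neg_apply, mul_apply] at this
      · intro a
        rw [ω.sum_ν fun k => (S.toBlocks₁₂ * b) (τ.ν a) k * S (.inr k) (.inl j),
          schur, Matrix.sub_apply, mul_apply (M := S.toBlocks₁₂ * b)]
        simp [toBlocks₁₁, toBlocks₂₁]
    intro j m
    have h2 := sum_congr (rfl : (Finset.univ : Finset I) = _) fun l _ =>
      congrArg (fun x => x * schur S' b' l m) (h1 j l)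
    have h3 : ∀ a : I, ∑ l, G (.inl a) (.inl l) * schur S' b' l m = if a = m then 1 else 0 := by
      intro a
      have h7 := congrFun (congrFun (mul_schur hGS hc) a) m
      rwa [mul_apply, one_apply] at h7
    have h4 : ∑ l, (schur S b * G.toBlocks₁₁) (τ.ν j) l * schur S' b' l m =
        schur S b (τ.ν j) m := by
      rw [← mul_apply, Matrix.mul_assoc, mul_schur hGS hc, Matrix.mul_one]
    simp only [sub_mul, smul_mul_assoc, sum_sub_distrib, ← smul_sum, h4,
      sum_mul, ite_mul, zero_mul, mul_assoc] at h2
    rw [sum_comm] at h2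
    simp only [← smul_sum, ← mul_sum, h3, mul_ite, mul_one, mul_zero, smul_ite,
      smul_zero, sum_ite_eq', mem_univ, if_true, τ.eq_ν_iff (i := j)] at h2
    exact h2
  · intro j l
    have h2 := key (.inr j) (.inr l) (fun k => b' k l) (fun _ => 0) ?_ ?_
    · have e1 : ∀ k, (Sum.inr k : I ⊕ O) = Sum.inr j ↔ k = j := fun k => Sum.inr_injective.eq_iff
      have e2 : ∀ k, (Sum.inr (ω.ν k) : I ⊕ O) = Sum.inr l ↔ k = ω.ν l := fun k => by
        rw [Sum.inr_injective.eq_iff, eq_comm, ω.eq_ν_iff]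
      simp only [zero_mul, smul_zero, sum_const_zero, add_zero, SignedIndex.ν_inr,
          SignedIndex.e_inr, e1, e2, reduceCtorEq, if_false, sub_zero,
          Sum.inr.injEq, sum_ite_eq', mem_univ, if_true, add_sub_cancel_right] at h2
      have h3 : (b' * S.toBlocks₂₂) (ω.ν l) j =
          (G * S) (.inr (ω.ν l)) (.inr j)
          + ∑ m, (b' * S'.toBlocks₂₁) (ω.ν l) m * (G * S) (.inl m) (.inr j) := by
        have h4 : b' * S.toBlocks₂₂ =
            (G * S).toBlocks₂₂ + b' * S'.toBlocks₂₁ * (G * S).toBlocks₁₂ := by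
          rw [(toBlocks_mul G S).2.1, (toBlocks_mul G S).2.2.2, schur_toBlocks₂₂ hSG hc',
            schur_toBlocks₂₁ hSG hc', Matrix.mul_add]
          simp only [Matrix.sub_mul, Matrix.neg_mul, Matrix.mul_assoc]
          abel
        have h5 := congrFun (congrFun h4 (ω.ν l)) j
        rwa [Matrix.add_apply, mul_apply (M := b' * S'.toBlocks₂₁)] at h5
      rw [h3]
      linear_combination (norm := module) h2
    · intro k
      have := congrFun (congrFun (schur_toBlocks₂₂ hSG hc') k) l
      rwa [Matrix.sub_apply, mul_apply (M := b' * S'.toBlocks₂₁)] at this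
    · intro a
      rw [ω.sum_ν fun k => (S.toBlocks₁₂ * b) (τ.ν a) k * S (.inr k) (.inr j), zero_add]
      have h3 : S.toBlocks₁₂ = S.toBlocks₁₂ * b * S.toBlocks₂₂ := by
        rw [Matrix.mul_assoc, hb', Matrix.mul_one]
      exact congrFun (congrFun h3 (τ.ν a)) j

end

end SchurSymmetry

/-! ### Matrices of twisted Yangian type -/

section SymmetryRelation

/-- The symmetry relation solved for `S' = S(-u)`. -/
lemma symm_iff {K B : Type*} [CommRing K] [IsDomain K] [Ring B] [Algebra K B]
    [Module.IsTorsionFree K B] {ε : ℤ} {ι : Type*} {σ : SignedIndex ε ι} {S S' : Matrix ι ι B}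
    {h : K} (ne1 : 1 + h ≠ 0) (ne2 : 1 - h ≠ 0) :
    (∀ i j, (σ.e i * σ.e j) • S' (σ.ν j) (σ.ν i) = S i j + h • (S i j - S' i j)) ↔
    ∀ i j, (1 - h) • (σ.e i * σ.e j) • S' (σ.ν j) (σ.ν i) =
      S i j - h • (σ.e i * σ.e j) • S (σ.ν j) (σ.ν i) := by
  have hee : ∀ i j, σ.e (σ.ν j) * σ.e (σ.ν i) = σ.e i * σ.e j := by
    intro i j
    rw [σ.e_ν_eq, σ.e_ν_eq]
    linear_combination σ.e i * σ.e j * σ.ε_mul i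
  have hsq : ∀ i j, (σ.e i * σ.e j) * (σ.e i * σ.e j) = 1 := by
    intro i j
    linear_combination σ.e j * σ.e j * σ.e_mul i + σ.e_mul j
  constructor
  · intro hs i j
    have h1 := hs i j
    have h2 := congrArg (fun x => (σ.e i * σ.e j) • x) (hs (σ.ν j) (σ.ν i))
    simp only [σ.ν_ν, hee, smul_smul, hsq, one_smul] at h2
    refine smul_right_injective _ ne1 ?_
    simp only
    linear_combination (norm := module) h1 - h • h2
  · intro hs i j
    have h1 := hs i j
    have h2 := congrArg (fun x => (σ.e i * σ.e j) • x) (hs (σ.ν j) (σ.ν i))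
    simp only [σ.ν_ν, hee, smul_sub, smul_comm (σ.e i * σ.e j) (_ : K)] at h2
    simp only [smul_smul, hsq, one_smul] at h2
    refine smul_right_injective _ ne2 ?_
    simp only
    linear_combination (norm := module) h1 + h • h2

end SymmetryRelation

section TwistedMatrices

open PowerSeries

attribute [local instance 50] seriesAlgebra

variable {A : Type*} [Ring A] [Algebra ℂ A]

lemma evReflect_smul (c : ℂ) (f : ℂ⟦X⟧⟦X⟧) (a : A⟦X⟧⟦X⟧) :
    evReflect A c (f • a) = evReflect ℂ c f • evReflect A c a := by
  rw [series_smul_def, map_mul, ← toSeries_mul]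
  congr 1
  have : (evReflect A c).comp (PowerSeries.map (algebraMap ℂ⟦X⟧ A⟦X⟧)) =
      (toSeries A).comp (evReflect ℂ c) := by
    refine series_ringHom_ext (fun b => ?_) ?_ ?_
    · rw [RingHom.comp_apply, RingHom.comp_apply, map_C]
      erw [ev_C, ev_C]
      rfl
    · rw [RingHom.comp_apply, RingHom.comp_apply, map_X]
      erw [ev_X, ev_X]
      rfl
    · rw [RingHom.comp_apply, map_X]
      erw [ev_X]
      obtain ⟨g, hg⟩ := X_dvd_invShift c
      exact ⟨toSeries A (-g), by rw [hg, ← mul_neg, map_mul, toSeries_X]⟩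
  exact congrFun (congrArg DFunLike.coe this) f

lemma shiftTwo_smul (c : ℂ) (f : ℂ⟦X⟧⟦X⟧) (a : A⟦X⟧⟦X⟧) :
    shiftTwo A c (f • a) = shiftTwo ℂ c f • shiftTwo A c a := by
  rw [series_smul_def, map_mul, series_smul_def]
  congr 1
  have : (shiftTwo A c).comp (PowerSeries.map (algebraMap ℂ⟦X⟧ A⟦X⟧)) =
      (PowerSeries.map (algebraMap ℂ⟦X⟧ A⟦X⟧)).comp (shiftTwo ℂ c) := by
    have e : ∀ b : ℂ⟦X⟧, algebraMap ℂ⟦X⟧ A⟦X⟧ b = toSeries A b := fun b => rfl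
    refine series_ringHom_ext (fun b => ?_) ?_ ?_
    · have h1 := shiftTwo_inU (A := A) c (toSeries A b)
      have h2 := shiftTwo_inU (A := ℂ) c b
      simp only [inU] at h1 h2
      rw [RingHom.comp_apply, RingHom.comp_apply, map_C, e, h1, h2, map_C, e, shiftHom_toSeries]
    · have h1 := shiftTwo_inV (A := A) c X
      have h2 := shiftTwo_inV (A := ℂ) c X
      simp only [inV, map_X] at h1 h2
      rw [RingHom.comp_apply, RingHom.comp_apply, map_X, h1, h2, shiftHom_X, shiftHom_X]
      ext n : 1
      rw [coeff_map, coeff_map, coeff_map, e, toSeries, toSeries, coeff_map, coeff_map, map_C]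
      rfl
    · have h1 := shiftTwo_inV (A := A) c X
      simp only [inV, map_X] at h1
      rw [RingHom.comp_apply, map_X, h1, shiftHom_X]
      obtain ⟨g, hg⟩ := X_dvd_invShift c
      exact ⟨PowerSeries.map C (toSeries A g), by rw [hg, map_mul, map_mul, toSeries_X, map_X]⟩
  exact congrFun (congrArg DFunLike.coe this) f

/-- The value `a(-u-c)`. -/
noncomputable def opposite (A : Type*) [Ring A] [Algebra ℂ A] (c : ℂ) : A⟦X⟧ →+* A⟦X⟧ :=
  (shiftHom A c).comp (reflectHom A)

lemma opposite_smul (c : ℂ) (f : ℂ⟦X⟧) (a : A⟦X⟧) :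
    opposite A c (f • a) = opposite ℂ c f • opposite A c a := by
  simp only [opposite, RingHom.comp_apply, reflectHom_smul, shiftHom_smul]

lemma shiftHom_opposite (b c : ℂ) (a : A⟦X⟧) :
    shiftHom A b (opposite A c a) = opposite A (b + c) a := by
  simp only [opposite, RingHom.comp_apply, shiftHom_shiftHom]

lemma opposite_opposite (b c : ℂ) (a : A⟦X⟧) :
    opposite A b (opposite A c a) = shiftHom A (b - c) a := by
  simp only [opposite, RingHom.comp_apply, reflectHom_shiftHom, reflectHom_reflectHom,
    shiftHom_shiftHom, sub_eq_add_neg]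

lemma opposite_zero (a : A⟦X⟧) : opposite A 0 a = reflectHom A a := by
  rw [opposite, RingHom.comp_apply, shiftHom_zero]

variable {ε : ℤ} {ι : Type*} [DecidableEq ι]

/-- `S(u)` satisfies the defining relations of the twisted Yangian. -/
structure IsTwisted (σ : SignedIndex ε ι) (S : Matrix ι ι A⟦X⟧) : Prop where
  quad : QuadRel σ (inV X - inU X : ℂ⟦X⟧⟦X⟧) (inU X * inV X) (inU X + inV X) (inU X * inV X)
    (S.map inU) (S.map inV)
  symm : ∀ i j, (σ.e i * σ.e j) • reflectHom A (S (σ.ν j) (σ.ν i)) =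
    S i j + (C ((ε : ℂ) / 2) * X : ℂ⟦X⟧) • (S i j - reflectHom A (S i j))
  const : ∀ i j, constantCoeff (S i j) = if i = j then 1 else 0

lemma one_add_half_ne_zero (ε : ℤ) : (1 + C ((ε : ℂ) / 2) * X : ℂ⟦X⟧) ≠ 0 :=
  one_add_mul_ne_zero _

lemma one_sub_half_ne_zero (ε : ℤ) : (1 - C ((ε : ℂ) / 2) * X : ℂ⟦X⟧) ≠ 0 := by
  have := one_add_mul_ne_zero (-((ε : ℂ) / 2))
  rwa [map_neg, neg_mul, ← sub_eq_add_neg] at this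

lemma IsTwisted.symm_solved {σ : SignedIndex ε ι} {S : Matrix ι ι A⟦X⟧} (hS : IsTwisted σ S)
    (i j : ι) : (1 - C ((ε : ℂ) / 2) * X : ℂ⟦X⟧) • (σ.e i * σ.e j) •
      reflectHom A (S (σ.ν j) (σ.ν i)) =
      S i j - (C ((ε : ℂ) / 2) * X : ℂ⟦X⟧) • (σ.e i * σ.e j) • S (σ.ν j) (σ.ν i) :=
  (symm_iff (S' := S.map (reflectHom A)) (one_add_half_ne_zero ε)
    (one_sub_half_ne_zero ε)).1 hS.symm i j

lemma inU_smul_X (c : ℂ) : (1 + C c * X : ℂ⟦X⟧) * evReflect ℂ c (inV X) = -X := by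
  rw [evReflect_inV, reflectHom_X, map_neg, mul_neg, one_add_mul_shiftHom_X]

lemma IsTwisted.quad_opposite {σ : SignedIndex ε ι} {S : Matrix ι ι A⟦X⟧} (hS : IsTwisted σ S)
    (c : ℂ) : QuadRel σ (2 + C c * X : ℂ⟦X⟧) X (C (-c)) 1 S (S.map (opposite A c)) := by
  have h := hS.quad.map (evReflect A c) (evReflect ℂ c) (evReflect_smul c) (map_mul _)
  have e1 : ∀ a : A⟦X⟧, evReflect A c (inU a) = a := evReflect_inU c
  have e2 : ∀ a : A⟦X⟧, evReflect A c (inV a) = opposite A c a := evReflect_inV c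
  have hX := inU_smul_X c
  have hU := evReflect_inU c (X : ℂ⟦X⟧)
  refine QuadRel.rescale (h := ?_) (a := 1 + C c * X) (b := 1 + C c * X) (a' := -X) (b' := -X ^ 2)
    (d := evReflect ℂ c (inV X - inU X)) (t := evReflect ℂ c (inU X * inV X))
    (f := evReflect ℂ c (inU X + inV X)) (s := evReflect ℂ c (inU X * inV X)) ?_ ?_ ?_ ?_ ?_ ?_
  · convert h using 1
    · exact Matrix.ext fun i j => (e1 _).symm
    · exact Matrix.ext fun i j => (e2 _).symm
  · exact neg_ne_zero.2 X_ne_zero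
  · exact neg_ne_zero.2 (pow_ne_zero _ X_ne_zero)
  · rw [map_sub, hU]
    linear_combination hX
  · rw [map_mul, hU]
    linear_combination X * hX
  · rw [map_add, hU, map_neg]
    linear_combination hX
  · rw [map_mul, hU]
    linear_combination X * hX

end TwistedMatrices

/-! ### Invertibility -/

section Invertibility

open PowerSeries

variable {A ι : Type*} [Ring A] [Fintype ι] [DecidableEq ι]

/-- Matrices of series are series with matrix coefficients. -/
noncomputable def matrixOfSeries : (Matrix ι ι A)⟦X⟧ →+* Matrix ι ι A⟦X⟧ where
  toFun f := Matrix.of fun i j => PowerSeries.mk fun n => coeff n f i j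
  map_one' := by
    ext i j n
    simp only [of_apply, coeff_mk, coeff_one, one_apply]
    split_ifs with h1 h2 h2 <;> simp [h1, h2, one_apply]
  map_zero' := by
    ext i j n
    simp
  map_add' f g := by
    ext i j n
    simp
  map_mul' f g := by
    ext i j n
    simp only [of_apply, coeff_mk, coeff_mul, mul_apply, map_sum,
      Matrix.sum_apply]
    rw [sum_comm]

/-- A matrix of series with the constant term `1` is invertible. -/
lemma exists_inverse {S : Matrix ι ι A⟦X⟧}
    (hS : ∀ i j, constantCoeff (S i j) = if i = j then 1 else 0) :
    ∃ G, S * G = 1 ∧ G * S = 1 ∧ ∀ i j, constantCoeff (G i j) = if i = j then 1 else 0 := by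
  let f : (Matrix ι ι A)⟦X⟧ := PowerSeries.mk fun n => Matrix.of fun i j => coeff n (S i j)
  have hf : matrixOfSeries f = S := by
    ext i j n
    simp [matrixOfSeries, f]
  have hu : IsUnit f := by
    rw [isUnit_iff_constantCoeff]
    have : constantCoeff f = 1 := by
      ext i j
      rw [← coeff_zero_eq_constantCoeff_apply, coeff_mk, of_apply, one_apply, ← hS,
        coeff_zero_eq_constantCoeff_apply]
    rw [this]
    exact isUnit_one
  obtain ⟨g, hg, hg'⟩ := isUnit_iff_exists.1 hu
  have h1 : S * matrixOfSeries g = 1 := by rw [← hf, ← map_mul, hg, map_one]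
  refine ⟨matrixOfSeries g, h1, by rw [← hf, ← map_mul, hg', map_one], fun i j => ?_⟩
  have h2 := congrArg constantCoeff (congrFun (congrFun h1 i) j)
  simpa [mul_apply, hS, one_apply, apply_ite (constantCoeff (R := A))] using h2

end Invertibility

/-! ### The step from `S` to its Schur complement -/

section TwoByTwo

/-- The signed index set `{-, +}`. -/
def boolIndex (ε : ℤ) (hε : ε * ε = 1) : SignedIndex ε Bool where
  ν := not
  e b := if b then 1 else ε
  ν_ν := by decide
  e_mul := by rintro (_ | _) <;> simp [hε]
  e_ν := by rintro (_ | _) <;> simp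

variable {K B : Type*} [CommRing K] [Ring B] [Algebra K B]

/-- The adjugate matrix in the quadratic relation at `v = -u - 1`. -/
def signHat (ε : ℤ) (N : Matrix Bool Bool B) : Matrix Bool Bool B :=
  Matrix.of fun i j => if i = j then N i j else -ε • N i j

/-- The Sklyanin determinant of a `2 × 2` matrix. -/
def sdet (ε : ℤ) (N M : Matrix Bool Bool B) : B :=
  N true true * M true true - ε • (N true false * M false true)

variable [IsDomain K] [Module.IsTorsionFree K B] {ε : ℤ} {hε : ε * ε = 1} {d t : K}
  {M N : Matrix Bool Bool B}

lemma signHat_mul (h : QuadRel (boolIndex ε hε) d t (-1) 1 M N) (hd : d = 2 + t) (hd0 : d ≠ 0)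
    (h2 : (2 : K) ≠ 0) :
    signHat ε N * M = diagonal fun _ => sdet ε N M := by
  have hd2 : 2 * d ≠ 0 := mul_ne_zero h2 hd0
  have r1 := h false false true false
  have r2 := h true false false false
  have r3 := h false true false false
  have r4 := h false false false false
  have r5 := h false true true false
  simp only [boolIndex, Bool.not_true, Bool.not_false, if_true, Bool.false_eq_true, if_false, hd]
    at r1 r2 r3 r4 r5
  ext i j
  refine smul_right_injective B hd2 ?_
  obtain rfl | rfl := mul_self_eq_one_iff.1 hε
  · rcases i with _ | _ <;> rcases j with _ | _ <;>
      simp only [mul_apply, Fintype.sum_bool, signHat, of_apply, sdet,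
        Matrix.diagonal_apply, if_true, reduceCtorEq, if_false, smul_mul_assoc, hd] <;>
      simp only [mul_neg, mul_one, one_smul, one_mul, neg_neg, neg_smul, neg_mul] at *
    · linear_combination (norm := module) (2 + t) • r4 + (2 : K) • r5
    · linear_combination (norm := module) (2 : K) • r3
    · linear_combination (norm := module) (-(2 + t)) • r1 - t • r2
    · module
  · rcases i with _ | _ <;> rcases j with _ | _ <;>
      simp only [mul_apply, Fintype.sum_bool, signHat, of_apply, sdet,
        Matrix.diagonal_apply, if_true, reduceCtorEq, if_false, smul_mul_assoc, hd] <;>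
      simp only [mul_neg, mul_one, one_smul, one_mul, neg_neg, neg_smul, neg_mul] at *
    · linear_combination (norm := module) (2 + t) • r4 - (2 : K) • r5
    · linear_combination (norm := module) (2 : K) • r3
    · linear_combination (norm := module) (2 + t) • r1 + t • r2
    · module

lemma sdet_comm (h : QuadRel (boolIndex ε hε) d t (-1) 1 M N) (ht : t ≠ 0) :
    sdet ε M N = sdet ε N M := by
  have r1 := h false false true true
  simp only [boolIndex, Bool.not_true, Bool.not_false, if_true, Bool.false_eq_true, if_false] at r1
  refine smul_right_injective B ht ?_
  simp only [sdet]
  obtain rfl | rfl := mul_self_eq_one_iff.1 hε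
  · simp only [mul_neg, mul_one, one_smul, one_mul, neg_neg, neg_smul, neg_mul] at *
    linear_combination (norm := module) (-1 : K) • r1
  · simp only [mul_neg, mul_one, one_smul, one_mul, neg_neg, neg_smul, neg_mul] at *
    linear_combination (norm := module) r1

/-- The common factor in the symmetry of Schur complements. -/
lemma mul_factor_eq {h : K} {c z : B} {B₀ B₁ R β : Matrix Bool Bool B} (hε : ε * ε = 1)
    (hβ : ∀ i j, c * β i j = signHat ε B₀ i j)
    (hz : (2 : K) • ∑ k, (boolIndex ε hε).e k • (β k true * B₁ (!k) false)
      - (2 * (ε : K) * h) • ε • ∑ k, β false k * B₁ k false = z)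
    (h1 : (1 - h) • R false false = B₀ true true - h • B₀ false false)
    (h2 : (1 - h) • ε • R false true = B₀ false true - h • ε • B₀ false true) :
    c * z = (2 * (1 - h)) • (R false false * B₁ false false - ε • (R false true * B₁ true false)) := by
  have b1 := hβ true true
  have b2 := hβ false true
  have b4 := hβ false false
  have h1' := congrArg (fun x => x * B₁ false false) h1
  have h2' := congrArg (fun x => x * B₁ true false) h2
  simp only [signHat, of_apply, if_true, reduceCtorEq, if_false] at b1 b2 b4
  simp only [sub_mul, smul_mul_assoc] at h1' h2'
  rw [← hz]
  simp only [Fintype.sum_bool, mul_sub, mul_add, mul_smul_comm, ← mul_assoc, b1, b2, b4, boolIndex,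
    if_true, Bool.false_eq_true, if_false, Bool.not_true, Bool.not_false, smul_mul_assoc]
  obtain rfl | rfl := mul_self_eq_one_iff.1 hε
  · simp only [Int.cast_one, one_smul, mul_one] at *
    linear_combination (norm := module) (-2 : K) • h1' + (2 : K) • h2'
  · simp only [Int.cast_neg, Int.cast_one, mul_neg, mul_one, one_smul, one_mul, neg_neg, neg_smul,
      neg_mul] at *
    linear_combination (norm := module) (-2 : K) • h1' + (2 : K) • h2'

lemma symm_of_rescaled {I : Type*} {τ : SignedIndex ε I} {h : K} (h2 : (2 : K) ≠ 0)
    {T T' : Matrix I I B} {c c₁ z : B}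
    (hZ : ∀ j m, (2 : K) • τ.e m • T (τ.ν m) j - (2 * (ε : K) * h) • τ.e j • T (τ.ν j) m =
      τ.e (τ.ν j) • (z * T' (τ.ν j) m))
    (hz : c * z = (2 * (1 - h)) • c₁) (i j : I) :
    (1 - h) • (τ.e i * τ.e j) • (c₁ * T' (τ.ν j) (τ.ν i)) =
      c * T i j - h • (τ.e i * τ.e j) • (c * T (τ.ν j) (τ.ν i)) := by
  have hε := τ.ε_mul i
  have e1 := τ.e_mul i
  have e2 := τ.e_mul j
  have h3 := congrArg (fun x => τ.e (τ.ν i) • (c * x)) (hZ j (τ.ν i))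
  simp only [τ.ν_ν, mul_sub, mul_smul_comm, ← mul_assoc, hz, smul_mul_assoc] at h3
  simp only [τ.e_ν_eq, smul_sub, smul_smul] at h3
  simp only [smul_comm (_ : ℤ) (_ : K), smul_smul] at h3
  refine smul_right_injective B h2 ?_
  simp only
  rw [show ε * τ.e i * (ε * τ.e i) = 1 by linear_combination ε * ε * e1 + hε,
    show ε * τ.e i * (ε * τ.e j) = τ.e i * τ.e j by linear_combination τ.e i * τ.e j * hε,
    one_smul] at h3
  have hK : (ε : K) * (ε : K) = 1 := by exact_mod_cast congrArg (Int.cast (R := K)) hε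
  have h4 : (2 * (ε : K) * h) • (ε * τ.e i * τ.e j) • (c * T (τ.ν j) (τ.ν i)) =
      (2 * h) • (τ.e i * τ.e j) • (c * T (τ.ν j) (τ.ν i)) := by
    simp only [← Int.cast_smul_eq_zsmul K, smul_smul]
    congr 1
    push_cast
    linear_combination 2 * h * τ.e i * τ.e j * hK
  rw [h4] at h3
  linear_combination (norm := module) (-1 : K) • h3

end TwoByTwo

section CoefficientSubalgebra

open PowerSeries

attribute [local instance 50] seriesAlgebra

variable {A : Type*} [Ring A] [Algebra ℂ A]

/-- The series with coefficients in a subalgebra. -/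
def seriesIn (T : Subalgebra ℂ A) : Subring A⟦X⟧ where
  carrier := {a | ∀ n, coeff n a ∈ T}
  mul_mem' ha hb n := by
    rw [coeff_mul]
    exact Subalgebra.sum_mem _ fun p _ => T.mul_mem (ha _) (hb _)
  one_mem' n := by
    rw [coeff_one]
    split_ifs
    · exact T.one_mem
    · exact T.zero_mem
  add_mem' ha hb n := by
    rw [map_add]
    exact T.add_mem (ha n) (hb n)
  zero_mem' n := by
    rw [map_zero]
    exact T.zero_mem
  neg_mem' ha n := by
    rw [map_neg]
    exact T.neg_mem (ha n)

lemma mem_seriesIn {T : Subalgebra ℂ A} {a : A⟦X⟧} : a ∈ seriesIn T ↔ ∀ n, coeff n a ∈ T :=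
  Iff.rfl

lemma smul_mem_seriesIn {T : Subalgebra ℂ A} {a : A⟦X⟧} (ha : a ∈ seriesIn T) (f : ℂ⟦X⟧) :
    f • a ∈ seriesIn T := fun n => by
  rw [coeff_series_smul]
  exact Subalgebra.sum_mem _ fun p _ => T.smul_mem (ha _) _

lemma shiftHom_mem_seriesIn {T : Subalgebra ℂ A} {a : A⟦X⟧} (ha : a ∈ seriesIn T) (c : ℂ) :
    shiftHom A c a ∈ seriesIn T := fun n => by
  rw [shiftHom_apply, shift, coeff_mk]
  exact Subalgebra.sum_mem _ fun p _ => T.smul_mem (ha _) _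

lemma reflectHom_mem_seriesIn {T : Subalgebra ℂ A} {a : A⟦X⟧} (ha : a ∈ seriesIn T) :
    reflectHom A a ∈ seriesIn T := fun n => by
  rw [reflectHom_apply, reflect, coeff_mk]
  exact T.mul_mem (T.pow_mem (T.neg_mem T.one_mem) _) (ha n)

lemma opposite_mem_seriesIn {T : Subalgebra ℂ A} {a : A⟦X⟧} (ha : a ∈ seriesIn T) (c : ℂ) :
    opposite A c a ∈ seriesIn T :=
  shiftHom_mem_seriesIn (reflectHom_mem_seriesIn ha) c

/-- All coefficients of `a` commute with all coefficients of `b`. -/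
def CoeffCommute (a b : A⟦X⟧) : Prop :=
  ∀ p q, coeff p a * coeff q b = coeff q b * coeff p a

lemma coeffCommute_iff {a b : A⟦X⟧} :
    CoeffCommute a b ↔ a ∈ seriesIn (Subalgebra.centralizer ℂ {x | ∃ n, x = coeff n b}) := by
  simp only [CoeffCommute, mem_seriesIn, Subalgebra.mem_centralizer_iff, Set.mem_ofPred_eq]
  constructor
  · rintro h p _ ⟨q, rfl⟩
    exact (h p q).symm
  · intro h p q
    exact (h p _ ⟨q, rfl⟩).symm

namespace CoeffCommute

variable {a a' b : A⟦X⟧}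

lemma symm (h : CoeffCommute a b) : CoeffCommute b a := fun p q => (h q p).symm

lemma commute (h : CoeffCommute a b) : a * b = b * a := by
  ext n
  rw [coeff_mul, coeff_mul]
  refine Finset.sum_equiv (Equiv.prodComm ℕ ℕ) (fun i => ?_) fun i _ => h _ _
  simp [mem_antidiagonal, add_comm]

lemma mul_left (h : CoeffCommute a b) (h' : CoeffCommute a' b) : CoeffCommute (a * a') b := by
  rw [coeffCommute_iff] at *
  exact Subring.mul_mem _ h h'

lemma sub_left (h : CoeffCommute a b) (h' : CoeffCommute a' b) : CoeffCommute (a - a') b := by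
  rw [coeffCommute_iff] at *
  exact Subring.sub_mem _ h h'

lemma zsmul_left (h : CoeffCommute a b) (n : ℤ) : CoeffCommute (n • a) b := by
  rw [coeffCommute_iff] at *
  exact Subring.zsmul_mem _ h n

lemma shiftHom_left (h : CoeffCommute a b) (c : ℂ) : CoeffCommute (shiftHom A c a) b := by
  rw [coeffCommute_iff] at *
  exact shiftHom_mem_seriesIn h c

lemma opposite_left (h : CoeffCommute a b) (c : ℂ) : CoeffCommute (opposite A c a) b := by
  rw [coeffCommute_iff] at *
  exact opposite_mem_seriesIn h c

lemma inU_inV (h : CoeffCommute a b) : inU a * inV b = inV b * inU a := by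
  ext n m
  rw [inU, inV, coeff_C_mul, coeff_mul_C, coeff_map, coeff_mul_C, coeff_C_mul]
  exact h m n

end CoeffCommute

lemma coeffCommute_of_inV {a b : A⟦X⟧} (h : inV a * inU b = inU b * inV a) :
    CoeffCommute a b := by
  intro p q
  have h1 := congrArg (coeff q) (congrArg (coeff p) h)
  simp only [inU, inV, coeff_C_mul, coeff_mul_C, coeff_map] at h1
  simpa using h1

end CoefficientSubalgebra

section Step

open PowerSeries

attribute [local instance 50] seriesAlgebra

lemma schur_map {I O B B' : Type*} [Fintype O] [Ring B] [Ring B']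
    (φ : B →+* B') (S : Matrix (I ⊕ O) (I ⊕ O) B) (b : Matrix O O B) :
    (schur S b).map φ = schur (S.map φ) (b.map φ) := by
  ext i j
  simp [schur, mul_apply, toBlocks₁₁, toBlocks₁₂, toBlocks₂₁]

/-- Multiplication by commuting factors. -/
lemma QuadRel.central_mul {K B : Type*} [CommRing K] [Ring B] [Algebra K B] {ε : ℤ} {ι : Type*}
    {σ : SignedIndex ε ι} {d t f s : K} {S S' : Matrix ι ι B} (h : QuadRel σ d t f s S S')
    {c c' : B} (hcS : ∀ i j, c' * S i j = S i j * c') (hcS' : ∀ i j, c * S' i j = S' i j * c)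
    (hcc : c * c' = c' * c) :
    QuadRel σ d t f s (Matrix.of fun i j => c * S i j) (Matrix.of fun i j => c' * S' i j) := by
  intro i j k l
  have e1 : ∀ i j k l, c * S i j * (c' * S' k l) = c * c' * (S i j * S' k l) := by
    intro i j k l
    rw [mul_assoc, ← mul_assoc (S i j), ← hcS]
    simp only [mul_assoc]
  have e2 : ∀ i j k l, c' * S' i j * (c * S k l) = c * c' * (S' i j * S k l) := by
    intro i j k l
    rw [mul_assoc, ← mul_assoc (S' i j), ← hcS', hcc]
    simp only [mul_assoc]
  have h1 := congrArg (fun x => c * c' * x) (h i j k l)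
  simp only [mul_sub, mul_add, mul_smul_comm] at h1
  simp only [of_apply, e1, e2]
  exact h1

/-- A test for the non-vanishing of a series of two variables. -/
lemma ne_zero_of_map_eq_X {f : ℂ⟦X⟧⟦X⟧}
    (h : PowerSeries.map (constantCoeff (R := ℂ)) f = X) : f ≠ 0 := by
  rintro rfl
  rw [map_zero] at h
  exact X_ne_zero h.symm

lemma map_constantCoeff_inU :
    PowerSeries.map (constantCoeff (R := ℂ)) (inU X : ℂ⟦X⟧⟦X⟧) = 0 := by
  simp [inU]

lemma map_constantCoeff_inV :
    PowerSeries.map (constantCoeff (R := ℂ)) (inV X : ℂ⟦X⟧⟦X⟧) = X := by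
  simp [inV]

variable {A : Type*} [Ring A] [Algebra ℂ A] {ε : ℤ} {hε : ε * ε = 1}

lemma two_ne_zero_series : (2 : ℂ⟦X⟧) ≠ 0 := fun h => by
  have := congrArg (constantCoeff (R := ℂ)) h
  rw [map_ofNat, map_zero] at this
  exact two_ne_zero this

lemma two_add_ne_zero (c : ℂ) : (2 + C c * X : ℂ⟦X⟧) ≠ 0 := fun h => by
  have := congrArg (constantCoeff (R := ℂ)) h
  rw [map_add, map_ofNat, map_mul, constantCoeff_X, mul_zero, add_zero, map_zero] at this
  exact two_ne_zero this

variable {I : Type*} [Fintype I] [DecidableEq I] {τ : SignedIndex ε I}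
  {S : Matrix (I ⊕ Bool) (I ⊕ Bool) A⟦X⟧} {b : Matrix Bool Bool A⟦X⟧}

lemma constantCoeff_schur {O : Type*} [Fintype O] [DecidableEq O]
    {S : Matrix (I ⊕ O) (I ⊕ O) A⟦X⟧} (hS : ∀ i j, constantCoeff (S i j) = if i = j then 1 else 0)
    (b : Matrix O O A⟦X⟧) (i j : I) : constantCoeff (schur S b i j) = if i = j then 1 else 0 := by
  simp [schur, mul_apply, toBlocks₁₁, toBlocks₁₂, toBlocks₂₁, hS]

lemma constantCoeff_shiftHom (c : ℂ) (a : A⟦X⟧) :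
    constantCoeff (shiftHom A c a) = constantCoeff a := by
  rw [shiftHom_apply, ← coeff_zero_eq_constantCoeff_apply, shift, coeff_mk]
  simp

lemma constantCoeff_reflectHom (a : A⟦X⟧) : constantCoeff (reflectHom A a) = constantCoeff a := by
  rw [reflectHom_apply, ← coeff_zero_eq_constantCoeff_apply, reflect, coeff_mk]
  simp

/-- The two-dimensional Sklyanin determinant of the last block. -/
noncomputable def stepDet (ε : ℤ) (S : Matrix (I ⊕ Bool) (I ⊕ Bool) A⟦X⟧) : A⟦X⟧ :=
  sdet ε (S.toBlocks₂₂.map (opposite A 1)) S.toBlocks₂₂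

lemma IsTwisted.quad_opposite_one (hS : IsTwisted (τ.sum (boolIndex ε hε)) S) :
    QuadRel (boolIndex ε hε) (2 + X : ℂ⟦X⟧) X (-1) 1 S.toBlocks₂₂
      (S.toBlocks₂₂.map (opposite A 1)) := by
  have h := (hS.quad_opposite 1).submatrix (τ := boolIndex ε hε) Sum.inr (fun _ => rfl)
    (fun _ => rfl)
  rw [map_one, one_mul, map_neg, map_one] at h
  exact h

lemma map_mul_eq_one {ι B B' : Type*} [Fintype ι] [DecidableEq ι] [Ring B] [Ring B']
    {M N : Matrix ι ι B} (φ : B →+* B') (h : M * N = 1) : M.map φ * N.map φ = 1 := by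
  rw [← Matrix.map_mul, h, Matrix.map_one _ (map_zero φ) (map_one φ)]

lemma map_inU_mul_eq_one {ι : Type*} [Fintype ι] [DecidableEq ι] {M N : Matrix ι ι A⟦X⟧}
    (h : M * N = 1) : M.map inU * N.map inU = 1 := by
  have h1 := map_mul_eq_one (C (R := A⟦X⟧)) h
  exact h1

lemma map_inV_mul_eq_one {ι : Type*} [Fintype ι] [DecidableEq ι] {M N : Matrix ι ι A⟦X⟧}
    (h : M * N = 1) : M.map inV * N.map inV = 1 := by
  have h1 := map_mul_eq_one (PowerSeries.map (C (R := A))) h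
  exact h1

lemma toBlocks₂₂_map {I O B B' : Type*} (S : Matrix (I ⊕ O) (I ⊕ O) B) (φ : B → B') :
    (S.map φ).toBlocks₂₂ = S.toBlocks₂₂.map φ := rfl

lemma one_sub_mul_shiftHom_X : (1 - X) * shiftHom ℂ (-1) X = X := by
  have hX := one_add_mul_shiftHom_X (-1)
  rwa [map_neg, map_one, neg_one_mul, ← sub_eq_add_neg] at hX

/-- The shift by `1` of both variables in the quadratic relation of Schur complements. -/
lemma QuadRel.shift_two {T : Matrix I I A⟦X⟧}
    (h : QuadRel τ (inV X - inU X : ℂ⟦X⟧⟦X⟧) (inU X * inV X)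
      (inU X + inV X + 2 * (inU X * inV X)) (inU X * inV X) (T.map inU) (T.map inV)) :
    QuadRel τ (inV X - inU X : ℂ⟦X⟧⟦X⟧) (inU X * inV X) (inU X + inV X) (inU X * inV X)
      ((T.map (shiftHom A (-1))).map inU) ((T.map (shiftHom A (-1))).map inV) := by
  have h1 := h.map (shiftTwo A (-1)) (shiftTwo ℂ (-1)) (shiftTwo_smul (-1)) (map_mul _)
  have e3 : (T.map inU).map (shiftTwo A (-1)) = (T.map (shiftHom A (-1))).map inU :=
    Matrix.ext fun i j => shiftTwo_inU (-1) _
  have e4 : (T.map inV).map (shiftTwo A (-1)) = (T.map (shiftHom A (-1))).map inV :=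
    Matrix.ext fun i j => shiftTwo_inV (-1) _
  rw [e3, e4] at h1
  simp only [map_add, map_sub, map_mul, shiftTwo_inU, shiftTwo_inV, map_ofNat] at h1
  have hX := one_sub_mul_shiftHom_X
  have hx : (1 - inU X) * inU (shiftHom ℂ (-1) X) = (inU X : ℂ⟦X⟧⟦X⟧) := by
    have := congrArg (C (R := ℂ⟦X⟧)) hX
    rwa [map_mul, map_sub, map_one] at this
  have hy : (1 - inV X) * inV (shiftHom ℂ (-1) X) = (inV X : ℂ⟦X⟧⟦X⟧) := by
    have := congrArg (PowerSeries.map (C (R := ℂ))) hX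
    rwa [map_mul, map_sub, map_one] at this
  generalize inU (shiftHom ℂ (-1) X) = x' at *
  generalize inV (shiftHom ℂ (-1) X) = y' at *
  refine h1.rescale ((1 - inU X) * (1 - inV X)) ((1 - inU X) * (1 - inV X)) 1 1 one_ne_zero
    one_ne_zero ?_ ?_ ?_ ?_
  · linear_combination (1 - inU X) * hy - (1 - inV X) * hx
  · linear_combination (1 - inU X) * x' * hy + inV X * hx
  · linear_combination (1 - inU X) * hy + (1 - inV X) * hx +
        2 * ((1 - inU X) * x' * hy + inV X * hx)
  · linear_combination (1 - inU X) * x' * hy + inV X * hx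

lemma IsTwisted.opposite_stepDet (hS : IsTwisted (τ.sum (boolIndex ε hε)) S) :
    opposite A 1 (stepDet ε S) = stepDet ε S := by
  have h := sdet_comm hS.quad_opposite_one X_ne_zero
  conv_rhs => rw [stepDet, ← h]
  simp only [stepDet, sdet, map_apply, map_sub, map_mul, map_zsmul, opposite_opposite,
    sub_self, shiftHom_zero]

lemma IsTwisted.reflectHom_stepDet (hS : IsTwisted (τ.sum (boolIndex ε hε)) S) :
    reflectHom A (stepDet ε S) = shiftHom A (-1) (stepDet ε S) := by
  conv_lhs => rw [← hS.opposite_stepDet]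
  rw [opposite, RingHom.comp_apply, reflectHom_shiftHom, reflectHom_reflectHom]

lemma IsTwisted.shiftHom_stepDet (hS : IsTwisted (τ.sum (boolIndex ε hε)) S) :
    shiftHom A (-1) (stepDet ε S) =
      reflectHom A (S.toBlocks₂₂ false false) * shiftHom A (-1) (S.toBlocks₂₂ false false) -
      ε • (reflectHom A (S.toBlocks₂₂ false true) * shiftHom A (-1) (S.toBlocks₂₂ true false)) := by
  have h1 := congrFun (congrFun (signHat_mul hS.quad_opposite_one rfl
    (by simpa using two_add_ne_zero 1) two_ne_zero_series) false) false
  rw [Matrix.diagonal_apply_eq] at h1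
  rw [stepDet, ← h1, mul_apply, Fintype.sum_bool]
  simp only [signHat, of_apply, if_true, reduceCtorEq, if_false, map_apply, map_add,
    map_mul, map_zsmul, shiftHom_opposite, neg_add_cancel, opposite_zero, neg_smul, neg_mul,
    smul_mul_assoc, map_neg]
  abel

variable (hS : IsTwisted (τ.sum (boolIndex ε hε)) S) (hb : S.toBlocks₂₂ * b = 1)
  (hb' : b * S.toBlocks₂₂ = 1)

include hS hb

lemma IsTwisted.stepDet_mul (i j : Bool) :
    stepDet ε S * b i j = signHat ε (S.toBlocks₂₂.map (opposite A 1)) i j := by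
  have h1 := signHat_mul hS.quad_opposite_one rfl
    (by simpa using two_add_ne_zero 1) two_ne_zero_series
  have h2 := congrArg (· * b) h1
  simp only [Matrix.mul_assoc, hb, Matrix.mul_one] at h2
  rw [h2, diagonal_mul]
  rfl

include hb'

lemma IsTwisted.schur_coeffCommute (i j : I) (o p : Bool) :
    CoeffCommute (schur S b i j) (S.toBlocks₂₂ o p) := by
  obtain ⟨G, hG, hG', -⟩ := exists_inverse hS.const
  have h := hS.quad.schur_commute (map_inV_mul_eq_one hG) (map_inV_mul_eq_one hG')
    (b' := b.map inV) (by rw [toBlocks₂₂_map]; exact map_inV_mul_eq_one hb)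
    (by rw [toBlocks₂₂_map]; exact map_inV_mul_eq_one hb') ?_ i j o p
  · refine coeffCommute_of_inV ?_
    have h2 : schur (S.map inV) (b.map inV) = (schur S b).map inV :=
      (schur_map (PowerSeries.map C) S b).symm
    rw [h2] at h
    exact h
  · refine mul_ne_zero (ne_zero_of_map_eq_X ?_) (ne_zero_of_map_eq_X ?_) <;>
      simp [map_constantCoeff_inU, map_constantCoeff_inV]

lemma IsTwisted.stepDet_schur_coeffCommute (i j : I) :
    CoeffCommute (stepDet ε S) (schur S b i j) := by
  have h : ∀ o p, CoeffCommute (S.toBlocks₂₂ o p) (schur S b i j) := fun o p =>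
    (hS.schur_coeffCommute hb hb' i j o p).symm
  exact ((h _ _).opposite_left 1 |>.mul_left (h _ _)).sub_left
    (((h _ _).opposite_left 1 |>.mul_left (h _ _)).zsmul_left ε)

lemma IsTwisted.quad_schur :
    QuadRel τ (inV X - inU X : ℂ⟦X⟧⟦X⟧) (inU X * inV X) (inU X + inV X + 2 * (inU X * inV X))
      (inU X * inV X) ((schur S b).map inU) ((schur S b).map inV) := by
  obtain ⟨G, hG, hG', -⟩ := exists_inverse hS.const
  have hU1 := map_inU_mul_eq_one hG
  have hU2 := map_inU_mul_eq_one hG'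
  have hV1 := map_inV_mul_eq_one hG
  have hV2 := map_inV_mul_eq_one hG'
  have bU1 := map_inU_mul_eq_one hb
  have bU2 := map_inU_mul_eq_one hb'
  have bV1 := map_inV_mul_eq_one hb
  have bV2 := map_inV_mul_eq_one hb'
  rw [← toBlocks₂₂_map] at bU1 bU2 bV1 bV2
  have h := hS.quad.schur hU1 hU2 hV1 hV2 bU1 bU2 bV1 bV2
  have e1 : schur (S.map inV) (b.map inV) = (schur S b).map inV := by
    have := schur_map (PowerSeries.map (C (R := A))) S b
    exact this.symm
  have e2 : schur (S.map inU) (b.map inU) = (schur S b).map inU := by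
    have := schur_map (C (R := A⟦X⟧)) S b
    exact this.symm
  rw [e1, e2, Fintype.card_bool, Nat.cast_ofNat] at h
  refine h ?_ ?_ ?_ ?_
  · rw [mul_self_sub_mul_self]
    refine mul_ne_zero (ne_zero_of_map_eq_X ?_) (ne_zero_of_map_eq_X ?_) <;>
      simp [map_constantCoeff_inU, map_constantCoeff_inV]
  all_goals
    refine ne_zero_of_map_eq_X ?_
    simp [map_constantCoeff_inU, map_constantCoeff_inV]

lemma IsTwisted.quad_step (hc : CoeffCommute (stepDet ε S) (stepDet ε S)) :
    QuadRel τ (inV X - inU X : ℂ⟦X⟧⟦X⟧) (inU X * inV X) (inU X + inV X) (inU X * inV X)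
      ((Matrix.of fun i j => stepDet ε S * shiftHom A (-1) (schur S b i j)).map inU)
      ((Matrix.of fun i j => stepDet ε S * shiftHom A (-1) (schur S b i j)).map inV) := by
  have h2 := (hS.quad_schur hb hb').shift_two
  have hcσ : ∀ i j, CoeffCommute (stepDet ε S) (shiftHom A (-1) (schur S b i j)) := fun i j =>
    ((hS.stepDet_schur_coeffCommute hb hb' i j).symm.shiftHom_left _).symm
  have h3 := h2.central_mul (c := inU (stepDet ε S)) (c' := inV (stepDet ε S))
    (fun i j => ((hcσ i j).symm.inU_inV).symm) (fun i j => (hcσ i j).inU_inV) hc.inU_inV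
  have e1 : (Matrix.of fun i j => stepDet ε S * shiftHom A (-1) (schur S b i j)).map inU =
      Matrix.of fun i j => inU (stepDet ε S) * ((schur S b).map (shiftHom A (-1))).map inU i j :=
    Matrix.ext fun i j => map_mul (C (R := A⟦X⟧)) _ _
  have e2 : (Matrix.of fun i j => stepDet ε S * shiftHom A (-1) (schur S b i j)).map inV =
      Matrix.of fun i j => inV (stepDet ε S) * ((schur S b).map (shiftHom A (-1))).map inV i j :=
    Matrix.ext fun i j => map_mul (PowerSeries.map (C (R := A))) _ _
  rw [e1, e2]
  exact h3

lemma IsTwisted.symm_step (i j : I) :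
    (1 - C ((ε : ℂ) / 2) * X : ℂ⟦X⟧) • (τ.e i * τ.e j) •
      reflectHom A (stepDet ε S * shiftHom A (-1) (schur S b (τ.ν j) (τ.ν i))) =
    stepDet ε S * shiftHom A (-1) (schur S b i j) - (C ((ε : ℂ) / 2) * X : ℂ⟦X⟧) •
      (τ.e i * τ.e j) • (stepDet ε S * shiftHom A (-1) (schur S b (τ.ν j) (τ.ν i))) := by
  obtain ⟨G, hG, hG', -⟩ := exists_inverse hS.const
  have hhalf : (2 : ℂ⟦X⟧) * C (1 / 2) = 1 := by
    rw [← map_ofNat (C (R := ℂ)) 2, ← map_mul, mul_one_div_cancel two_ne_zero, map_one]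
  have hq := hS.quad_opposite 2
  rw [show (C (-2) : ℂ⟦X⟧) = -(2 * 1) by rw [map_neg, map_ofNat, mul_one]] at hq
  obtain ⟨z, hz1, hz2⟩ := schur_symmetry (b := b) (b' := b.map (opposite A 2)) hq
    (map_mul_eq_one (opposite A 2) hG) (map_mul_eq_one (opposite A 2) hG')
    (r := 2) (r' := C (1 / 2)) (by simp) hhalf one_ne_zero (two_add_ne_zero 2)
    hb hb' (by rw [toBlocks₂₂_map]; exact map_mul_eq_one (opposite A 2) hb)
    (by rw [toBlocks₂₂_map]; exact map_mul_eq_one (opposite A 2) hb')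
  have e1 : schur (S.map (opposite A 2)) (b.map (opposite A 2)) = (schur S b).map (opposite A 2) :=
    (schur_map _ S b).symm
  rw [e1] at hz1
  have hX := one_sub_mul_shiftHom_X
  have hd : (1 - X) * shiftHom ℂ (-1) (2 + C 2 * X) = 2 := by
    rw [map_add, map_mul, shiftHom_C, map_ofNat, map_ofNat]
    linear_combination 2 * hX
  have h2h : (2 * (ε : ℂ⟦X⟧) * (C ((ε : ℂ) / 2) * X)) = X := by
    rw [← map_ofNat (C (R := ℂ)) 2, ← map_intCast (C (R := ℂ)), ← mul_assoc, ← map_mul, ← map_mul,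
      show (2 * (ε : ℂ) * ((ε : ℂ) / 2)) = ((ε * ε : ℤ) : ℂ) by push_cast; ring, hε]
    simp
  have hz1' : ∀ j m, (2 : ℂ⟦X⟧) • τ.e m • shiftHom A (-1) (schur S b (τ.ν m) j)
      - (X : ℂ⟦X⟧) • τ.e j • shiftHom A (-1) (schur S b (τ.ν j) m) =
      τ.e (τ.ν j) • (((1 - X : ℂ⟦X⟧) • shiftHom A (-1) z) * opposite A 1 (schur S b (τ.ν j) m)) := by
    intro j m
    have h1 := congrArg (fun x => (1 - X : ℂ⟦X⟧) • shiftHom A (-1) x) (hz1 j m)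
    simp only [map_sub, shiftHom_smul, map_zsmul, map_mul, smul_sub, smul_smul _ _ (_ : A⟦X⟧), hd,
      hX, map_apply, shiftHom_opposite] at h1
    rw [h1, smul_comm, smul_mul_assoc, show (-1 + 2 : ℂ) = 1 by norm_num]
  have hz2' := congrArg (fun x => (1 - X : ℂ⟦X⟧) • shiftHom A (-1) x) (hz2 false true)
  simp only [map_sub, shiftHom_smul, map_zsmul, map_mul, map_sum, smul_sub,
    smul_smul _ _ (_ : A⟦X⟧), hd, hX, map_apply, shiftHom_opposite, mul_apply] at hz2'
  rw [if_pos (by rfl), show (-1 + 2 : ℂ) = 1 by norm_num,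
    show (boolIndex ε hε).e true = 1 from rfl, one_smul, ← h2h] at hz2'
  have hβ : ∀ i j, stepDet ε S * opposite A 1 (b i j) = signHat ε S.toBlocks₂₂ i j := by
    intro i j
    have h1 := congrArg (opposite A 1) (hS.stepDet_mul hb i j)
    rw [map_mul, hS.opposite_stepDet] at h1
    rw [h1]
    simp only [signHat, of_apply, apply_ite (opposite A 1), map_apply, map_zsmul,
      opposite_opposite, sub_self, shiftHom_zero]
  have hsymm : ∀ i j, (1 - C ((ε : ℂ) / 2) * X : ℂ⟦X⟧) •
      ((boolIndex ε hε).e i * (boolIndex ε hε).e j) • reflectHom A (S.toBlocks₂₂ (!j) (!i)) =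
      S.toBlocks₂₂ i j - (C ((ε : ℂ) / 2) * X : ℂ⟦X⟧) •
        ((boolIndex ε hε).e i * (boolIndex ε hε).e j) • S.toBlocks₂₂ (!j) (!i) :=
    fun i j => hS.symm_solved (.inr i) (.inr j)
  have hcz := mul_factor_eq (B₀ := S.toBlocks₂₂) (B₁ := S.toBlocks₂₂.map (shiftHom A (-1)))
    (R := S.toBlocks₂₂.map (reflectHom A)) (β := b.map (opposite A 1)) hε hβ hz2'
    (by simpa [boolIndex] using hsymm true true) (by simpa [boolIndex] using hsymm false true)
  simp only [map_apply] at hcz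
  rw [← hS.shiftHom_stepDet, ← hS.reflectHom_stepDet] at hcz
  rw [← h2h] at hz1'
  have key := symm_of_rescaled (T := (schur S b).map (shiftHom A (-1)))
    (T' := (schur S b).map (opposite A 1)) two_ne_zero_series hz1' hcz i j
  simp only [map_apply] at key
  rw [map_mul, reflectHom_shiftHom, neg_neg]
  exact key

lemma IsTwisted.step (hc : CoeffCommute (stepDet ε S) (stepDet ε S)) :
    IsTwisted τ (Matrix.of fun i j => stepDet ε S * shiftHom A (-1) (schur S b i j)) where
  quad := hS.quad_step hb hb' hc
  symm := (symm_iff (S' := Matrix.of fun i j => reflectHom A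
      (stepDet ε S * shiftHom A (-1) (schur S b i j))) (one_add_half_ne_zero ε)
      (one_sub_half_ne_zero ε)).2 (hS.symm_step hb hb')
  const i j := by
    rw [of_apply, map_mul, constantCoeff_shiftHom, constantCoeff_schur hS.const]
    simp [stepDet, sdet, toBlocks₂₂, opposite, constantCoeff_shiftHom,
      constantCoeff_reflectHom, hS.const]

end Step

/-! ### Operators on tensor powers -/

section Tensor

variable {ι B : Type*} [Ring B] {n : ℕ}

/-- The operator `M` in the factor `p`. -/
def opAt [DecidableEq ι] (M : Matrix ι ι B) (p : Fin n) : Matrix (Fin n → ι) (Fin n → ι) B :=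
  Matrix.of fun a b => if ∀ q, q ≠ p → a q = b q then M (a p) (b p) else 0

/-- The permutation operator. -/
def permOp (ι B : Type*) [DecidableEq ι] [Ring B] {n : ℕ} (σ : Equiv.Perm (Fin n)) :
    Matrix (Fin n → ι) (Fin n → ι) B :=
  Matrix.of fun a b => if a ∘ σ = b then 1 else 0

/-- The operator `X` in the factors `p` and `q`. -/
def embedTwo [DecidableEq ι] (p q : Fin n) (X : Matrix (ι × ι) (ι × ι) B) :
    Matrix (Fin n → ι) (Fin n → ι) B :=
  Matrix.of fun a b => if ∀ r, r ≠ p → r ≠ q → a r = b r then X (a p, a q) (b p, b q) else 0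

/-- The operator `X` acts only in the factors from `s`. -/
structure LocalOn (s : Finset (Fin n)) (X : Matrix (Fin n → ι) (Fin n → ι) B) : Prop where
  eq_zero : ∀ a b r, r ∉ s → a r ≠ b r → X a b = 0
  congr : ∀ a b a' b', (∀ r ∈ s, a r = a' r) → (∀ r ∈ s, b r = b' r) → (∀ r, r ∉ s → a r = b r) →
    (∀ r, r ∉ s → a' r = b' r) → X a b = X a' b'

lemma localOn_opAt [DecidableEq ι] (M : Matrix ι ι B) (p : Fin n) : LocalOn {p} (opAt M p) where
  eq_zero a b r hr hab := by
    rw [opAt, of_apply, if_neg]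
    exact fun h => hab (h r (by simpa using hr))
  congr a b a' b' ha hb h h' := by
    simp only [Finset.mem_singleton, forall_eq] at ha hb h h'
    simp only [opAt, of_apply]
    rw [if_pos h, if_pos h', ha, hb]

lemma localOn_embedTwo [DecidableEq ι] (X : Matrix (ι × ι) (ι × ι) B) (p q : Fin n) :
    LocalOn {p, q} (embedTwo p q X) where
  eq_zero a b r hr hab := by
    simp only [Finset.mem_insert, Finset.mem_singleton, not_or] at hr
    rw [embedTwo, of_apply, if_neg]
    exact fun h => hab (h r hr.1 hr.2)
  congr a b a' b' ha hb h h' := by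
    simp only [Finset.mem_insert, Finset.mem_singleton, not_or, and_imp] at ha hb h h'
    simp only [embedTwo, of_apply]
    rw [if_pos h, if_pos h', ha p (Or.inl rfl), ha q (Or.inr rfl), hb p (Or.inl rfl),
      hb q (Or.inr rfl)]

variable [Fintype ι]

lemma LocalOn.mul_apply {s s' : Finset (Fin n)} (hd : Disjoint s s')
    {X Y : Matrix (Fin n → ι) (Fin n → ι) B} (hX : LocalOn s X) (hY : LocalOn s' Y)
    (a b : Fin n → ι) (h : ∀ r, r ∉ s → r ∉ s' → a r = b r) :
    (X * Y) a b = X a (s.piecewise b a) * Y (s.piecewise b a) b := by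
  rw [Matrix.mul_apply, sum_eq_single (s.piecewise b a)]
  · intro c _ hc
    obtain ⟨r, hr⟩ := Function.ne_iff.1 hc
    by_cases hrs : r ∈ s
    · rw [Finset.piecewise_eq_of_mem _ _ _ hrs] at hr
      rw [hY.eq_zero c b r (Finset.disjoint_left.1 hd hrs) hr, mul_zero]
    · rw [piecewise_eq_of_notMem _ _ _ hrs] at hr
      rw [hX.eq_zero a c r hrs hr.symm, zero_mul]
  · simp

/-- Operators acting in different factors commute. -/
lemma LocalOn.commute {s s' : Finset (Fin n)} (hd : Disjoint s s')
    {X Y : Matrix (Fin n → ι) (Fin n → ι) B} (hX : LocalOn s X) (hY : LocalOn s' Y)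
    (hXY : ∀ a b c d, X a b * Y c d = Y c d * X a b) : Commute X Y := by
  ext a b
  by_cases h : ∀ r, r ∉ s → r ∉ s' → a r = b r
  · rw [LocalOn.mul_apply hd hX hY a b h,
      LocalOn.mul_apply hd.symm hY hX a b fun r h1 h2 => h r h2 h1, hXY]
    congr 1
    · refine hY.congr _ _ _ _ (fun r hr => ?_) (fun r hr => ?_) (fun r hr => ?_) fun r hr => ?_
      · rw [piecewise_eq_of_notMem _ _ _ (Finset.disjoint_right.1 hd hr)]
      · rw [Finset.piecewise_eq_of_mem _ _ _ hr]
      · by_cases hrs : r ∈ s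
        · rw [Finset.piecewise_eq_of_mem _ _ _ hrs]
        · rw [piecewise_eq_of_notMem _ _ _ hrs]
          exact h r hrs hr
      · rw [piecewise_eq_of_notMem _ _ _ hr]
    · refine hX.congr _ _ _ _ (fun r hr => ?_) (fun r hr => ?_) (fun r hr => ?_) fun r hr => ?_
      · rw [piecewise_eq_of_notMem _ _ _ (Finset.disjoint_left.1 hd hr)]
      · rw [Finset.piecewise_eq_of_mem _ _ _ hr]
      · rw [piecewise_eq_of_notMem _ _ _ hr]
      · by_cases hrs : r ∈ s'
        · rw [Finset.piecewise_eq_of_mem _ _ _ hrs]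
        · rw [piecewise_eq_of_notMem _ _ _ hrs]
          exact h r hr hrs
  · push Not at h
    obtain ⟨r, h1, h2, h3⟩ := h
    have h4 : ∀ c, X a c * Y c b = 0 ∧ Y a c * X c b = 0 := by
      intro c
      by_cases hc : a r = c r
      · have hc' : c r ≠ b r := fun h => h3 (hc.trans h)
        rw [hX.eq_zero c b r h1 hc', hY.eq_zero c b r h2 hc']
        simp
      · rw [hX.eq_zero a c r h1 hc, hY.eq_zero a c r h2 hc]
        simp
    rw [Matrix.mul_apply, Matrix.mul_apply, sum_eq_zero fun c _ => (h4 c).1,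
      sum_eq_zero fun c _ => (h4 c).2]

variable [DecidableEq ι]

lemma permOp_mul_apply (σ : Equiv.Perm (Fin n)) (X : Matrix (Fin n → ι) (Fin n → ι) B)
    (a b : Fin n → ι) : (permOp ι B σ * X) a b = X (a ∘ σ) b := by
  simp [mul_apply, permOp]

lemma mul_permOp_apply (σ : Equiv.Perm (Fin n)) (X : Matrix (Fin n → ι) (Fin n → ι) B)
    (a b : Fin n → ι) : (X * permOp ι B σ) a b = X a (b ∘ σ.symm) := by
  rw [mul_apply, sum_eq_single (b ∘ σ.symm)]
  · simp [permOp, Function.comp_assoc]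
  · intro c _ hc
    rw [permOp, of_apply, if_neg, mul_zero]
    rintro rfl
    exact hc (by simp [Function.comp_assoc])
  · simp

lemma permOp_mul (σ τ : Equiv.Perm (Fin n)) :
    permOp ι B σ * permOp ι B τ = permOp ι B (σ * τ) := by
  ext a b
  rw [permOp_mul_apply]
  rfl

lemma permOp_one : permOp ι B (1 : Equiv.Perm (Fin n)) = 1 := by
  ext a b
  simp [permOp, one_apply]

lemma permOp_mul_opAt (σ : Equiv.Perm (Fin n)) (M : Matrix ι ι B) (p : Fin n) :
    permOp ι B σ * opAt M p = opAt M (σ p) * permOp ι B σ := by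
  ext a b
  rw [permOp_mul_apply, mul_permOp_apply]
  simp only [opAt, of_apply, Function.comp_apply, Equiv.symm_apply_apply]
  congr 1
  refine propext ⟨fun h q hq => ?_, fun h q hq => ?_⟩
  · simpa using h (σ.symm q) (by rwa [Ne, Equiv.symm_apply_eq])
  · simpa using h (σ q) (by simpa using hq)

lemma permOp_mul_embedTwo (σ : Equiv.Perm (Fin n)) (X : Matrix (ι × ι) (ι × ι) B) (p q : Fin n) :
    permOp ι B σ * embedTwo p q X = embedTwo (σ p) (σ q) X * permOp ι B σ := by
  ext a b
  rw [permOp_mul_apply, mul_permOp_apply]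
  simp only [embedTwo, of_apply, Function.comp_apply, Equiv.symm_apply_apply]
  congr 1
  refine propext ⟨fun h r hr hr' => ?_, fun h r hr hr' => ?_⟩
  · simpa using h (σ.symm r) (by rwa [Ne, Equiv.symm_apply_eq]) (by rwa [Ne, Equiv.symm_apply_eq])
  · simpa using h (σ r) (by simpa using hr) (by simpa using hr')

/-- The sum over tuples which differ from `a` only at the places `p` and `q`. -/
lemma sum_eq_sum_update {M : Type*} [AddCommMonoid M] {p q : Fin n} (hpq : p ≠ q)
    (a : Fin n → ι) (f : (Fin n → ι) → M)
    (hf : ∀ c, (∃ r, r ≠ p ∧ r ≠ q ∧ a r ≠ c r) → f c = 0) :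
    ∑ c, f c = ∑ x : ι × ι, f (update (update a p x.1) q x.2) := by
  symm
  refine Finset.sum_of_injOn (fun x => update (update a p x.1) q x.2) ?_ ?_ ?_ ?_
  · rintro ⟨x, y⟩ - ⟨x', y'⟩ - h
    have h1 := congrFun h p
    have h2 := congrFun h q
    simp only [update_self, update_of_ne hpq] at h1 h2
    rw [h1, h2]
  · simp
  · intro c _ hc
    refine hf c ?_
    by_contra! h
    refine hc ⟨(c p, c q), by simp, ?_⟩
    funext r
    by_cases hq : r = q
    · subst hq
      simp
    · by_cases hp : r = p
      · subst hp
        simp [update_of_ne hq]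
      · simp only [update_of_ne hq, update_of_ne hp]
        exact h r hp hq
  · simp

lemma embedTwo_mul_apply {p q : Fin n} (hpq : p ≠ q) (X : Matrix (ι × ι) (ι × ι) B)
    (Y : Matrix (Fin n → ι) (Fin n → ι) B) (a b : Fin n → ι) :
    (embedTwo p q X * Y) a b =
      ∑ x : ι × ι, X (a p, a q) x * Y (update (update a p x.1) q x.2) b := by
  rw [mul_apply, sum_eq_sum_update hpq a]
  · refine sum_congr rfl fun x _ => ?_
    rw [embedTwo, of_apply, if_pos]
    · simp [update_of_ne hpq]
    · intro r hp hq
      rw [update_of_ne hq, update_of_ne hp]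
  · rintro c ⟨r, hp, hq, h⟩
    rw [embedTwo, of_apply, if_neg, zero_mul]
    exact fun h' => h (h' r hp hq)

lemma mul_embedTwo_apply {p q : Fin n} (hpq : p ≠ q) (X : Matrix (ι × ι) (ι × ι) B)
    (Y : Matrix (Fin n → ι) (Fin n → ι) B) (a b : Fin n → ι) :
    (Y * embedTwo p q X) a b =
      ∑ x : ι × ι, Y a (update (update b p x.1) q x.2) * X x (b p, b q) := by
  rw [mul_apply, sum_eq_sum_update hpq b]
  · refine sum_congr rfl fun x _ => ?_
    rw [embedTwo, of_apply, if_pos]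
    · simp [update_of_ne hpq]
    · intro r hp hq
      rw [update_of_ne hq, update_of_ne hp]
  · rintro c ⟨r, hp, hq, h⟩
    rw [embedTwo, of_apply, if_neg, mul_zero]
    exact fun h' => h (h' r hp hq).symm

lemma embedTwo_mul {p q : Fin n} (hpq : p ≠ q) (X Y : Matrix (ι × ι) (ι × ι) B) :
    embedTwo p q (X * Y) = embedTwo p q X * embedTwo p q Y := by
  ext a b
  rw [embedTwo_mul_apply hpq]
  simp only [embedTwo, of_apply, mul_apply]
  have h : ∀ x : ι × ι, (∀ r, r ≠ p → r ≠ q →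
      update (update a p x.1) q x.2 r = b r) ↔
      ∀ r, r ≠ p → r ≠ q → a r = b r := by
    intro x
    refine forall_congr' fun r => forall_congr' fun hp => forall_congr' fun hq => ?_
    rw [update_of_ne hq, update_of_ne hp]
  simp only [h, update_self, update_of_ne hpq, mul_ite, mul_zero]
  split_ifs <;> simp

lemma embedTwo_add (p q : Fin n) (X Y : Matrix (ι × ι) (ι × ι) B) :
    embedTwo p q (X + Y) = embedTwo p q X + embedTwo p q Y := by
  ext a b
  simp only [embedTwo, of_apply, Matrix.add_apply]
  split_ifs <;> simp

lemma embedTwo_sub (p q : Fin n) (X Y : Matrix (ι × ι) (ι × ι) B) :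
    embedTwo p q (X - Y) = embedTwo p q X - embedTwo p q Y := by
  ext a b
  simp only [embedTwo, of_apply, Matrix.sub_apply]
  split_ifs <;> simp

lemma embedTwo_smul {K : Type*} [CommRing K] [Algebra K B] (p q : Fin n) (c : K)
    (X : Matrix (ι × ι) (ι × ι) B) : embedTwo p q (c • X) = c • embedTwo p q X := by
  ext a b
  simp only [embedTwo, of_apply, Matrix.smul_apply]
  split_ifs <;> simp

lemma eq_iff_off_two {p q : Fin n} {a b : Fin n → ι} :
    a = b ↔ (∀ r, r ≠ p → r ≠ q → a r = b r) ∧ a p = b p ∧ a q = b q := by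
  refine ⟨by rintro rfl; simp, fun ⟨h, hp, hq⟩ => funext fun r => ?_⟩
  by_cases h1 : r = p
  · rw [h1, hp]
  · by_cases h2 : r = q
    · rw [h2, hq]
    · exact h r h1 h2

lemma embedTwo_one (p q : Fin n) : embedTwo p q (1 : Matrix (ι × ι) (ι × ι) B) = 1 := by
  ext a b
  simp only [embedTwo, of_apply, one_apply, eq_iff_off_two (p := p) (q := q) (a := a),
    Prod.mk.injEq, ite_and]

lemma embedTwo_onFirst {p q : Fin n} (hpq : p ≠ q) (M : Matrix ι ι B) :
    embedTwo p q (onFirst M) = opAt M p := by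
  ext a b
  simp only [embedTwo, opAt, of_apply, onFirst_apply]
  rw [← ite_and]
  congr 1
  refine propext ⟨fun h r hr => ?_, fun h => ⟨fun r hp _ => h r hp, h q hpq.symm⟩⟩
  by_cases hq : r = q
  · rw [hq, h.2]
  · exact h.1 r hr hq

lemma embedTwo_onSecond {p q : Fin n} (hpq : p ≠ q) (M : Matrix ι ι B) :
    embedTwo p q (onSecond M) = opAt M q := by
  ext a b
  simp only [embedTwo, opAt, of_apply, onSecond_apply]
  rw [← ite_and]
  congr 1
  refine propext ⟨fun h r hr => ?_, fun h => ⟨fun r _ hp => h r hp, h p hpq⟩⟩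
  by_cases hq : r = p
  · rw [hq, h.2]
  · exact h.1 r hq hr

lemma embedTwo_flipP (p q : Fin n) :
    embedTwo p q (flipP ι B) = permOp ι B (swap p q) := by
  ext a b
  simp only [embedTwo, permOp, of_apply, flipP]
  rw [← ite_and]
  congr 1
  rw [eq_iff_off_two (p := p) (q := q) (b := b)]
  simp only [Function.comp_apply, Equiv.swap_apply_left, swap_apply_right]
  refine propext (and_congr (forall_congr' fun r => forall_congr' fun hp => forall_congr' fun hq => ?_)
    and_comm)
  rw [swap_apply_of_ne_of_ne hp hq]

end Tensor

/-! ### Antisymmetry of fused products -/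

section Fusion

variable {K B : Type*} [CommRing K] [Ring B] [Algebra K B]
variable {ε : ℤ} {ι : Type*} [Fintype ι] [DecidableEq ι] (σ : SignedIndex ε ι) {n : ℕ}

/-- The operator `Q` in the factors `p` and `q`. -/
def siteQ (B : Type*) [Ring B] (p q : Fin n) : Matrix (Fin n → ι) (Fin n → ι) B :=
  embedTwo p q (transQ σ B)

lemma siteQ_apply (p q : Fin n) (a b : Fin n → ι) :
    siteQ σ B p q a b = if (∀ r, r ≠ p → r ≠ q → a r = b r) ∧ a p = σ.ν (a q) ∧ b p = σ.ν (b q)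
      then ((σ.e (a q) * σ.e (b q) : ℤ) : B) else 0 := by
  simp only [siteQ, embedTwo, transQ, of_apply, ite_and]

lemma siteQ_commute (p q : Fin n) (a b : Fin n → ι) (x : B) :
    siteQ σ B p q a b * x = x * siteQ σ B p q a b := by
  rw [siteQ_apply]
  split_ifs
  · exact (Int.cast_commute _ _).eq
  · simp

lemma mul_siteQ_apply {p q : Fin n} (hpq : p ≠ q) (X : Matrix (Fin n → ι) (Fin n → ι) B)
    (a b : Fin n → ι) : (X * siteQ σ B p q) a b = if b p = σ.ν (b q) then
      ∑ x, (σ.e x * σ.e (b q)) • X a (update (update b p (σ.ν x)) q x) else 0 := by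
  rw [siteQ, mul_embedTwo_apply hpq, Fintype.sum_prod_type, sum_comm]
  simp only [transQ, of_apply, mul_ite, mul_zero, ite_and]
  split_ifs with h
  · refine sum_congr rfl fun y _ => ?_
    simp only [sum_ite_eq', mem_univ, if_true]
    rw [zsmul_eq_mul, (Int.cast_commute _ _).eq]
  · simp

lemma siteQ_mul_siteQ {p r s : Fin n} (hpr : p ≠ r) (hps : p ≠ s) (hrs : r ≠ s) :
    siteQ σ B p r * siteQ σ B p s = siteQ σ B p r * permOp ι B (swap r s) := by
  ext a b
  rw [mul_siteQ_apply σ hps, mul_permOp_apply, Equiv.symm_swap, siteQ_apply]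
  simp only [Function.comp_apply, Equiv.swap_apply_left, swap_apply_of_ne_of_ne hpr hps]
  have h0 : ∀ x, siteQ σ B p r a (update (update b p (σ.ν x)) s x) =
      if ((∀ q, q ≠ p → q ≠ r → a q = b (swap r s q)) ∧ a p = σ.ν (a r)) ∧ x = b r then
        ((σ.e (a r) * σ.e (b r) : ℤ) : B) else 0 := by
    intro x
    rw [siteQ_apply]
    simp only [update_of_ne hps, update_of_ne hrs, update_self,
      update_of_ne hpr.symm]
    have h1 : ((∀ q, q ≠ p → q ≠ r →
        a q = update (update b p (σ.ν x)) s x q) ∧ a p = σ.ν (a r) ∧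
          σ.ν x = σ.ν (b r)) ↔ ((∀ q, q ≠ p → q ≠ r → a q = b (swap r s q)) ∧
          a p = σ.ν (a r)) ∧ x = b r := by
      rw [σ.ν_inj]
      constructor
      · rintro ⟨h, h', rfl⟩
        refine ⟨⟨fun q hp hr => ?_, h'⟩, rfl⟩
        rw [h q hp hr]
        by_cases hs : q = s
        · rw [hs, update_self, swap_apply_right]
        · rw [update_of_ne hs, update_of_ne hp,
            swap_apply_of_ne_of_ne hr hs]
      · rintro ⟨⟨h, h'⟩, rfl⟩
        refine ⟨fun q hp hr => ?_, h', rfl⟩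
        rw [h q hp hr]
        by_cases hs : q = s
        · rw [hs, update_self, swap_apply_right]
        · rw [update_of_ne hs, update_of_ne hp,
            swap_apply_of_ne_of_ne hr hs]
    simp only [h1]
  simp only [h0, ite_and, smul_ite, smul_zero]
  by_cases h1 : ∀ q, q ≠ p → q ≠ r → a q = b (swap r s q)
  · by_cases h2 : a p = σ.ν (a r)
    · by_cases h3 : b p = σ.ν (b s)
      · rw [if_pos h1, if_pos h2, if_pos h3, if_pos h3]
        simp only [if_pos h1, if_pos h2, sum_ite_eq', mem_univ, if_true]
        rw [zsmul_eq_mul, ← Int.cast_mul]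
        congr 1
        linear_combination σ.e (b s) * σ.e (a r) * σ.e_mul (b r)
      · simp [h3]
    · simp [h2]
  · simp [h1]

lemma permOp_mul_siteQ (τ : Equiv.Perm (Fin n)) (p q : Fin n) :
    permOp ι B τ * siteQ σ B p q = siteQ σ B (τ p) (τ q) * permOp ι B τ :=
  permOp_mul_embedTwo τ _ p q

/-- The factor `1 + w Q`. -/
def siteR (B : Type*) [Ring B] [Algebra K B] (w : K) (p q : Fin n) :
    Matrix (Fin n → ι) (Fin n → ι) B :=
  1 + w • siteQ σ B p q

lemma permOp_mul_siteR (τ : Equiv.Perm (Fin n)) (w : K) (p q : Fin n) :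
    permOp ι B τ * siteR σ B w p q = siteR σ B w (τ p) (τ q) * permOp ι B τ := by
  simp only [siteR, mul_add, add_mul, mul_one, one_mul, mul_smul_comm, smul_mul_assoc,
    permOp_mul_siteQ]

lemma commute_siteR {w w' : K} {p q p' q' : Fin n} (h1 : p ≠ p') (h2 : p ≠ q') (h3 : q ≠ p')
    (h4 : q ≠ q') : Commute (siteR σ B w p q) (siteR σ B w' p' q') := by
  have h : Commute (siteQ σ B p q) (siteQ σ B p' q') := by
    refine LocalOn.commute (s := {p, q}) (s' := {p', q'}) ?_ (localOn_embedTwo _ _ _)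
      (localOn_embedTwo _ _ _) fun a b c d => siteQ_commute σ p q a b _
    simp [h1.symm, h2.symm, h3.symm, h4.symm]
  exact (Commute.one_left _).add_left
    (((Commute.one_right _).add_right (h.smul_right w')).smul_left w)

lemma commute_opAt_siteR {w : K} {M : Matrix ι ι B} {p p' q' : Fin n} (h1 : p ≠ p')
    (h2 : p ≠ q') : Commute (opAt M p) (siteR σ B w p' q') := by
  have h : Commute (opAt M p) (siteQ σ B p' q') := by
    refine LocalOn.commute (s := {p}) (s' := {p', q'}) ?_ (localOn_opAt _ _)
      (localOn_embedTwo _ _ _) fun a b c d => (siteQ_commute σ p' q' c d _).symm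
    simp [h1, h2]
  exact (Commute.one_right _).add_right (h.smul_right w)

/-- `Y` maps tensors symmetric under the transposition `P` to symmetric tensors. -/
def SymmPreserving (P Y : Matrix (Fin n → ι) (Fin n → ι) B) : Prop :=
  (1 - P) * Y * (1 + P) = 0

section SymmPreserving

variable {P Y Z : Matrix (Fin n → ι) (Fin n → ι) B}

lemma SymmPreserving.of_commute (hP : P * P = 1) (h : Commute P Y) : SymmPreserving P Y := by
  have h1 : (1 - P) * Y = Y * (1 - P) := by rw [sub_mul, mul_sub, one_mul, mul_one, h.eq]
  rw [SymmPreserving, h1, mul_assoc, sub_mul, one_mul, mul_add, hP, mul_one, add_comm P 1,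
    sub_self, mul_zero]

variable [IsDomain K] [Module.IsTorsionFree K B] (h2 : (2 : K) ≠ 0)

include h2 in
lemma two_mul_eq_zero {κ κ' : Type*} {X : Matrix κ κ' B} (h : X + X = 0) : X = 0 := by
  ext a b
  have h3 := congrFun (congrFun h a) b
  rw [Matrix.add_apply, Matrix.zero_apply, ← two_smul K, smul_eq_zero] at h3
  exact h3.resolve_left h2

include h2 in
lemma SymmPreserving.mul (hY : SymmPreserving P Y) (hZ : SymmPreserving P Z) :
    SymmPreserving P (Y * Z) := by
  have h3 : Z * (1 + P) = P * Z * (1 + P) := by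
    have := hZ
    rw [SymmPreserving, sub_mul, sub_mul, one_mul, sub_eq_zero] at this
    exact this
  have h4 : Z * (1 + P) + Z * (1 + P) = (1 + P) * (Z * (1 + P)) := by
    rw [add_mul, one_mul, ← mul_assoc P, ← h3]
  refine two_mul_eq_zero (K := K) h2 ?_
  calc _ = (1 - P) * Y * (Z * (1 + P) + Z * (1 + P)) := by
        rw [mul_add ((1 - P) * Y)]
        simp only [mul_assoc]
    _ = ((1 - P) * Y * (1 + P)) * (Z * (1 + P)) := by rw [h4, mul_assoc, mul_assoc, mul_assoc]
    _ = 0 := by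
        have := hY
        rw [SymmPreserving] at this
        rw [this, zero_mul]

include h2 in
/-- Left multiplication by an antisymmetric operator gives an antisymmetric operator. -/
lemma SymmPreserving.antisymm (hY : SymmPreserving P Y)
    {A : Matrix (Fin n → ι) (Fin n → ι) B} (hA : A * P = -A) : A * Y * P = -(A * Y) := by
  rw [← add_eq_zero_iff_eq_neg]
  refine two_mul_eq_zero (K := K) h2 ?_
  have h3 : A * ((1 - P) * Y * (1 + P)) = 0 := by
    have := hY
    rw [SymmPreserving] at this
    rw [this, mul_zero]
  rw [← h3]
  have h4 : A * (1 - P) = A + A := by rw [mul_sub, mul_one, hA, sub_neg_eq_add]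
  rw [← mul_assoc, ← mul_assoc, h4, mul_add, mul_one]
  simp only [add_mul]
  abel

end SymmPreserving

lemma permOp_swap_mul_self (p q : Fin n) :
    permOp ι B (swap p q) * permOp ι B (swap p q) = 1 := by
  rw [permOp_mul, Equiv.swap_mul_self, permOp_one]

/-- The pair of factors `R_{pr} R_{ps}`. -/
lemma symmPreserving_right {p r s : Fin n} (hpr : p ≠ r) (hps : p ≠ s) (hrs : r ≠ s) {w w' : K}
    (hw : w - w' + w * w' = 0) :
    SymmPreserving (permOp ι B (swap r s)) (siteR σ B w p r * siteR σ B w' p s) := by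
  set P := permOp ι B (swap r s) with hP
  have hPP : P * P = 1 := permOp_swap_mul_self r s
  have h1 : P * siteQ σ B p r = siteQ σ B p s * P := by
    rw [hP, permOp_mul_siteQ, Equiv.swap_apply_left, swap_apply_of_ne_of_ne hpr hps]
  have h2 : P * siteQ σ B p s = siteQ σ B p r * P := by
    rw [hP, permOp_mul_siteQ, swap_apply_right, swap_apply_of_ne_of_ne hpr hps]
  have h3 : siteQ σ B p r * siteQ σ B p s = siteQ σ B p r * P := siteQ_mul_siteQ σ hpr hps hrs
  have h4 : siteR σ B w p r * siteR σ B w' p s = 1 + w • siteQ σ B p r + w' • siteQ σ B p s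
      + (w * w') • (siteQ σ B p r * P) := by
    rw [← h3]
    simp only [siteR, mul_add, add_mul, mul_one, one_mul, mul_smul_comm, smul_mul_assoc, smul_add,
      smul_smul]
    rw [mul_comm w' w]
    abel
  rw [SymmPreserving, h4]
  generalize siteQ σ B p r = Q at *
  generalize siteQ σ B p s = Q' at *
  simp only [mul_add, add_mul, sub_mul, mul_one, one_mul, mul_smul_comm, smul_mul_assoc,
    mul_assoc, hPP]
  simp only [← mul_assoc, h1, h2]
  simp only [mul_assoc, hPP, mul_one]
  have hw' : w' = w + w * w' := by linear_combination -hw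
  have e : ∀ x : Matrix (Fin n → ι) (Fin n → ι) B, w' • x = w • x + (w * w') • x := by
    intro x
    rw [← add_smul, ← hw']
  simp only [e, smul_sub]
  abel

lemma siteQ_symm (p q : Fin n) : siteQ σ B p q = siteQ σ B q p := by
  ext a b
  rw [siteQ_apply, siteQ_apply]
  have h1 : ((∀ r, r ≠ p → r ≠ q → a r = b r) ∧ a p = σ.ν (a q) ∧ b p = σ.ν (b q)) ↔
      ((∀ r, r ≠ q → r ≠ p → a r = b r) ∧ a q = σ.ν (a p) ∧ b q = σ.ν (b p)) := by
    rw [σ.eq_ν_iff (i := a p), σ.eq_ν_iff (i := b p)]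
    exact and_congr_left' ⟨fun h r h1 h2 => h r h2 h1, fun h r h1 h2 => h r h2 h1⟩
  by_cases h : (∀ r, r ≠ p → r ≠ q → a r = b r) ∧ a p = σ.ν (a q) ∧ b p = σ.ν (b q)
  · rw [if_pos h, if_pos (h1.1 h), h.2.1, h.2.2, σ.e_ν_eq, σ.e_ν_eq]
    congr 1
    linear_combination (-σ.e (a q) * σ.e (b q)) * σ.ε_mul (a q)
  · rw [if_neg h, if_neg fun h' => h (h1.2 h')]

/-- The pair of factors `R_{rm} R_{sm}`. -/
lemma symmPreserving_left {m r s : Fin n} (hpr : r ≠ m) (hps : s ≠ m) (hrs : r ≠ s) {w w' : K}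
    (hw : w - w' + w * w' = 0) :
    SymmPreserving (permOp ι B (swap r s)) (siteR σ B w r m * siteR σ B w' s m) := by
  have h := symmPreserving_right (B := B) σ hpr.symm hps.symm hrs hw
  rwa [siteR, siteR, siteQ_symm σ m r, siteQ_symm σ m s] at h

/-- The block `S_r R_{rs} S_s`. -/
lemma symmPreserving_reflection {r s : Fin n} (hrs : r ≠ s) {w : K} {S S' : Matrix ι ι B}
    (h : QuadRel σ 1 1 1 w S S') :
    SymmPreserving (permOp ι B (swap r s)) (opAt S r * siteR σ B w r s * opAt S' s) := by
  rw [quadRel_iff] at h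
  have h1 := congrArg (embedTwo r s) h
  simp only [embedTwo_mul hrs, embedTwo_sub, embedTwo_add, embedTwo_smul, embedTwo_one,
    embedTwo_onFirst hrs, embedTwo_onSecond hrs, embedTwo_flipP, one_smul] at h1
  have h2 : siteR σ B w r s = 1 + w • embedTwo r s (transQ σ B) := rfl
  have h3 : (1 - permOp ι B (swap r s)) * (1 + permOp ι B (swap r s)) = 0 := by
    rw [sub_mul, one_mul, mul_add, permOp_swap_mul_self, mul_one,
      add_comm (permOp ι B (swap r s)) 1, sub_self]
  rw [SymmPreserving, h2, ← mul_assoc, ← mul_assoc, h1, mul_assoc, h3, mul_zero]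

/-! ### The recursion for the products of reflection type -/

variable (s : ℕ → Matrix ι ι B) (w : ℕ → ℕ → K)

/-- The factor `S_p` of a product with `n` tensor factors. -/
def factorS (n : ℕ) (p : ℕ) : Matrix (Fin n → ι) (Fin n → ι) B :=
  if h : p < n then opAt (s p) ⟨p, h⟩ else 1

/-- The factor `R_{pq}` of a product with `n` tensor factors. -/
def factorR (n : ℕ) (p q : ℕ) : Matrix (Fin n → ι) (Fin n → ι) B :=
  if h : p < n ∧ q < n then siteR σ B (w p q) ⟨p, h.1⟩ ⟨q, h.2⟩ else 1

/-- The product `R_{0m} R_{1m} ⋯ R_{q-1,m}`. -/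
def columnR (n m : ℕ) : ℕ → Matrix (Fin n → ι) (Fin n → ι) B
  | 0 => 1
  | q + 1 => columnR n m q * factorR σ w n q m

/-- The product `⟨S_0, …, S_{m-1}⟩` with `n` tensor factors. -/
def bracket (n : ℕ) : ℕ → Matrix (Fin n → ι) (Fin n → ι) B
  | 0 => 1
  | m + 1 => bracket n m * columnR σ w n m m * factorS s n m

variable {s w}

lemma commute_factorR {p q p' q' : ℕ} (h1 : p ≠ p') (h2 : p ≠ q') (h3 : q ≠ p') (h4 : q ≠ q') :
    Commute (factorR (B := B) σ w n p q) (factorR σ w n p' q') := by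
  unfold factorR
  split_ifs
  · exact commute_siteR σ (by simpa [Fin.ext_iff]) (by simpa [Fin.ext_iff])
      (by simpa [Fin.ext_iff]) (by simpa [Fin.ext_iff])
  · exact Commute.one_right _
  · exact Commute.one_left _
  · exact Commute.one_left _

lemma commute_factorS_factorR {p p' q' : ℕ} (h1 : p ≠ p') (h2 : p ≠ q') :
    Commute (factorS s n p) (factorR σ w n p' q') := by
  unfold factorR factorS
  split_ifs
  · exact commute_opAt_siteR σ (by simpa [Fin.ext_iff]) (by simpa [Fin.ext_iff])
  · exact Commute.one_right _
  · exact Commute.one_left _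
  · exact Commute.one_left _

lemma commute_columnR {X : Matrix (Fin n → ι) (Fin n → ι) B} {m q : ℕ}
    (h : ∀ p < q, Commute X (factorR σ w n p m)) : Commute X (columnR σ w n m q) := by
  induction q with
  | zero => exact Commute.one_right _
  | succ q ih =>
    exact (ih fun p hp => h p (hp.trans q.lt_succ_self)).mul_right (h q q.lt_succ_self)

lemma commute_permOp_factorR {r r' : Fin n} {p q : ℕ} (h1 : p ≠ r) (h2 : p ≠ r') (h3 : q ≠ r)
    (h4 : q ≠ r') : Commute (permOp ι B (swap r r')) (factorR σ w n p q) := by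
  unfold factorR
  split_ifs with h
  · rw [commute_iff_eq, permOp_mul_siteR, swap_apply_of_ne_of_ne, swap_apply_of_ne_of_ne]
      <;> simpa [Fin.ext_iff]
  · exact Commute.one_right _

lemma commute_permOp_factorS {r r' : Fin n} {p : ℕ} (h1 : p ≠ r) (h2 : p ≠ r') :
    Commute (permOp ι B (swap r r')) (factorS s n p) := by
  unfold factorS
  split_ifs with h
  · rw [commute_iff_eq, permOp_mul_opAt, swap_apply_of_ne_of_ne]
      <;> simpa [Fin.ext_iff]
  · exact Commute.one_right _

lemma commute_permOp_bracket {r r' : Fin n} {m : ℕ} (h1 : m ≤ r) (h2 : m ≤ r') :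
    Commute (permOp ι B (swap r r')) (bracket σ s w n m) := by
  induction m with
  | zero => exact Commute.one_right _
  | succ m ih =>
    refine ((ih (by omega) (by omega)).mul_right (commute_columnR σ fun p hp => ?_)).mul_right
      (commute_permOp_factorS (by omega) (by omega))
    exact commute_permOp_factorR σ (by omega) (by omega) (by omega) (by omega)

variable [IsDomain K] [Module.IsTorsionFree K B] (h2 : (2 : K) ≠ 0)
  (hw : ∀ p r, w p r - w p (r + 1) + w p r * w p (r + 1) = 0)
  (hw' : ∀ r m, w r m - w (r + 1) m + w r m * w (r + 1) m = 0)
  (hs : ∀ r, QuadRel σ 1 1 1 (w r (r + 1)) (s r) (s (r + 1)))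

include h2 hw' in
lemma symmPreserving_columnR {r m q : ℕ} (hr : r + 1 < n) (hm : r + 1 < m) (hmn : m < n)
    (hq : r + 1 < q) : SymmPreserving (permOp ι B (swap ⟨r, by omega⟩ ⟨r + 1, hr⟩))
      (columnR (B := B) σ w n m q) := by
  induction q with
  | zero => omega
  | succ q ih =>
    have hP := permOp_swap_mul_self (ι := ι) (B := B) (⟨r, by omega⟩ : Fin n) ⟨r + 1, hr⟩
    rcases Nat.lt_or_ge (r + 1) q with hq' | hq'
    · exact (ih hq').mul h2 (SymmPreserving.of_commute hP (commute_permOp_factorR σ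
        (by simp; omega) (by simp; omega) (by simp; omega) (by simp; omega)))
    · obtain rfl : q = r + 1 := by omega
      rw [columnR, columnR, mul_assoc]
      refine (SymmPreserving.of_commute hP (commute_columnR σ fun p hp => commute_permOp_factorR σ
        (by simp; omega) (by simp; omega) (by simp; omega) (by simp; omega))).mul h2 ?_
      rw [factorR, factorR, dif_pos ⟨by omega, hmn⟩, dif_pos ⟨by omega, hmn⟩]
      exact symmPreserving_left σ (by simp; omega) (by simp; omega) (by simp) (hw' r m)

include h2 hw in
lemma symmPreserving_columnR_pair {r q : ℕ} (hr : r + 1 < n) (hq : q ≤ r) :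
    SymmPreserving (permOp ι B (swap ⟨r, by omega⟩ ⟨r + 1, hr⟩))
      (columnR (B := B) σ w n r q * columnR (B := B) σ w n (r + 1) q) := by
  induction q with
  | zero =>
    exact SymmPreserving.of_commute (permOp_swap_mul_self _ _) (by simp [columnR])
  | succ q ih =>
    have h3 : Commute (factorR (B := B) σ w n q r) (columnR σ w n (r + 1) q) :=
      commute_columnR σ fun p hp => commute_factorR σ (by omega) (by omega) (by omega) (by omega)
    have h4 : columnR (B := B) σ w n r (q + 1) * columnR σ w n (r + 1) (q + 1) =
        (columnR σ w n r q * columnR σ w n (r + 1) q)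
          * (factorR σ w n q r * factorR σ w n q (r + 1)) := by
      rw [columnR, columnR, mul_assoc, ← mul_assoc (factorR σ w n q r), h3.eq]
      simp only [mul_assoc]
    rw [h4]
    refine (ih (by omega)).mul h2 ?_
    rw [factorR, factorR, dif_pos ⟨by omega, by omega⟩, dif_pos ⟨by omega, by omega⟩]
    exact symmPreserving_right σ (by simp; omega) (by simp; omega) (by simp) (hw q r)

include h2 hw hw' hs in
/-- The products of reflection type preserve symmetric tensors. -/
lemma symmPreserving_bracket {r m : ℕ} (hr : r + 1 < m) (hm : m ≤ n) :
    SymmPreserving (permOp ι B (swap ⟨r, by omega⟩ ⟨r + 1, by omega⟩))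
      (bracket σ s w n m) := by
  induction m with
  | zero => omega
  | succ m ih =>
    have hP := permOp_swap_mul_self (ι := ι) (B := B) (⟨r, by omega⟩ : Fin n) ⟨r + 1, by omega⟩
    rcases Nat.lt_or_ge (r + 1) m with hm' | hm'
    · exact ((ih hm' (by omega)).mul h2 (symmPreserving_columnR σ h2 hw' (by omega) hm' (by omega)
        hm')).mul h2 (SymmPreserving.of_commute hP (commute_permOp_factorS
        (by simp; omega) (by simp; omega)))
    · obtain rfl : m = r + 1 := by omega
      have h3 : Commute (factorS s n r) (columnR σ w n (r + 1) r) :=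
        commute_columnR σ fun p hp => commute_factorS_factorR σ (by omega) (by omega)
      have h4 : bracket σ s w n (r + 1 + 1) = bracket σ s w n r
          * (columnR σ w n r r * columnR σ w n (r + 1) r)
          * (factorS s n r * factorR σ w n r (r + 1) * factorS s n (r + 1)) := by
        rw [bracket, bracket, columnR]
        simp only [mul_assoc]
        rw [← mul_assoc (factorS s n r) (columnR σ w n (r + 1) r), h3.eq]
        simp only [mul_assoc]
      rw [h4]
      refine ((SymmPreserving.of_commute hP (commute_permOp_bracket σ ?_ ?_)).mul h2
        (symmPreserving_columnR_pair σ h2 hw (by omega) le_rfl)).mul h2 ?_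
      · simp
      · simp
      · rw [factorS, factorS, factorR, dif_pos (show r < n by omega),
          dif_pos (show r + 1 < n by omega), dif_pos (show r < n ∧ r + 1 < n by omega)]
        exact symmPreserving_reflection σ (by simp) (hs r)

end Fusion

section Extend

/-- The extension of a permutation by a fixed point at the end. -/
def extendLast {K : ℕ} (τ : Equiv.Perm (Fin K)) : Equiv.Perm (Fin (K + 1)) :=
  τ.extendDomain (finSuccAboveEquiv (Fin.last K))

lemma extendLast_last {K : ℕ} (τ : Equiv.Perm (Fin K)) :
    extendLast τ (Fin.last K) = Fin.last K :=
  Equiv.Perm.extendDomain_apply_not_subtype _ _ (not_not.2 rfl)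

lemma extendLast_castSucc {K : ℕ} (τ : Equiv.Perm (Fin K)) (q : Fin K) :
    extendLast τ q.castSucc = (τ q).castSucc := by
  have h := Equiv.Perm.extendDomain_apply_image τ (finSuccAboveEquiv (Fin.last K)) q
  simp only [finSuccAboveEquiv_apply, Fin.succAbove_last] at h
  exact h

lemma sign_extendLast {K : ℕ} (τ : Equiv.Perm (Fin K)) :
    Equiv.Perm.sign (extendLast τ) = Equiv.Perm.sign τ :=
  Equiv.Perm.sign_extendDomain _ _

lemma extendLast_injective {K : ℕ} : Function.Injective (extendLast (K := K)) :=
  Equiv.Perm.extendDomainHom_injective _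

lemma exists_extendLast {K : ℕ} {σ : Equiv.Perm (Fin (K + 1))} (h : σ (Fin.last K) = Fin.last K) :
    ∃ τ, extendLast τ = σ := by
  have hp : ∀ x, σ x ≠ Fin.last K ↔ x ≠ Fin.last K := by
    intro x
    rw [not_iff_not]
    exact ⟨fun hx => σ.injective (hx.trans h.symm), fun hx => by rw [hx, h]⟩
  refine ⟨(finSuccAboveEquiv (Fin.last K)).permCongr.symm (σ.subtypePerm hp), ?_⟩
  ext1 x
  refine lastCases ?_ (fun q => ?_) x
  · rw [extendLast_last, h]
  · have h1 : ∀ y, ((finSuccAboveEquiv (Fin.last K)).symm y).castSucc = y := by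
      intro y
      have := congrArg Subtype.val ((finSuccAboveEquiv (Fin.last K)).apply_symm_apply y)
      simp only [finSuccAboveEquiv_apply, Fin.succAbove_last] at this
      exact this
    rw [extendLast_castSucc]
    exact (h1 _).trans (by simp [finSuccAboveEquiv_apply])

lemma sum_eq_sum_extendLast {M : Type*} [AddCommMonoid M] {K : ℕ}
    (f : Equiv.Perm (Fin (K + 1)) → M) (hf : ∀ σ, σ (Fin.last K) ≠ Fin.last K → f σ = 0) :
    ∑ σ, f σ = ∑ τ, f (extendLast τ) := by
  symm
  refine Finset.sum_of_injOn extendLast extendLast_injective.injOn (by simp) (fun σ _ hσ => ?_)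
    fun _ _ => rfl
  refine hf σ fun h => hσ ?_
  obtain ⟨τ, rfl⟩ := exists_extendLast h
  simp

lemma snoc_comp_extendLast {ι : Type*} {K : ℕ} (a : Fin K → ι) (c : ι) (τ : Equiv.Perm (Fin K)) :
    (snoc a c : Fin (K + 1) → ι) ∘ extendLast τ = snoc (a ∘ τ) c := by
  funext q
  refine lastCases ?_ (fun q => ?_) q
  · simp [extendLast_last]
  · simp [extendLast_castSucc]

end Extend

section Minor

variable {K B : Type*} [CommRing K] [Ring B] [Algebra K B]
variable {ε : ℤ} {ι : Type*} [Fintype ι] [DecidableEq ι] (σ : SignedIndex ε ι) {n : ℕ}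

/-- The antisymmetrizer. -/
def antisym (ι B : Type*) [DecidableEq ι] [Ring B] (n : ℕ) :
    Matrix (Fin n → ι) (Fin n → ι) B :=
  ∑ τ : Equiv.Perm (Fin n), (Equiv.Perm.sign τ : ℤ) • permOp ι B τ

lemma antisym_mul_apply (X : Matrix (Fin n → ι) (Fin n → ι) B) (a b : Fin n → ι) :
    (antisym ι B n * X) a b =
      ∑ τ : Equiv.Perm (Fin n), (Equiv.Perm.sign τ : ℤ) • X (a ∘ τ) b := by
  simp only [antisym, sum_mul, Matrix.sum_apply, smul_mul_assoc, Matrix.smul_apply,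
    permOp_mul_apply]

lemma antisym_mul_permOp (τ : Equiv.Perm (Fin n)) :
    antisym ι B n * permOp ι B τ = (Equiv.Perm.sign τ : ℤ) • antisym ι B n := by
  rw [antisym, sum_mul, smul_sum]
  refine Fintype.sum_equiv (Equiv.mulRight τ) _ _ fun ρ => ?_
  rw [smul_mul_assoc, permOp_mul, Equiv.coe_mulRight, Equiv.Perm.sign_mul, smul_smul]
  have : ((Equiv.Perm.sign ρ : ℤ)) = Equiv.Perm.sign τ * (Equiv.Perm.sign ρ * Equiv.Perm.sign τ : ℤˣ) := by
    rw [Units.val_mul, mul_left_comm, Int.units_coe_mul_self, mul_one]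
  rw [← this]

lemma permOp_mul_antisym (τ : Equiv.Perm (Fin n)) :
    permOp ι B τ * antisym ι B n = (Equiv.Perm.sign τ : ℤ) • antisym ι B n := by
  rw [antisym, mul_sum, smul_sum]
  refine Fintype.sum_equiv (Equiv.mulLeft τ) _ _ fun ρ => ?_
  rw [mul_smul_comm, permOp_mul, Equiv.coe_mulLeft, Equiv.Perm.sign_mul, smul_smul]
  have : ((Equiv.Perm.sign ρ : ℤ)) = Equiv.Perm.sign τ * (Equiv.Perm.sign τ * Equiv.Perm.sign ρ : ℤˣ) := by
    rw [Units.val_mul, ← mul_assoc, Int.units_coe_mul_self, one_mul]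
  rw [← this]

lemma antisym_mul_comp_apply (X : Matrix (Fin n → ι) (Fin n → ι) B) (a b : Fin n → ι)
    (τ : Equiv.Perm (Fin n)) : (antisym ι B n * X) (a ∘ τ) b =
      (Equiv.Perm.sign τ : ℤ) • (antisym ι B n * X) a b := by
  rw [← permOp_mul_apply τ (antisym ι B n * X), ← mul_assoc, permOp_mul_antisym, smul_mul_assoc, Matrix.smul_apply]

/-- The operators `Y` with `Y P = - P` for the transpositions `P` of the first `m` factors. -/
def LowerAntisymm (m : ℕ) (Y : Matrix (Fin n → ι) (Fin n → ι) B) : Prop :=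
  ∀ p q : Fin n, (p : ℕ) < m → (q : ℕ) < m → p ≠ q → Y * permOp ι B (swap p q) = -Y

lemma lowerAntisymm_of_adjacent {m : ℕ} {Y : Matrix (Fin n → ι) (Fin n → ι) B}
    (h : ∀ (r : ℕ) (_ : r + 1 < m) (h' : r + 1 < n),
      Y * permOp ι B (swap ⟨r, by omega⟩ ⟨r + 1, h'⟩) = -Y) : LowerAntisymm m Y := by
  have key : ∀ (d r : ℕ) (_ : r + d + 1 < m) (h' : r + d + 1 < n),
      Y * permOp ι B (swap ⟨r, by omega⟩ ⟨r + d + 1, h'⟩) = -Y := by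
    intro d
    induction d with
    | zero => exact fun r h1 h2 => h r h1 h2
    | succ d ih =>
      intro r h1 h2
      have e : (swap ⟨r, by omega⟩ ⟨r + (d + 1) + 1, h2⟩ : Equiv.Perm (Fin n)) =
          swap ⟨r + d + 1, by omega⟩ ⟨r + d + 1 + 1, h2⟩
            * swap ⟨r, by omega⟩ ⟨r + d + 1, by omega⟩
            * swap ⟨r + d + 1, by omega⟩ ⟨r + d + 1 + 1, h2⟩ := by
        have e1 := Equiv.swap_mul_swap_mul_swap (x := (⟨r, by omega⟩ : Fin n))
          (y := ⟨r + d + 1, by omega⟩) (z := ⟨r + d + 1 + 1, h2⟩) (by simp; omega) (by simp; omega)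
        exact (Equiv.swap_comm _ _).trans e1.symm
      rw [e, ← permOp_mul, ← permOp_mul, ← mul_assoc, ← mul_assoc, h (r + d + 1) (by omega) h2,
        neg_mul, ih r (by omega) (by omega), neg_neg, h (r + d + 1) (by omega) h2]
  intro p q hp hq hpq
  rcases lt_trichotomy p q with h1 | h1 | h1
  · have := key (q - p - 1) p (by omega) (by omega)
    convert this using 3
    congr 1
    ext
    simp only
    omega
  · exact absurd h1 hpq
  · have := key (p - q - 1) q (by omega) (by omega)
    rw [Equiv.swap_comm]
    convert this using 3
    congr 1
    ext
    simp only
    omega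

lemma LowerAntisymm.apply_swap {m : ℕ} {Y : Matrix (Fin n → ι) (Fin n → ι) B}
    (h : LowerAntisymm m Y) {p q : Fin n} (hp : (p : ℕ) < m) (hq : (q : ℕ) < m) (hpq : p ≠ q)
    (a b : Fin n → ι) : Y a (b ∘ swap p q) = -Y a b := by
  rw [← Matrix.neg_apply, ← h p q hp hq hpq, mul_permOp_apply, Equiv.symm_swap]

lemma LowerAntisymm.apply_comp {Y : Matrix (Fin n → ι) (Fin n → ι) B}
    (h : LowerAntisymm n Y) (a b : Fin n → ι) (τ : Equiv.Perm (Fin n)) :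
    Y a (b ∘ τ) = (Equiv.Perm.sign τ : ℤ) • Y a b := by
  have key : Y * permOp ι B τ⁻¹ = (Equiv.Perm.sign τ⁻¹ : ℤ) • Y := by
    induction τ⁻¹ using Equiv.Perm.swap_induction_on with
    | one => simp [permOp_one]
    | swap_mul f x y hxy ih =>
      rw [← permOp_mul, ← mul_assoc, h x y x.2 y.2 hxy, neg_mul, ih, Equiv.Perm.sign_mul,
        Equiv.Perm.sign_swap hxy]
      simp
  rw [Equiv.Perm.sign_inv] at key
  rw [← Matrix.smul_apply, ← key, mul_permOp_apply]
  rfl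

lemma LowerAntisymm.apply_eq_zero [IsDomain K] [Module.IsTorsionFree K B] (h2 : (2 : K) ≠ 0)
    {m : ℕ} {Y : Matrix (Fin n → ι) (Fin n → ι) B}
    (h : LowerAntisymm m Y) {p q : Fin n} (hp : (p : ℕ) < m) (hq : (q : ℕ) < m) (hpq : p ≠ q)
    (a : Fin n → ι) {b : Fin n → ι} (hb : b p = b q) : Y a b = 0 := by
  have h3 := h.apply_swap hp hq hpq a b
  have h4 : b ∘ swap p q = b := by
    funext r
    by_cases hr : r = p
    · rw [hr, Function.comp_apply, Equiv.swap_apply_left, hb]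
    · by_cases hr' : r = q
      · rw [hr', Function.comp_apply, swap_apply_right, hb]
      · rw [Function.comp_apply, swap_apply_of_ne_of_ne hr hr']
  rw [h4, ← add_eq_zero_iff_eq_neg, ← two_smul K, smul_eq_zero] at h3
  exact h3.resolve_left h2

/-! ### Adding a tensor factor -/

/-- `X ⊗ 1`. -/
def liftLast (X : Matrix (Fin n → ι) (Fin n → ι) B) :
    Matrix (Fin (n + 1) → ι) (Fin (n + 1) → ι) B :=
  Matrix.of fun a b => if a (Fin.last n) = b (Fin.last n) then X (Fin.init a) (Fin.init b) else 0

lemma liftLast_apply (X : Matrix (Fin n → ι) (Fin n → ι) B) (a b : Fin (n + 1) → ι) :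
    liftLast X a b =
      if a (Fin.last n) = b (Fin.last n) then X (Fin.init a) (Fin.init b) else 0 :=
  rfl

lemma sum_snoc {M : Type*} [AddCommMonoid M] (f : (Fin (n + 1) → ι) → M) :
    ∑ a, f a = ∑ c : ι, ∑ a : Fin n → ι, f (snoc a c) := by
  rw [← (Fin.snocEquiv fun _ => ι).sum_comp, Fintype.sum_prod_type]
  rfl

lemma liftLast_one : liftLast (1 : Matrix (Fin n → ι) (Fin n → ι) B) = 1 := by
  ext a b
  have h : a = b ↔ a (Fin.last n) = b (Fin.last n) ∧ Fin.init a = Fin.init b := by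
    refine ⟨fun h => by rw [h]; simp, fun h => ?_⟩
    rw [← Fin.snoc_init_self a, ← Fin.snoc_init_self b, h.1, h.2]
  simp only [liftLast, of_apply, one_apply, h, ite_and]

lemma liftLast_mul (X Y : Matrix (Fin n → ι) (Fin n → ι) B) :
    liftLast (X * Y) = liftLast X * liftLast Y := by
  ext a b
  rw [mul_apply, sum_snoc]
  simp only [liftLast_apply, snoc_last, Fin.init_snoc, mul_apply]
  rw [sum_eq_single (a (Fin.last n))]
  · split_ifs <;> simp_all
  · intro c _ hc
    refine sum_eq_zero fun d _ => ?_
    rw [if_neg hc.symm, zero_mul]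
  · simp

lemma liftLast_opAt (M : Matrix ι ι B) (p : Fin n) :
    liftLast (opAt M p) = opAt M p.castSucc := by
  ext a b
  have h : (∀ q, q ≠ p.castSucc → a q = b q) ↔
      a (Fin.last n) = b (Fin.last n) ∧ ∀ q, q ≠ p → Fin.init a q = Fin.init b q := by
    rw [Fin.forall_fin_succ']
    simp only [Ne, Fin.castSucc_inj, Fin.init, and_comm, (castSucc_ne_last p).symm,
      not_false_eq_true, true_imp_iff]
  simp only [liftLast, opAt, of_apply, h, ite_and]
  rfl

lemma liftLast_embedTwo (X : Matrix (ι × ι) (ι × ι) B) (p q : Fin n) :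
    liftLast (embedTwo p q X) = embedTwo p.castSucc q.castSucc X := by
  ext a b
  have h : (∀ r, r ≠ p.castSucc → r ≠ q.castSucc → a r = b r) ↔
      a (Fin.last n) = b (Fin.last n) ∧ ∀ r, r ≠ p → r ≠ q → Fin.init a r = Fin.init b r := by
    rw [Fin.forall_fin_succ']
    simp only [Ne, Fin.castSucc_inj, Fin.init, and_comm, (castSucc_ne_last p).symm,
      (castSucc_ne_last q).symm, not_false_eq_true, true_imp_iff]
  simp only [liftLast, embedTwo, of_apply, h, ite_and]
  rfl

lemma liftLast_siteR (w : K) (p q : Fin n) :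
    liftLast (siteR σ B w p q) = siteR σ B w p.castSucc q.castSucc := by
  rw [siteR, siteR, siteQ, siteQ, ← liftLast_embedTwo, ← liftLast_one]
  ext a b
  simp only [liftLast, of_apply, Matrix.add_apply, Matrix.smul_apply]
  split_ifs <;> simp

variable (s : ℕ → Matrix ι ι B) (w : ℕ → ℕ → K)

lemma liftLast_factorS {p : ℕ} (hp : p < n) :
    liftLast (factorS s n p) = factorS s (n + 1) p := by
  rw [factorS, factorS, dif_pos hp, dif_pos (hp.trans n.lt_succ_self), liftLast_opAt]
  rfl

lemma liftLast_factorR {p q : ℕ} (hp : p < n) (hq : q < n) :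
    liftLast (factorR (B := B) σ w n p q) = factorR σ w (n + 1) p q := by
  rw [factorR, factorR, dif_pos ⟨hp, hq⟩, dif_pos ⟨hp.trans n.lt_succ_self, hq.trans n.lt_succ_self⟩,
    liftLast_siteR]
  rfl

lemma liftLast_columnR {m q : ℕ} (hm : m < n) (hq : q ≤ n) :
    liftLast (columnR (B := B) σ w n m q) = columnR σ w (n + 1) m q := by
  induction q with
  | zero => exact liftLast_one
  | succ q ih => rw [columnR, columnR, liftLast_mul, ih (by omega), liftLast_factorR σ w hq hm]

lemma liftLast_bracket {m : ℕ} (hm : m ≤ n) :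
    liftLast (bracket σ s w n m) = bracket σ s w (n + 1) m := by
  induction m with
  | zero => exact liftLast_one
  | succ m ih =>
    rw [bracket, bracket, liftLast_mul, liftLast_mul, ih (by omega), liftLast_factorS s hm,
      liftLast_columnR σ w hm (by omega)]

lemma antisym_mul_liftLast_eq_zero (X : Matrix (Fin n → ι) (Fin n → ι) B)
    {a b : Fin (n + 1) → ι} (h : ∀ p, a p ≠ b (Fin.last n)) :
    (antisym ι B (n + 1) * liftLast X) a b = 0 := by
  rw [antisym_mul_apply]
  refine sum_eq_zero fun τ _ => ?_
  rw [liftLast_apply, if_neg (show ¬ (a ∘ τ) (Fin.last n) = b (Fin.last n) from h _), smul_zero]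

lemma antisym_mul_liftLast (X : Matrix (Fin n → ι) (Fin n → ι) B) {a b : Fin n → ι} {c : ι}
    (h : ∀ p, a p ≠ c) :
    (antisym ι B (n + 1) * liftLast X) (snoc a c) (snoc b c) =
      (antisym ι B n * X) a b := by
  rw [antisym_mul_apply, antisym_mul_apply, sum_eq_sum_extendLast]
  · refine sum_congr rfl fun τ _ => ?_
    rw [sign_extendLast, snoc_comp_extendLast, liftLast_apply]
    simp [Fin.init_snoc]
  · intro τ hτ
    rw [liftLast_apply, if_neg, smul_zero]
    obtain ⟨q, hq⟩ := Fin.exists_castSucc_eq.2 hτ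
    rw [Function.comp_apply, ← hq]
    simpa using h q

end Minor

section Minor

variable {K B : Type*} [CommRing K] [Ring B] [Algebra K B]
variable {ε : ℤ} {ι : Type*} [Fintype ι] [DecidableEq ι] (σ : SignedIndex ε ι) {n : ℕ}
variable (s : ℕ → Matrix ι ι B) (w : ℕ → ℕ → K)

/-- The Sklyanin minors. -/
def minor (a b : Fin n → ι) : B :=
  (antisym ι B n * bracket σ s w n n) a b

/-- The product `A_{n+1} ⟨S_0, …, S_{n-1}⟩`. -/
def preMinor (ι B : Type*) [Ring B] [Algebra K B] [Fintype ι] [DecidableEq ι]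
    (σ : SignedIndex ε ι) (s : ℕ → Matrix ι ι B) (w : ℕ → ℕ → K) (n : ℕ) :
    Matrix (Fin (n + 1) → ι) (Fin (n + 1) → ι) B :=
  antisym ι B (n + 1) * bracket σ s w (n + 1) n

lemma mul_opAt_apply (X : Matrix (Fin n → ι) (Fin n → ι) B) (M : Matrix ι ι B) (p : Fin n)
    (a b : Fin n → ι) :
    (X * opAt M p) a b = ∑ c, X a (update b p c) * M c (b p) := by
  rw [mul_apply]
  symm
  refine Finset.sum_of_injOn (fun c => update b p c) ?_ (by simp) ?_ ?_
  · exact (Function.update_injective b p).injOn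
  · intro c _ hc
    rw [opAt, of_apply, if_neg, mul_zero]
    intro h
    refine hc ⟨c p, by simp, ?_⟩
    funext q
    by_cases hq : q = p
    · subst hq
      simp
    · simp [hq, h q hq]
  · intro c _
    rw [opAt, of_apply, if_pos]
    · simp
    · intro q hq
      simp [hq]

lemma preMinor_eq_zero {a : Fin (n + 1) → ι} {b : Fin n → ι} {c : ι} (h : ∀ p, a p ≠ c) :
    preMinor ι B σ s w n a (snoc b c) = 0 := by
  rw [preMinor, ← liftLast_bracket σ s w le_rfl]
  exact antisym_mul_liftLast_eq_zero _ (by simpa using h)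

lemma preMinor_snoc {a b : Fin n → ι} {c : ι} (h : ∀ p, a p ≠ c) :
    preMinor ι B σ s w n (snoc a c) (snoc b c) = minor σ s w a b := by
  rw [preMinor, ← liftLast_bracket σ s w le_rfl]
  exact antisym_mul_liftLast _ h

lemma minor_comp_left (a b : Fin n → ι) (τ : Equiv.Perm (Fin n)) :
    minor σ s w (a ∘ τ) b = (Equiv.Perm.sign τ : ℤ) • minor σ s w a b :=
  antisym_mul_comp_apply _ _ _ _

variable {σ s w} [IsDomain K] [Module.IsTorsionFree K B] (h2 : (2 : K) ≠ 0)
  (hw : ∀ p r, w p r - w p (r + 1) + w p r * w p (r + 1) = 0)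
  (hw' : ∀ r m, w r m - w (r + 1) m + w r m * w (r + 1) m = 0)
  (hs : ∀ r, QuadRel σ 1 1 1 (w r (r + 1)) (s r) (s (r + 1)))

include h2 hw hw' hs in
lemma lowerAntisymm_bracket {m : ℕ} (hm : m ≤ n) :
    LowerAntisymm m (antisym ι B n * bracket σ s w n m) := by
  refine lowerAntisymm_of_adjacent fun r hr hr' => ?_
  refine (symmPreserving_bracket σ h2 hw hw' hs hr hm).antisymm h2 ?_
  rw [antisym_mul_permOp, Equiv.Perm.sign_swap (by simp)]
  simp

include h2 hw hw' hs in
lemma minor_comp_right (a b : Fin n → ι) (τ : Equiv.Perm (Fin n)) :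
    minor σ s w a (b ∘ τ) = (Equiv.Perm.sign τ : ℤ) • minor σ s w a b :=
  (lowerAntisymm_bracket h2 hw hw' hs le_rfl).apply_comp _ _ _

include h2 hw hw' hs in
lemma minor_comp_comp (a b : Fin n → ι) (τ : Equiv.Perm (Fin n)) :
    minor σ s w (a ∘ τ) (b ∘ τ) = minor σ s w a b := by
  rw [minor_comp_left, minor_comp_right h2 hw hw' hs, smul_smul, Int.units_coe_mul_self, one_smul]

include h2 hw hw' hs in
lemma minor_eq_zero_right {a b : Fin n → ι} {p q : Fin n} (hpq : p ≠ q) (hb : b p = b q) :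
    minor σ s w a b = 0 :=
  (lowerAntisymm_bracket h2 hw hw' hs le_rfl).apply_eq_zero h2 p.2 q.2 hpq _ hb

include h2 in
lemma minor_eq_zero_left {a b : Fin n → ι} {p q : Fin n} (hpq : p ≠ q) (ha : a p = a q) :
    minor σ s w a b = 0 := by
  have h4 : a ∘ swap p q = a := by
    funext r
    by_cases hr : r = p
    · rw [hr, Function.comp_apply, Equiv.swap_apply_left, ha]
    · by_cases hr' : r = q
      · rw [hr', Function.comp_apply, swap_apply_right, ha]
      · rw [Function.comp_apply, swap_apply_of_ne_of_ne hr hr']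
  have h3 := minor_comp_left σ s w a b (swap p q)
  rw [h4, Equiv.Perm.sign_swap hpq, Units.val_neg, Units.val_one, neg_smul, one_smul,
    ← add_eq_zero_iff_eq_neg, ← two_smul K, smul_eq_zero] at h3
  exact h3.resolve_left h2

include hw' in
lemma one_sub_mul_weight (m r : ℕ) : w r m * (1 - r * w 0 m) = w 0 m := by
  induction r with
  | zero => simp
  | succ r ih =>
    push_cast
    linear_combination (1 + w (r + 1) m) * ih - (1 - r * w 0 m) * hw' r m

include hw' in
lemma mul_columnR {Y : Matrix (Fin (n + 1) → ι) (Fin (n + 1) → ι) B} (hY : LowerAntisymm n Y)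
    {q : ℕ} (hq : q ≤ n) : Y * columnR σ w (n + 1) n q = Y + w 0 n • ∑ p ∈ Finset.range q,
      if h : p < n then Y * siteQ σ B (⟨p, h⟩ : Fin n).castSucc (Fin.last n) else 0 := by
  induction q with
  | zero => simp [columnR]
  | succ q ih =>
    have h1 : ∀ p ∈ Finset.range q,
        (if h : p < n then Y * siteQ σ B (⟨p, h⟩ : Fin n).castSucc (Fin.last n) else 0)
          * siteQ σ B (⟨q, hq⟩ : Fin n).castSucc (Fin.last n)
        = - (Y * siteQ σ B (⟨q, hq⟩ : Fin n).castSucc (Fin.last n)) := by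
      intro p hp
      rw [mem_range] at hp
      rw [dif_pos (hp.trans hq), mul_assoc, siteQ_symm σ _ (Fin.last n), siteQ_symm σ _ (Fin.last n),
        siteQ_mul_siteQ σ (by simp [Fin.ext_iff]; omega) (by simp [Fin.ext_iff]; omega)
          (by simp [Fin.ext_iff]; omega)]
      have h3 := permOp_mul_siteQ (B := B) σ (swap (⟨p, hp.trans hq⟩ : Fin n).castSucc
        (⟨q, hq⟩ : Fin n).castSucc) (Fin.last n) (⟨q, hq⟩ : Fin n).castSucc
      rw [swap_apply_right, swap_apply_of_ne_of_ne (by simp [Fin.ext_iff]; omega)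
        (by simp [Fin.ext_iff]; omega)] at h3
      rw [← h3, ← mul_assoc, hY (⟨p, hp.trans hq⟩ : Fin n).castSucc (⟨q, hq⟩ : Fin n).castSucc
        (hp.trans hq) hq (by simp [Fin.ext_iff]; omega), neg_mul]
    have h4 : factorR (B := B) σ w (n + 1) q n =
        1 + w q n • siteQ σ B (⟨q, hq⟩ : Fin n).castSucc (Fin.last n) := by
      rw [factorR, dif_pos ⟨by omega, by omega⟩]
      rfl
    rw [columnR, ← mul_assoc, ih (by omega), h4, Finset.sum_range_succ, dif_pos (show q < n from hq), mul_add, mul_one,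
      add_mul, mul_smul_comm, smul_mul_assoc, mul_smul_comm, sum_mul, sum_congr rfl h1,
      Finset.sum_const, Finset.card_range, smul_neg]
    have h5 := one_sub_mul_weight hw' n q
    have h6 : w q n - q * (w 0 n * w q n) = w 0 n := by linear_combination h5
    generalize Y * siteQ σ B (⟨q, hq⟩ : Fin n).castSucc (Fin.last n) = Z
    rw [← Nat.cast_smul_eq_nsmul K]
    linear_combination (norm := module) h6 • Z

include h2 hw hw' hs in
lemma minor_snoc_right (a : Fin (n + 1) → ι) (b : Fin n → ι) (j : ι) :
    minor σ s w a (snoc b j) = ∑ c, (preMinor ι B σ s w n a (snoc b c) +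
      w 0 n • ∑ p, if b p = σ.ν c then ∑ x, (σ.e x * σ.e c) •
        preMinor ι B σ s w n a (snoc (update b p (σ.ν x)) x) else 0) * s n c j := by
  have hY := lowerAntisymm_bracket (n := n + 1) h2 hw hw' hs n.le_succ
  rw [minor, bracket, ← mul_assoc, ← mul_assoc, mul_columnR hw' hY le_rfl, factorS,
    dif_pos n.lt_succ_self, mul_opAt_apply]
  refine sum_congr rfl fun c _ => ?_
  change _ * s n c ((snoc b j : Fin (n + 1) → ι) (Fin.last n)) = _
  rw [snoc_last]
  congr 1
  change (_ : Matrix (Fin (n + 1) → ι) (Fin (n + 1) → ι) B) a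
    (update (snoc b j : Fin (n + 1) → ι) (Fin.last n) c) = _
  rw [Fin.update_snoc_last, Matrix.add_apply, Matrix.smul_apply, Matrix.sum_apply,
    Finset.sum_range]
  congr 2
  refine sum_congr rfl fun p _ => ?_
  rw [dif_pos p.2, mul_siteQ_apply σ (castSucc_ne_last _)]
  simp only [Fin.eta, snoc_castSucc, snoc_last, ← Fin.snoc_update, Fin.update_snoc_last]
  rfl

lemma sum_mul_eq_of_row {M : Matrix ι ι B} {o : Fin n → ι} (ho : Function.Injective o) {i : ι}
    (hi : ∀ p, o p ≠ i) {r : ι → B} (hr : ∀ c, c ≠ i → (∀ p, o p ≠ c) → r c = 0)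
    (hz : ∀ q, ∑ c, r c * M c (o q) = 0) {N : Matrix (Fin n) (Fin n) B}
    (hN : M.submatrix o o * N = 1) {W : Fin n → B}
    (hW : ∀ q, M i (o q) + ∑ p, W p * M (o p) (o q) = 0) (j : ι) :
    ∑ c, r c * M c j = r i * (M i j + ∑ p, W p * M (o p) j) := by
  have key : ∀ j, ∑ c, r c * M c j = r i * M i j + ∑ p, r (o p) * M (o p) j := by
    intro j
    rw [← Finset.sum_subset (Finset.subset_univ (insert i (Finset.univ.image o))),
      Finset.sum_insert (by simpa using hi), Finset.sum_image ho.injOn]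
    intro c _ hc
    simp only [Finset.mem_insert, Finset.mem_image, mem_univ, true_and, not_or,
      not_exists] at hc
    rw [hr c hc.1 hc.2, zero_mul]
  have h1 : Matrix.vecMul (fun p => r (o p) - r i * W p) (M.submatrix o o) = 0 := by
    funext q
    have h3 := hz q
    rw [key] at h3
    have h4 := congrArg (r i * ·) (hW q)
    simp only [mul_add, mul_zero, mul_sum] at h4
    simp only [Matrix.vecMul, dotProduct, submatrix_apply, sub_mul, sum_sub_distrib,
      Pi.zero_apply, mul_assoc]
    rw [sub_eq_zero]
    exact add_left_cancel (h3.trans h4.symm)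
  have h5 : (fun p => r (o p) - r i * W p) = 0 := by
    rw [← Matrix.vecMul_one (fun p => r (o p) - r i * W p), ← hN, ← Matrix.vecMul_vecMul, h1,
      Matrix.zero_vecMul]
  rw [key, mul_add, mul_sum]
  congr 1
  refine sum_congr rfl fun p _ => ?_
  rw [← mul_assoc, sub_eq_zero.1 (congrFun h5 p)]

include h2 hw hw' hs in
/-- The minors with one row and one column added are quasideterminants. -/
lemma minor_snoc_snoc {o : Fin n → ι} (ho : Function.Injective o)
    (hν : ∀ p, ∃ q, o q = σ.ν (o p)) {i : ι} (hi : ∀ p, o p ≠ i) {N : Matrix (Fin n) (Fin n) B}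
    (hN : (s n).submatrix o o * N = 1) {W : Fin n → B}
    (hW : ∀ q, s n i (o q) + ∑ p, W p * s n (o p) (o q) = 0) (j : ι) :
    minor σ s w (snoc o i : Fin (n + 1) → ι) (snoc o j : Fin (n + 1) → ι) =
      minor σ s w o o * (s n i j + ∑ p, W p * s n (o p) j) := by
  have hν' : ∀ c, (∀ p, o p ≠ c) → ∀ p, o p ≠ σ.ν c := by
    intro c hc p hp
    obtain ⟨q, hq⟩ := hν p
    exact hc q (by rw [hq, hp, σ.ν_ν])
  have h1 : preMinor ι B σ s w n (snoc o i) (snoc o i) +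
      w 0 n • ∑ p, (if o p = σ.ν i then ∑ x, (σ.e x * σ.e i) •
        preMinor ι B σ s w n (snoc o i) (snoc (update o p (σ.ν x)) x) else 0)
      = minor σ s w o o := by
    rw [preMinor_snoc σ s w hi, sum_eq_zero fun p _ => if_neg (hν' i hi p), smul_zero, add_zero]
  rw [minor_snoc_right h2 hw hw' hs, sum_mul_eq_of_row ho hi _ _ hN hW j, h1]
  · intro c hc hc'
    rw [sum_eq_zero fun p _ => if_neg (hν' c hc' p), preMinor_eq_zero σ s w, smul_zero, add_zero]
    intro p
    refine lastCases ?_ (fun p => ?_) p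
    · simpa using hc.symm
    · simpa using hc' p
  · intro q
    rw [← minor_snoc_right h2 hw hw' hs]
    refine minor_eq_zero_right h2 hw hw' hs (p := q.castSucc) (q := Fin.last n)
      (castSucc_ne_last _) ?_
    simp

lemma snoc_snoc_comp_swap (o : Fin n → ι) (x y : ι) :
    (snoc (snoc o x : Fin (n + 1) → ι) y : Fin (n + 2) → ι)
        ∘ swap (Fin.last n).castSucc (Fin.last (n + 1)) =
      snoc (snoc o y : Fin (n + 1) → ι) x := by
  funext q
  refine lastCases ?_ (fun q => lastCases ?_ (fun q => ?_) q) q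
  · simp
  · simp
  · rw [Function.comp_apply, swap_apply_of_ne_of_ne (by simp [Fin.ext_iff]; omega)
      (castSucc_ne_last _)]
    simp

include h2 hw hw' hs in
/-- The principal minors with a pair of opposite indices added. -/
lemma minor_snoc_pair {o : Fin n → ι} (ho : Function.Injective o)
    (hν : ∀ p, ∃ q, o q = σ.ν (o p)) {i : ι} (hi : ∀ p, o p ≠ i) (hii : σ.ν i ≠ i)
    {N : Matrix (Fin (n + 1)) (Fin (n + 1)) B}
    (hN : (s (n + 1)).submatrix (snoc o (σ.ν i) : Fin (n + 1) → ι)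
      (snoc o (σ.ν i) : Fin (n + 1) → ι) * N = 1) {W : Fin (n + 1) → B}
    (hW : ∀ q, s (n + 1) i ((snoc o (σ.ν i) : Fin (n + 1) → ι) q) +
      ∑ p, W p * s (n + 1) ((snoc o (σ.ν i) : Fin (n + 1) → ι) p)
        ((snoc o (σ.ν i) : Fin (n + 1) → ι) q) = 0) :
    minor σ s w (snoc (snoc o (σ.ν i) : Fin (n + 1) → ι) i : Fin (n + 2) → ι)
      (snoc (snoc o (σ.ν i) : Fin (n + 1) → ι) i : Fin (n + 2) → ι) =
    (minor σ s w (snoc o (σ.ν i) : Fin (n + 1) → ι) (snoc o (σ.ν i) : Fin (n + 1) → ι)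
      + w 0 (n + 1) •
        (minor σ s w (snoc o (σ.ν i) : Fin (n + 1) → ι) (snoc o (σ.ν i) : Fin (n + 1) → ι)
        - ε • minor σ s w (snoc o i : Fin (n + 1) → ι) (snoc o i : Fin (n + 1) → ι)))
      * (s (n + 1) i i + ∑ p, W p * s (n + 1) ((snoc o (σ.ν i) : Fin (n + 1) → ι) p) i) := by
  have hν' : ∀ c, (∀ p, o p ≠ c) → ∀ p, o p ≠ σ.ν c := by
    intro c hc p hp
    obtain ⟨q, hq⟩ := hν p
    exact hc q (by rw [hq, hp, σ.ν_ν])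
  have hi' := hν' i hi
  have ho' : Function.Injective (snoc o (σ.ν i) : Fin (n + 1) → ι) :=
    Fin.snoc_injective_iff.2 ⟨ho, by simpa using hi'⟩
  have hio : ∀ p, (snoc o (σ.ν i) : Fin (n + 1) → ι) p ≠ i := by
    intro p
    refine lastCases ?_ (fun p => ?_) p
    · simpa using hii
    · simpa using hi p
  have h1 : preMinor ι B σ s w (n + 1) (snoc (snoc o (σ.ν i) : Fin (n + 1) → ι) i)
        (snoc (snoc o (σ.ν i) : Fin (n + 1) → ι) i) +
      w 0 (n + 1) • ∑ p, (if (snoc o (σ.ν i) : Fin (n + 1) → ι) p = σ.ν i then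
        ∑ x, (σ.e x * σ.e i) • preMinor ι B σ s w (n + 1)
          (snoc (snoc o (σ.ν i) : Fin (n + 1) → ι) i)
          (snoc (update (snoc o (σ.ν i) : Fin (n + 1) → ι) p (σ.ν x)) x) else 0)
      = minor σ s w (snoc o (σ.ν i) : Fin (n + 1) → ι) (snoc o (σ.ν i) : Fin (n + 1) → ι)
      + w 0 (n + 1) •
        (minor σ s w (snoc o (σ.ν i) : Fin (n + 1) → ι) (snoc o (σ.ν i) : Fin (n + 1) → ι)
        - ε • minor σ s w (snoc o i : Fin (n + 1) → ι) (snoc o i : Fin (n + 1) → ι)) := by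
    rw [preMinor_snoc σ s w hio, sum_univ_castSucc,
      sum_eq_zero fun p _ => if_neg (by rw [snoc_castSucc]; exact hi' p), zero_add,
      snoc_last, if_pos rfl]
    congr 2
    simp only [Fin.update_snoc_last]
    have h3 : ∀ x, x ≠ i → x ≠ σ.ν i → preMinor ι B σ s w (n + 1)
          (snoc (snoc o (σ.ν i) : Fin (n + 1) → ι) i)
          (snoc (snoc o (σ.ν x) : Fin (n + 1) → ι) x) = 0 := by
      intro x hx hx'
      by_cases hxo : ∃ q, o q = x
      · obtain ⟨q, rfl⟩ := hxo
        obtain ⟨q', hq'⟩ := hν q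
        refine (lowerAntisymm_bracket (n := n + 2) h2 hw hw' hs (n + 1).le_succ).apply_eq_zero h2
          (p := q'.castSucc.castSucc) (q := (Fin.last n).castSucc) ?_ ?_ ?_ _ ?_
        · simp
        · simp
        · simp [Fin.ext_iff]; omega
        · simp [hq']
      · push Not at hxo
        refine preMinor_eq_zero σ s w fun p => ?_
        refine lastCases ?_ (fun p => lastCases ?_ (fun p => ?_) p) p
        · simpa using hx.symm
        · simpa using hx'.symm
        · simpa using hxo p
    rw [← Finset.sum_subset (Finset.subset_univ {i, σ.ν i}), Finset.sum_pair hii.symm,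
      preMinor_snoc σ s w hio, σ.ν_ν]
    · have h4 : (snoc (snoc o (σ.ν i) : Fin (n + 1) → ι) i : Fin (n + 2) → ι) =
          (snoc (snoc o i : Fin (n + 1) → ι) (σ.ν i) : Fin (n + 2) → ι)
            ∘ swap (Fin.last n).castSucc (Fin.last (n + 1)) :=
        (snoc_snoc_comp_swap o i (σ.ν i)).symm
      have h5 : ∀ p, (snoc o i : Fin (n + 1) → ι) p ≠ σ.ν i := by
        intro p
        refine lastCases ?_ (fun p => ?_) p
        · simpa using hii.symm
        · simpa using hi' p
      rw [h4, preMinor, antisym_mul_comp_apply, ← preMinor, preMinor_snoc σ s w h5,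
        Equiv.Perm.sign_swap (castSucc_ne_last _), σ.e_mul, one_smul, σ.e_ν_eq]
      have h6 : ε * σ.e i * σ.e i = ε := by rw [mul_assoc, σ.e_mul, mul_one]
      rw [h6, Units.val_neg, Units.val_one, neg_smul, one_smul, smul_neg, sub_eq_add_neg]
    · intro x _ hx
      simp only [Finset.mem_insert, Finset.mem_singleton, not_or] at hx
      rw [h3 x hx.1 hx.2, smul_zero]
  rw [minor_snoc_right h2 hw hw' hs, sum_mul_eq_of_row ho' hio _ _ hN hW i, h1]
  · intro c hc hc'
    rw [sum_eq_zero fun p _ => if_neg ?_, preMinor_eq_zero σ s w, smul_zero, add_zero]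
    · intro p
      refine lastCases ?_ (fun p => ?_) p
      · simpa using hc.symm
      · rw [snoc_castSucc]
        exact hc' p
    · refine lastCases ?_ (fun p => ?_) p
      · rw [snoc_last, σ.ν_inj]
        exact hc.symm
      · rw [snoc_castSucc]
        exact hν' c (fun q => by simpa using hc' q.castSucc) p
  · intro q
    rw [← minor_snoc_right h2 hw hw' hs]
    refine minor_eq_zero_right h2 hw hw' hs (p := q.castSucc) (q := Fin.last (n + 1))
      (castSucc_ne_last _) ?_
    simp

end Minor

section Equivariance

variable {K B : Type*} [CommRing K] [Ring B] [Algebra K B]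
variable {ε : ℤ} {ι : Type*} [Fintype ι] [DecidableEq ι] {σ : SignedIndex ε ι} {n : ℕ}

/-- The operator by which an element `x` with the matrix `ρ` acts on tensors. -/
def totalOp (n : ℕ) (x : B) (ρ : Matrix ι ι B) : Matrix (Fin n → ι) (Fin n → ι) B :=
  diagonal (fun _ => x) + ∑ p, opAt ρ p

variable {x : B} {ρ : Matrix ι ι B} (hρ : ∀ i j b, ρ i j * b = b * ρ i j)

include hρ in
lemma commute_totalOp_opAt {S : Matrix ι ι B}
    (h : ∀ i j, x * S i j + ∑ c, ρ i c * S c j = S i j * x + ∑ c, S i c * ρ c j) (p : Fin n) :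
    Commute (totalOp n x ρ) (opAt S p) := by
  have h1 : Commute (diagonal (fun _ => x) + opAt ρ p) (opAt S p) := by
    have e1 : ∀ M N : Matrix ι ι B, opAt M p * opAt N p = opAt (M * N) p := by
      intro M N
      ext a b
      rw [mul_opAt_apply]
      simp only [opAt, of_apply, update_self, mul_apply]
      split_ifs with h
      · refine sum_congr rfl fun c _ => ?_
        rw [if_pos]
        intro q hq
        rw [update_of_ne hq, h q hq]
      · refine sum_eq_zero fun c _ => ?_
        rw [if_neg, zero_mul]
        intro h'
        exact h fun q hq => by rw [h' q hq, update_of_ne hq]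
    rw [commute_iff_eq, add_mul, mul_add, e1, e1]
    ext a b
    rw [Matrix.add_apply, Matrix.add_apply, diagonal_mul, mul_diagonal]
    simp only [opAt, of_apply, mul_apply]
    split_ifs
    · exact h _ _
    · simp
  rw [totalOp, ← Finset.add_sum_erase _ _ (mem_univ p), ← add_assoc]
  refine h1.add_left (Commute.sum_left _ _ _ fun q hq => ?_)
  refine LocalOn.commute (s := {q}) (s' := {p}) ?_ (localOn_opAt _ _) (localOn_opAt _ _) ?_
  · simpa using Finset.ne_of_mem_erase hq
  · intro a b c d
    rw [opAt, of_apply]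
    split_ifs
    · exact hρ _ _ _
    · simp

lemma commute_totalOp_permOp (τ : Equiv.Perm (Fin n)) :
    Commute (totalOp n x ρ) (permOp ι B τ) := by
  refine Commute.add_left ?_ ?_
  · rw [commute_iff_eq]
    ext a b
    rw [diagonal_mul, mul_diagonal, permOp, of_apply]
    split_ifs <;> simp
  · rw [commute_iff_eq, sum_mul, mul_sum]
    simp only [permOp_mul_opAt]
    exact (Equiv.sum_comp τ fun p => opAt ρ p * permOp ι B τ).symm

lemma commute_totalOp_antisym : Commute (totalOp n x ρ) (antisym ι B n) :=
  Commute.sum_right _ _ _ fun τ _ => (commute_totalOp_permOp τ).smul_right _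

include hρ in
lemma commute_totalOp_siteQ (hQ : ∀ i j, (σ.e i * σ.e j) • ρ (σ.ν j) (σ.ν i) = -ρ i j)
    {p q : Fin n} (hpq : p ≠ q) : Commute (totalOp n x ρ) (siteQ σ B p q) := by
  have hQ1 : ∀ i j, ρ i (σ.ν j) = -((ε * σ.e i * σ.e j) • ρ j (σ.ν i)) := by
    intro i j
    rw [← neg_eq_iff_eq_neg, ← hQ, σ.ν_ν, σ.e_ν_eq]
    congr 1
    ring
  have hQ2 : ∀ i j, ρ (σ.ν i) j = -((ε * σ.e i * σ.e j) • ρ (σ.ν j) i) := by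
    intro i j
    rw [← neg_eq_iff_eq_neg, ← hQ, σ.ν_ν, σ.e_ν_eq]
  have e0 : opAt ρ p = embedTwo p q (onFirst ρ) := (embedTwo_onFirst hpq ρ).symm
  have e0' : opAt ρ q = embedTwo p q (onSecond ρ) := (embedTwo_onSecond hpq ρ).symm
  have h1 : Commute (opAt ρ p + opAt ρ q) (siteQ σ B p q) := by
    have h3 : (onFirst ρ + onSecond ρ) * transQ σ B = 0 := by
      ext ⟨i, k⟩ ⟨j, l⟩
      rw [add_mul, Matrix.add_apply, onFirst_mul_apply, onSecond_mul_apply,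
        sum_eq_single (σ.ν k), sum_eq_single (σ.ν i), hQ1 i k]
      · simp only [transQ, of_apply, σ.ν_ν, true_and, Matrix.zero_apply, σ.e_ν_eq]
        split_ifs
        · rw [← (Int.cast_commute _ (ρ k (σ.ν i))).eq, zsmul_eq_mul, ← neg_mul, mul_assoc,
            ← (Int.cast_commute _ (ρ k (σ.ν i))).eq, ← mul_assoc, ← Int.cast_neg, ← Int.cast_mul,
            ← add_mul, ← Int.cast_add]
          refine mul_eq_zero_of_left ?_ _
          rw [← Int.cast_zero]
          congr 1
          linear_combination (-ε * σ.e i * σ.e l) * σ.e_mul k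
        · simp
      · intro y _ hy
        rw [transQ, of_apply, if_neg, mul_zero]
        rintro ⟨h, -⟩
        exact hy (σ.eq_ν_iff.1 h)
      · simp
      · intro y _ hy
        rw [transQ, of_apply, if_neg, mul_zero]
        rintro ⟨h, -⟩
        exact hy h
      · simp
    have h4 : transQ σ B * (onFirst ρ + onSecond ρ) = 0 := by
      ext ⟨i, k⟩ ⟨j, l⟩
      rw [mul_add, Matrix.add_apply, mul_onFirst_apply, mul_onSecond_apply,
        sum_eq_single (σ.ν l), sum_eq_single (σ.ν j), hQ2 l j]
      · simp only [transQ, of_apply, σ.ν_ν, and_true, Matrix.zero_apply, σ.e_ν_eq]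
        split_ifs
        · rw [zsmul_eq_mul, mul_neg, ← mul_assoc, ← Int.cast_mul, ← neg_mul, ← Int.cast_neg,
            ← add_mul, ← Int.cast_add]
          refine mul_eq_zero_of_left ?_ _
          rw [← Int.cast_zero]
          congr 1
          linear_combination (-ε * σ.e k * σ.e j) * σ.e_mul l
        · simp
      · intro y _ hy
        rw [transQ, of_apply, if_neg, zero_mul]
        rintro ⟨-, h⟩
        exact hy (σ.eq_ν_iff.1 h)
      · simp
      · intro y _ hy
        rw [transQ, of_apply, if_neg, zero_mul]
        rintro ⟨-, h⟩
        exact hy h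
      · simp
    rw [commute_iff_eq, e0, e0', siteQ, ← embedTwo_add, ← embedTwo_mul hpq, ← embedTwo_mul hpq, h3,
      h4]
  have h2 : Commute (diagonal fun _ => x) (siteQ σ B p q) := by
    rw [commute_iff_eq]
    ext a b
    rw [diagonal_mul, mul_diagonal, siteQ_commute]
  rw [totalOp, ← Finset.add_sum_erase _ _ (mem_univ p), ← Finset.add_sum_erase _ _
    (Finset.mem_erase.2 ⟨hpq.symm, mem_univ q⟩), ← add_assoc (opAt ρ p)]
  refine h2.add_left (h1.add_left (Commute.sum_left _ _ _ fun r hr => ?_))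
  simp only [Finset.mem_erase, mem_univ, and_true] at hr
  refine LocalOn.commute (s := {r}) (s' := {p, q}) ?_ (localOn_opAt _ _) (localOn_embedTwo _ _ _)
    fun a b c d => ?_
  · simpa using ⟨hr.2, hr.1⟩
  · exact (siteQ_commute σ p q c d _).symm

variable {s : ℕ → Matrix ι ι B} {w : ℕ → ℕ → K}
  (hQ : ∀ i j, (σ.e i * σ.e j) • ρ (σ.ν j) (σ.ν i) = -ρ i j)
  (hs : ∀ p i j, x * s p i j + ∑ c, ρ i c * s p c j = s p i j * x + ∑ c, s p i c * ρ c j)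

include hρ hQ hs in
lemma commute_totalOp_bracket {m : ℕ} : Commute (totalOp n x ρ) (bracket σ s w n m) := by
  induction m with
  | zero => exact Commute.one_right _
  | succ m ih =>
    refine (ih.mul_right (commute_columnR σ fun p hp => ?_)).mul_right ?_
    · unfold factorR
      split_ifs with h
      · refine (Commute.one_right _).add_right (Commute.smul_right ?_ _)
        exact commute_totalOp_siteQ hρ hQ (by simp [Fin.ext_iff]; omega)
      · exact Commute.one_right _
    · unfold factorS
      split_ifs with h
      · exact commute_totalOp_opAt hρ (hs m) _
      · exact Commute.one_right _

lemma opAt_mul_apply (M : Matrix ι ι B) (p : Fin n) (X : Matrix (Fin n → ι) (Fin n → ι) B)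
    (a b : Fin n → ι) :
    (opAt M p * X) a b = ∑ c, M (a p) c * X (update a p c) b := by
  rw [mul_apply]
  symm
  refine Finset.sum_of_injOn (fun c => update a p c) ?_ (by simp) ?_ ?_
  · exact (Function.update_injective a p).injOn
  · intro c _ hc
    rw [opAt, of_apply, if_neg, zero_mul]
    intro h
    refine hc ⟨c p, by simp, ?_⟩
    funext q
    by_cases hq : q = p
    · subst hq
      simp
    · simp [hq, h q hq]
  · intro c _
    rw [opAt, of_apply, if_pos]
    · simp
    · intro q hq
      simp [hq]

variable [IsDomain K] [Module.IsTorsionFree K B] (h2 : (2 : K) ≠ 0)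
  (hw : ∀ p r, w p r - w p (r + 1) + w p r * w p (r + 1) = 0)
  (hw' : ∀ r m, w r m - w (r + 1) m + w r m * w (r + 1) m = 0)
  (hq : ∀ r, QuadRel σ 1 1 1 (w r (r + 1)) (s r) (s (r + 1)))

include hρ hQ hs h2 hw hw' hq in
/-- Minors commute with the elements which permute their rows and columns. -/
lemma commute_minor {a b : Fin n → ι}
    (ha : ∀ p c, c ≠ a p → ρ (a p) c = 0 ∨ ∃ q, q ≠ p ∧ a q = c)
    (hb : ∀ p c, c ≠ b p → ρ c (b p) = 0 ∨ ∃ q, q ≠ p ∧ b q = c)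
    (hab : ∑ p, ρ (a p) (a p) = ∑ p, ρ (b p) (b p)) : Commute x (minor σ s w a b) := by
  have h := ((commute_totalOp_antisym (n := n) (x := x) (ρ := ρ)).mul_right
    (commute_totalOp_bracket (w := w) (m := n) hρ hQ hs)).eq
  have h' := congrFun (congrFun h a) b
  rw [totalOp, add_mul, mul_add, Matrix.add_apply, Matrix.add_apply, diagonal_mul,
    mul_diagonal, sum_mul, mul_sum, Matrix.sum_apply, Matrix.sum_apply] at h'
  have h3 : ∀ p, (opAt ρ p * (antisym ι B n * bracket σ s w n n)) a b =
      ρ (a p) (a p) * minor σ s w a b := by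
    intro p
    rw [opAt_mul_apply, sum_eq_single (a p)]
    · rw [Function.update_eq_self]
      rfl
    · intro c _ hc
      rcases ha p c hc with h0 | ⟨q, hqp, rfl⟩
      · rw [h0, zero_mul]
      · refine mul_eq_zero_of_right _ ?_
        exact minor_eq_zero_left (σ := σ) (s := s) (w := w) h2 hqp (by simp [hqp])
    · simp
  have h4 : ∀ p, ((antisym ι B n * bracket σ s w n n) * opAt ρ p) a b =
      ρ (b p) (b p) * minor σ s w a b := by
    intro p
    rw [mul_opAt_apply, sum_eq_single (b p)]
    · rw [Function.update_eq_self, hρ]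
      rfl
    · intro c _ hc
      rcases hb p c hc with h0 | ⟨q, hqp, rfl⟩
      · rw [h0, mul_zero]
      · refine mul_eq_zero_of_left ?_ _
        exact minor_eq_zero_right (σ := σ) (s := s) (w := w) h2 hw hw' hq hqp (by simp [hqp])
    · simp
  rw [sum_congr rfl fun p _ => h3 p, sum_congr rfl fun p _ => h4 p, ← sum_mul,
    ← sum_mul, hab] at h'
  exact add_right_cancel h'

end Equivariance

section SeriesMinor

open PowerSeries

attribute [local instance 50] seriesAlgebra

variable {A : Type*} [Ring A] [Algebra ℂ A]

lemma ev_smul {τ : ℂ⟦X⟧} (hτ : X ∣ τ) (f : ℂ⟦X⟧⟦X⟧) (a : A⟦X⟧⟦X⟧) :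
    ev τ hτ (f • a) = ev τ hτ f • ev τ hτ a := by
  rw [series_smul_def, map_mul, ← toSeries_mul]
  congr 1
  have : (ev τ hτ).comp (PowerSeries.map (algebraMap ℂ⟦X⟧ A⟦X⟧)) =
      (toSeries A).comp (ev τ hτ) := by
    refine series_ringHom_ext (fun b => ?_) ?_ ?_
    · rw [RingHom.comp_apply, RingHom.comp_apply, map_C, ev_C, ev_C]
      rfl
    · rw [RingHom.comp_apply, RingHom.comp_apply, map_X, ev_X, ev_X]
      rfl
    · rw [RingHom.comp_apply, map_X, ev_X]
      obtain ⟨g, hg⟩ := hτ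
      exact ⟨toSeries A g, by rw [hg, map_mul, toSeries_X]⟩
  exact congrFun (congrArg DFunLike.coe this) f

/-- The series `(2u - p - q)⁻¹`. -/
noncomputable def weight (p q : ℕ) : ℂ⟦X⟧ :=
  C (1 / 2) * invShift (-(((p : ℂ) + (q : ℂ)) / 2))

lemma weight_eq (p q : ℕ) : (2 - C ((p : ℂ) + q) * X) * weight p q = X := by
  have h := one_add_mul_invShift (-(((p : ℂ) + (q : ℂ)) / 2))
  have h1 : (2 - C ((p : ℂ) + q) * X : ℂ⟦X⟧) = C 2 * (1 + C (-(((p : ℂ) + (q : ℂ)) / 2)) * X) := by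
    rw [mul_add, mul_one, ← mul_assoc, ← map_mul, map_ofNat, sub_eq_add_neg, ← neg_mul, ← map_neg]
    congr 3
    ring
  rw [h1, weight, mul_mul_mul_comm, h, ← map_mul, mul_one_div_cancel two_ne_zero, map_one, one_mul]

lemma two_sub_ne_zero (c : ℂ) : (2 - C c * X : ℂ⟦X⟧) ≠ 0 := by
  have := two_add_ne_zero (-c)
  rwa [map_neg, neg_mul, ← sub_eq_add_neg] at this

lemma weight_comm (p q : ℕ) : weight p q = weight q p := by
  rw [weight, weight, add_comm (p : ℂ)]

lemma weight_succ_right (p r : ℕ) :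
    weight p r - weight p (r + 1) + weight p r * weight p (r + 1) = 0 := by
  have h1 := weight_eq p r
  have h2 := weight_eq p (r + 1)
  have h3 : (C ((p : ℂ) + (r + 1 : ℕ)) : ℂ⟦X⟧) = C ((p : ℂ) + r) + 1 := by
    rw [← map_one (C (R := ℂ)), ← map_add]
    push_cast
    rw [add_assoc]
  rw [h3] at h2
  refine (mul_eq_zero.1 ?_).resolve_left (two_sub_ne_zero ((p : ℂ) + r))
  refine (mul_eq_zero.1 ?_).resolve_left (two_sub_ne_zero ((p : ℂ) + (r + 1 : ℕ)))
  rw [h3]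
  linear_combination (2 - (C ((p : ℂ) + r) + 1) * X + (2 - (C ((p : ℂ) + r) + 1) * X) * weight p (r + 1)) * h1
    + (X - (2 - C ((p : ℂ) + r) * X)) * h2

lemma weight_succ_left (r m : ℕ) :
    weight r m - weight (r + 1) m + weight r m * weight (r + 1) m = 0 := by
  rw [weight_comm r, weight_comm (r + 1)]
  exact weight_succ_right m r

lemma shiftHom_weight (c p q : ℕ) :
    shiftHom ℂ (-(c : ℂ)) (weight p q) = weight (p + c) (q + c) := by
  rw [weight, weight, map_mul, shiftHom_C, ← shiftHom_complex_X, shiftHom_shiftHom,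
    ← shiftHom_complex_X]
  congr 3
  push_cast
  ring

variable {ε : ℤ} {ι : Type*} [Fintype ι] [DecidableEq ι] {σ : SignedIndex ε ι}
  {S : Matrix ι ι A⟦X⟧}

lemma IsTwisted.quad_succ (hS : IsTwisted σ S) (r : ℕ) :
    QuadRel σ 1 1 1 (weight r (r + 1)) (S.map (shiftHom A (-(r : ℂ))))
      (S.map (shiftHom A (-((r + 1 : ℕ) : ℂ)))) := by
  have h1 := hS.quad.map (ev (invShift (-1)) (X_dvd_invShift (-1)))
    (ev (invShift (-1)) (X_dvd_invShift (-1))) (ev_smul _) (map_mul _)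
  have e3 : (S.map inU).map (ev (invShift (-1)) (X_dvd_invShift (-1))) = S :=
    Matrix.ext fun i j => ev_C (invShift (-1)) (X_dvd_invShift (-1)) _
  have e4 : (S.map inV).map (ev (invShift (-1)) (X_dvd_invShift (-1))) = S.map (shiftHom A (-1)) :=
    Matrix.ext fun i j => rfl
  have eU : ev (invShift (-1)) (X_dvd_invShift (-1)) (inU (X : ℂ⟦X⟧)) = X :=
    ev_C _ _ _
  have eV : ev (invShift (-1)) (X_dvd_invShift (-1)) (inV (X : ℂ⟦X⟧)) = shiftHom ℂ (-1) X := rfl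
  rw [e3, e4] at h1
  simp only [map_sub, map_add, map_mul, eU, eV] at h1
  have hX := one_sub_mul_shiftHom_X
  have hw := weight_eq 0 1
  rw [Nat.cast_zero, zero_add, Nat.cast_one, map_one, one_mul] at hw
  have h2 : QuadRel σ 1 1 1 (weight 0 1) S (S.map (shiftHom A (-1))) := by
    refine h1.rescale (1 - X) (1 - X) (X ^ 2) (X * (2 - X)) (pow_ne_zero _ X_ne_zero)
      (mul_ne_zero X_ne_zero ?_) ?_ ?_ ?_ ?_
    · simpa using two_sub_ne_zero 1
    · linear_combination hX
    · linear_combination X * hX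
    · linear_combination hX
    · linear_combination X * hX - X * hw
  have h3 := h2.map (shiftHom A (-(r : ℂ))) (shiftHom ℂ (-(r : ℂ))) (shiftHom_smul _) (map_mul _)
  rw [map_one, shiftHom_weight, zero_add, add_comm 1 r] at h3
  convert h3 using 1
  ext i j : 2
  rw [map_apply, map_apply, map_apply, shiftHom_shiftHom]
  congr 2
  push_cast
  ring_nf

/-- The Sklyanin minors of a matrix of series. -/
noncomputable def seriesMinor (σ : SignedIndex ε ι) (S : Matrix ι ι A⟦X⟧) {n : ℕ}
    (a b : Fin n → ι) : A⟦X⟧ :=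
  minor σ (fun p => S.map (shiftHom A (-(p : ℂ)))) weight a b

/-- The double sign `±` as an integer. -/
def Kind.sgn : Kind → ℤ
  | .orthogonal => 1
  | .symplectic => -1

/-- The signed index set of the matrices from `𝔤_N`. -/
def idxSigned (t : Kind) (N : ℕ) (h : t = Kind.symplectic → Even N) :
    SignedIndex t.sgn (Idx N) where
  ν := Idx.neg
  e i := match t with
    | .orthogonal => 1
    | .symplectic => Int.sign (i : ℤ)
  ν_ν i := Subtype.ext (neg_neg (i : ℤ))
  e_mul i := by
    cases t
    · rfl
    · have h0 : (i : ℤ) ≠ 0 := fun h0 => by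
        have := (mem_idx.1 i.2).2 h0
        have := Nat.even_iff.1 (h rfl)
        omega
      rcases lt_or_gt_of_ne h0 with h1 | h1
      · simp [Int.sign_eq_neg_one_of_neg h1]
      · simp [Int.sign_eq_one_of_pos h1]
  e_ν i := by
    cases t
    · rfl
    · have h0 : (i : ℤ) ≠ 0 := fun h0 => by
        have := (mem_idx.1 i.2).2 h0
        have := Nat.even_iff.1 (h rfl)
        omega
      change Int.sign (i : ℤ) * Int.sign (-(i : ℤ)) = -1
      rw [Int.sign_neg]
      rcases lt_or_gt_of_ne h0 with h1 | h1
      · simp [Int.sign_eq_neg_one_of_neg h1]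
      · simp [Int.sign_eq_one_of_pos h1]

lemma theta_eq (t : Kind) {N : ℕ} (h : t = Kind.symplectic → Even N) (i j : Idx N) :
    theta t i j = (idxSigned t N h).e i * (idxSigned t N h).e j := by
  cases t <;> rfl

variable {t : Kind} {N k : ℕ} (h : t = Kind.symplectic → Even N) (F : Matrix (Idx N) (Idx N) A⟦X⟧)

lemma antiSymmetrizer_eq : antiSymmetrizer A N k = antisym (Idx N) A⟦X⟧ k := by
  ext a b : 1
  rw [antiSymmetrizer, antisym, Matrix.sum_apply, Matrix.sum_apply]
  refine sum_congr rfl fun τ _ => ?_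
  rw [Matrix.smul_apply, permOp, of_apply, of_apply]
  split_ifs <;> simp

lemma tensorS_eq (p : Fin k) :
    tensorS F p = factorS (fun p => F.map (shiftHom A (-(p : ℂ)))) k p := by
  rw [factorS, dif_pos p.2]
  ext a b
  simp only [tensorS, opAt, of_apply, map_apply, shiftHom_apply]

lemma tensorR_eq (p q : Fin k) : tensorR A t p q = factorR (idxSigned t N h) weight k p q := by
  have h1 : tensorQ A t p q = siteQ (idxSigned t N h) A⟦X⟧ p q := by
    ext a b
    rw [siteQ_apply, tensorQ, of_apply, theta_eq t h, mul_comm]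
    rfl
  rw [factorR, dif_pos ⟨p.2, q.2⟩, siteR, tensorR, h1]
  rfl

lemma prod_mul_prod_eq {R : Type*} [Monoid R] (f r : ℕ → R) (m : ℕ)
    (hfr : ∀ p q, p < q → q < m → Commute (r p) (f q)) :
    ((List.range m).map fun p => f p * r p).prod =
      ((List.range m).map f).prod * ((List.range m).map r).prod := by
  induction m with
  | zero => simp
  | succ m ih =>
    rw [List.range_succ, List.map_append, List.map_append, List.map_append, List.prod_append,
      List.prod_append, List.prod_append, ih fun p q h1 h2 => hfr p q h1 (by omega)]
    have h1 : Commute ((List.range m).map r).prod (f m) := by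
      refine (Commute.list_prod_right _ _ fun x hx => ?_).symm
      obtain ⟨p, hp, rfl⟩ := List.mem_map.1 hx
      exact (hfr p m (List.mem_range.1 hp) (by omega)).symm
    simp only [List.map_cons, List.map_nil, List.prod_singleton]
    rw [mul_assoc, ← mul_assoc (List.prod _) (f m), h1.eq]
    simp only [mul_assoc]

/-- The product `S_p R_{p,p+1} ⋯ R_{p,m-1}`. -/
def rowFactor {K B : Type*} [CommRing K] [Ring B] [Algebra K B] (σ : SignedIndex ε ι)
    (s : ℕ → Matrix ι ι B) (w : ℕ → ℕ → K) (n m p : ℕ) : Matrix (Fin n → ι) (Fin n → ι) B :=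
  factorS s n p * (((List.range m).filter fun q => p < q).map fun q => factorR σ w n p q).prod

lemma prod_rowFactor {K B : Type*} [CommRing K] [Ring B] [Algebra K B] (σ : SignedIndex ε ι)
    (s : ℕ → Matrix ι ι B) (w : ℕ → ℕ → K) (n m : ℕ) :
    ((List.range m).map (rowFactor σ s w n m)).prod = bracket σ s w n m := by
  induction m with
  | zero => rfl
  | succ m ih =>
    have h1 : ∀ p ∈ List.range m, rowFactor σ s w n (m + 1) p =
        rowFactor σ s w n m p * factorR σ w n p m := by
      intro p hp
      rw [rowFactor, rowFactor, List.range_succ, List.filter_append, List.map_append,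
        List.prod_append, mul_assoc]
      simp [List.mem_range.1 hp]
    have h2 : rowFactor σ s w n (m + 1) m = factorS s n m := by
      rw [rowFactor, List.filter_eq_nil_iff.2, List.map_nil, List.prod_nil, mul_one]
      intro q hq
      rw [List.mem_range] at hq
      simp
      omega
    have h3 : ∀ q, columnR (B := B) σ w n m q =
        ((List.range q).map fun p => factorR σ w n p m).prod := by
      intro q
      induction q with
      | zero => rfl
      | succ q ih => rw [columnR, ih, List.range_succ, List.map_append, List.prod_append]; simp
    rw [List.range_succ, List.map_append, List.prod_append, List.map_congr_left h1,
      prod_mul_prod_eq, ih, bracket, h3]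
    · simp [h2]
    · intro p q hpq hqm
      refine ((commute_factorS_factorR σ (by omega) (by omega)).mul_left ?_).symm
      refine Commute.list_prod_left _ _ fun x hx => ?_
      obtain ⟨q', hq', rfl⟩ := List.mem_map.1 hx
      have hq'' := List.mem_range.1 (List.mem_of_mem_filter hq')
      have := List.of_mem_filter hq'
      simp only [decide_eq_true_eq] at this
      exact commute_factorR σ (by omega) (by omega) (by omega) (by omega)

lemma bracketS_eq : bracketS t F k =
    bracket (idxSigned t N h) (fun p => F.map (shiftHom A (-(p : ℂ)))) weight k k := by
  rw [← prod_rowFactor, bracketS, ← List.map_coe_finRange_eq_range, List.map_map]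
  congr 1
  refine List.map_congr_left fun p _ => ?_
  rw [Function.comp_apply, rowFactor, ← tensorS_eq, ← List.map_coe_finRange_eq_range,
    List.filter_map, List.map_map]
  congr 2
  exact List.map_congr_left fun q _ => tensorR_eq h p q

lemma sklyaninMinor_eq (a b : Fin k → Idx N) :
    sklyaninMinor t F a b = seriesMinor (idxSigned t N h) F a b := by
  rw [sklyaninMinor, antiSymmetrizer_eq, bracketS_eq h]
  rfl

end SeriesMinor

section Level

open PowerSeries

attribute [local instance 50] seriesAlgebra

variable {A : Type*} [Ring A] [Algebra ℂ A]

/-- The inverse of a matrix with coefficients in a subalgebra. -/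
lemma exists_inverse_mem {ι : Type*} [Fintype ι] [DecidableEq ι] {T : Subalgebra ℂ A}
    {S : Matrix ι ι A⟦X⟧} (hS : ∀ i j, constantCoeff (S i j) = if i = j then 1 else 0)
    (hT : ∀ i j, S i j ∈ seriesIn T) :
    ∃ G, S * G = 1 ∧ G * S = 1 ∧ (∀ i j, constantCoeff (G i j) = if i = j then 1 else 0) ∧
      ∀ i j, G i j ∈ seriesIn T := by
  let S' : Matrix ι ι T⟦X⟧ := Matrix.of fun i j => PowerSeries.mk fun n => ⟨coeff n (S i j), hT i j n⟩
  have hS' : S'.map (PowerSeries.map T.val.toRingHom) = S := by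
    ext i j n
    simp [S']
  obtain ⟨G, h1, h2, -⟩ := exists_inverse (S := S') fun i j => Subtype.ext (by
    have := hS i j
    rw [← coeff_zero_eq_constantCoeff_apply] at this
    rw [← coeff_zero_eq_constantCoeff_apply]
    simp only [S', of_apply, coeff_mk, this]
    split_ifs <;> rfl)
  have h3 := map_mul_eq_one (PowerSeries.map T.val.toRingHom) h1
  have h4 := map_mul_eq_one (PowerSeries.map T.val.toRingHom) h2
  rw [hS'] at h3 h4
  refine ⟨_, h3, h4, fun i j => ?_, fun i j n => ?_⟩
  · obtain ⟨G', h5, h6, h7⟩ := exists_inverse hS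
    rw [← left_inv_eq_right_inv h6 h3]
    exact h7 i j
  · rw [map_apply, coeff_map]
    exact (coeff n (G i j)).2

lemma exists_inverse_series {T : Subalgebra ℂ A} {a : A⟦X⟧} (ha : constantCoeff a = 1)
    (hT : a ∈ seriesIn T) :
    ∃ b, a * b = 1 ∧ b * a = 1 ∧ constantCoeff b = 1 ∧ b ∈ seriesIn T := by
  obtain ⟨G, h1, h2, h3, h4⟩ := exists_inverse_mem (ι := Unit) (S := Matrix.of fun _ _ => a)
    (T := T) (by simp [ha]) fun _ _ => hT
  refine ⟨G () (), ?_, ?_, by simpa using h3 () (), h4 () ()⟩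
  · simpa [mul_apply] using congrFun (congrFun h1 ()) ()
  · simpa [mul_apply] using congrFun (congrFun h2 ()) ()

lemma coeffCommute_of_mem {T : Subalgebra ℂ A} {a b : A⟦X⟧} (ha : a ∈ seriesIn T)
    (hb : b ∈ seriesIn (Subalgebra.centralizer ℂ (T : Set A))) : CoeffCommute a b := fun p q =>
  (Subalgebra.mem_centralizer_iff ℂ).1 (hb q) _ (ha p)

/-- Multiplication of `S(u)` by an even series commuting with it. -/
lemma IsTwisted.even_mul {ε : ℤ} {I : Type*} [Fintype I] [DecidableEq I] {τ : SignedIndex ε I}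
    {S : Matrix I I A⟦X⟧} (hS : IsTwisted τ S) {z : A⟦X⟧} (hz : reflectHom A z = z)
    (h1 : constantCoeff z = 1) (hzz : CoeffCommute z z) (hzS : ∀ i j, CoeffCommute z (S i j)) :
    IsTwisted τ (Matrix.of fun i j => z * S i j) where
  quad := by
    have h3 := hS.quad.central_mul (c := inU z) (c' := inV z)
      (fun i j => ((hzS i j).symm.inU_inV).symm) (fun i j => (hzS i j).inU_inV) hzz.inU_inV
    have e1 : (Matrix.of fun i j => z * S i j).map inU =
        Matrix.of fun i j => inU z * S.map inU i j :=
      Matrix.ext fun i j => map_mul (C (R := A⟦X⟧)) _ _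
    have e2 : (Matrix.of fun i j => z * S i j).map inV =
        Matrix.of fun i j => inV z * S.map inV i j :=
      Matrix.ext fun i j => map_mul (PowerSeries.map (C (R := A))) _ _
    rw [e1, e2]
    exact h3
  symm i j := by
    have h := congrArg (z * ·) (hS.symm i j)
    simp only [mul_smul_comm, mul_add, mul_sub] at h
    simp only [of_apply, map_mul, hz, smul_sub] at h ⊢
    exact h
  const i j := by
    rw [of_apply, map_mul, h1, hS.const, one_mul]

variable {ε : ℤ} {ι : Type*} [Fintype ι] [DecidableEq ι] {σ : SignedIndex ε ι}
  {S : Matrix ι ι A⟦X⟧} {n : ℕ}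

/-- The algebra generated by the coefficients of a block of `S(u)`. -/
def blockAlg (S : Matrix ι ι A⟦X⟧) (o : Fin n → ι) : Subalgebra ℂ A :=
  Algebra.adjoin ℂ {x | ∃ p q r, x = coeff r (S (o p) (o q))}

/-- The minors commute with the blocks of `S(u)`, as they do for the matrices `1 + F (u + c)⁻¹`. -/
structure IsEquivariant (σ : SignedIndex ε ι) (S : Matrix ι ι A⟦X⟧) : Prop where
  principal : ∀ {n : ℕ} {o : Fin n → ι}, Function.Injective o → (∀ p, ∃ q, o q = σ.ν (o p)) →
    seriesMinor σ S o o ∈ seriesIn (Subalgebra.centralizer ℂ (blockAlg S o : Set A))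
  bordered : ∀ {n : ℕ} {o : Fin n → ι}, Function.Injective o → (∀ p, ∃ q, o q = σ.ν (o p)) →
    ∀ i j, (∀ p, o p ≠ i) → (∀ p, o p ≠ j) →
    seriesMinor σ S (snoc o i : Fin (n + 1) → ι) (snoc o j : Fin (n + 1) → ι) ∈
      seriesIn (Subalgebra.centralizer ℂ (blockAlg S o : Set A))

variable {I : Type*} [Fintype I] [DecidableEq I]

/-- A stage in the elimination of the rows and columns of `S(u)` with the indices from `o`. The
remaining indices are numbered by `I`; the Schur complement of `S(u)` is `T(u)`. -/
structure IsLevel (σ : SignedIndex ε ι) (S : Matrix ι ι A⟦X⟧) (τ : SignedIndex ε I) (f : I → ι)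
    (o : Fin n → ι) (α : ℂ⟦X⟧) (W : I → Fin n → A⟦X⟧) (T : Matrix I I A⟦X⟧) (g : A⟦X⟧)
    (H : Matrix I I A⟦X⟧) : Prop where
  twisted : IsTwisted τ H
  map_ν : ∀ i, f (τ.ν i) = σ.ν (f i)
  f_injective : Function.Injective f
  o_injective : Function.Injective o
  o_ne : ∀ p i, o p ≠ f i
  o_ν : ∀ p, ∃ q, o q = σ.ν (o p)
  row : ∀ i q, S (f i) (o q) + ∑ p, W i p * S (o p) (o q) = 0
  T_eq : ∀ i j, T i j = S (f i) (f j) + ∑ p, W i p * S (o p) (f j)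
  H_eq : ∀ i j, H i j = g * shiftHom A (-((n : ℂ) / 2)) (T i j)
  g_eq : g = α • shiftHom A ((n : ℂ) / 2) (seriesMinor σ S o o)
  g_const : constantCoeff g = 1
  g_opposite : opposite A 1 g = g
  g_mem : g ∈ seriesIn (blockAlg S o)

namespace IsLevel

lemma minor_bordered (hS : IsTwisted σ S) {o : Fin n → ι} (ho : Function.Injective o)
    (hν : ∀ p, ∃ q, o q = σ.ν (o p)) {i : ι} (hi : ∀ p, o p ≠ i) {W : Fin n → A⟦X⟧}
    (hW : ∀ q, S i (o q) + ∑ p, W p * S (o p) (o q) = 0) (j : ι) :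
    seriesMinor σ S (snoc o i : Fin (n + 1) → ι) (snoc o j : Fin (n + 1) → ι) =
      seriesMinor σ S o o * shiftHom A (-(n : ℂ)) (S i j + ∑ p, W p * S (o p) j) := by
  obtain ⟨N, hN, -⟩ := exists_inverse (S := S.submatrix o o) fun i j => by
    rw [submatrix_apply, hS.const]
    simp only [ho.eq_iff]
  have h := minor_snoc_snoc (σ := σ) (s := fun p => S.map (shiftHom A (-(p : ℂ)))) (w := weight)
    two_ne_zero_series weight_succ_right weight_succ_left hS.quad_succ ho hν hi
    (map_mul_eq_one (shiftHom A (-(n : ℂ))) hN) (W := fun p => shiftHom A (-(n : ℂ)) (W p))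
    (fun q => by
      have := congrArg (shiftHom A (-(n : ℂ))) (hW q)
      simpa only [map_add, map_sum, map_mul, map_zero, map_apply] using this) j
  rw [seriesMinor, h]
  simp only [map_add, map_sum, map_mul, map_apply]
  rfl

variable {τ : SignedIndex ε I} {f : I → ι} {o : Fin n → ι} {α : ℂ⟦X⟧} {W : I → Fin n → A⟦X⟧}
  {T : Matrix I I A⟦X⟧} {g : A⟦X⟧} {H : Matrix I I A⟦X⟧}

section

variable (hL : IsLevel σ S τ f o α W T g H) (hS : IsTwisted σ S)

include hL hS in
lemma H_eq_minor (i j : I) : H i j = α • shiftHom A ((n : ℂ) / 2)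
    (seriesMinor σ S (snoc o (f i) : Fin (n + 1) → ι) (snoc o (f j) : Fin (n + 1) → ι)) := by
  rw [minor_bordered hS hL.o_injective hL.o_ν (fun p => hL.o_ne p i) (hL.row i), map_mul,
    shiftHom_shiftHom, ← smul_mul_assoc, ← hL.g_eq, ← hL.T_eq, hL.H_eq]
  congr 3
  ring

include hL hS in
lemma H_mem (hE : IsEquivariant σ S) (i j : I) :
    H i j ∈ seriesIn (Subalgebra.centralizer ℂ (blockAlg S o : Set A)) := by
  rw [hL.H_eq_minor hS]
  exact smul_mem_seriesIn (shiftHom_mem_seriesIn (hE.bordered hL.o_injective hL.o_ν _ _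
    (fun p => hL.o_ne p i) fun p => hL.o_ne p j) _) _

include hL in
lemma g_mem_centralizer (hE : IsEquivariant σ S) :
    g ∈ seriesIn (Subalgebra.centralizer ℂ (blockAlg S o : Set A)) := by
  rw [hL.g_eq]
  exact smul_mem_seriesIn (shiftHom_mem_seriesIn (hE.principal hL.o_injective hL.o_ν) _) _

include hL in
lemma T_const (i j : I) : constantCoeff (T i j) = if i = j then 1 else 0 := by
  have h := hL.twisted.const i j
  rwa [hL.H_eq, map_mul, hL.g_const, one_mul, constantCoeff_shiftHom] at h

end

end IsLevel

end Level

section Step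

open PowerSeries

attribute [local instance 50] seriesAlgebra

lemma scaled_eq {K B : Type*} [CommRing K] [IsDomain K] [Ring B] [Algebra K B]
    [Module.IsTorsionFree K B] {ε : ℤ} {h x x₁ w α α₁ : K} {m m' P : B} (hh : 2 * h = ε)
    (hx : (1 + x) * x₁ = x) (hw : (2 + x) * w = x) (hα : (2 + (2 - 2 * h) * x) * α = (2 + x) * α₁)
    (hP : (1 - h * x₁) • P = α₁ • m - (h * x₁) • α₁ • m') (h0 : 2 + (2 - 2 * h) * x ≠ 0) :
    α • (m + w • (m - ε • m')) = P := by
  refine smul_right_injective B h0 ?_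
  have e1 : (2 + (2 - 2 * h) * x) • P = (2 * (1 + x)) • (1 - h * x₁) • P := by
    rw [smul_smul]
    congr 1
    linear_combination 2 * h * hx
  simp only
  rw [e1, hP, smul_smul, hα, ← Int.cast_smul_eq_zsmul K, ← hh]
  simp only [smul_add, smul_sub, smul_smul]
  rw [show (2 + x) * α₁ * w = x * α₁ by linear_combination α₁ * hw,
    show (2 + x) * α₁ * (w * (2 * h)) = 2 * h * x * α₁ by linear_combination 2 * h * α₁ * hw,
    show 2 * (1 + x) * (h * x₁ * α₁) = 2 * h * x * α₁ by linear_combination 2 * h * α₁ * hx]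
  module

variable {A : Type*} [Ring A] [Algebra ℂ A]
variable {ε : ℤ} {ι : Type*} [Fintype ι] [DecidableEq ι] {σ : SignedIndex ε ι}
  {S : Matrix ι ι A⟦X⟧} {n : ℕ}

lemma blockAlg_mono {m : ℕ} {o : Fin n → ι} {o' : Fin m → ι} (h : ∀ p, ∃ q, o' q = o p) :
    blockAlg S o ≤ blockAlg S o' := by
  refine Algebra.adjoin_mono ?_
  rintro x ⟨p, q, r, rfl⟩
  obtain ⟨p', hp⟩ := h p
  obtain ⟨q', hq⟩ := h q
  exact ⟨p', q', r, by rw [hp, hq]⟩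

lemma mem_blockAlg {o : Fin n → ι} (p q : Fin n) : S (o p) (o q) ∈ seriesIn (blockAlg S o) :=
  fun r => Algebra.subset_adjoin ⟨p, q, r, rfl⟩

lemma seriesIn_mono {T T' : Subalgebra ℂ A} (h : T ≤ T') {a : A⟦X⟧} (ha : a ∈ seriesIn T) :
    a ∈ seriesIn T' := fun n => h (ha n)

lemma centralizer_anti {T T' : Subalgebra ℂ A} (h : T ≤ T') :
    Subalgebra.centralizer ℂ (T' : Set A) ≤ Subalgebra.centralizer ℂ (T : Set A) :=
  Subalgebra.centralizer_le ℂ _ _ h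

variable {J : Type*} [Fintype J] [DecidableEq J] {τ : SignedIndex ε J} {hε : ε * ε = 1}
  {f : J ⊕ Bool → ι} {o : Fin n → ι} {α : ℂ⟦X⟧} {W : J ⊕ Bool → Fin n → A⟦X⟧}
  {T : Matrix (J ⊕ Bool) (J ⊕ Bool) A⟦X⟧} {g : A⟦X⟧} {H : Matrix (J ⊕ Bool) (J ⊕ Bool) A⟦X⟧}

namespace IsLevel

variable (hL : IsLevel σ S (τ.sum (boolIndex ε hε)) f o α W T g H) (hS : IsTwisted σ S)

/-- The eliminated indices at the next stage. -/
def nextTuple (f : J ⊕ Bool → ι) (o : Fin n → ι) : Fin (n + 2) → ι :=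
  snoc (snoc o (f (.inr false)) : Fin (n + 1) → ι) (f (.inr true))

/-- The factor of the normalization at the next stage. -/
noncomputable def nextFactor (σ : SignedIndex ε ι) (S : Matrix ι ι A⟦X⟧) (f : J ⊕ Bool → ι)
    (o : Fin n → ι) (α : ℂ⟦X⟧) : A⟦X⟧ :=
  α • shiftHom A (((n + 2 : ℕ) : ℂ) / 2) (seriesMinor σ S (nextTuple f o) (nextTuple f o))

include hL in
lemma f_false : f (.inr false) = σ.ν (f (.inr true)) := hL.map_ν (.inr true)

lemma nextTuple_castSucc (p : Fin n) : nextTuple f o p.castSucc.castSucc = o p := by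
  simp [nextTuple]

lemma nextTuple_false : nextTuple f o (Fin.last n).castSucc = f (.inr false) := by
  simp [nextTuple]

lemma nextTuple_true : nextTuple f o (Fin.last (n + 1)) = f (.inr true) := by
  simp [nextTuple]

lemma exists_nextTuple (p : Fin n) : ∃ q, nextTuple f o q = o p :=
  ⟨p.castSucc.castSucc, by simp [nextTuple]⟩

lemma exists_nextTuple_bool (x : Bool) : ∃ q, nextTuple f o q = f (.inr x) := by
  rcases x with _ | _
  · exact ⟨(Fin.last n).castSucc, by simp [nextTuple]⟩
  · exact ⟨Fin.last (n + 1), by simp [nextTuple]⟩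

lemma forall_nextTuple {P : ι → Prop} (h : ∀ p, P (o p)) (h' : ∀ x, P (f (.inr x)))
    (q : Fin (n + 2)) : P (nextTuple f o q) := by
  refine lastCases ?_ (fun q => lastCases ?_ (fun q => ?_) q) q
  · rw [nextTuple_true]
    exact h' true
  · rw [nextTuple_false]
    exact h' false
  · rw [nextTuple_castSucc]
    exact h q

include hL in
lemma nextTuple_injective : Function.Injective (nextTuple f o) := by
  refine Fin.snoc_injective_iff.2 ⟨Fin.snoc_injective_iff.2 ⟨hL.o_injective, ?_⟩, ?_⟩
  · rintro ⟨p, hp⟩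
    exact hL.o_ne p _ hp
  · rintro ⟨p, hp⟩
    revert hp
    refine lastCases ?_ (fun p => ?_) p
    · rw [snoc_last, hL.f_injective.eq_iff]
      simp
    · rw [snoc_castSucc]
      exact hL.o_ne p _

include hL in
lemma nextTuple_ν (p : Fin (n + 2)) : ∃ q, nextTuple f o q = σ.ν (nextTuple f o p) := by
  refine forall_nextTuple (P := fun c => ∃ q, nextTuple f o q = σ.ν c) (fun p => ?_) (fun x => ?_) p
  · obtain ⟨q, hq⟩ := hL.o_ν p
    rw [← hq]
    exact exists_nextTuple q
  · rw [← hL.map_ν]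
    exact exists_nextTuple_bool _

include hL hS in
lemma nextFactor_eq {α' : ℂ⟦X⟧} (hα : (2 + C (2 - (ε : ℂ)) * X) * α' = (2 + X) * shiftHom ℂ 1 α)
    {b : A⟦X⟧} (hb' : b * T (.inr false) (.inr false) = 1) :
    nextFactor σ S f o α' = opposite A 1 (H (.inr true) (.inr true)) *
      shiftHom A (-((n : ℂ) / 2)) (T (.inr true) (.inr true) -
        T (.inr true) (.inr false) * b * T (.inr false) (.inr true)) := by
  obtain ⟨N, hN, -⟩ := exists_inverse (S := S.submatrix (snoc o (f (.inr false)) : Fin (n + 1) → ι)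
      (snoc o (f (.inr false)) : Fin (n + 1) → ι)) fun i j => by
    rw [submatrix_apply, hS.const]
    have : Function.Injective (snoc o (f (.inr false)) : Fin (n + 1) → ι) :=
      Fin.snoc_injective_iff.2 ⟨hL.o_injective, by rintro ⟨p, hp⟩; exact hL.o_ne p _ hp⟩
    simp only [this.eq_iff]
  set W₁ : Fin (n + 1) → A⟦X⟧ := snoc (fun p => W (.inr true) p -
    T (.inr true) (.inr false) * b * W (.inr false) p) (-(T (.inr true) (.inr false) * b)) with hW₁
  have hrow : ∀ c, S (f (.inr true)) c +
      ∑ p, W₁ p * S ((snoc o (f (.inr false)) : Fin (n + 1) → ι) p) c =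
      (S (f (.inr true)) c + ∑ p, W (.inr true) p * S (o p) c) - T (.inr true) (.inr false) * b *
        (S (f (.inr false)) c + ∑ p, W (.inr false) p * S (o p) c) := by
    intro c
    rw [sum_univ_castSucc, hW₁]
    simp only [snoc_castSucc, snoc_last, sub_mul, sum_sub_distrib, mul_add,
      mul_sum, neg_mul, mul_assoc]
    abel
  have hrow0 : ∀ q, S (f (.inr true)) ((snoc o (f (.inr false)) : Fin (n + 1) → ι) q) +
      ∑ p, W₁ p * S ((snoc o (f (.inr false)) : Fin (n + 1) → ι) p)
        ((snoc o (f (.inr false)) : Fin (n + 1) → ι) q) = 0 := by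
    intro q
    rw [hrow]
    refine lastCases ?_ (fun q => ?_) q
    · rw [snoc_last, ← hL.T_eq, ← hL.T_eq, mul_assoc, hb', mul_one, sub_self]
    · rw [snoc_castSucc, hL.row, hL.row, mul_zero, sub_zero]
  have hff := hL.f_false
  have key := minor_snoc_pair (σ := σ) (s := fun p => S.map (shiftHom A (-(p : ℂ)))) (w := weight)
    two_ne_zero_series weight_succ_right weight_succ_left hS.quad_succ hL.o_injective hL.o_ν
    (i := f (.inr true)) (fun p => hL.o_ne p _) (by rw [← hff, Ne, hL.f_injective.eq_iff]; simp)
    (by rw [← hff]; exact map_mul_eq_one (shiftHom A (-((n + 1 : ℕ) : ℂ))) hN)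
    (W := fun p => shiftHom A (-((n + 1 : ℕ) : ℂ)) (W₁ p))
    (fun q => by
      rw [← hff]
      have := congrArg (shiftHom A (-((n + 1 : ℕ) : ℂ))) (hrow0 q)
      simpa only [map_add, map_sum, map_mul, map_zero, map_apply] using this)
  rw [← hff] at key
  have key' : seriesMinor σ S (nextTuple f o) (nextTuple f o) =
      (seriesMinor σ S (snoc o (f (.inr false)) : Fin (n + 1) → ι)
          (snoc o (f (.inr false)) : Fin (n + 1) → ι) + weight 0 (n + 1) •
        (seriesMinor σ S (snoc o (f (.inr false)) : Fin (n + 1) → ι)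
          (snoc o (f (.inr false)) : Fin (n + 1) → ι) -
         ε • seriesMinor σ S (snoc o (f (.inr true)) : Fin (n + 1) → ι)
          (snoc o (f (.inr true)) : Fin (n + 1) → ι))) *
      shiftHom A (-((n + 1 : ℕ) : ℂ)) (T (.inr true) (.inr true) -
        T (.inr true) (.inr false) * b * T (.inr false) (.inr true)) := by
    rw [hL.T_eq (.inr true) (.inr true), hL.T_eq (.inr false) (.inr true), ← hrow]
    simp only [map_add, map_sum, map_mul]
    exact key
  rw [nextFactor, key', map_mul, shiftHom_shiftHom, ← smul_mul_assoc]
  congr 1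
  · have hX := one_add_mul_shiftHom_X 1
    rw [map_one, one_mul] at hX
    have hw : (2 + X) * shiftHom ℂ (((n + 2 : ℕ) : ℂ) / 2) (weight 0 (n + 1)) = X := by
      have h1 := one_add_mul_invShift (1 / 2)
      rw [weight, map_mul, shiftHom_C, ← shiftHom_complex_X, shiftHom_shiftHom, shiftHom_complex_X,
        show ((n + 2 : ℕ) : ℂ) / 2 + -((((0 : ℕ) : ℂ) + ((n + 1 : ℕ) : ℂ)) / 2) = 1 / 2 by
          push_cast; ring]
      have h2 : (2 : ℂ⟦X⟧) * C (1 / 2) = 1 := by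
        rw [← map_ofNat (C (R := ℂ)) 2, ← map_mul, mul_one_div_cancel two_ne_zero, map_one]
      linear_combination h1 + invShift (1 / 2) * h2
    have hC : (C (2 - (ε : ℂ)) : ℂ⟦X⟧) = 2 - 2 * C ((ε : ℂ) / 2) := by
      rw [← map_ofNat (C (R := ℂ)) 2, ← map_mul, ← map_sub]
      congr 1
      ring
    have hs := congrArg (shiftHom A 1) (hL.twisted.symm_solved (.inr false) (.inr false))
    have hn : (1 : ℂ) + n / 2 = ((n + 2 : ℕ) : ℂ) / 2 := by push_cast; ring
    have hm : ∀ x, shiftHom A 1 (H (.inr x) (.inr x)) = shiftHom ℂ 1 α •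
        shiftHom A (((n + 2 : ℕ) : ℂ) / 2) (seriesMinor σ S
          (snoc o (f (.inr x)) : Fin (n + 1) → ι) (snoc o (f (.inr x)) : Fin (n + 1) → ι)) :=
      fun x => by rw [hL.H_eq_minor hS, shiftHom_smul, shiftHom_shiftHom, hn]
    rw [(τ.sum (boolIndex ε hε)).e_mul, one_smul, one_smul, map_sub, shiftHom_smul, shiftHom_smul,
      show (τ.sum (boolIndex ε hε)).ν (.inr false) = .inr true from rfl, hm, hm, map_sub, map_one,
      map_mul, shiftHom_C] at hs
    rw [map_add, shiftHom_smul, map_sub, map_zsmul]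
    refine scaled_eq (h := C ((ε : ℂ) / 2)) (x := X) (x₁ := shiftHom ℂ 1 X) ?_ hX hw
      (by rw [← hC]; exact hα) hs ?_
    · rw [← map_ofNat (C (R := ℂ)) 2, ← map_mul, mul_div_cancel₀ _ two_ne_zero, map_intCast]
    · rw [← hC]
      exact two_add_ne_zero _
  · congr 2
    push_cast
    ring

end IsLevel

end Step

section Step

open PowerSeries

attribute [local instance 50] seriesAlgebra

variable {A : Type*} [Ring A] [Algebra ℂ A]
variable {ε : ℤ} {ι : Type*} [Fintype ι] [DecidableEq ι] {σ : SignedIndex ε ι}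
  {S : Matrix ι ι A⟦X⟧} {n : ℕ}

lemma schur_apply {I O B : Type*} [Fintype O] [Ring B] (S : Matrix (I ⊕ O) (I ⊕ O) B)
    (b : Matrix O O B) (i j : I) :
    schur S b i j = S (.inl i) (.inl j) - ∑ y, (S.toBlocks₁₂ * b) i y * S (.inr y) (.inl j) := by
  rw [schur, Matrix.sub_apply, mul_apply]
  rfl

variable {J : Type*} [Fintype J] [DecidableEq J] {τ : SignedIndex ε J} {hε : ε * ε = 1}
  {f : J ⊕ Bool → ι} {o : Fin n → ι} {α : ℂ⟦X⟧} {W : J ⊕ Bool → Fin n → A⟦X⟧}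
  {T : Matrix (J ⊕ Bool) (J ⊕ Bool) A⟦X⟧} {g : A⟦X⟧} {H : Matrix (J ⊕ Bool) (J ⊕ Bool) A⟦X⟧}

namespace IsLevel

/-- The rows of the elimination at the next stage. -/
noncomputable def nextRow (W : J ⊕ Bool → Fin n → A⟦X⟧) (T : Matrix (J ⊕ Bool) (J ⊕ Bool) A⟦X⟧)
    (β : Matrix Bool Bool A⟦X⟧) (i : J) : Fin (n + 2) → A⟦X⟧ :=
  snoc (snoc (fun p => W (.inl i) p - ∑ x, (T.toBlocks₁₂ * β) i x * W (.inr x) p)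
    (-(T.toBlocks₁₂ * β) i false) : Fin (n + 1) → A⟦X⟧) (-(T.toBlocks₁₂ * β) i true)

lemma nextRow_sum (β : Matrix Bool Bool A⟦X⟧) (i : J) (c : ι) :
    S (f (.inl i)) c + ∑ p, nextRow W T β i p * S (nextTuple f o p) c =
      (S (f (.inl i)) c + ∑ p, W (.inl i) p * S (o p) c) - ∑ x, (T.toBlocks₁₂ * β) i x *
        (S (f (.inr x)) c + ∑ p, W (.inr x) p * S (o p) c) := by
  rw [sum_univ_castSucc, sum_univ_castSucc]
  simp only [nextTuple_castSucc, nextTuple_false, nextTuple_true]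
  simp only [nextRow, snoc_castSucc, snoc_last, Fintype.sum_bool, sub_mul, add_mul,
    sum_sub_distrib, sum_add_distrib, mul_add, mul_sum, neg_mul, mul_assoc]
  abel

variable (hL : IsLevel σ S (τ.sum (boolIndex ε hε)) f o α W T g H) (hS : IsTwisted σ S)
  (hE : IsEquivariant σ S) {α' : ℂ⟦X⟧}
  (hα : (2 + C (2 - (ε : ℂ)) * X) * α' = (2 + X) * shiftHom ℂ 1 α)
  {β : Matrix Bool Bool A⟦X⟧} (hβ : T.toBlocks₂₂ * β = 1) (hβ' : β * T.toBlocks₂₂ = 1)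

include hL hE in
lemma exists_inverse_g : ∃ g', g * g' = 1 ∧ g' * g = 1 ∧ constantCoeff g' = 1 ∧
    g' ∈ seriesIn (blockAlg S o) ∧
    g' ∈ seriesIn (Subalgebra.centralizer ℂ (blockAlg S o : Set A)) := by
  obtain ⟨g', h1, h2, h3, h4⟩ := exists_inverse_series (a := g)
    (T := blockAlg S o ⊓ Subalgebra.centralizer ℂ (blockAlg S o : Set A)) hL.g_const
    fun r => ⟨hL.g_mem r, hL.g_mem_centralizer hE r⟩
  exact ⟨g', h1, h2, h3, fun r => (h4 r).1, fun r => (h4 r).2⟩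

include hL hS hE in
lemma T_mem (i j : J ⊕ Bool) :
    T i j ∈ seriesIn (Subalgebra.centralizer ℂ (blockAlg S o : Set A)) := by
  obtain ⟨g', -, h2, -, -, h5⟩ := hL.exists_inverse_g hE
  have h : T i j = shiftHom A ((n : ℂ) / 2) (g' * H i j) := by
    rw [hL.H_eq, ← mul_assoc, h2, one_mul, shiftHom_shiftHom, add_neg_cancel, shiftHom_zero]
  rw [h]
  exact shiftHom_mem_seriesIn (Subring.mul_mem _ h5 (hL.H_mem hS hE i j)) _

include hL in
lemma W_mem (hS : IsTwisted σ S) (x : Bool) (p : Fin n) :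
    W (.inr x) p ∈ seriesIn (blockAlg S (nextTuple f o)) := by
  have hle : blockAlg S o ≤ blockAlg S (nextTuple f o) := blockAlg_mono exists_nextTuple
  obtain ⟨N, hN, -, -, hN'⟩ := exists_inverse_mem (S := S.submatrix o o) (T := blockAlg S o)
    (fun i j => by rw [submatrix_apply, hS.const]; simp only [hL.o_injective.eq_iff])
    fun i j => mem_blockAlg i j
  have h1 : W (.inr x) = -Matrix.vecMul (fun q => S (f (.inr x)) (o q)) N := by
    have h2 : Matrix.vecMul (W (.inr x)) (S.submatrix o o) = -(fun q => S (f (.inr x)) (o q)) := by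
      funext q
      exact eq_neg_of_add_eq_zero_right (hL.row _ q)
    rw [← Matrix.neg_vecMul, ← h2, Matrix.vecMul_vecMul, hN, Matrix.vecMul_one]
  rw [h1, Pi.neg_apply, Matrix.vecMul, dotProduct]
  refine Subring.neg_mem _ (Subring.sum_mem _ fun q _ => Subring.mul_mem _ ?_
    (seriesIn_mono hle (hN' _ _)))
  obtain ⟨y, hy⟩ := exists_nextTuple_bool (f := f) (o := o) x
  obtain ⟨q', hq⟩ := exists_nextTuple (f := f) (o := o) q
  rw [← hy, ← hq]
  exact mem_blockAlg _ _

include hL in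
lemma T_mem_next (hS : IsTwisted σ S) (x y : Bool) :
    T (.inr x) (.inr y) ∈ seriesIn (blockAlg S (nextTuple f o)) := by
  rw [hL.T_eq]
  obtain ⟨x', hx⟩ := exists_nextTuple_bool (f := f) (o := o) x
  obtain ⟨y', hy⟩ := exists_nextTuple_bool (f := f) (o := o) y
  refine Subring.add_mem _ ?_ (Subring.sum_mem _ fun q _ => Subring.mul_mem _ (hL.W_mem hS x q) ?_)
  · rw [← hx, ← hy]
    exact mem_blockAlg _ _
  · obtain ⟨q', hq⟩ := exists_nextTuple (f := f) (o := o) q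
    rw [← hy, ← hq]
    exact mem_blockAlg _ _

include hL hS hα in
/-- The value of the new factor, with its membership. -/
lemma exists_nextFactor : ∃ b, T (.inr false) (.inr false) * b = 1 ∧
    b * T (.inr false) (.inr false) = 1 ∧ b ∈ seriesIn (blockAlg S (nextTuple f o)) ∧
    nextFactor σ S f o α' = opposite A 1 (H (.inr true) (.inr true)) *
      shiftHom A (-((n : ℂ) / 2)) (T (.inr true) (.inr true) -
        T (.inr true) (.inr false) * b * T (.inr false) (.inr true)) := by
  obtain ⟨b, h1, h2, -, h4⟩ := exists_inverse_series (a := T (.inr false) (.inr false))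
    (T := blockAlg S (nextTuple f o)) (by rw [hL.T_const, if_pos rfl]) (hL.T_mem_next hS _ _)
  exact ⟨b, h1, h2, h4, hL.nextFactor_eq hS hα h2⟩

include hL hS hα in
lemma nextFactor_mem : nextFactor σ S f o α' ∈ seriesIn (blockAlg S (nextTuple f o)) := by
  have hle : blockAlg S o ≤ blockAlg S (nextTuple f o) := blockAlg_mono exists_nextTuple
  obtain ⟨b, -, -, h4, h5⟩ := hL.exists_nextFactor hS hα
  rw [h5, hL.H_eq]
  have hT := hL.T_mem_next hS
  exact Subring.mul_mem _ (opposite_mem_seriesIn (Subring.mul_mem _ (seriesIn_mono hle hL.g_mem)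
    (shiftHom_mem_seriesIn (hT _ _) _)) _) (shiftHom_mem_seriesIn (Subring.sub_mem _ (hT _ _)
      (Subring.mul_mem _ (Subring.mul_mem _ (hT _ _) h4) (hT _ _))) _)

include hL hS hα in
lemma nextFactor_const : constantCoeff (nextFactor σ S f o α') = 1 := by
  obtain ⟨b, -, -, -, h5⟩ := hL.exists_nextFactor hS hα
  rw [h5, map_mul, constantCoeff_shiftHom, map_sub, map_mul, map_mul, hL.T_const, hL.T_const,
    opposite, RingHom.comp_apply, constantCoeff_shiftHom, constantCoeff_reflectHom,
    hL.twisted.const]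
  simp

include hL hE in
lemma nextFactor_mem_centralizer : nextFactor σ S f o α' ∈
    seriesIn (Subalgebra.centralizer ℂ (blockAlg S (nextTuple f o) : Set A)) :=
  smul_mem_seriesIn (shiftHom_mem_seriesIn (hE.principal hL.nextTuple_injective hL.nextTuple_ν) _) _

include hL hS hE hα in
/-- The product of two consecutive factors is a Sklyanin determinant. -/
lemma nextFactor_mul : nextFactor σ S f o α' * g = stepDet ε H := by
  obtain ⟨b, h1, h2, -, h5⟩ := hL.exists_nextFactor hS hα
  have hgT : ∀ i j, CoeffCommute g (T i j) := fun i j =>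
    coeffCommute_of_mem hL.g_mem (hL.T_mem hS hE i j)
  obtain ⟨b', h6, h7, -, h8⟩ := exists_inverse_series (a := T (.inr false) (.inr false))
    (T := Subalgebra.centralizer ℂ (blockAlg S o : Set A)) (by rw [hL.T_const, if_pos rfl])
    (hL.T_mem hS hE _ _)
  rw [left_inv_eq_right_inv h7 h1] at h8
  have hQ : CoeffCommute g (shiftHom A (-((n : ℂ) / 2)) (T (.inr true) (.inr true) -
        T (.inr true) (.inr false) * b * T (.inr false) (.inr true))) := by
    refine coeffCommute_of_mem hL.g_mem (shiftHom_mem_seriesIn (Subring.sub_mem _ (hL.T_mem hS hE _ _)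
      (Subring.mul_mem _ (Subring.mul_mem _ (hL.T_mem hS hE _ _) h8) (hL.T_mem hS hE _ _))) _)
  have h9 := congrFun (congrFun (signHat_mul hL.twisted.quad_opposite_one rfl
    (by simpa using two_add_ne_zero 1) two_ne_zero_series) true) false
  rw [Matrix.diagonal_apply_ne _ (by simp), mul_apply, Fintype.sum_bool] at h9
  simp only [signHat, of_apply, if_true, reduceCtorEq, if_false, map_apply, neg_smul,
    neg_mul, smul_mul_assoc] at h9
  rw [← sub_eq_add_neg, sub_eq_zero] at h9
  change opposite A 1 (H (.inr true) (.inr true)) * H (.inr true) (.inr false) =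
    ε • (opposite A 1 (H (.inr true) (.inr false)) * H (.inr false) (.inr false)) at h9
  have h10 := congrArg (shiftHom A (-((n : ℂ) / 2))) h1
  rw [map_mul, map_one] at h10
  rw [h5, mul_assoc, ← hQ.commute, map_sub, map_mul, map_mul, mul_sub, ← hL.H_eq]
  have h11 : g * (shiftHom A (-((n : ℂ) / 2)) (T (.inr true) (.inr false)) *
      shiftHom A (-((n : ℂ) / 2)) b * shiftHom A (-((n : ℂ) / 2)) (T (.inr false) (.inr true))) =
      H (.inr true) (.inr false) * (shiftHom A (-((n : ℂ) / 2)) b *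
        shiftHom A (-((n : ℂ) / 2)) (T (.inr false) (.inr true))) := by
    rw [hL.H_eq]
    simp only [mul_assoc]
  rw [h11, mul_sub, ← mul_assoc _ (H (.inr true) (.inr false)), h9, smul_mul_assoc, mul_assoc _
    (H (.inr false) (.inr false)), hL.H_eq (.inr false) (.inr false), mul_assoc g,
    ← mul_assoc _ (shiftHom A (-((n : ℂ) / 2)) b), h10, one_mul, ← hL.H_eq]
  rfl

include hL hS hE hα in
lemma nextFactor_commute : CoeffCommute (nextFactor σ S f o α') g ∧
    CoeffCommute (nextFactor σ S f o α') (nextFactor σ S f o α') ∧ CoeffCommute g g := by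
  have hle : blockAlg S o ≤ blockAlg S (nextTuple f o) := blockAlg_mono exists_nextTuple
  have h1 := hL.nextFactor_mem_centralizer (α' := α') hE
  exact ⟨(coeffCommute_of_mem (seriesIn_mono hle hL.g_mem) h1).symm,
    coeffCommute_of_mem (hL.nextFactor_mem hS hα) h1,
    coeffCommute_of_mem hL.g_mem (hL.g_mem_centralizer hE)⟩

include hL hS hE hα in
lemma nextFactor_opposite :
    opposite A 1 (nextFactor σ S f o α') = nextFactor σ S f o α' := by
  obtain ⟨g', h1, -⟩ := hL.exists_inverse_g hE
  have h := hL.twisted.opposite_stepDet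
  rw [← hL.nextFactor_mul hS hE hα, map_mul, hL.g_opposite] at h
  have h3 := congrArg (· * g') h
  simpa only [mul_assoc, h1, mul_one] using h3

include hL hS hE hα in
lemma stepDet_commute : CoeffCommute (stepDet ε H) (stepDet ε H) := by
  obtain ⟨h1, h2, h3⟩ := hL.nextFactor_commute hS hE hα
  rw [← hL.nextFactor_mul hS hE hα]
  exact ((h2.symm.mul_left h1.symm).symm.mul_left ((h1.mul_left h3).symm))

include hβ hβ' hL in
/-- The inverse of the last block of `H`, and the Schur complement of `H`. -/
lemma schur_eq {g' : A⟦X⟧} (h1 : g * g' = 1) (h2 : g' * g = 1) :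
    H.toBlocks₂₂ * (Matrix.of fun x y => shiftHom A (-((n : ℂ) / 2)) (β x y) * g') = 1 ∧
    (Matrix.of fun x y => shiftHom A (-((n : ℂ) / 2)) (β x y) * g') * H.toBlocks₂₂ = 1 ∧
    ∀ i j, schur H (Matrix.of fun x y => shiftHom A (-((n : ℂ) / 2)) (β x y) * g') i j =
      g * shiftHom A (-((n : ℂ) / 2)) (schur T β i j) := by
  have e1 := map_mul_eq_one (shiftHom A (-((n : ℂ) / 2))) hβ
  have e2 := map_mul_eq_one (shiftHom A (-((n : ℂ) / 2))) hβ'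
  refine ⟨?_, ?_, fun i j => ?_⟩
  · ext x y : 1
    have h3 := congrFun (congrFun e1 x) y
    simp only [mul_apply, map_apply, toBlocks₂₂, of_apply] at h3 ⊢
    simp only [hL.H_eq, mul_assoc]
    simp only [← mul_assoc _ _ g', ← mul_sum, ← sum_mul, h3, one_apply]
    split_ifs <;> simp [h1]
  · ext x y : 1
    have h3 := congrFun (congrFun e2 x) y
    simp only [mul_apply, map_apply, toBlocks₂₂, of_apply] at h3 ⊢
    simp only [hL.H_eq, mul_assoc]
    simp only [← mul_assoc g', h2, one_mul, h3]
  · rw [schur_apply, schur_apply]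
    simp only [mul_apply, toBlocks₁₂, of_apply, hL.H_eq, mul_assoc, map_sub,
      map_sum, map_mul, mul_sub, mul_sum, sum_mul]
    simp only [← mul_assoc g', h2, one_mul]

include hL hS hE hα hβ hβ' in
lemma next : IsLevel σ S τ (f ∘ Sum.inl) (nextTuple f o) α' (nextRow W T β) (schur T β)
    (nextFactor σ S f o α') (Matrix.of fun i j => nextFactor σ S f o α' *
      shiftHom A (-(((n + 2 : ℕ) : ℂ) / 2)) (schur T β i j)) where
  twisted := by
    obtain ⟨g', h1, h2, h3, h4, h5⟩ := hL.exists_inverse_g hE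
    obtain ⟨c1, c2, c3⟩ := hL.nextFactor_commute hS hE hα
    obtain ⟨e1, e2, e3⟩ := hL.schur_eq hβ hβ' h1 h2
    have hle : blockAlg S o ≤ blockAlg S (nextTuple f o) := blockAlg_mono exists_nextTuple
    have hst := hL.twisted.step e1 e2 (hL.stepDet_commute hS hE hα)
    have hr : reflectHom A g = shiftHom A (-1) g := by
      conv_lhs => rw [← hL.g_opposite]
      rw [opposite, RingHom.comp_apply, reflectHom_shiftHom, reflectHom_reflectHom]
    have hr' : reflectHom A g' = shiftHom A (-1) g' := by
      have h6 := congrArg (reflectHom A) h2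
      have h7 := congrArg (shiftHom A (-1)) h1
      rw [map_mul, map_one, hr] at h6
      rw [map_mul, map_one] at h7
      exact left_inv_eq_right_inv h6 h7
    have hgg : CoeffCommute g' g' := coeffCommute_of_mem h4 h5
    have hz : reflectHom A (g' * shiftHom A (-1) g') = g' * shiftHom A (-1) g' := by
      rw [map_mul, ← hr', reflectHom_reflectHom, hr']
      exact (hgg.shiftHom_left _).commute
    have hzm : g' * shiftHom A (-1) g' ∈ seriesIn (blockAlg S o) :=
      Subring.mul_mem _ h4 (shiftHom_mem_seriesIn h4 _)
    have hzc : g' * shiftHom A (-1) g' ∈ seriesIn (Subalgebra.centralizer ℂ (blockAlg S o : Set A)) :=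
      Subring.mul_mem _ h5 (shiftHom_mem_seriesIn h5 _)
    have hn := seriesIn_mono (centralizer_anti hle) (hL.nextFactor_mem_centralizer (α' := α') hE)
    have hsT : ∀ i j, schur T β i j ∈ seriesIn (Subalgebra.centralizer ℂ (blockAlg S o : Set A)) := by
      intro i j
      obtain ⟨β₁, -, h8, -, h9⟩ := exists_inverse_mem (S := T.toBlocks₂₂)
        (T := Subalgebra.centralizer ℂ (blockAlg S o : Set A))
        (fun x y => by
          have := hL.T_const (.inr x) (.inr y)
          simpa only [toBlocks₂₂, of_apply, Sum.inr.injEq] using this) fun x y => hL.T_mem hS hE _ _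
      rw [← left_inv_eq_right_inv h8 hβ, schur_apply]
      refine Subring.sub_mem _ (hL.T_mem hS hE _ _) (Subring.sum_mem _ fun y _ => Subring.mul_mem _
        (by
          rw [mul_apply]
          exact Subring.sum_mem _ fun x _ => Subring.mul_mem _ (hL.T_mem hS hE _ _) (h9 _ _))
        (hL.T_mem hS hE _ _))
    have hfin := hst.even_mul hz (by rw [map_mul, constantCoeff_shiftHom, h3, one_mul])
      (coeffCommute_of_mem hzm hzc) fun i j => coeffCommute_of_mem hzm (by
        rw [of_apply, ← hL.nextFactor_mul hS hE hα, e3]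
        exact Subring.mul_mem _ (Subring.mul_mem _ hn (hL.g_mem_centralizer hE))
          (shiftHom_mem_seriesIn (Subring.mul_mem _ (hL.g_mem_centralizer hE)
            (shiftHom_mem_seriesIn (hsT i j) _)) _))
    convert hfin using 1
    ext i j : 1
    have c4 : CoeffCommute (g' * shiftHom A (-1) g') (nextFactor σ S f o α') :=
      coeffCommute_of_mem hzm hn
    have h10 := congrArg (shiftHom A (-1)) h2
    rw [map_mul, map_one] at h10
    rw [of_apply, of_apply, of_apply, e3, ← hL.nextFactor_mul hS hE hα, map_mul,
      shiftHom_shiftHom]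
    have h11 : g' * shiftHom A (-1) g' * (nextFactor σ S f o α' * g * (shiftHom A (-1) g *
        shiftHom A (-1 + -((n : ℂ) / 2)) (schur T β i j))) =
        nextFactor σ S f o α' * shiftHom A (-1 + -((n : ℂ) / 2)) (schur T β i j) := by
      have c5 : shiftHom A (-1) g' * g = g * shiftHom A (-1) g' :=
        ((coeffCommute_of_mem h4 (hL.g_mem_centralizer hE)).shiftHom_left _).commute
      calc _ = (g' * shiftHom A (-1) g' * nextFactor σ S f o α') * (g * (shiftHom A (-1) g *
            shiftHom A (-1 + -((n : ℂ) / 2)) (schur T β i j))) := by simp only [mul_assoc]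
        _ = nextFactor σ S f o α' * (g' * ((shiftHom A (-1) g' * g) * (shiftHom A (-1) g *
            shiftHom A (-1 + -((n : ℂ) / 2)) (schur T β i j)))) := by
          rw [c4.commute]
          simp only [mul_assoc]
        _ = nextFactor σ S f o α' * ((g' * g) * ((shiftHom A (-1) g' * shiftHom A (-1) g) *
            shiftHom A (-1 + -((n : ℂ) / 2)) (schur T β i j))) := by
          rw [c5]
          simp only [mul_assoc]
        _ = _ := by rw [h2, h10, one_mul, one_mul]
    rw [h11]
    congr 3
    push_cast
    ring
  map_ν j := hL.map_ν (.inl j)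
  f_injective := hL.f_injective.comp Sum.inl_injective
  o_injective := hL.nextTuple_injective
  o_ne p j := forall_nextTuple (P := fun c => c ≠ f (.inl j)) (fun p => hL.o_ne p _)
    (fun x => by rw [Ne, hL.f_injective.eq_iff]; simp) p
  o_ν := hL.nextTuple_ν
  row j q := by
    rw [Function.comp_apply, nextRow_sum]
    refine forall_nextTuple (P := fun c => S (f (.inl j)) c + ∑ p, W (.inl j) p * S (o p) c -
      ∑ x, (T.toBlocks₁₂ * β) j x * (S (f (.inr x)) c + ∑ p, W (.inr x) p * S (o p) c) = 0)
      (fun p => ?_) (fun x => ?_) q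
    · simp only [hL.row, mul_zero, sum_const_zero, sub_zero]
    · simp only [← hL.T_eq]
      have h : T.toBlocks₁₂ * β * T.toBlocks₂₂ = T.toBlocks₁₂ := by
        rw [Matrix.mul_assoc, hβ', Matrix.mul_one]
      have h' := congrFun (congrFun h j) x
      rw [mul_apply] at h'
      rw [sub_eq_zero]
      exact h'.symm
  T_eq j j' := by
    rw [Function.comp_apply, Function.comp_apply, nextRow_sum, schur_apply]
    simp only [← hL.T_eq]
  H_eq j j' := rfl
  g_eq := rfl
  g_const := hL.nextFactor_const hS hα
  g_opposite := hL.nextFactor_opposite hS hE hα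
  g_mem := hL.nextFactor_mem hS hα

end IsLevel

end Step

section Reduction

open PowerSeries

attribute [local instance 50] seriesAlgebra

variable {A : Type*} [Ring A] [Algebra ℂ A]

section Step

variable {J : Type*} [Fintype J] [DecidableEq J]

/-- A step of the elimination, in terms of the normalized Schur complements and the factors. -/
def IsStep (ε : ℤ) (H : Matrix (J ⊕ Bool) (J ⊕ Bool) A⟦X⟧) (g : A⟦X⟧) (H' : Matrix J J A⟦X⟧)
    (g' : A⟦X⟧) : Prop :=
  ∃ γ β, g * γ = 1 ∧ γ * g = 1 ∧ H.toBlocks₂₂ * β = 1 ∧ β * H.toBlocks₂₂ = 1 ∧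
    g' = stepDet ε H * γ ∧ ∀ i j, H' i j = g' * shiftHom A (-1) (γ * schur H β i j)

lemma IsStep.unique {ε : ℤ} {H : Matrix (J ⊕ Bool) (J ⊕ Bool) A⟦X⟧} {g g₁ g₂ : A⟦X⟧}
    {H₁ H₂ : Matrix J J A⟦X⟧} (h : IsStep ε H g H₁ g₁) (h' : IsStep ε H g H₂ g₂) :
    H₁ = H₂ ∧ g₁ = g₂ := by
  obtain ⟨γ, β, h1, -, h3, -, rfl, h6⟩ := h
  obtain ⟨γ', β', -, h2', -, h4', rfl, h6'⟩ := h'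
  obtain rfl := left_inv_eq_right_inv h2' h1
  obtain rfl := left_inv_eq_right_inv h4' h3
  exact ⟨Matrix.ext fun i j => by rw [h6, h6'], rfl⟩

lemma exists_isStep {ε : ℤ} {H : Matrix (J ⊕ Bool) (J ⊕ Bool) A⟦X⟧} {g : A⟦X⟧}
    (hH : ∀ i j, constantCoeff (H i j) = if i = j then 1 else 0) (hg : constantCoeff g = 1) :
    ∃ H' g', IsStep ε H g H' g' := by
  obtain ⟨γ, h1, h2, -, -⟩ := exists_inverse_series (T := ⊤) hg fun _ => Algebra.mem_top
  obtain ⟨β, h3, h4, -⟩ := exists_inverse (S := H.toBlocks₂₂) fun x y => by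
    have := hH (.inr x) (.inr y)
    simpa only [toBlocks₂₂, of_apply, Sum.inr.injEq] using this
  exact ⟨_, _, γ, β, h1, h2, h3, h4, rfl, fun _ _ => rfl⟩

variable {B : Type*} [Ring B] [Algebra ℂ B]

lemma map_opposite (φ : A →ₐ[ℂ] B) (c : ℂ) (a : A⟦X⟧) :
    PowerSeries.map (φ : A →+* B) (opposite A c a) =
      opposite B c (PowerSeries.map (φ : A →+* B) a) := by
  rw [opposite, RingHom.comp_apply, map_shiftHom (φ : A →+* B) φ.commutes, map_reflectHom]
  rfl

lemma IsStep.map_of {ε : ℤ} {H : Matrix (J ⊕ Bool) (J ⊕ Bool) A⟦X⟧} {g g' : A⟦X⟧}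
    {H' : Matrix J J A⟦X⟧} (h : IsStep ε H g H' g') (Φ : A⟦X⟧ →+* B⟦X⟧)
    (hs : ∀ a, Φ (shiftHom A (-1) a) = shiftHom B (-1) (Φ a))
    (ho : ∀ a, Φ (opposite A 1 a) = opposite B 1 (Φ a)) :
    IsStep ε (H.map Φ) (Φ g) (H'.map Φ) (Φ g') := by
  obtain ⟨γ, β, h1, h2, h3, h4, h5, h6⟩ := h
  have e1 := congrArg Φ h1
  have e2 := congrArg Φ h2
  rw [map_mul, map_one] at e1 e2
  refine ⟨Φ γ, β.map Φ, e1, e2, map_mul_eq_one Φ h3, map_mul_eq_one Φ h4, ?_, fun i j => ?_⟩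
  · rw [h5, map_mul]
    simp only [stepDet, sdet, map_sub, map_mul, map_zsmul, map_apply, ho, toBlocks₂₂,
      of_apply]
  · rw [map_apply, h6, map_mul, hs, map_mul, ← schur_map, map_apply]

lemma IsStep.map {ε : ℤ} {H : Matrix (J ⊕ Bool) (J ⊕ Bool) A⟦X⟧} {g g' : A⟦X⟧}
    {H' : Matrix J J A⟦X⟧} (h : IsStep ε H g H' g') (φ : A →ₐ[ℂ] B) :
    IsStep ε (H.map (PowerSeries.map (φ : A →+* B))) (PowerSeries.map (φ : A →+* B) g)
      (H'.map (PowerSeries.map (φ : A →+* B))) (PowerSeries.map (φ : A →+* B) g') :=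
  h.map_of _ (map_shiftHom _ φ.commutes _) (map_opposite φ 1)

end Step

lemma seriesMinor_zero {ε : ℤ} {ι : Type*} [Fintype ι] [DecidableEq ι] (σ : SignedIndex ε ι)
    (S : Matrix ι ι A⟦X⟧) (a b : Fin 0 → ι) : seriesMinor σ S a b = 1 := by
  rw [Subsingleton.elim a b, seriesMinor, minor, bracket, mul_one, antisym]
  simp [permOp]

lemma isLevel_init {ε : ℤ} {ι : Type*} [Fintype ι] [DecidableEq ι] {σ : SignedIndex ε ι}
    {S : Matrix ι ι A⟦X⟧} (hS : IsTwisted σ S) :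
    IsLevel σ S σ id (Fin.elim0 : Fin 0 → ι) 1 (fun _ => Fin.elim0) S 1 S where
  twisted := hS
  map_ν _ := rfl
  f_injective := Function.injective_id
  o_injective p := p.elim0
  o_ne p := p.elim0
  o_ν p := p.elim0
  row _ q := q.elim0
  T_eq i j := by simp
  H_eq i j := by simp [shiftHom_zero]
  g_eq := by rw [seriesMinor_zero, map_one, one_smul]
  g_const := map_one _
  g_opposite := map_one _
  g_mem := Subring.one_mem _

lemma IsLevel.reindex {ε : ℤ} {ι : Type*} [Fintype ι] [DecidableEq ι] {σ : SignedIndex ε ι}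
    {S : Matrix ι ι A⟦X⟧} {n : ℕ} {I I' : Type*} [Fintype I] [DecidableEq I] [Fintype I']
    [DecidableEq I'] {τ : SignedIndex ε I} {f : I → ι} {o : Fin n → ι} {α : ℂ⟦X⟧}
    {W : I → Fin n → A⟦X⟧} {T : Matrix I I A⟦X⟧} {g : A⟦X⟧} {H : Matrix I I A⟦X⟧}
    (hL : IsLevel σ S τ f o α W T g H) {τ' : SignedIndex ε I'} (φ : I' ≃ I)
    (hν : ∀ i, φ (τ'.ν i) = τ.ν (φ i)) (he : ∀ i, τ'.e i = τ.e (φ i)) :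
    IsLevel σ S τ' (f ∘ φ) o α (fun i => W (φ i)) (T.submatrix φ φ) g (H.submatrix φ φ) where
  twisted := {
    quad := hL.twisted.quad.submatrix φ hν he
    symm := fun i j => by simpa only [submatrix_apply, hν, he] using hL.twisted.symm (φ i) (φ j)
    const := fun i j => by
      rw [submatrix_apply, hL.twisted.const]
      simp only [φ.injective.eq_iff] }
  map_ν i := by rw [Function.comp_apply, hν, hL.map_ν, Function.comp_apply]
  f_injective := hL.f_injective.comp φ.injective
  o_injective := hL.o_injective
  o_ne p i := hL.o_ne p _
  o_ν := hL.o_ν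
  row i := hL.row _
  T_eq i j := hL.T_eq _ _
  H_eq i j := hL.H_eq _ _
  g_eq := hL.g_eq
  g_const := hL.g_const
  g_opposite := hL.g_opposite
  g_mem := hL.g_mem

lemma IsLevel.exists_next {ε : ℤ} {ι : Type*} [Fintype ι] [DecidableEq ι] {σ : SignedIndex ε ι}
    {S : Matrix ι ι A⟦X⟧} {n : ℕ} {J : Type*} [Fintype J] [DecidableEq J] {τ : SignedIndex ε J}
    {hε : ε * ε = 1} {f : J ⊕ Bool → ι} {o : Fin n → ι} {α : ℂ⟦X⟧} {W : J ⊕ Bool → Fin n → A⟦X⟧}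
    {T : Matrix (J ⊕ Bool) (J ⊕ Bool) A⟦X⟧} {g : A⟦X⟧} {H : Matrix (J ⊕ Bool) (J ⊕ Bool) A⟦X⟧}
    (hL : IsLevel σ S (τ.sum (boolIndex ε hε)) f o α W T g H) (hS : IsTwisted σ S)
    (hE : IsEquivariant σ S) {α' : ℂ⟦X⟧}
    (hα : (2 + C (2 - (ε : ℂ)) * X) * α' = (2 + X) * shiftHom ℂ 1 α) {H' : Matrix J J A⟦X⟧}
    {g' : A⟦X⟧} (hs : IsStep ε H g H' g') :
    ∃ W' T', IsLevel σ S τ (f ∘ Sum.inl) (IsLevel.nextTuple f o) α' W' T' g' H' := by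
  obtain ⟨β, hβ, hβ', -⟩ := exists_inverse (S := T.toBlocks₂₂) fun x y => by
    have := hL.T_const (.inr x) (.inr y)
    simpa only [toBlocks₂₂, of_apply, Sum.inr.injEq] using this
  obtain ⟨γ, h1, h2, -⟩ := hL.exists_inverse_g hE
  obtain ⟨h3, h4, h5⟩ := hL.schur_eq hβ hβ' h1 h2
  have hn := hL.next hS hE hα hβ hβ'
  have hs' : IsStep ε H g _ _ := ⟨γ, _, h1, h2, h3, h4,
    (by rw [← hL.nextFactor_mul hS hE hα, mul_assoc, h1, mul_one] :
      IsLevel.nextFactor σ S f o α' = _), fun i j => (by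
        rw [h5, ← mul_assoc, h2, one_mul, shiftHom_shiftHom, of_apply]
        congr 3
        push_cast
        ring : (Matrix.of fun i j => IsLevel.nextFactor σ S f o α' *
          shiftHom A (-(((n + 2 : ℕ) : ℂ) / 2)) (schur T β i j)) i j = _)⟩
  obtain ⟨rfl, rfl⟩ := hs.unique hs'
  exact ⟨_, _, hn⟩

/-- The index `n` of the matrices of the size `N + 2`, `n = ⌊N/2⌋ + 1`. -/
def topIdx (N : ℕ) : Idx (N + 2) :=
  ⟨((N + 2) / 2 : ℕ), mem_idx.2 ⟨⟨by omega, le_rfl⟩, fun h => by omega⟩⟩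

/-- The index set of `(N+2) × (N+2)` matrices is obtained by adding two elements. -/
noncomputable def splitIdx (N : ℕ) : Idx N ⊕ Bool ≃ Idx (N + 2) :=
  Equiv.ofBijective (Sum.elim Idx.incl fun b => if b then topIdx N else (topIdx N).neg) <| by
    constructor
    · rintro (i | _ | _) (j | _ | _) h <;> simp only [Sum.elim_inl, Sum.elim_inr, Subtype.ext_iff, Idx.incl,
        topIdx, Idx.neg, if_true, Bool.false_eq_true, if_false] at h
      · rw [Subtype.ext h]
      all_goals first
        | rfl
        | (have := mem_idx.1 i.2; omega)
        | (have := mem_idx.1 j.2; omega)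
        | omega
    · intro i
      have hi := mem_idx.1 i.2
      by_cases h : (i : ℤ) = ((N + 2) / 2 : ℕ)
      · exact ⟨.inr true, Subtype.ext h.symm⟩
      by_cases h' : (i : ℤ) = -((N + 2) / 2 : ℕ)
      · exact ⟨.inr false, Subtype.ext h'.symm⟩
      · exact ⟨.inl ⟨i, mem_idx.2 ⟨⟨by omega, by omega⟩, fun h0 => by have := hi.2 h0; omega⟩⟩, rfl⟩

lemma splitIdx_false {N : ℕ} : splitIdx N (.inr false) = (topIdx N).neg := rfl

lemma splitIdx_true {N : ℕ} : splitIdx N (.inr true) = topIdx N := rfl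

variable {t : Kind}

lemma Kind.sgn_mul_sgn (t : Kind) : t.sgn * t.sgn = 1 := by cases t <;> rfl

lemma splitIdx_ν {N : ℕ} (h : t = .symplectic → Even N) (h' : t = .symplectic → Even (N + 2))
    (i : Idx N ⊕ Bool) :
    splitIdx N (((idxSigned t N h).sum (boolIndex t.sgn t.sgn_mul_sgn)).ν i) =
      (idxSigned t (N + 2) h').ν (splitIdx N i) := by
  rcases i with i | _ | _
  · rfl
  · exact ((idxSigned t (N + 2) h').ν_ν _).symm
  · rfl

lemma splitIdx_e {N : ℕ} (h : t = .symplectic → Even N) (h' : t = .symplectic → Even (N + 2))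
    (i : Idx N ⊕ Bool) :
    ((idxSigned t N h).sum (boolIndex t.sgn t.sgn_mul_sgn)).e i =
      (idxSigned t (N + 2) h').e (splitIdx N i) := by
  rcases i with i | i
  · cases t <;> rfl
  have h1 : (0 : ℤ) < ((N + 2) / 2 : ℕ) := by omega
  rcases i with _ | _ <;> cases t
  · rfl
  · exact (Int.sign_eq_neg_one_of_neg (neg_neg_of_pos h1)).symm
  · rfl
  · exact (Int.sign_eq_one_of_pos h1).symm

lemma alpha_succ (t : Kind) (d : ℕ) : (2 + C (2 - (t.sgn : ℂ)) * X) * alpha t (-((d + 1 : ℕ) : ℤ)) =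
    (2 + X) * shiftHom ℂ 1 (alpha t (-(d : ℤ))) := by
  cases t with
  | orthogonal =>
    have : (C (2 - ((1 : ℤ) : ℂ)) : ℂ⟦X⟧) = 1 := by rw [← map_one C]; norm_num
    change (2 + C (2 - ((1 : ℤ) : ℂ)) * X) * 1 = (2 + X) * shiftHom ℂ 1 1
    rw [this, map_one, one_mul]
  | symplectic =>
    have h1 : ∀ p : ℤ, (1 + C (1 / 2 - (p : ℂ)) * X) * alpha .symplectic p = 1 + C (1 / 2) * X := by
      intro p
      have h := one_add_mul_invShift (1 / 2 - (p : ℂ))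
      rw [invShift, mul_left_comm, mul_eq_left₀ X_ne_zero] at h
      rw [alpha, mul_left_comm, show (p : ℂ) - 1 / 2 = -(1 / 2 - p) by ring, h, mul_one]
    have h2 := h1 (-((d + 1 : ℕ) : ℤ))
    have h3 := congrArg (shiftHom ℂ 1) (h1 (-(d : ℤ)))
    have hX := one_add_mul_shiftHom_X 1
    simp only [map_mul, map_add, map_one, shiftHom_C, one_mul] at h3 hX
    have e1 : (C (1 / 2 - ((-((d + 1 : ℕ) : ℤ) : ℤ) : ℂ)) : ℂ⟦X⟧) =
        C (1 / 2 - ((-(d : ℤ) : ℤ) : ℂ)) + 1 := by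
      rw [← map_one C, ← map_add]
      congr 1
      push_cast
      ring
    have e2 : (C (2 - (Kind.symplectic.sgn : ℂ)) : ℂ⟦X⟧) = 4 * C (1 / 2) + 1 := by
      rw [← map_one C, ← map_ofNat C 4, ← map_mul, ← map_add]
      congr 1
      norm_num [Kind.sgn]
    have e3 : (2 * C (1 / 2) : ℂ⟦X⟧) = 1 := by
      rw [← map_one C, ← map_ofNat C 2, ← map_mul]
      congr 1
      norm_num
    have hne := one_add_mul_ne_zero (1 / 2 - ((-((d + 1 : ℕ) : ℤ) : ℤ) : ℂ))
    refine mul_left_cancel₀ hne ?_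
    rw [mul_left_comm, h2, e2, e1]
    linear_combination (-(2 + X) * (1 + X)) * h3 + (2 + X) * (C (1 / 2 - ((-(d : ℤ) : ℤ) : ℂ)) *
      shiftHom ℂ 1 (alpha .symplectic (-(d : ℤ))) - C (1 / 2)) * hX + (2 * X + (2 * C (1 / 2) + 1) * X ^ 2) * e3

variable {N : ℕ}

/-- The matrices and the factors which are obtained from `S(u)` by `d` steps of the elimination. -/
inductive Reduces (t : Kind) {N : ℕ} (S : Matrix (Idx N) (Idx N) A⟦X⟧) :
    (d q : ℕ) → Matrix (Idx q) (Idx q) A⟦X⟧ → A⟦X⟧ → Prop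
  | refl : Reduces t S 0 N S 1
  | step {d q : ℕ} {H : Matrix (Idx (q + 2)) (Idx (q + 2)) A⟦X⟧} {g : A⟦X⟧}
      {H' : Matrix (Idx q) (Idx q) A⟦X⟧} {g' : A⟦X⟧} (h : Reduces t S d (q + 2) H g)
      (hs : IsStep t.sgn (H.submatrix (splitIdx q) (splitIdx q)) g H' g') :
      Reduces t S (d + 1) q H' g'

lemma Reduces.size {S : Matrix (Idx N) (Idx N) A⟦X⟧} {d q : ℕ} {H : Matrix (Idx q) (Idx q) A⟦X⟧}
    {g : A⟦X⟧} (h : Reduces t S d q H g) : q + 2 * d = N := by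
  induction h with
  | refl => rfl
  | step _ _ ih => omega

lemma Reduces.isLevel {S : Matrix (Idx N) (Idx N) A⟦X⟧} {d q : ℕ}
    {H : Matrix (Idx q) (Idx q) A⟦X⟧} {g : A⟦X⟧} (hr : Reduces t S d q H g)
    (h : t = .symplectic → Even N) (hS : IsTwisted (idxSigned t N h) S)
    (hE : IsEquivariant (idxSigned t N h) S) (hq : t = .symplectic → Even q) :
    ∃ (f : Idx q → Idx N) (o : Fin (2 * d) → Idx N) (W : Idx q → Fin (2 * d) → A⟦X⟧)
      (T : Matrix (Idx q) (Idx q) A⟦X⟧), IsLevel (idxSigned t N h) S (idxSigned t q hq) f o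
        (alpha t (-(d : ℤ))) W T g H ∧ (∀ i, (f i : ℤ) = i) ∧ ∀ p, (o p : ℤ) =
          if (p : ℕ) % 2 = 0 then (((p : ℕ) / 2 : ℕ) : ℤ) - (N / 2 : ℕ) else
            (N / 2 : ℕ) - (((p : ℕ) / 2 : ℕ) : ℤ) := by
  induction hr with
  | refl =>
    refine ⟨id, Fin.elim0, fun _ => Fin.elim0, S, ?_, fun i => rfl, fun p => p.elim0⟩
    have : alpha t (-((0 : ℕ) : ℤ)) = 1 := by
      cases t
      · rfl
      · have h := one_add_mul_invShift (1 / 2)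
        rw [invShift, mul_left_comm, mul_eq_left₀ X_ne_zero] at h
        rw [alpha, Int.cast_neg, Int.cast_natCast, Nat.cast_zero, neg_zero, zero_sub, h]
    rw [this]
    exact isLevel_init hS
  | @step d q H g H' g' hr hs ih =>
    have hsize := hr.size
    have hq' : t = .symplectic → Even (q + 2) := fun ht => (hq ht).add even_two
    obtain ⟨f, o, W, T, hL, hf, ho⟩ := ih hq'
    obtain ⟨W', T', hL'⟩ := (hL.reindex (splitIdx q) (splitIdx_ν hq hq')
      (splitIdx_e hq hq')).exists_next hS hE (alpha_succ t d) hs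
    refine ⟨_, _, W', T', hL', fun i => hf _, fun p => ?_⟩
    revert p
    change ∀ p : Fin (2 * d + 2), _
    intro p
    refine lastCases ?_ (fun p => lastCases ?_ (fun p => ?_) p) p
    · rw [IsLevel.nextTuple_true, Function.comp_apply, hf, splitIdx_true, Fin.val_last, if_neg (by omega)]
      simp only [topIdx]
      omega
    · rw [IsLevel.nextTuple_false, Function.comp_apply, hf, splitIdx_false, Fin.val_castSucc, Fin.val_last,
        if_pos (by omega)]
      simp only [topIdx, Idx.neg]
      omega
    · rw [IsLevel.nextTuple_castSucc, ho]
      rfl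

lemma exists_reduces {S : Matrix (Idx N) (Idx N) A⟦X⟧} (h : t = .symplectic → Even N)
    (hS : IsTwisted (idxSigned t N h) S) (hE : IsEquivariant (idxSigned t N h) S) (d q : ℕ)
    (hq : q + 2 * d = N) : ∃ H g, Reduces t S d q H g := by
  induction d generalizing q with
  | zero =>
    obtain rfl := hq
    exact ⟨S, 1, .refl⟩
  | succ d ih =>
    obtain ⟨H, g, hr⟩ := ih (q + 2) (by omega)
    have hq' : t = .symplectic → Even (q + 2) := fun ht => by
      have := Nat.even_iff.1 (h ht)
      exact Nat.even_iff.2 (by omega)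
    obtain ⟨f, o, W, T, hL, -⟩ := hr.isLevel h hS hE hq'
    obtain ⟨H', g', hs⟩ := exists_isStep (ε := t.sgn) (H := H.submatrix (splitIdx q) (splitIdx q))
      (fun i j => by
        rw [submatrix_apply, hL.twisted.const]
        simp only [(splitIdx q).injective.eq_iff]) hL.g_const
    exact ⟨H', g', hr.step hs⟩

lemma Reduces.eq_minor {M k : ℕ} {S : Matrix (Idx (M + 2 * k)) (Idx (M + 2 * k)) A⟦X⟧}
    {H : Matrix (Idx M) (Idx M) A⟦X⟧} {g : A⟦X⟧} (hr : Reduces t S k M H g)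
    (h : t = .symplectic → Even (M + 2 * k)) (hS : IsTwisted (idxSigned t _ h) S)
    (hE : IsEquivariant (idxSigned t _ h) S) (hM : t = .symplectic → Even M) (i j : Idx M) :
    toSeries A (alpha t (-(k : ℤ))) * shift (k : ℂ)
      (sklyaninMinor t S (indexSeq k i) (indexSeq k j)) = H i j := by
  obtain ⟨f, o, W, T, hL, hf, ho⟩ := hr.isLevel h hS hE hM
  have hτ : Function.Bijective fun q : Fin (2 * k + 1) =>
      (⟨if (q : ℕ) % 2 = 0 then q / 2 else 2 * k - q / 2, by split_ifs <;> omega⟩ :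
        Fin (2 * k + 1)) := by
    refine Finite.injective_iff_bijective.1 fun p q hpq => ?_
    simp only [Fin.mk.injEq] at hpq
    ext
    split_ifs at hpq <;> omega
  have key : ∀ i : Idx M, (snoc o (f i) : Fin (2 * k + 1) → Idx (M + 2 * k)) =
      indexSeq k i ∘ Equiv.ofBijective _ hτ := by
    intro i
    funext q
    refine lastCases ?_ (fun q => ?_) q
    · rw [snoc_last]
      refine Subtype.ext ?_
      rw [hf]
      simp only [indexSeq, Function.comp_apply, Equiv.ofBijective_apply, Fin.val_last]
      rw [if_neg (by split_ifs <;> omega), if_pos (by split_ifs <;> omega)]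
    · rw [snoc_castSucc]
      refine Subtype.ext ?_
      rw [ho]
      have := q.2
      simp only [indexSeq, Function.comp_apply, Equiv.ofBijective_apply, Fin.val_castSucc]
      split_ifs <;> omega
  rw [hL.H_eq_minor hS, key, key, sklyaninMinor_eq h, toSeries_mul, ← shiftHom_apply, seriesMinor,
    seriesMinor, minor_comp_comp two_ne_zero_series weight_succ_right weight_succ_left hS.quad_succ]
  congr 3
  push_cast
  ring

lemma Reduces.coeff_mem {M k : ℕ} {S : Matrix (Idx (M + 2 * k)) (Idx (M + 2 * k)) A⟦X⟧}
    {H : Matrix (Idx M) (Idx M) A⟦X⟧} {g : A⟦X⟧} (hr : Reduces t S k M H g)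
    (h : t = .symplectic → Even (M + 2 * k)) (hS : IsTwisted (idxSigned t _ h) S)
    (hE : IsEquivariant (idxSigned t _ h) S) (hM : t = .symplectic → Even M) :
    IsTwisted (idxSigned t M hM) H ∧ constantCoeff g = 1 ∧
    ∀ a b : Idx (M + 2 * k), M / 2 + 1 ≤ (a : ℤ).natAbs → M / 2 + 1 ≤ (b : ℤ).natAbs →
      ∀ r, (∀ i j s, coeff r (S a b) * coeff s (H i j) = coeff s (H i j) * coeff r (S a b)) ∧
        ∀ s, coeff r (S a b) * coeff s g = coeff s g * coeff r (S a b) := by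
  obtain ⟨f, o, W, T, hL, -, ho⟩ := hr.isLevel h hS hE hM
  have key : ∀ c : Idx (M + 2 * k), M / 2 + 1 ≤ (c : ℤ).natAbs → ∃ p, o p = c := by
    intro c hc
    have hc' := mem_idx.1 c.2
    by_cases h0 : (c : ℤ) < 0
    · refine ⟨⟨2 * ((c : ℤ) + ((M + 2 * k) / 2 : ℕ)).toNat, by omega⟩, Subtype.ext ?_⟩
      rw [ho]
      dsimp only
      split_ifs <;> omega
    · refine ⟨⟨2 * (((M + 2 * k) / 2 : ℕ) - (c : ℤ)).toNat + 1, by omega⟩, Subtype.ext ?_⟩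
      rw [ho]
      dsimp only
      split_ifs <;> omega
  refine ⟨hL.twisted, hL.g_const, fun a b ha hb r => ?_⟩
  obtain ⟨p, rfl⟩ := key a ha
  obtain ⟨q, rfl⟩ := key b hb
  have hm := mem_blockAlg (S := S) (o := o) p q r
  exact ⟨fun i j s => (Subalgebra.mem_centralizer_iff ℂ).1 (hL.H_mem hS hE i j s) _ hm,
    fun s => (Subalgebra.mem_centralizer_iff ℂ).1 (hL.g_mem_centralizer hE s) _ hm⟩

end Reduction

section Classical

open PowerSeries

attribute [local instance 50] seriesAlgebra

variable {ε : ℤ} {ι : Type*} [DecidableEq ι]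

/-- The relations between the generators `F_{ij}` of an orthogonal or symplectic Lie algebra. -/
structure IsClassical (σ : SignedIndex ε ι) {A : Type*} [Ring A] (F : ι → ι → A) : Prop where
  symm : ∀ i j, F (σ.ν j) (σ.ν i) = -((σ.e i * σ.e j) • F i j)
  comm : ∀ i j k l, F i j * F k l - F k l * F i j =
    (if k = j then F i l else 0) - (if i = l then F k j else 0)
      - (σ.e k * σ.e (σ.ν j)) • (if i = σ.ν k then F (σ.ν j) l else 0)
      + (σ.e i * σ.e (σ.ν l)) • (if σ.ν l = j then F k (σ.ν i) else 0)

lemma isClassical_matrix [Fintype ι] (σ : SignedIndex ε ι) : IsClassical σ fun i j : ι =>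
    (Matrix.single i j 1 - (σ.e i * σ.e j) • Matrix.single (σ.ν j) (σ.ν i) 1 : Matrix ι ι ℂ) where
  symm i j := by
    simp only [σ.ν_ν, σ.e_ν_eq]
    rw [smul_sub, smul_smul, show σ.e i * σ.e j * (σ.e i * σ.e j) = 1 by
      linear_combination σ.e j * σ.e j * σ.e_mul i + σ.e_mul j,
      show ε * σ.e j * (ε * σ.e i) = σ.e i * σ.e j by
        linear_combination σ.e i * σ.e j * σ.ε_mul i]
    module
  comm i j k l := by
    have hs : ∀ i j k l : ι, (Matrix.single i j 1 * Matrix.single k l 1 : Matrix ι ι ℂ) =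
        (if j = k then (1 : ℤ) else 0) • Matrix.single i l 1 := by
      intro i j k l
      split_ifs with h
      · subst h
        simp
      · simp [h]
    have hi : ∀ (p : Prop) [Decidable p] (M : Matrix ι ι ℂ), (if p then M else 0) =
        (if p then (1 : ℤ) else 0) • M := by
      intro p _ M
      split_ifs <;> simp
    have q1 : (j = k) = (k = j) := propext eq_comm
    have q2 : (l = i) = (i = l) := propext eq_comm
    have q3 : (σ.ν i = k) = (i = σ.ν k) := propext (by rw [σ.eq_ν_iff, eq_comm])
    have q4 : (σ.ν k = i) = (i = σ.ν k) := propext eq_comm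
    have q5 : (l = σ.ν j) = (j = σ.ν l) := propext σ.eq_ν_iff
    have q6 : (σ.ν l = j) = (j = σ.ν l) := propext eq_comm
    simp only [sub_mul, mul_sub, smul_mul_assoc, mul_smul_comm, hs, hi, σ.ν_ν, σ.ν_inj, σ.e_ν_eq, q1,
      q2, q3, q4, q5, q6]
    have h1 : (if k = j then (1 : ℤ) else 0) * (σ.e k - σ.e j) = 0 := by split_ifs with h <;> simp [h]
    have h2 : (if i = l then (1 : ℤ) else 0) * (σ.e i - σ.e l) = 0 := by split_ifs with h <;> simp [h]
    have h3 : (if i = σ.ν k then (1 : ℤ) else 0) * (σ.e i - ε * σ.e k) = 0 := by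
      split_ifs with h <;> simp [h, σ.e_ν_eq]
    have h4 : (if j = σ.ν l then (1 : ℤ) else 0) * (σ.e j - ε * σ.e l) = 0 := by
      split_ifs with h <;> simp [h, σ.e_ν_eq]
    simp only [smul_sub, smul_smul]
    generalize (if k = j then (1 : ℤ) else 0) = D1 at *
    generalize (if i = l then (1 : ℤ) else 0) = D2 at *
    generalize (if i = σ.ν k then (1 : ℤ) else 0) = D3 at *
    generalize (if j = σ.ν l then (1 : ℤ) else 0) = D4 at *
    have ei := σ.e_mul i
    have ej := σ.e_mul j
    have ek := σ.e_mul k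
    have el := σ.e_mul l
    have eε := σ.ε_mul i
    match_scalars
    all_goals try ring1
    · linear_combination (-σ.e j) * h3
    · linear_combination σ.e k * σ.e l * D4 * ε * ε * ei + σ.e k * σ.e l * D4 * eε
    · linear_combination σ.e k * σ.e j * σ.e l * h2 + σ.e k * σ.e j * D2 * el
    · linear_combination (-σ.e k * σ.e l * D3 * ε * ε) * ej - σ.e k * σ.e l * D3 * eε
    · linear_combination σ.e i * h4
    · linear_combination (-σ.e i * σ.e l * σ.e j) * h1 - σ.e i * σ.e l * D1 * ej

section Lie

attribute [local instance 100] LieRing.ofAssociativeRing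

lemma Fmat_eq {t : Kind} {N : ℕ} (h : t = .symplectic → Even N) (i j : Idx N) :
    Fmat t i j = Matrix.single i j 1 - ((idxSigned t N h).e i * (idxSigned t N h).e j) •
      Matrix.single ((idxSigned t N h).ν j) ((idxSigned t N h).ν i) 1 := by
  rw [Fmat, theta_eq t h, Int.cast_smul_eq_zsmul]
  rfl

lemma isClassical_FU {t : Kind} {N : ℕ} (h : t = .symplectic → Even N) :
    IsClassical (idxSigned t N h) fun i j => FU t i j where
  symm i j := by
    have h1 := (isClassical_matrix (idxSigned t N h)).symm i j
    simp only [← Fmat_eq h] at h1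
    have h2 : F t ((idxSigned t N h).ν j) ((idxSigned t N h).ν i) =
        -(((idxSigned t N h).e i * (idxSigned t N h).e j) • F t i j) := Subtype.ext h1
    rw [FU, h2, map_neg, map_zsmul]
    rfl
  comm i j k l := by
    have h1 := (isClassical_matrix (idxSigned t N h)).comm i j k l
    simp only [← Fmat_eq h] at h1
    have h2 : ⁅F t i j, F t k l⁆ = (if k = j then F t i l else 0) - (if i = l then F t k j else 0)
      - ((idxSigned t N h).e k * (idxSigned t N h).e ((idxSigned t N h).ν j)) •
        (if i = (idxSigned t N h).ν k then F t ((idxSigned t N h).ν j) l else 0)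
      + ((idxSigned t N h).e i * (idxSigned t N h).e ((idxSigned t N h).ν l)) •
        (if (idxSigned t N h).ν l = j then F t k ((idxSigned t N h).ν i) else 0) := by
      refine Subtype.ext (Eq.trans ?_ (h1.trans ?_))
      · rfl
      · push_cast
        split_ifs <;> rfl
    have h3 := congrArg (UniversalEnvelopingAlgebra.ι ℂ) h2
    rw [LieHom.map_lie, LieRing.of_associative_ring_bracket] at h3
    refine Eq.trans h3 ?_
    simp only [map_add, map_sub, map_zsmul, apply_ite (UniversalEnvelopingAlgebra.ι ℂ), map_zero]
    rfl

end Lie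

/-- The quadratic relation for the matrix `1 + κ F`. -/
lemma IsClassical.quadRel {K B : Type*} [CommRing K] [Ring B] [Algebra K B] {σ : SignedIndex ε ι}
    {F : ι → ι → B} (hF : IsClassical σ F) {d t f s κ κ' : K} (h1 : d * κ * κ' = t * (κ' - κ))
    (h2 : s * (κ + κ') = (f + ε * s) * (κ * κ')) :
    QuadRel σ d t f s (Matrix.of fun i j => (if i = j then 1 else 0) + κ • F i j)
      (Matrix.of fun i j => (if i = j then 1 else 0) + κ' • F i j) := by
  intro i j k l
  have hs : ∀ (p : Prop) [Decidable p], (if p then (1 : B) else 0) = (if p then (1 : K) else 0) • 1 := by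
    intro p _
    split_ifs <;> simp
  have hi : ∀ (p : Prop) [Decidable p] (M : B), (if p then M else 0) = (if p then (1 : K) else 0) • M := by
    intro p _ M
    split_ifs <;> simp
  have hc := hF.comm i j k l
  have hik : F i (σ.ν k) = -((ε * σ.e k * σ.e i) • F k (σ.ν i)) := by
    have := hF.symm k (σ.ν i)
    rw [σ.ν_ν, σ.e_ν_eq] at this
    rw [this]
    congr 2
    ring
  have hlj : F (σ.ν l) j = -((ε * σ.e l * σ.e j) • F (σ.ν j) l) := by
    have := hF.symm (σ.ν j) l
    rw [σ.ν_ν, σ.e_ν_eq] at this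
    rw [this]
    congr 2
    ring
  have q3 : (k = σ.ν i) = (i = σ.ν k) := propext σ.eq_ν_iff
  have q6 : (σ.ν j = l) = (σ.ν l = j) := propext (by rw [eq_comm, σ.eq_ν_iff, eq_comm])
  simp only [of_apply, hik, hlj, hs, hi, mul_add, add_mul, smul_mul_assoc, mul_smul_comm,
    mul_one, one_mul, q3, q6, σ.e_ν_eq, ← Int.cast_smul_eq_zsmul K, neg_mul, mul_neg] at hc ⊢
  have h3 : (if i = σ.ν k then (1 : K) else 0) * ((σ.e i : K) - ε * σ.e k) = 0 := by
    split_ifs with h <;> simp [h, σ.e_ν_eq]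
  have h4 : (if σ.ν l = j then (1 : K) else 0) * ((σ.e j : K) - ε * σ.e l) = 0 := by
    split_ifs with h
    · rw [← h, σ.e_ν_eq]
      push_cast
      ring
    · rw [zero_mul]
  have q7 : (i = l) = (l = i) := propext eq_comm
  have q8 : (j = k) = (k = j) := propext eq_comm
  have q9 : (i = j) = (j = i) := propext eq_comm
  generalize (if k = j then (1 : K) else 0) = D1 at *
  generalize (if i = l then (1 : K) else 0) = D2 at *
  generalize (if i = σ.ν k then (1 : K) else 0) = D3 at *
  generalize (if σ.ν l = j then (1 : K) else 0) = D4 at *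
  generalize (if i = j then (1 : K) else 0) = D5 at *
  generalize (if k = l then (1 : K) else 0) = D6 at *
  have ei := congrArg (Int.cast (R := K)) (σ.e_mul i)
  have ej := congrArg (Int.cast (R := K)) (σ.e_mul j)
  have ek := congrArg (Int.cast (R := K)) (σ.e_mul k)
  have el := congrArg (Int.cast (R := K)) (σ.e_mul l)
  have eε := congrArg (Int.cast (R := K)) (σ.ε_mul i)
  push_cast at ei ej ek el eε hc ⊢
  generalize (σ.e i : K) = a at *
  generalize (σ.e j : K) = b at *
  generalize (σ.e k : K) = c at *
  generalize (σ.e l : K) = g at *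
  generalize (ε : K) = z at *
  linear_combination (norm := skip) (d * f * κ * κ') • hc
  match_scalars
  all_goals try ring1
  · linear_combination d * s * z * (c * D3 * h4 - g * D4 * h3)
  · linear_combination f * D1 * h1
  · linear_combination (-f * D2) * h1
  · linear_combination c * z * b * D3 * d * h2 + (d * s * b * κ - s * z * b * d * κ * κ') * h3 +
      d * s * b * κ * a * D3 * (g * g * eε + el) + s * a * z * b * D3 * h1
  · linear_combination (-a * z * g * D4 * d) * h2 + (s * a * z * d * κ * κ' - d * s * κ * a) * h4 -
      d * s * κ * a * b * D4 * (c * c * eε + ek) - s * a * z * b * D4 * h1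
  · linear_combination d * s * z * z * a * b * κ * κ' * (el - ek)

lemma IsClassical.map {σ : SignedIndex ε ι} {A B : Type*} [Ring A] [Ring B] {F : ι → ι → A}
    (hF : IsClassical σ F) (φ : A →+* B) : IsClassical σ fun i j => φ (F i j) where
  symm i j := by rw [hF.symm, map_neg, map_zsmul]
  comm i j k l := by
    have h := congrArg φ (hF.comm i j k l)
    simpa only [map_sub, map_add, map_mul, map_zsmul, apply_ite φ, map_zero] using h

variable {A : Type*} [Ring A] [Algebra ℂ A]

lemma inU_smul (f : ℂ⟦X⟧) (a : A⟦X⟧) : inU (f • a) = inU f • inU a := by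
  rw [series_smul_def, series_smul_def, inU, inU, inU, map_mul, map_C]
  rfl

lemma inV_smul (f : ℂ⟦X⟧) (a : A⟦X⟧) : inV (f • a) = inV f • inV a := by
  rw [series_smul_def, series_smul_def, inV, inV, inV, map_mul]
  congr 1
  ext n : 1
  rw [coeff_map, coeff_map, coeff_map, coeff_map]
  exact (map_C (algebraMap ℂ A) _).symm

/-- The matrix `1 + F (u + ε/2)⁻¹`. -/
noncomputable def classicalMatrix (ε : ℤ) (F : ι → ι → A) : Matrix ι ι A⟦X⟧ :=
  Matrix.of fun i j => (if i = j then 1 else 0) + invShift ((ε : ℂ) / 2) • C (F i j)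

lemma fMatrix_eq (t : Kind) (N : ℕ) :
    fMatrix t N = classicalMatrix t.sgn fun i j : Idx N => FU t i j := by
  ext i j : 1
  have h : pm t = (t.sgn : ℂ) := by cases t <;> simp [pm, Kind.sgn]
  rw [fMatrix, classicalMatrix, of_apply, of_apply, h, ← toSeries_mul]
  congr 1
  ext n
  rw [coeff_C_mul, coeff_mul_C, toSeries, coeff_map, Algebra.commutes]

lemma coeff_classicalMatrix (F : ι → ι → A) (i j : ι) (r : ℕ) :
    coeff r (classicalMatrix ε F i j) = (if r = 0 then (if i = j then 1 else 0) else 0) +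
      coeff r (invShift ((ε : ℂ) / 2)) • F i j := by
  rw [classicalMatrix, of_apply, map_add, ← toSeries_mul, coeff_mul_C, toSeries, coeff_map,
    ← Algebra.smul_def]
  congr 1
  split_ifs with h1 h2 h2 <;> simp [coeff_one, *]

lemma constantCoeff_invShift (c : ℂ) : constantCoeff (invShift c) = 0 :=
  X_dvd_iff.1 (X_dvd_invShift c)

lemma IsClassical.isTwisted {σ : SignedIndex ε ι} {F : ι → ι → A} (hF : IsClassical σ F) :
    IsTwisted σ (classicalMatrix ε F) where
  quad := by
    have hx := congrArg (inU (A := ℂ)) (one_add_mul_invShift ((ε : ℂ) / 2))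
    have hy := congrArg (inV (A := ℂ)) (one_add_mul_invShift ((ε : ℂ) / 2))
    have h := (hF.map ((C (R := A⟦X⟧)).comp (C (R := A)))).quadRel (K := ℂ⟦X⟧⟦X⟧)
      (d := inV X - inU X) (t := inU X * inV X) (f := inU X + inV X) (s := inU X * inV X)
      (κ := inU (invShift ((ε : ℂ) / 2))) (κ' := inV (invShift ((ε : ℂ) / 2))) ?_ ?_
    · convert h using 1
      · ext i j : 1
        rw [map_apply, classicalMatrix, of_apply, of_apply]
        refine (map_add (C (R := A⟦X⟧)) _ _).trans ?_
        congr 1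
        · split_ifs <;> simp
        · exact inU_smul _ _
      · ext i j : 1
        rw [map_apply, classicalMatrix, of_apply, of_apply]
        refine (map_add (PowerSeries.map (C (R := A))) _ _).trans ?_
        congr 1
        · split_ifs <;> simp
        · refine (inV_smul _ _).trans ?_
          rw [inV, inV, map_C]
          rfl
    all_goals
      have h2 : (2 : ℂ⟦X⟧⟦X⟧) * C (C ((ε : ℂ) / 2)) = ε := by
        rw [← map_ofNat ((C (R := ℂ⟦X⟧)).comp (C (R := ℂ))) 2, RingHom.comp_apply, ← map_mul,
          ← map_mul, mul_div_cancel₀ _ two_ne_zero, map_intCast, map_intCast]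
      simp only [inU, inV, map_mul, map_add, map_one, map_C] at hx hy ⊢
    · linear_combination (PowerSeries.map C X * PowerSeries.map C (invShift ((ε : ℂ) / 2))) * hx -
        C X * C (invShift ((ε : ℂ) / 2)) * hy
    · linear_combination (-PowerSeries.map C X * PowerSeries.map C (invShift ((ε : ℂ) / 2))) * hx -
        C X * C (invShift ((ε : ℂ) / 2)) * hy + C X * PowerSeries.map C X *
          C (invShift ((ε : ℂ) / 2)) * PowerSeries.map C (invShift ((ε : ℂ) / 2)) * h2
  symm i j := by
    have hx := one_add_mul_invShift ((ε : ℂ) / 2)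
    have hr := congrArg (reflectHom ℂ) hx
    rw [map_mul, map_add, map_one, map_mul, reflectHom_C, reflectHom_X] at hr
    have hS : ∀ i j, reflectHom A (classicalMatrix ε F i j) = (if i = j then 1 else 0) +
        reflectHom ℂ (invShift ((ε : ℂ) / 2)) • C (F i j) := by
      intro i j
      rw [classicalMatrix, of_apply, map_add, reflectHom_smul, reflectHom_C]
      congr 1
      split_ifs <;> simp
    have e1 : (σ.e i * σ.e j) • (if i = j then (1 : A⟦X⟧) else 0) = if i = j then 1 else 0 := by
      split_ifs with h
      · rw [h, σ.e_mul, one_smul]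
      · rw [smul_zero]
    have e2 : σ.e i * σ.e j * (σ.e i * σ.e j) = 1 := by
      linear_combination σ.e j * σ.e j * σ.e_mul i + σ.e_mul j
    have q : (σ.ν j = σ.ν i) = (i = j) := propext (by rw [σ.ν_inj, eq_comm])
    rw [hS, hS, hF.symm, classicalMatrix, of_apply]
    simp only [q]
    rw [smul_add, e1, map_neg, map_zsmul, smul_neg, smul_neg, smul_comm (σ.e i * σ.e j), smul_smul (σ.e i * σ.e j), e2, one_smul]
    generalize invShift ((ε : ℂ) / 2) = κ at *
    generalize reflectHom ℂ κ = κ' at *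
    generalize (C (F i j) : A⟦X⟧) = f
    have e3 : -κ' = κ + C ((ε : ℂ) / 2) * X * (κ - κ') := by linear_combination -hr - hx
    rw [← neg_smul, e3, add_sub_add_left_eq_sub, ← sub_smul, smul_smul, add_assoc, ← add_smul]
  const i j := by
    have := coeff_classicalMatrix (ε := ε) F i j 0
    rw [coeff_zero_eq_constantCoeff_apply, coeff_zero_eq_constantCoeff_apply,
      constantCoeff_invShift, zero_smul, add_zero, if_pos rfl] at this
    exact this

section Equivariant

variable [Fintype ι]

/-- The matrix of `-F_{ab}` on the dual space, with integer entries. -/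
def actionMatrix (σ : SignedIndex ε ι) (B : Type*) [Ring B] (a b : ι) : Matrix ι ι B :=
  Matrix.of fun i j => (((if i = σ.ν a then if j = σ.ν b then σ.e a * σ.e b else 0 else 0) -
    if i = b then if j = a then 1 else 0 else 0 : ℤ) : B)

lemma IsClassical.mul_add_action {K B : Type*} [CommRing K] [Ring B] [Algebra K B]
    {σ : SignedIndex ε ι} {F : ι → ι → B} (hF : IsClassical σ F) {κ : K} {S : Matrix ι ι B}
    (hS : ∀ i j, S i j = (if i = j then 1 else 0) + κ • F i j) (a b i j : ι) :
    F a b * S i j + ∑ c, actionMatrix σ B a b i c * S c j =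
      S i j * F a b + ∑ c, S i c * actionMatrix σ B a b c j := by
  have h1 := hF.comm a b i j
  have q1 : (a = σ.ν i) = (i = σ.ν a) := propext σ.eq_ν_iff
  have q2 : (σ.ν j = b) = (j = σ.ν b) := propext (by rw [eq_comm, σ.eq_ν_iff])
  have q3 : (a = j) = (j = a) := propext eq_comm
  simp only [hS, actionMatrix, of_apply, Int.cast_sub, Int.cast_ite, Int.cast_zero,
    Int.cast_one, mul_add, add_mul, mul_sub, sub_mul,
    sum_add_distrib, sum_sub_distrib, ite_mul, mul_ite, zero_mul, mul_zero,
    mul_one, one_mul, sum_ite_eq, sum_ite_eq', mem_univ, if_true,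
    Finset.sum_ite_irrel, sum_const_zero]
  have e1 : ∀ y : B, (σ.e i * σ.e (σ.ν b)) • (if i = σ.ν a then y else 0) =
      (σ.e a * σ.e b) • (if i = σ.ν a then y else 0) := by
    intro y
    split_ifs with h
    · rw [h, σ.e_ν_eq, σ.e_ν_eq]
      congr 1
      linear_combination σ.e a * σ.e b * σ.ε_mul a
    · rw [smul_zero, smul_zero]
  have e2 : ∀ y : B, (σ.e a * σ.e (σ.ν j)) • (if j = σ.ν b then y else 0) =
      (σ.e a * σ.e b) • (if j = σ.ν b then y else 0) := by
    intro y
    split_ifs with h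
    · rw [h, σ.ν_ν]
    · rw [smul_zero, smul_zero]
  simp only [q1, q2, q3, e1, e2] at h1
  rw [← (Int.cast_commute _ (_ • F i (σ.ν a))).eq]
  simp only [← zsmul_eq_mul, smul_mul_assoc, mul_smul_comm]
  have hi : ∀ (p : Prop) [Decidable p] (y : B), (if p then y else 0) =
      (if p then (1 : K) else 0) • y := by
    intro p _ y
    split_ifs <;> simp
  simp only [hi] at h1 ⊢
  linear_combination (norm := skip) κ • h1
  simp only [zsmul_eq_mul, mul_smul_comm, mul_one]
  match_scalars <;> ring

lemma IsClassical.commute_seriesMinor {σ : SignedIndex ε ι} {F : ι → ι → A} (hF : IsClassical σ F)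
    {a b : ι} {n : ℕ} {r c : Fin n → ι} (hr : ∀ j, j = a ∨ j = σ.ν b → ∃ q, r q = j)
    (hc : ∀ j, j = b ∨ j = σ.ν a → ∃ q, c q = j)
    (hrc : ∑ p, actionMatrix σ A⟦X⟧ a b (r p) (r p) = ∑ p, actionMatrix σ A⟦X⟧ a b (c p) (c p)) (m : ℕ) :
    Commute (F a b) (coeff m (seriesMinor σ (classicalMatrix ε F) r c)) := by
  have key : Commute (C (F a b)) (seriesMinor σ (classicalMatrix ε F) r c) := by
    refine commute_minor (ρ := actionMatrix σ A⟦X⟧ a b) (fun i j y => ?_) (fun i j => ?_)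
      (fun p i j => ?_) two_ne_zero_series weight_succ_right weight_succ_left hF.isTwisted.quad_succ
      (fun p j hj => ?_) (fun p j hj => ?_) hrc
    · exact Int.cast_comm _ _
    · have q1 : (σ.ν j = b) = (j = σ.ν b) := propext (by rw [eq_comm, σ.eq_ν_iff])
      have q2 : (σ.ν i = a) = (i = σ.ν a) := propext (by rw [eq_comm, σ.eq_ν_iff])
      simp only [actionMatrix, of_apply, σ.ν_inj, q1, q2]
      rw [zsmul_eq_mul, ← Int.cast_mul, ← Int.cast_neg]
      congr 1
      have e2 : σ.e b * σ.e a * (σ.e a * σ.e b) = 1 := by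
        linear_combination σ.e b * σ.e b * σ.e_mul a + σ.e_mul b
      have e3 : ε * σ.e a * (ε * σ.e b) = σ.e a * σ.e b := by
        linear_combination σ.e a * σ.e b * σ.ε_mul a
      rw [mul_sub, neg_sub]
      congr 1
      · by_cases h1 : i = b <;> by_cases h2 : j = a <;> simp [h1, h2, e2]
      · by_cases h1 : i = σ.ν a <;> by_cases h2 : j = σ.ν b <;> simp [h1, h2, σ.e_ν_eq, e3]
    · refine (hF.map (C (R := A))).mul_add_action (κ := shiftHom ℂ (-(p : ℂ))
        (invShift ((ε : ℂ) / 2))) (fun i j => ?_) a b i j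
      rw [map_apply, classicalMatrix, of_apply, map_add, shiftHom_smul, shiftHom_C]
      congr 1
      split_ifs <;> simp
    · by_cases h : j = a ∨ j = σ.ν b
      · obtain ⟨q, rfl⟩ := hr j h
        exact .inr ⟨q, fun hq => hj (by rw [hq]), rfl⟩
      · push Not at h
        left
        simp [actionMatrix, h]
    · by_cases h : j = b ∨ j = σ.ν a
      · obtain ⟨q, rfl⟩ := hc j h
        exact .inr ⟨q, fun hq => hj (by rw [hq]), rfl⟩
      · push Not at h
        left
        simp [actionMatrix, h]
  have h := congrArg (coeff m) key.eq
  rwa [coeff_C_mul, coeff_mul_C] at h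

lemma mem_centralizer_blockAlg {F : ι → ι → A} {n : ℕ} {o : Fin n → ι} {x : A}
    (h : ∀ p q, Commute (F (o p) (o q)) x) :
    x ∈ Subalgebra.centralizer ℂ (blockAlg (classicalMatrix ε F) o : Set A) := by
  have h1 : blockAlg (classicalMatrix ε F) o ≤ Subalgebra.centralizer ℂ {x} := by
    refine Algebra.adjoin_le ?_
    rintro _ ⟨p, q, r, rfl⟩
    rw [coeff_classicalMatrix]
    refine Subalgebra.add_mem _ ?_ (Subalgebra.smul_mem _ ?_ _)
    · split_ifs
      exacts [Subalgebra.one_mem _, Subalgebra.zero_mem _, Subalgebra.zero_mem _]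
    · rw [Subalgebra.mem_centralizer_iff]
      rintro _ rfl
      exact (h p q).eq.symm
  rw [Subalgebra.mem_centralizer_iff]
  intro y hy
  exact ((Subalgebra.mem_centralizer_iff ℂ).1 (h1 hy) x rfl).symm

lemma IsClassical.isEquivariant {σ : SignedIndex ε ι} {F : ι → ι → A} (hF : IsClassical σ F) :
    IsEquivariant σ (classicalMatrix ε F) where
  principal {n o} ho hν := fun m => by
    refine mem_centralizer_blockAlg fun p q => hF.commute_seriesMinor ?_ ?_ rfl m
    · rintro _ (rfl | rfl)
      exacts [⟨p, rfl⟩, hν q]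
    · rintro _ (rfl | rfl)
      exacts [⟨q, rfl⟩, hν p]
  bordered {n o} ho hν i j hi hj := fun m => by
    refine mem_centralizer_blockAlg fun p q => hF.commute_seriesMinor ?_ ?_ ?_ m
    · rintro _ (rfl | rfl)
      · exact ⟨p.castSucc, by simp⟩
      · obtain ⟨q', hq⟩ := hν q
        exact ⟨q'.castSucc, by simp [hq]⟩
    · rintro _ (rfl | rfl)
      · exact ⟨q.castSucc, by simp⟩
      · obtain ⟨q', hq⟩ := hν p
        exact ⟨q'.castSucc, by simp [hq]⟩
    · have h0 : ∀ i, (∀ r, o r ≠ i) → actionMatrix σ A⟦X⟧ (o p) (o q) i i = 0 := by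
        intro i hi
        obtain ⟨p', hp⟩ := hν p
        have h1 : i ≠ σ.ν (o p) := by
          rw [← hp]
          exact (hi p').symm
        simp [actionMatrix, h1, (hi q).symm]
      rw [sum_univ_castSucc, sum_univ_castSucc]
      simp only [snoc_castSucc, snoc_last, h0 i hi, h0 j hj]

end Equivariant

section Degree

/-- The series whose coefficients have degrees bounded by their numbers. -/
noncomputable def degreeSeries (t : Kind) (N : ℕ) : Subring (U t N)⟦X⟧ where
  carrier := {a | ∀ r, coeff r a ∈ UFil t N r}
  mul_mem' ha hb r := by
    rw [coeff_mul]
    refine Submodule.sum_mem _ fun p hp => ?_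
    rw [← mem_antidiagonal.1 hp]
    exact UFil_mul t N (ha _) (hb _)
  one_mem' r := by
    rw [coeff_one]
    split_ifs
    · exact UFil_mono t N (Nat.zero_le r) (by rw [UFil, pow_zero]; exact Submodule.one_le.1 le_rfl)
    · exact Submodule.zero_mem _
  add_mem' ha hb r := Submodule.add_mem _ (ha r) (hb r)
  zero_mem' _ := Submodule.zero_mem _
  neg_mem' ha r := Submodule.neg_mem _ (ha r)

variable {t : Kind} {N : ℕ}

lemma smul_mem_degreeSeries {a : (U t N)⟦X⟧} (ha : a ∈ degreeSeries t N) (f : ℂ⟦X⟧) :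
    f • a ∈ degreeSeries t N := fun r => by
  rw [coeff_series_smul]
  refine Submodule.sum_mem _ fun p hp => Submodule.smul_mem _ _ (UFil_mono t N ?_ (ha _))
  rw [← mem_antidiagonal.1 hp]
  omega

lemma shift_mem_degreeSeries {a : (U t N)⟦X⟧} (ha : a ∈ degreeSeries t N) (c : ℂ) :
    shift c a ∈ degreeSeries t N := fun r => by
  rw [shift, coeff_mk]
  refine Submodule.sum_mem _ fun p hp => Submodule.smul_mem _ _ (UFil_mono t N ?_ (ha _))
  rw [mem_range] at hp
  omega

lemma fMatrix_mem_degreeSeries (i j : Idx N) : fMatrix t N i j ∈ degreeSeries t N := fun r => by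
  rw [fMatrix_eq, coeff_classicalMatrix]
  have h1 : (1 : U t N) ∈ UFil t N 0 := by rw [UFil, pow_zero]; exact Submodule.one_le.1 le_rfl
  refine Submodule.add_mem _ ?_ ?_
  · split_ifs
    exacts [UFil_mono t N (Nat.zero_le r) h1, Submodule.zero_mem _, Submodule.zero_mem _]
  · rcases r with _ | r
    · rw [coeff_zero_eq_constantCoeff_apply, constantCoeff_invShift, zero_smul]
      exact Submodule.zero_mem _
    · refine Submodule.smul_mem _ _ (UFil_mono t N (Nat.le_add_left 1 r) ?_)
      rw [UFil, pow_one]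
      exact Submodule.mem_sup_right ⟨F t i j, rfl⟩

lemma mul_mem_entries {R ι : Type*} [Ring R] [Fintype ι] (T : Subring R) {M N : Matrix ι ι R}
    (hM : ∀ a b, M a b ∈ T) (hN : ∀ a b, N a b ∈ T) (a b : ι) : (M * N) a b ∈ T := by
  rw [mul_apply]
  exact T.sum_mem fun c _ => T.mul_mem (hM _ _) (hN _ _)

lemma list_prod_mem_entries {R ι : Type*} [Ring R] [Fintype ι] [DecidableEq ι] (T : Subring R)
    {l : List (Matrix ι ι R)} (hl : ∀ M ∈ l, ∀ a b, M a b ∈ T) : ∀ a b, l.prod a b ∈ T := by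
  induction l with
  | nil =>
    intro a b
    rw [List.prod_nil, one_apply]
    split_ifs
    exacts [T.one_mem, T.zero_mem]
  | cons M l ih =>
    rw [List.prod_cons]
    exact mul_mem_entries T (hl M List.mem_cons_self) (ih fun M hM => hl M (List.mem_cons_of_mem _ hM))

lemma coeff_psiSeries_mem (t : Kind) (M k : ℕ) (i j : Idx M) (r : ℕ) :
    coeff r (psiSeries t M k i j) ∈ UFil t (M + 2 * k) r := by
  suffices h : psiSeries t M k i j ∈ degreeSeries t (M + 2 * k) from h r
  rw [psiSeries, toSeries_mul]
  refine smul_mem_degreeSeries (shift_mem_degreeSeries ?_ _) _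
  refine mul_mem_entries _ (fun a b => ?_) (list_prod_mem_entries _ fun L hL => ?_) _ _
  · rw [antiSymmetrizer, Matrix.sum_apply]
    refine Subring.sum_mem _ fun τ _ => ?_
    rw [of_apply]
    split_ifs
    exacts [intCast_mem _ _, Subring.zero_mem _]
  · obtain ⟨p, -, rfl⟩ := List.mem_map.1 hL
    refine mul_mem_entries _ (fun a b => ?_) (list_prod_mem_entries _ fun L hL => ?_)
    · rw [tensorS, of_apply]
      split_ifs
      exacts [shift_mem_degreeSeries (fMatrix_mem_degreeSeries _ _) _, Subring.zero_mem _]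
    · obtain ⟨q, -, rfl⟩ := List.mem_map.1 hL
      intro a b
      rw [tensorR, Matrix.add_apply, Matrix.smul_apply, smul_eq_mul, toSeries_mul]
      refine Subring.add_mem _ ?_ (smul_mem_degreeSeries ?_ _)
      · rw [one_apply]
        split_ifs
        exacts [Subring.one_mem _, Subring.zero_mem _]
      · rw [tensorQ, of_apply]
        split_ifs
        exacts [intCast_mem _ _, Subring.zero_mem _]

end Degree

end Classical

section Yangian

open PowerSeries

attribute [local instance 50] seriesAlgebra

variable {A : Type*} [Ring A] [Algebra ℂ A] {t : Kind} {M : ℕ}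

lemma IsTwisted.quad_eq {hM : t = .symplectic → Even M} {H : Matrix (Idx M) (Idx M) A⟦X⟧}
    (hH : IsTwisted (idxSigned t M hM) H) (i j k l : Idx M) :
    quadLHS H i j k l = quadRHS t H i j k l := by
  have h := hH.quad i j k l
  have e1 : PowerSeries.map (algebraMap ℂ⟦X⟧ A⟦X⟧) (inU X) = inU X := by
    rw [inU, inU, map_C]
    congr 1
    exact toSeries_X
  have e2 : PowerSeries.map (algebraMap ℂ⟦X⟧ A⟦X⟧) (inV X) = inV X := by
    rw [inV, inV, map_X, map_X, map_X]
  rw [show (inV X - inU X : ℂ⟦X⟧⟦X⟧) * (inU X + inV X) = inV X ^ 2 - inU X ^ 2 by ring,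
    show (inV X - inU X : ℂ⟦X⟧⟦X⟧) * (inU X * inV X) = inU X * inV X * (inV X - inU X) by ring,
    show (inU X * inV X : ℂ⟦X⟧⟦X⟧) * (inU X * inV X) = inU X ^ 2 * inV X ^ 2 by ring] at h
  simp only [series_smul_def, map_mul, map_sub, map_add, map_pow, e1, e2, zsmul_eq_mul,
    map_apply, ← theta_eq t hM] at h
  simp only [quadLHS, quadRHS]
  rw [mul_assoc _ (theta t i j.neg : A⟦X⟧⟦X⟧)]
  exact h

lemma IsTwisted.symm_eq {hM : t = .symplectic → Even M} {H : Matrix (Idx M) (Idx M) A⟦X⟧}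
    (hH : IsTwisted (idxSigned t M hM) H) (i j : Idx M) : symmLHS t H i j = symmRHS t H i j := by
  have h : pm t = (t.sgn : ℂ) := by cases t <;> simp [pm, Kind.sgn]
  simp only [symmLHS, symmRHS]
  rw [toSeries_mul, theta_eq t hM, ← zsmul_eq_mul, h]
  exact hH.symm i j

lemma map_quadLHS {B : Type*} [Ring B] (φ : A →+* B) (S : Idx M → Idx M → A⟦X⟧) (i j k l : Idx M) :
    PowerSeries.map (PowerSeries.map φ) (quadLHS S i j k l) =
      quadLHS (fun i j => PowerSeries.map φ (S i j)) i j k l := by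
  have hU : ∀ a : A⟦X⟧, PowerSeries.map (PowerSeries.map φ) (inU a) = inU (PowerSeries.map φ a) :=
    fun a => map_C _ _
  have hV : ∀ a : A⟦X⟧, PowerSeries.map (PowerSeries.map φ) (inV a) = inV (PowerSeries.map φ a) := by
    intro a
    ext n : 1
    rw [inV, inV, coeff_map, coeff_map, coeff_map, coeff_map, map_C]
  simp only [quadLHS, map_mul, map_sub, map_pow, hU, hV, map_X]

lemma map_quadRHS {B : Type*} [Ring B] (φ : A →+* B) (S : Idx M → Idx M → A⟦X⟧) (i j k l : Idx M) :
    PowerSeries.map (PowerSeries.map φ) (quadRHS t S i j k l) =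
      quadRHS t (fun i j => PowerSeries.map φ (S i j)) i j k l := by
  have hU : ∀ a : A⟦X⟧, PowerSeries.map (PowerSeries.map φ) (inU a) = inU (PowerSeries.map φ a) :=
    fun a => map_C _ _
  have hV : ∀ a : A⟦X⟧, PowerSeries.map (PowerSeries.map φ) (inV a) = inV (PowerSeries.map φ a) := by
    intro a
    ext n : 1
    rw [inV, inV, coeff_map, coeff_map, coeff_map, coeff_map, map_C]
  simp only [quadRHS, map_mul, map_sub, map_add, map_pow, hU, hV, map_X, map_intCast]

/-- The image of the generator of the twisted Yangian in an algebra with a matrix `H(u)`. -/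
noncomputable def freeLift (H : Matrix (Idx M) (Idx M) A⟦X⟧) : FreeAlgebra ℂ (Gen M) →ₐ[ℂ] A :=
  FreeAlgebra.lift ℂ fun x : Gen M => coeff (x.2.2 + 1) (H x.1 x.2.1)

lemma map_freeLift {H : Matrix (Idx M) (Idx M) A⟦X⟧}
    (hH : ∀ i j, constantCoeff (H i j) = if i = j then 1 else 0) (i j : Idx M) :
    PowerSeries.map (freeLift H : FreeAlgebra ℂ (Gen M) →+* A) (freeS i j) = H i j := by
  ext r
  rw [coeff_map, freeS, coeff_mk]
  rcases r with _ | r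
  · rw [coeff_zero_eq_constantCoeff_apply, hH]
    split_ifs
    exacts [map_one _, map_zero _]
  · exact FreeAlgebra.lift_ι_apply _ _

/-- A matrix which satisfies the defining relations gives a representation of the twisted Yangian. -/
lemma IsTwisted.exists_hom {hM : t = .symplectic → Even M} {H : Matrix (Idx M) (Idx M) A⟦X⟧}
    (hH : IsTwisted (idxSigned t M hM) H) : ∃ φ : Y t M →ₐ[ℂ] A, ∀ i j,
    PowerSeries.map (φ : Y t M →+* A) (sSeries t i j) = H i j := by
  have hrel : ∀ ⦃x y⦄, YRel t M x y → freeLift H x = freeLift H y := by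
    intro x y hxy
    have hf : (fun i j => PowerSeries.map (freeLift H : FreeAlgebra ℂ (Gen M) →+* A) (freeS i j)) = H :=
      funext fun i => funext fun j => map_freeLift hH.const i j
    cases hxy with
    | quad i j k l p q =>
      have h := hH.quad_eq i j k l
      rw [← hf, ← map_quadLHS, ← map_quadRHS] at h
      have h2 := congrArg (coeff p) (congrArg (coeff q) h)
      simp only [coeff_map] at h2
      exact h2
    | symm i j p =>
      have h := congrArg (coeff p) (hH.symm_eq i j)
      rw [← hf, symmLHS, symmRHS] at h
      have e : ∀ i j, reflect (PowerSeries.map (freeLift H : FreeAlgebra ℂ (Gen M) →+* A) (freeS i j)) =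
          PowerSeries.map (freeLift H : FreeAlgebra ℂ (Gen M) →+* A) (reflect (freeS i j)) :=
        fun i j => (map_reflectHom _ _).symm
      have e' : ∀ f, toSeries A f = PowerSeries.map (freeLift H : FreeAlgebra ℂ (Gen M) →+* A)
          (toSeries _ f) := fun f => by
        ext n
        simp [toSeries]
      simp only [e, e', ← map_sub, ← map_mul, ← map_add, ← map_intCast (PowerSeries.map
        (freeLift H : FreeAlgebra ℂ (Gen M) →+* A)), coeff_map] at h
      exact h
  refine ⟨RingQuot.liftAlgHom ℂ ⟨freeLift H, hrel⟩, fun i j => ?_⟩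
  rw [← map_freeLift hH.const]
  ext r
  rw [coeff_map, coeff_map, sSeries, coeff_map]
  exact RingQuot.liftAlgHom_mkAlgHom_apply ℂ _ hrel _

lemma adjoin_coeff_sSeries (t : Kind) (M : ℕ) :
    Algebra.adjoin ℂ {x | ∃ (i j : Idx M) (r : ℕ), x = coeff r (sSeries t i j)} = ⊤ := by
  rw [eq_top_iff]
  rintro x -
  obtain ⟨x, rfl⟩ := RingQuot.mkAlgHom_surjective ℂ (YRel t M) x
  induction x using FreeAlgebra.induction with
  | grade0 c =>
    rw [AlgHom.commutes]
    exact Subalgebra.algebraMap_mem _ c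
  | grade1 x =>
    refine Algebra.subset_adjoin ⟨x.1, x.2.1, x.2.2 + 1, ?_⟩
    rw [sSeries, coeff_map, freeS, coeff_mk]
    rfl
  | mul a b ha hb => rw [map_mul]; exact Subalgebra.mul_mem _ ha hb
  | add a b ha hb => rw [map_add]; exact Subalgebra.add_mem _ ha hb

variable (hM : t = .symplectic → Even M) (k : ℕ)

include hM in
lemma even_add : t = .symplectic → Even (M + 2 * k) := fun ht =>
  (hM ht).add (even_two_mul k)

lemma isTwisted_fMatrix (N : ℕ) (h : t = .symplectic → Even N) :
    IsTwisted (idxSigned t N h) (fMatrix t N) := by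
  rw [fMatrix_eq]
  exact (isClassical_FU h).isTwisted

lemma isEquivariant_fMatrix (N : ℕ) (h : t = .symplectic → Even N) :
    IsEquivariant (idxSigned t N h) (fMatrix t N) := by
  rw [fMatrix_eq]
  exact (isClassical_FU h).isEquivariant

lemma coeff_one_fMatrix {N : ℕ} (a b : Idx N) : coeff 1 (fMatrix t N a b) = FU t a b := by
  rw [fMatrix_eq, coeff_classicalMatrix, if_neg one_ne_zero, zero_add]
  have : coeff 1 (invShift ((t.sgn : ℂ) / 2)) = 1 := by
    exact (coeff_succ_X_mul 0 _).trans (by rw [coeff_mk, pow_zero])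
  rw [this, one_smul]

include hM in
/-- The series `psiSeries`, as the result of the elimination. -/
lemma Reduces.psiSeries_eq {H : Matrix (Idx M) (Idx M) (U t (M + 2 * k))⟦X⟧} {g : (U t (M + 2 * k))⟦X⟧}
    (hr : Reduces t (fMatrix t (M + 2 * k)) k M H g) (i j : Idx M) : psiSeries t M k i j = H i j :=
  hr.eq_minor (even_add hM k) (isTwisted_fMatrix _ _) (isEquivariant_fMatrix _ _) hM i j

include hM in
lemma exists_psi_reduces : ∃ H g, Reduces t (fMatrix t (M + 2 * k)) k M H g :=
  exists_reduces (even_add hM k) (isTwisted_fMatrix _ _) (isEquivariant_fMatrix _ _) k M rfl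

include hM in
lemma Reduces.coeff_mem_centralizerAlg {H : Matrix (Idx M) (Idx M) (U t (M + 2 * k))⟦X⟧}
    {g : (U t (M + 2 * k))⟦X⟧} (hr : Reduces t (fMatrix t (M + 2 * k)) k M H g) (r : ℕ) :
    (∀ i j, coeff r (H i j) ∈ centralizerAlg t M (M + 2 * k)) ∧
      coeff r g ∈ centralizerAlg t M (M + 2 * k) := by
  obtain ⟨-, -, h⟩ := hr.coeff_mem (even_add hM k) (isTwisted_fMatrix _ _)
    (isEquivariant_fMatrix _ _) hM
  simp only [centralizerAlg, Subalgebra.mem_centralizer_iff]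
  constructor
  · rintro i j _ ⟨a, b, ha, hb, rfl⟩
    rw [← coeff_one_fMatrix]
    exact (h a b ha hb 1).1 i j r
  · rintro _ ⟨a, b, ha, hb, rfl⟩
    rw [← coeff_one_fMatrix]
    exact (h a b ha hb 1).2 r

include hM in
lemma exists_isPsi : ∃ ψ : Y t M →ₐ[ℂ] centralizerAlg t M (M + 2 * k), IsPsi t M k ψ := by
  obtain ⟨H, g, hr⟩ := exists_psi_reduces hM k
  obtain ⟨hH, -⟩ := hr.coeff_mem (even_add hM k) (isTwisted_fMatrix _ _)
    (isEquivariant_fMatrix _ _) hM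
  obtain ⟨φ, hφ⟩ := hH.exists_hom
  have hmem : ∀ y, φ y ∈ centralizerAlg t M (M + 2 * k) := by
    intro y
    have hy : y ∈ Algebra.adjoin ℂ {x | ∃ (i j : Idx M) (r : ℕ), x = coeff r (sSeries t i j)} := by
      rw [adjoin_coeff_sSeries]
      exact Algebra.mem_top
    have hle : Algebra.adjoin ℂ {x | ∃ (i j : Idx M) (r : ℕ), x = coeff r (sSeries t i j)} ≤
        (centralizerAlg t M (M + 2 * k)).comap φ := by
      refine Algebra.adjoin_le ?_
      rintro _ ⟨i, j, r, rfl⟩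
      have := (hr.coeff_mem_centralizerAlg hM k r).1 i j
      rw [← hφ, coeff_map] at this
      exact this
    exact hle hy
  refine ⟨φ.codRestrict _ hmem, fun i j => ?_⟩
  rw [hr.psiSeries_eq hM, ← hφ]
  rfl

lemma IsPsi.coeff_eq {ψ : Y t M →ₐ[ℂ] centralizerAlg t M (M + 2 * k)} (h : IsPsi t M k ψ)
    (i j : Idx M) (r : ℕ) : (ψ (coeff r (sSeries t i j)) : U t (M + 2 * k)) =
      coeff r (psiSeries t M k i j) := by
  rw [← h, coeff_map]
  rfl

lemma IsPsi.unique {ψ ψ' : Y t M →ₐ[ℂ] centralizerAlg t M (M + 2 * k)} (h : IsPsi t M k ψ)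
    (h' : IsPsi t M k ψ') : ψ' = ψ := by
  refine AlgHom.ext_of_adjoin_eq_top (adjoin_coeff_sSeries t M) ?_
  rintro _ ⟨i, j, r, rfl⟩
  exact Subtype.ext (by rw [h.coeff_eq, h'.coeff_eq])

lemma IsPsi.bounded {ψ : ∀ k, Y t M →ₐ[ℂ] centralizerAlg t M (M + 2 * k)}
    (h : ∀ k, IsPsi t M k (ψ k)) (y : Y t M) :
    ∃ d, ∀ k, (ψ k y : U t (M + 2 * k)) ∈ UFil t (M + 2 * k) d := by
  have hy : y ∈ Algebra.adjoin ℂ {x | ∃ (i j : Idx M) (r : ℕ), x = coeff r (sSeries t i j)} := by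
    rw [adjoin_coeff_sSeries]
    exact Algebra.mem_top
  induction hy using Algebra.adjoin_induction with
  | mem x hx =>
    obtain ⟨i, j, r, rfl⟩ := hx
    exact ⟨r, fun k => by rw [(h k).coeff_eq]; exact coeff_psiSeries_mem t M k i j r⟩
  | algebraMap c =>
    refine ⟨0, fun k => ?_⟩
    rw [AlgHom.commutes, UFil, pow_zero]
    exact Submodule.algebraMap_mem c
  | add x y _ _ hx hy =>
    obtain ⟨d, hd⟩ := hx
    obtain ⟨e, he⟩ := hy
    refine ⟨max d e, fun k => ?_⟩
    rw [map_add]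
    exact Submodule.add_mem _ (UFil_mono t _ (le_max_left d e) (hd k))
      (UFil_mono t _ (le_max_right d e) (he k))
  | mul x y _ _ hx hy =>
    obtain ⟨d, hd⟩ := hx
    obtain ⟨e, he⟩ := hy
    refine ⟨d + e, fun k => ?_⟩
    rw [map_mul]
    exact UFil_mul t _ (hd k) (he k)

end Yangian

section VectorFields

open MvPolynomial

attribute [local instance 100] LieRing.ofAssociativeRing

lemma derivation_C_mul_apply {σ : Type*}
    (D : Derivation ℂ (MvPolynomial σ ℂ) (MvPolynomial σ ℂ)) (c : ℂ) (p : MvPolynomial σ ℂ) :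
    D (C c * p) = C c * D p := by
  rw [C_mul', D.map_smul, C_mul']

lemma adjoin_range_ι_env (L : Type*) [LieRing L] [LieAlgebra ℂ L] : Algebra.adjoin ℂ
    (Set.range (UniversalEnvelopingAlgebra.ι ℂ : L → UniversalEnvelopingAlgebra ℂ L)) = ⊤ := by
  have h1 : Function.Surjective (UniversalEnvelopingAlgebra.mkAlgHom ℂ L) :=
    RingCon.mk'_surjective _
  rw [← (AlgHom.range_eq_top _).2 h1, ← Algebra.map_top, ← TensorAlgebra.adjoin_range_ι,
    AlgHom.map_adjoin, ← Set.range_comp]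
  rfl

section Rep

variable {L σ : Type*} [LieRing L] [LieAlgebra ℂ L] (v : L →ₗ[ℂ] σ → MvPolynomial σ ℂ)
  (hv : ∀ X Y s, mkDerivation ℂ (v X) (v Y s) - mkDerivation ℂ (v Y) (v X s) = v ⁅X, Y⁆ s)

/-- The action of a universal enveloping algebra on polynomials by polynomial vector fields. -/
noncomputable def polyRep : UniversalEnvelopingAlgebra ℂ L →ₐ[ℂ] Module.End ℂ (MvPolynomial σ ℂ) :=
  UniversalEnvelopingAlgebra.lift ℂ
    { toFun := fun X => (mkDerivation ℂ (v X) : MvPolynomial σ ℂ →ₗ[ℂ] MvPolynomial σ ℂ)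
      map_add' := fun X Y => by
        have h : mkDerivation ℂ (v (X + Y)) = mkDerivation ℂ (v X) + mkDerivation ℂ (v Y) :=
          derivation_ext fun s => by simp
        rw [h]
        rfl
      map_smul' := fun c X => by
        have h : mkDerivation ℂ (v (c • X)) = c • mkDerivation ℂ (v X) :=
          derivation_ext fun s => by simp
        rw [h]
        rfl
      map_lie' := fun {X Y} => by
        have h : mkDerivation ℂ (v ⁅X, Y⁆) = ⁅mkDerivation ℂ (v X), mkDerivation ℂ (v Y)⁆ := by
          refine derivation_ext fun s => ?_
          rw [Derivation.commutator_apply, mkDerivation_X, mkDerivation_X, mkDerivation_X, hv]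
        change ((mkDerivation ℂ (v ⁅X, Y⁆) : MvPolynomial σ ℂ →ₗ[ℂ] MvPolynomial σ ℂ)) = _
        rw [h]
        rfl }

lemma polyRep_ι (X : L) (p : MvPolynomial σ ℂ) :
    polyRep v hv (UniversalEnvelopingAlgebra.ι ℂ X) p = mkDerivation ℂ (v X) p := by
  rw [polyRep, UniversalEnvelopingAlgebra.lift_ι_apply]
  rfl

end Rep

variable {ι : Type*} [Fintype ι] [DecidableEq ι] (L : LieSubalgebra ℂ (Matrix ι ι ℂ)) (κ : Type*)

/-- The left-invariant vector fields on matrices. -/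
noncomputable def affineField : L →ₗ[ℂ] κ × ι → MvPolynomial (κ × ι) ℂ where
  toFun Z s := ∑ k, C ((Z : Matrix ι ι ℂ) k s.2) * X (s.1, k)
  map_add' Y Z := by
    funext s
    change ∑ k, C ((Y : Matrix ι ι ℂ) k s.2 + (Z : Matrix ι ι ℂ) k s.2) * X (s.1, k) = _
    simp only [map_add, add_mul, sum_add_distrib, Pi.add_apply]
  map_smul' c Z := by
    funext s
    change ∑ k, C (c * (Z : Matrix ι ι ℂ) k s.2) * X (s.1, k) = _
    simp only [map_mul, mul_assoc, RingHom.id_apply, Pi.smul_apply, ← C_mul', mul_sum]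

lemma affineField_lie (Y Z : L) (s : κ × ι) :
    mkDerivation ℂ (affineField L κ Y) (affineField L κ Z s) -
      mkDerivation ℂ (affineField L κ Z) (affineField L κ Y s) = affineField L κ ⁅Y, Z⁆ s := by
  have key : ∀ Y Z : L, mkDerivation ℂ (affineField L κ Y) (affineField L κ Z s) =
      ∑ l, C (((Y : Matrix ι ι ℂ) * (Z : Matrix ι ι ℂ)) l s.2) * X (s.1, l) := by
    intro Y Z
    simp only [affineField, LinearMap.coe_mk, AddHom.coe_mk, map_sum, derivation_C_mul_apply,
      mkDerivation_X, mul_apply, mul_sum, sum_mul, map_mul]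
    rw [sum_comm]
    refine sum_congr rfl fun l _ => sum_congr rfl fun k _ => ?_
    ring
  rw [key, key, ← sum_sub_distrib]
  refine sum_congr rfl fun l _ => ?_
  rw [← sub_mul, ← map_sub, LieSubalgebra.coe_bracket, LieRing.of_associative_ring_bracket]
  rfl

/-- The action of the enveloping algebra by differential operators on matrices. -/
noncomputable def affineRep :
    UniversalEnvelopingAlgebra ℂ L →ₐ[ℂ] Module.End ℂ (MvPolynomial (κ × ι) ℂ) :=
  polyRep (affineField L κ) (affineField_lie L κ)

section Faithful

/-- Evaluation at the identity matrix. -/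
noncomputable def evalOne (ι : Type*) [DecidableEq ι] : MvPolynomial (ι × ι) ℂ →ₐ[ℂ] ℂ :=
  aeval fun s => if s.1 = s.2 then 1 else 0

/-- The ideal of the identity matrix. -/
noncomputable def idealOne (ι : Type*) [DecidableEq ι] : Ideal (MvPolynomial (ι × ι) ℂ) :=
  RingHom.ker (evalOne ι)

lemma derivation_mem_pow (D : Derivation ℂ (MvPolynomial (ι × ι) ℂ) (MvPolynomial (ι × ι) ℂ))
    (I : Ideal (MvPolynomial (ι × ι) ℂ)) (k : ℕ) {p : MvPolynomial (ι × ι) ℂ} (hp : p ∈ I ^ (k + 1)) :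
    D p ∈ I ^ k := by
  induction k generalizing p with
  | zero => simp
  | succ k ih =>
    rw [pow_succ] at hp
    refine Submodule.mul_induction_on hp (fun a ha b hb => ?_) fun a b ha hb => ?_
    · rw [D.leibniz, smul_eq_mul, smul_eq_mul, mul_comm b]
      refine Ideal.add_mem _ (Ideal.mul_mem_right _ _ ha) ?_
      rw [pow_succ]
      exact Ideal.mul_mem_mul (ih ha) hb
    · rw [map_add]
      exact Ideal.add_mem _ ha hb

/-- The canonical filtration. -/
noncomputable def envFil (d : ℕ) : Submodule ℂ (UniversalEnvelopingAlgebra ℂ L) :=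
  (1 ⊔ LinearMap.range (UniversalEnvelopingAlgebra.ι ℂ : L →ₗ⁅ℂ⁆ _).toLinearMap) ^ d

variable {L}

lemma affineRep_mem_pow {e : ℕ} {w : UniversalEnvelopingAlgebra ℂ L} (hw : w ∈ envFil L e) (k : ℕ)
    {p : MvPolynomial (ι × ι) ℂ} (hp : p ∈ idealOne ι ^ (k + e)) :
    affineRep L ι w p ∈ idealOne ι ^ k := by
  induction e generalizing w p with
  | zero =>
    rw [envFil, pow_zero] at hw
    obtain ⟨c, rfl⟩ := Submodule.mem_one.1 hw
    rw [AlgHom.commutes, Module.algebraMap_end_apply, smul_eq_C_mul]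
    exact Ideal.mul_mem_left _ _ hp
  | succ e ih =>
    rw [envFil, pow_succ] at hw
    refine Submodule.mul_induction_on hw (fun a ha b hb => ?_) fun a b ha hb => ?_
    · rw [map_mul, Module.End.mul_apply]
      refine ih ha ?_
      obtain ⟨b₁, hb₁, _, ⟨Z, rfl⟩, rfl⟩ := Submodule.mem_sup.1 hb
      obtain ⟨c, rfl⟩ := Submodule.mem_one.1 hb₁
      rw [map_add, AlgHom.commutes, LinearMap.add_apply, Module.algebraMap_end_apply, smul_eq_C_mul]
      refine Ideal.add_mem _ (Ideal.mul_mem_left _ _ (Ideal.pow_le_pow_right (by omega) hp)) ?_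
      change polyRep _ _ (UniversalEnvelopingAlgebra.ι ℂ Z) p ∈ _
      rw [polyRep_ι]
      exact derivation_mem_pow _ _ _ hp
    · rw [map_add, LinearMap.add_apply]
      exact Ideal.add_mem _ ha hb

/-- A linear form on matrices, as a function vanishing at the identity. -/
noncomputable def linearFunction (ℓ : Matrix ι ι ℂ →ₗ[ℂ] ℂ) : MvPolynomial (ι × ι) ℂ :=
  ∑ s : ι × ι, C (ℓ (Matrix.single s.1 s.2 1)) * (X s - if s.1 = s.2 then 1 else 0)

lemma linearFunction_mem (ℓ : Matrix ι ι ℂ →ₗ[ℂ] ℂ) : linearFunction ℓ ∈ idealOne ι := by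
  rw [idealOne, RingHom.mem_ker, linearFunction, map_sum]
  refine sum_eq_zero fun s _ => ?_
  rw [map_mul, map_sub, evalOne, aeval_X]
  split_ifs <;> simp

lemma derivation_linearFunction (ℓ : Matrix ι ι ℂ →ₗ[ℂ] ℂ) (Z : L) :
    mkDerivation ℂ (affineField L ι Z) (linearFunction ℓ) - C (ℓ (Z : Matrix ι ι ℂ)) ∈ idealOne ι := by
  rw [idealOne, RingHom.mem_ker, map_sub, linearFunction, map_sum, map_sum, sub_eq_zero]
  have h1 : (Z : Matrix ι ι ℂ) = ∑ s : ι × ι, (Z : Matrix ι ι ℂ) s.1 s.2 • Matrix.single s.1 s.2 1 := by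
    rw [Fintype.sum_prod_type]
    conv_lhs => rw [Matrix.matrix_eq_sum_single (Z : Matrix ι ι ℂ)]
    simp
  conv_rhs => rw [h1, map_sum]
  rw [evalOne, algHom_C, Algebra.algebraMap_self_apply]
  refine sum_congr rfl fun s _ => ?_
  rw [map_smul, derivation_C_mul_apply, map_mul, algHom_C, Algebra.algebraMap_self_apply, map_sub,
    mkDerivation_X, smul_eq_mul, mul_comm]
  congr 1
  have h2 : mkDerivation ℂ (affineField L ι Z) (if s.1 = s.2 then 1 else 0) = 0 := by
    split_ifs <;> simp
  rw [h2, sub_zero]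
  simp [affineField]

lemma affineRep_list (ℓ : Matrix ι ι ℂ →ₗ[ℂ] ℂ) (d : ℕ) (l : List L) (hl : l.length ≤ d) :
    affineRep L ι (l.map (UniversalEnvelopingAlgebra.ι ℂ)).prod (linearFunction ℓ ^ d) -
      C ((d.descFactorial l.length : ℂ) * (l.map fun Z : L => ℓ (Z : Matrix ι ι ℂ)).prod) *
        linearFunction ℓ ^ (d - l.length) ∈ idealOne ι ^ (d - l.length + 1) := by
  induction l with
  | nil => simp
  | cons Z l ih =>
    rw [List.length_cons] at hl ⊢
    obtain ⟨e, he⟩ : ∃ e, d - l.length = e + 1 := ⟨d - l.length - 1, by omega⟩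
    have h1 := ih (by omega)
    rw [he] at h1
    have h2 := derivation_mem_pow (mkDerivation ℂ (affineField L ι Z)) _ _ h1
    rw [show d - (l.length + 1) = e by omega, List.map_cons, List.map_cons, List.prod_cons,
      List.prod_cons, map_mul, Module.End.mul_apply, Nat.descFactorial_succ, he]
    have h3 : ∀ p, affineRep L ι (UniversalEnvelopingAlgebra.ι ℂ Z) p =
        mkDerivation ℂ (affineField L ι Z) p := polyRep_ι _ _ Z
    rw [h3]
    rw [map_sub, derivation_C_mul_apply, Derivation.leibniz_pow, Nat.add_sub_cancel] at h2
    have h4 := Ideal.mul_mem_left _ (C ((d.descFactorial l.length : ℂ) *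
      (l.map fun Z : L => ℓ (Z : Matrix ι ι ℂ)).prod) * ((e + 1 : ℕ) : MvPolynomial (ι × ι) ℂ))
      (Ideal.mul_mem_mul (Ideal.pow_mem_pow (linearFunction_mem ℓ) e) (derivation_linearFunction ℓ Z))
    rw [← pow_succ] at h4
    convert Ideal.add_mem _ h2 h4 using 1
    simp only [nsmul_eq_mul, smul_eq_mul, map_mul, map_natCast, Nat.cast_mul]
    ring

lemma envFil_mul {d e : ℕ} {x y : UniversalEnvelopingAlgebra ℂ L} (hx : x ∈ envFil L d)
    (hy : y ∈ envFil L e) : x * y ∈ envFil L (d + e) := by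
  rw [envFil, pow_add]
  exact Submodule.mul_mem_mul hx hy

lemma envFil_mono : Monotone (envFil L) := fun _ _ h => pow_le_pow_right' le_sup_left h

lemma ι_mem_envFil (Z : L) : UniversalEnvelopingAlgebra.ι ℂ Z ∈ envFil L 1 := by
  rw [envFil, pow_one]
  exact Submodule.mem_sup_right ⟨Z, rfl⟩

lemma list_prod_mem_envFil (l : List L) :
    (l.map (UniversalEnvelopingAlgebra.ι ℂ)).prod ∈ envFil L l.length := by
  induction l with
  | nil =>
    rw [envFil, List.length_nil, pow_zero]
    exact Submodule.one_le.1 le_rfl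
  | cons Z l ih =>
    rw [List.map_cons, List.prod_cons, List.length_cons, add_comm]
    exact envFil_mul (ι_mem_envFil Z) ih

lemma list_perm_sub_mem {l l' : List L} (h : l.Perm l') :
    (l.map (UniversalEnvelopingAlgebra.ι ℂ)).prod - (l'.map (UniversalEnvelopingAlgebra.ι ℂ)).prod ∈
      envFil L (l.length - 1) := by
  induction h with
  | nil => simp
  | @cons Z l l' h ih =>
    rcases l with _ | ⟨Y, l⟩
    · rw [h.nil_eq]
      simp
    · rw [List.map_cons, List.prod_cons, List.map_cons (l := l'), List.prod_cons, ← mul_sub]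
      have h1 := envFil_mul (ι_mem_envFil Z) ih
      simpa [add_comm] using h1
  | swap Y Z l =>
    simp only [List.map_cons, List.prod_cons, ← mul_assoc, ← sub_mul]
    have h1 := envFil_mul (ι_mem_envFil ⁅Z, Y⁆) (list_prod_mem_envFil l)
    rw [LieHom.map_lie, LieRing.of_associative_ring_bracket] at h1
    simpa [add_comm] using h1
  | @trans l₁ l₂ l₃ h₁ h₂ ih₁ ih₂ =>
    rw [← h₁.length_eq] at ih₂
    simpa using Submodule.add_mem _ ih₁ ih₂

/-- The ordered monomials in the elements of a basis. -/
noncomputable def orderedMonomial {J : Type*} (b : J → L) (f : J →₀ ℕ) :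
    UniversalEnvelopingAlgebra ℂ L :=
  ((f.toMultiset.toList.map b).map (UniversalEnvelopingAlgebra.ι ℂ)).prod

lemma envFil_le_span {J : Type*} (b : Module.Basis J ℂ L) (d : ℕ) :
    envFil L d ≤ Submodule.span ℂ {x | ∃ l : List J, l.length ≤ d ∧
      x = ((l.map b).map (UniversalEnvelopingAlgebra.ι ℂ)).prod} := by
  induction d with
  | zero =>
    rw [envFil, pow_zero, Submodule.one_eq_span, Submodule.span_singleton_le_iff_mem]
    exact Submodule.subset_span ⟨[], le_rfl, by simp⟩
  | succ d ih =>
    have h1 : (1 ⊔ LinearMap.range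
        (UniversalEnvelopingAlgebra.ι ℂ : L →ₗ⁅ℂ⁆ UniversalEnvelopingAlgebra ℂ L).toLinearMap) ≤
        Submodule.span ℂ {x | ∃ l : List J, l.length ≤ 1 ∧
          x = ((l.map b).map (UniversalEnvelopingAlgebra.ι ℂ)).prod} := by
      refine sup_le ?_ ?_
      · rw [Submodule.one_eq_span, Submodule.span_singleton_le_iff_mem]
        exact Submodule.subset_span ⟨[], by simp, by simp⟩
      · rw [LinearMap.range_eq_map, ← b.span_eq, Submodule.map_span, Submodule.span_le]
        rintro _ ⟨_, ⟨j, rfl⟩, rfl⟩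
        exact Submodule.subset_span ⟨[j], by simp, by simp⟩
    rw [envFil, pow_succ]
    refine (mul_le_mul' ih h1).trans ?_
    rw [Submodule.span_mul_span, Submodule.span_le]
    rintro _ ⟨_, ⟨l, hl, rfl⟩, _, ⟨l', hl', rfl⟩, rfl⟩
    refine Submodule.subset_span ⟨l ++ l', ?_, by simp⟩
    rw [List.length_append]
    omega

lemma envFil_succ_le {J : Type*} (b : Module.Basis J ℂ L) (d : ℕ) :
    envFil L (d + 1) ≤
      Submodule.span ℂ (orderedMonomial b '' {f | f.toMultiset.card = d + 1}) ⊔ envFil L d := by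
  classical
  refine (envFil_le_span b (d + 1)).trans (Submodule.span_le.2 ?_)
  rintro _ ⟨l, hl, rfl⟩
  rcases Nat.lt_or_ge l.length (d + 1) with h | h
  · refine Submodule.mem_sup_right (envFil_mono (show (l.map b).length ≤ d by simpa using by omega) ?_)
    exact list_prod_mem_envFil _
  · have hp : l.Perm (Multiset.toFinsupp (l : Multiset J)).toMultiset.toList := by
      rw [Multiset.toFinsupp_toMultiset]
      exact (Multiset.coe_eq_coe.1 (Multiset.coe_toList _)).symm
    have h1 := list_perm_sub_mem (hp.map b)
    rw [List.length_map, show l.length - 1 = d by omega] at h1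
    rw [← sub_add_cancel ((l.map b).map (UniversalEnvelopingAlgebra.ι ℂ)).prod]
    refine Submodule.add_mem _ (Submodule.mem_sup_right h1)
      (Submodule.mem_sup_left (Submodule.subset_span ⟨Multiset.toFinsupp (l : Multiset J), ?_, rfl⟩))
    change Multiset.card _ = _
    rw [Multiset.toFinsupp_toMultiset, Multiset.coe_card]
    omega

lemma affineRep_orderedMonomial {J : Type*} (b : J → L) (ℓ : Matrix ι ι ℂ →ₗ[ℂ] ℂ) (f : J →₀ ℕ)
    (d : ℕ) (hf : f.toMultiset.card = d) :
    evalOne ι (affineRep L ι (orderedMonomial b f) (linearFunction ℓ ^ d)) =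
      d.factorial * f.prod fun j e => ℓ (b j : Matrix ι ι ℂ) ^ e := by
  have h1 := affineRep_list ℓ d (f.toMultiset.toList.map b) (by simp [hf])
  rw [List.length_map, Multiset.length_toList, hf, Nat.sub_self, pow_zero, mul_one, zero_add, pow_one,
    idealOne, RingHom.mem_ker, map_sub, sub_eq_zero] at h1
  refine h1.trans ?_
  rw [evalOne, algHom_C, Algebra.algebraMap_self_apply, Nat.descFactorial_self, List.map_map,
    ← Multiset.prod_coe, ← Multiset.map_coe, Multiset.coe_toList, Finsupp.toMultiset_map,
    Finsupp.prod_toMultiset, Finsupp.prod_mapDomain_index (fun _ => pow_zero _) fun _ _ _ => pow_add _ _ _]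
  rfl

lemma mem_envFil_of_affineRep_eq_zero {d : ℕ} {z : UniversalEnvelopingAlgebra ℂ L}
    (hz : z ∈ envFil L (d + 1)) (h0 : affineRep L ι z = 0) : z ∈ envFil L d := by
  let b := Module.finBasis ℂ L
  obtain ⟨y, hy, w, hw, rfl⟩ := Submodule.mem_sup.1 (envFil_succ_le b d hz)
  obtain ⟨c, hc, rfl⟩ := (Finsupp.mem_span_image_iff_linearCombination ℂ).1 hy
  suffices hc0 : c = 0 by
    rw [hc0, map_zero, zero_add]
    exact hw
  rw [Finsupp.mem_supported] at hc
  have hP : (c.sum fun f a => monomial f a : MvPolynomial (Fin (Module.finrank ℂ L)) ℂ) = 0 := by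
    refine MvPolynomial.funext fun v => ?_
    obtain ⟨ℓ, hℓ⟩ := LinearMap.exists_extend (p := L.toSubmodule) (b.constr ℂ v)
    have hℓ' : ∀ j, ℓ (b j : Matrix ι ι ℂ) = v j := fun j => by
      rw [← b.constr_basis ℂ v j, ← hℓ]
      rfl
    have h1 : evalOne ι (affineRep L ι (Finsupp.linearCombination ℂ (orderedMonomial b) c + w)
        (linearFunction ℓ ^ (d + 1))) = 0 := by
      rw [h0, LinearMap.zero_apply, map_zero]
    have h2 : evalOne ι (affineRep L ι w (linearFunction ℓ ^ (d + 1))) = 0 := by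
      have h3 := affineRep_mem_pow hw 1 (p := linearFunction ℓ ^ (d + 1))
        (by rw [add_comm]; exact Ideal.pow_mem_pow (linearFunction_mem ℓ) _)
      rw [pow_one] at h3
      exact h3
    rw [map_add, LinearMap.add_apply, map_add, h2, add_zero, Finsupp.linearCombination_apply,
      Finsupp.sum, map_sum, LinearMap.sum_apply, map_sum] at h1
    have h3 : ((d + 1).factorial : ℂ) ≠ 0 := by exact_mod_cast Nat.factorial_ne_zero _
    rw [map_zero, Finsupp.sum, map_sum]
    refine (mul_eq_zero.1 (Eq.trans ?_ h1)).resolve_left h3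
    rw [mul_sum]
    refine sum_congr rfl fun f hf => ?_
    rw [map_smul, LinearMap.smul_apply, map_smul, affineRep_orderedMonomial b ℓ f (d + 1) (hc hf),
      eval_monomial, smul_eq_mul]
    simp only [hℓ']
    ring
  ext f
  have h4 := congrArg (coeff f) hP
  rw [coeff_zero, Finsupp.sum, coeff_sum] at h4
  simp only [coeff_monomial, sum_ite_eq'] at h4
  by_cases hf : f ∈ c.support
  · rwa [if_pos hf] at h4
  · exact Finsupp.notMem_support_iff.1 hf

lemma exists_mem_envFil (z : UniversalEnvelopingAlgebra ℂ L) : ∃ d, z ∈ envFil L d := by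
  have h : z ∈ Algebra.adjoin ℂ
      (Set.range (UniversalEnvelopingAlgebra.ι ℂ : L → UniversalEnvelopingAlgebra ℂ L)) := by
    rw [adjoin_range_ι_env]
    trivial
  induction h using Algebra.adjoin_induction with
  | mem x hx =>
    obtain ⟨Z, rfl⟩ := hx
    exact ⟨1, ι_mem_envFil Z⟩
  | algebraMap r =>
    refine ⟨0, ?_⟩
    rw [envFil, pow_zero]
    exact Submodule.algebraMap_mem r
  | add x y _ _ hx hy =>
    obtain ⟨d, hd⟩ := hx
    obtain ⟨e, he⟩ := hy
    exact ⟨max d e, Submodule.add_mem _ (envFil_mono (le_max_left d e) hd)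
      (envFil_mono (le_max_right d e) he)⟩
  | mul x y _ _ hx hy =>
    obtain ⟨d, hd⟩ := hx
    obtain ⟨e, he⟩ := hy
    exact ⟨d + e, envFil_mul hd he⟩

/-- The enveloping algebra of a linear Lie algebra acts faithfully on the polynomials in the matrix
entries. -/
lemma affineRep_injective : Function.Injective (affineRep L ι) := by
  refine (injective_iff_map_eq_zero _).2 fun z h0 => ?_
  obtain ⟨d, hd⟩ := exists_mem_envFil z
  induction d with
  | zero =>
    rw [envFil, pow_zero] at hd
    obtain ⟨c, rfl⟩ := Submodule.mem_one.1 hd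
    have h1 := congrArg (evalOne ι) (LinearMap.congr_fun h0 1)
    rw [AlgHom.commutes, Module.algebraMap_end_apply, map_smul, map_one, LinearMap.zero_apply, map_zero,
      smul_eq_mul, mul_one] at h1
    rw [h1, map_zero]
  | succ d ih => exact ih (mem_envFil_of_affineRep_eq_zero hd h0)

end Faithful

end VectorFields

section ProjectiveFields

open MvPolynomial

attribute [local instance 100] LieRing.ofAssociativeRing

variable {ι : Type*} [Fintype ι] [DecidableEq ι] (κ : Type*) (o : ι)

/-- The inhomogeneous coordinates on a projective space, the coordinate numbered by `o` being `1`. -/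
noncomputable def projCoord (j : ι) : MvPolynomial ((κ × ι) ⊕ ι) ℂ := if j = o then 1 else X (Sum.inr j)

/-- The linear combination of inhomogeneous coordinates given by a column of a matrix. -/
noncomputable def projColumn (Z : Matrix ι ι ℂ) (j : ι) : MvPolynomial ((κ × ι) ⊕ ι) ℂ :=
  ∑ k, C (Z k j) * projCoord κ o k

variable (L : LieSubalgebra ℂ (Matrix ι ι ℂ))

/-- The vector fields on the product of a matrix space and a projective space. -/
noncomputable def projField : L →ₗ[ℂ] (κ × ι) ⊕ ι → MvPolynomial ((κ × ι) ⊕ ι) ℂ where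
  toFun Z := Sum.elim (fun s => ∑ k, C ((Z : Matrix ι ι ℂ) k s.2) * X (Sum.inl (s.1, k)))
    fun j => projColumn κ o Z j - projColumn κ o Z o * projCoord κ o j
  map_add' Y Z := by
    have h : ∀ j, projColumn κ o ((Y + Z : L) : Matrix ι ι ℂ) j =
        projColumn κ o Y j + projColumn κ o Z j := fun j => by
      change ∑ k, C ((Y : Matrix ι ι ℂ) k j + (Z : Matrix ι ι ℂ) k j) * projCoord κ o k = _
      simp only [map_add, add_mul, sum_add_distrib, projColumn]
    funext s
    rcases s with s | j
    · change ∑ k, C ((Y : Matrix ι ι ℂ) k s.2 + (Z : Matrix ι ι ℂ) k s.2) * X (Sum.inl (s.1, k)) = _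
      simp only [map_add, add_mul, sum_add_distrib, Pi.add_apply, Sum.elim_inl]
    · simp only [Sum.elim_inr, h, Pi.add_apply]
      ring
  map_smul' c Z := by
    have h : ∀ j, projColumn κ o ((c • Z : L) : Matrix ι ι ℂ) j = c • projColumn κ o Z j := fun j => by
      change ∑ k, C (c * (Z : Matrix ι ι ℂ) k j) * projCoord κ o k = _
      simp only [map_mul, mul_assoc, ← C_mul', mul_sum, projColumn]
    funext s
    rcases s with s | j
    · change ∑ k, C (c * (Z : Matrix ι ι ℂ) k s.2) * X (Sum.inl (s.1, k)) = _
      simp only [map_mul, mul_assoc, RingHom.id_apply, Pi.smul_apply, ← C_mul', mul_sum,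
        Sum.elim_inl]
    · simp only [Sum.elim_inr, h, Pi.smul_apply, RingHom.id_apply, smul_sub, smul_mul_assoc]

variable {L}

lemma projField_projCoord (Z : L) (j : ι) :
    mkDerivation ℂ (projField κ o L Z) (projCoord κ o j) =
      projColumn κ o Z j - projColumn κ o Z o * projCoord κ o j := by
  rw [projCoord]
  split_ifs with h
  · rw [h, mul_one, sub_self, Derivation.map_one_eq_zero]
  · rw [mkDerivation_X]
    simp [projField, projCoord, h]

lemma projField_projColumn (Y : L) (Z : Matrix ι ι ℂ) (j : ι) :
    mkDerivation ℂ (projField κ o L Y) (projColumn κ o Z j) =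
      projColumn κ o ((Y : Matrix ι ι ℂ) * Z) j - projColumn κ o Y o * projColumn κ o Z j := by
  rw [projColumn, map_sum]
  simp only [derivation_C_mul_apply, projField_projCoord, mul_sub, sum_sub_distrib]
  congr 1
  · simp only [projColumn, mul_apply, map_sum, map_mul, mul_sum, sum_mul]
    rw [sum_comm]
    refine sum_congr rfl fun l _ => sum_congr rfl fun k _ => ?_
    ring
  · simp only [projColumn, mul_sum]
    refine sum_congr rfl fun l _ => ?_
    ring

lemma projField_lie (Y Z : L) (s : (κ × ι) ⊕ ι) :
    mkDerivation ℂ (projField κ o L Y) (projField κ o L Z s) -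
      mkDerivation ℂ (projField κ o L Z) (projField κ o L Y s) = projField κ o L ⁅Y, Z⁆ s := by
  rcases s with s | j
  · have key : ∀ Y Z : L, mkDerivation ℂ (projField κ o L Y) (projField κ o L Z (Sum.inl s)) =
        ∑ l, C (((Y : Matrix ι ι ℂ) * (Z : Matrix ι ι ℂ)) l s.2) * X (Sum.inl (s.1, l)) := by
      intro Y Z
      simp only [projField, LinearMap.coe_mk, AddHom.coe_mk, map_sum, derivation_C_mul_apply,
        mkDerivation_X, mul_apply, mul_sum, sum_mul, map_mul, Sum.elim_inl]
      rw [sum_comm]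
      refine sum_congr rfl fun l _ => sum_congr rfl fun k _ => ?_
      ring
    rw [key, key, ← sum_sub_distrib]
    refine sum_congr rfl fun l _ => ?_
    rw [← sub_mul, ← map_sub, LieSubalgebra.coe_bracket, LieRing.of_associative_ring_bracket]
    rfl
  · have key : ∀ Y : L, projField κ o L Y (Sum.inr j) =
      projColumn κ o Y j - projColumn κ o Y o * projCoord κ o j := fun Y => rfl
    have h : ∀ i, projColumn κ o ((⁅Y, Z⁆ : L) : Matrix ι ι ℂ) i =
        projColumn κ o ((Y : Matrix ι ι ℂ) * (Z : Matrix ι ι ℂ)) i -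
          projColumn κ o ((Z : Matrix ι ι ℂ) * (Y : Matrix ι ι ℂ)) i := fun i => by
      rw [LieSubalgebra.coe_bracket, LieRing.of_associative_ring_bracket]
      simp only [projColumn, Matrix.sub_apply, map_sub, sub_mul, sum_sub_distrib]
    simp only [key, map_sub, Derivation.leibniz, projField_projColumn, projField_projCoord, h, smul_eq_mul]
    ring

/-- The action of the enveloping algebra by differential operators on the product of a matrix space and
a projective space. -/
noncomputable def projRep :
    UniversalEnvelopingAlgebra ℂ L →ₐ[ℂ] Module.End ℂ (MvPolynomial ((κ × ι) ⊕ ι) ℂ) :=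
  polyRep (projField κ o L) (projField_lie κ o)

/-- The matrix entries reduced along the line given by the point of the projective space. -/
noncomputable def reducedEntry (s : κ × ι) : MvPolynomial ((κ × ι) ⊕ ι) ℂ :=
  X (Sum.inl s) - X (Sum.inl (s.1, o)) * projCoord κ o s.2

lemma projField_reducedEntry (Z : L) (s : κ × ι) :
    mkDerivation ℂ (projField κ o L Z) (reducedEntry κ o s) =
      ∑ k, C ((Z : Matrix ι ι ℂ) k s.2) * reducedEntry κ o (s.1, k) -
        (∑ k, C ((Z : Matrix ι ι ℂ) k o) * reducedEntry κ o (s.1, k)) * projCoord κ o s.2 := by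
  rw [reducedEntry, map_sub, Derivation.leibniz, projField_projCoord, mkDerivation_X, mkDerivation_X]
  simp only [projField, LinearMap.coe_mk, AddHom.coe_mk, Sum.elim_inl, reducedEntry, mul_sub,
    sum_sub_distrib, smul_eq_mul]
  have h : ∀ j, ∑ k, C ((Z : Matrix ι ι ℂ) k j) * (X (Sum.inl (s.1, o)) * projCoord κ o k) =
      X (Sum.inl (s.1, o)) * projColumn κ o Z j := fun j => by
    rw [projColumn, mul_sum]
    exact sum_congr rfl fun k _ => by ring
  rw [h, h]
  ring

lemma reducedEntry_self (a : κ) : reducedEntry κ o (a, o) = 0 := by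
  simp [reducedEntry, projCoord]

end ProjectiveFields

section Intersection

open MvPolynomial

attribute [local instance 100] LieRing.ofAssociativeRing

variable (t : Kind) (N : ℕ)

/-- The substitution of the reduced matrix entries. -/
noncomputable def reducedHom : MvPolynomial (Idx N × Idx N) ℂ →ₐ[ℂ]
    MvPolynomial ((Idx N × Idx (N + 2)) ⊕ Idx (N + 2)) ℂ :=
  aeval fun s => reducedEntry (Idx N) (topIdx N).neg (s.1, s.2.incl)

lemma incl_ne_topIdx {N : ℕ} (i : Idx N) : i.incl ≠ topIdx N := fun h => by
  have := (splitIdx N).injective (a₁ := Sum.inl i) (a₂ := Sum.inr true) h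
  simp at this

lemma incl_ne_topIdx_neg {N : ℕ} (i : Idx N) : i.incl ≠ (topIdx N).neg := fun h => by
  have := (splitIdx N).injective (a₁ := Sum.inl i) (a₂ := Sum.inr false) h
  simp at this

lemma topIdx_ne_neg {N : ℕ} : topIdx N ≠ (topIdx N).neg := fun h => by
  have := (splitIdx N).injective (a₁ := Sum.inr true) (a₂ := Sum.inr false) h
  simp at this

lemma reducedHom_injective : Function.Injective (reducedHom N) := by
  let ρ : MvPolynomial ((Idx N × Idx (N + 2)) ⊕ Idx (N + 2)) ℂ →ₐ[ℂ] MvPolynomial (Idx N × Idx N) ℂ :=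
    aeval (Sum.elim (fun s => Sum.elim (fun i => X (s.1, i)) (fun _ => 0) ((splitIdx N).symm s.2))
      fun _ => 0)
  have h : ρ.comp (reducedHom N) = AlgHom.id ℂ _ := by
    refine algHom_ext fun s => ?_
    have h1 : (splitIdx N).symm s.2.incl = Sum.inl s.2 := (splitIdx N).symm_apply_eq.2 rfl
    have h2 : (splitIdx N).symm (topIdx N).neg = Sum.inr false := (splitIdx N).symm_apply_eq.2 rfl
    simp [ρ, reducedHom, reducedEntry, h1, h2]
  exact Function.LeftInverse.injective (g := ρ) fun x => AlgHom.congr_fun h x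

lemma projRep_reducedHom (z : U t N) (p : MvPolynomial (Idx N × Idx N) ℂ) :
    projRep (Idx N) (topIdx N).neg (UIncl t N z) (reducedHom N p) =
      reducedHom N (affineRep (g t N) (Idx N) z p) := by
  have h : z ∈ Algebra.adjoin ℂ (Set.range (UniversalEnvelopingAlgebra.ι ℂ : g t N → U t N)) := by
    rw [adjoin_range_ι_env]
    trivial
  induction h using Algebra.adjoin_induction generalizing p with
  | mem x hx =>
    obtain ⟨Z, rfl⟩ := hx
    rw [UIncl, UniversalEnvelopingAlgebra.lift_ι_apply, LieHom.comp_apply, projRep, polyRep_ι, affineRep,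
      polyRep_ι]
    induction p using MvPolynomial.induction_on with
    | C a => simp [reducedHom]
    | add p q hp hq => rw [map_add, map_add, hp, hq, map_add, map_add]
    | mul_X p s hp =>
      rw [map_mul, Derivation.leibniz, Derivation.leibniz, hp, map_add, smul_eq_mul, smul_eq_mul,
        smul_eq_mul, smul_eq_mul, map_mul, map_mul, mkDerivation_X, reducedHom, aeval_X,
        projField_reducedEntry]
      have h1 : ∀ k j, ((gIncl t N Z : g t (N + 2)) : Matrix (Idx (N + 2)) (Idx (N + 2)) ℂ) k j =
        (inclMatrix N * (Z : Matrix (Idx N) (Idx N) ℂ) * (inclMatrix N).transpose) k j := fun _ _ => rfl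
      have h2 : ∀ k, ((gIncl t N Z : g t (N + 2)) : Matrix (Idx (N + 2)) (Idx (N + 2)) ℂ) k
          (topIdx N).neg = 0 := fun k => by
        rw [h1, mul_apply]
        refine sum_eq_zero fun j _ => ?_
        simp [inclMatrix, (incl_ne_topIdx_neg j).symm]
      have h3 : ∀ k (j : Idx N), ((gIncl t N Z : g t (N + 2)) : Matrix (Idx (N + 2)) (Idx (N + 2)) ℂ) k
          j.incl = ∑ l, if k = l.incl then (Z : Matrix (Idx N) (Idx N) ℂ) l j else 0 := fun k j => by
        rw [h1, mul_apply]
        simp [inclMatrix, Idx.incl_injective.eq_iff, mul_apply]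
      simp only [h2, h3, map_zero, zero_mul, sum_const_zero, sub_zero]
      congr 2
      simp only [affineField, LinearMap.coe_mk, AddHom.coe_mk, map_sum, map_mul, algHom_C, aeval_X,
        sum_mul]
      rw [sum_comm]
      refine sum_congr rfl fun l _ => ?_
      rw [sum_eq_single l.incl (fun k _ hk => by rw [if_neg hk, map_zero, zero_mul]) (by simp),
        if_pos rfl, MvPolynomial.algebraMap_eq]
  | algebraMap r => simp
  | add x y _ _ hx hy => rw [map_add, map_add, LinearMap.add_apply, hx, hy, map_add, LinearMap.add_apply, map_add]
  | mul x y _ _ hx hy => rw [map_mul, map_mul, Module.End.mul_apply, hy, hx, map_mul, Module.End.mul_apply]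

lemma projRep_leftIdeal {w : U t (N + 2)} (hw : w ∈ leftIdeal t (N + 2))
    (p : MvPolynomial (Idx N × Idx N) ℂ) :
    projRep (Idx N) (topIdx N).neg w (reducedHom N p) = 0 := by
  rw [leftIdeal] at hw
  induction hw using Submodule.span_induction with
  | mem x hx =>
    obtain ⟨i, j, hj, rfl⟩ := hx
    obtain rfl : j = topIdx N := Subtype.ext (hj.trans (by simp [topIdx]))
    rw [FU, projRep, polyRep_ι]
    induction p using MvPolynomial.induction_on with
    | C a => simp [reducedHom]
    | add p q hp hq => rw [map_add, map_add, hp, hq, add_zero]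
    | mul_X p s hp =>
      rw [map_mul, Derivation.leibniz, hp, reducedHom, aeval_X, projField_reducedEntry]
      have h1 : ∀ c, c ≠ topIdx N → ∀ k, C (((F t i (topIdx N) : g t (N + 2)) :
          Matrix (Idx (N + 2)) (Idx (N + 2)) ℂ) k c) * reducedEntry (Idx N) (topIdx N).neg (s.1, k) = 0 := by
        intro c hc k
        change C (Fmat t i (topIdx N) k c) * _ = _
        by_cases hk : k = (topIdx N).neg
        · rw [hk, reducedEntry_self, mul_zero]
        · simp [Fmat, hc.symm, Ne.symm hk]
      simp [h1 _ (incl_ne_topIdx s.2), h1 _ topIdx_ne_neg.symm]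
  | zero => simp
  | add x y _ _ hx hy => rw [map_add, LinearMap.add_apply, hx, hy, add_zero]
  | smul a x _ hx => rw [smul_eq_mul, map_mul, Module.End.mul_apply, hx, map_zero]

/-- The subalgebra `U(𝔤_N)` meets the left ideal `I(N + 2)` trivially. -/
lemma eq_zero_of_UIncl_mem {z : U t N} (hz : UIncl t N z ∈ leftIdeal t (N + 2)) : z = 0 := by
  refine affineRep_injective (L := g t N) (LinearMap.ext fun p => reducedHom_injective N ?_)
  rw [← projRep_reducedHom, projRep_leftIdeal t N hz, map_zero, LinearMap.zero_apply, map_zero]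

end Intersection

section Parabolic

variable {ε : ℤ} {ι : Type*} [DecidableEq ι] {σ : SignedIndex ε ι} {A : Type*} [Ring A] [Algebra ℂ A]
  (F : ι → ι → A) (n : ι)

/-- The left ideal generated by a column. -/
def columnIdeal : Ideal A := Ideal.span (Set.range fun i => F i n)

lemma mem_columnIdeal (i : ι) : F i n ∈ columnIdeal F n := Submodule.subset_span ⟨i, rfl⟩

/-- The subalgebra generated by the entries outside the two extreme rows and columns. -/
def innerAlgebra (σ : SignedIndex ε ι) : Subalgebra ℂ A :=
  Algebra.adjoin ℂ {x | ∃ i j, (i ≠ n ∧ i ≠ σ.ν n) ∧ (j ≠ n ∧ j ≠ σ.ν n) ∧ x = F i j}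

variable {F n} (hF : IsClassical σ F)
include hF

lemma column_mul_mem {a b : A} (ha : a ∈ innerAlgebra F n σ) (hb : ∀ i, F i n * b ∈ columnIdeal F n)
    (i : ι) : F i n * (a * b) ∈ columnIdeal F n := by
  induction ha using Algebra.adjoin_induction generalizing b i with
  | mem x hx =>
    obtain ⟨k, l, hk, hl, rfl⟩ := hx
    have h := hF.comm i n k l
    rw [if_neg hk.1, if_neg (show ¬σ.ν l = n from fun h => hl.2 (by rw [← h, σ.ν_ν]))] at h
    rw [← mul_assoc, eq_add_of_sub_eq h]
    simp only [zero_sub, smul_zero, add_zero, add_mul, sub_mul, neg_mul, smul_mul_assoc]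
    refine Ideal.add_mem _ (Ideal.sub_mem _ (Ideal.neg_mem_iff _ |>.2 ?_) (zsmul_mem ?_ _)) ?_
    · split_ifs
      · exact hb k
      · simp
    · split_ifs
      · rw [show F (σ.ν n) l = -((σ.e (σ.ν l) * σ.e n) • F (σ.ν l) n) by
          have := hF.symm (σ.ν l) n
          rwa [σ.ν_ν] at this, neg_mul, smul_mul_assoc]
        exact Ideal.neg_mem_iff _ |>.2 (zsmul_mem (hb _) _)
      · simp
    · rw [mul_assoc]
      exact Ideal.mul_mem_left _ _ (hb i)
  | algebraMap r =>
    rw [← mul_assoc, ← Algebra.commutes, mul_assoc]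
    exact Ideal.mul_mem_left _ _ (hb i)
  | add x y _ _ hx hy =>
    rw [add_mul, mul_add]
    exact Ideal.add_mem _ (hx hb i) (hy hb i)
  | mul x y _ _ hx hy =>
    rw [mul_assoc]
    exact hx (fun j => hy hb j) i

lemma columnIdeal_mul_mem {w a : A} (hw : w ∈ columnIdeal F n) (ha : a ∈ innerAlgebra F n σ) :
    w * a ∈ columnIdeal F n := by
  rw [columnIdeal] at hw
  induction hw using Submodule.span_induction with
  | mem x hx =>
    obtain ⟨i, rfl⟩ := hx
    have h := column_mul_mem hF ha (b := 1) (fun i => by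
      rw [mul_one]
      exact mem_columnIdeal F n i) i
    rwa [mul_one] at h
  | zero =>
    rw [zero_mul]
    exact zero_mem _
  | add x y _ _ hx hy =>
    rw [add_mul]
    exact Ideal.add_mem _ hx hy
  | smul c x _ hx =>
    rw [smul_eq_mul, mul_assoc]
    exact Ideal.mul_mem_left _ _ hx

omit hF in
variable (σ F n) in
/-- The sums of products of at most `r` raising elements, inner elements, and elements of the ideal. -/
def raisingFil : ℕ → Submodule ℂ A
  | 0 => Subalgebra.toSubmodule (innerAlgebra F n σ) ⊔ (columnIdeal F n).restrictScalars ℂ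
  | r + 1 => raisingFil r ⊔ ⨆ i, (raisingFil r).map (LinearMap.mulLeft ℂ (F n i))

omit hF in
lemma raising_mul_mem {r : ℕ} (i : ι) {x : A} (hx : x ∈ raisingFil σ F n r) :
    F n i * x ∈ raisingFil σ F n (r + 1) :=
  Submodule.mem_sup_right (Submodule.mem_iSup_of_mem i ⟨x, hx, rfl⟩)

lemma lowering_mul_mem (r : ℕ) : (∀ i j, i ≠ n → j ≠ σ.ν n → ∀ x ∈ raisingFil σ F n r,
      F i j * x ∈ raisingFil σ F n r) ∧
    ∀ i j, ∀ x ∈ raisingFil σ F n r, F i j * x ∈ raisingFil σ F n (r + 1) := by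
  have main : ∀ r, (∀ i j, i ≠ n → j ≠ σ.ν n → ∀ x ∈ raisingFil σ F n r,
      F i j * x ∈ raisingFil σ F n r) →
      ∀ i j, ∀ x ∈ raisingFil σ F n r, F i j * x ∈ raisingFil σ F n (r + 1) := by
    intro r h i j x hx
    by_cases hi : i = n
    · rw [hi]
      exact raising_mul_mem j hx
    by_cases hj : j = σ.ν n
    · rw [show F i j = -((σ.e n * σ.e (σ.ν i)) • F n (σ.ν i)) by
        rw [hj, ← hF.symm, σ.ν_ν], neg_mul, smul_mul_assoc]
      exact neg_mem (zsmul_mem (raising_mul_mem _ hx) _)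
    · exact Submodule.mem_sup_left (h i j hi hj x hx)
  refine ⟨?_, main r ?_⟩ <;>
  · induction r with
    | zero =>
      intro i j hi hj x hx
      obtain ⟨a, ha, w, hw, rfl⟩ := Submodule.mem_sup.1 hx
      rw [mul_add]
      refine Submodule.add_mem _ ?_ (Submodule.mem_sup_right (Ideal.mul_mem_left _ _ hw))
      by_cases hj' : j = n
      · rw [hj']
        exact Submodule.mem_sup_right (columnIdeal_mul_mem hF (mem_columnIdeal F n i) ha)
      by_cases hi' : i = σ.ν n
      · rw [show F i j = -((σ.e (σ.ν j) * σ.e n) • F (σ.ν j) n) by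
          rw [hi', ← hF.symm, σ.ν_ν], neg_mul, smul_mul_assoc]
        exact Submodule.mem_sup_right
          (neg_mem (zsmul_mem (columnIdeal_mul_mem hF (mem_columnIdeal F n _) ha) _))
      · exact Submodule.mem_sup_left
          (Subalgebra.mul_mem _ (Algebra.subset_adjoin ⟨i, j, ⟨hi, hi'⟩, ⟨hj', hj⟩, rfl⟩) ha)
    | succ r ih =>
      intro i j hi hj x hx
      have hle : raisingFil σ F n (r + 1) ≤
          (raisingFil σ F n (r + 1)).comap (LinearMap.mulLeft ℂ (F i j)) := by
        refine sup_le (fun y hy => Submodule.mem_sup_left (ih i j hi hj y hy)) (iSup_le fun k => ?_)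
        rintro _ ⟨y, hy, rfl⟩
        change F i j * (F n k * y) ∈ raisingFil σ F n (r + 1)
        rw [← mul_assoc, eq_add_of_sub_eq (hF.comm i j n k)]
        have hz : ∀ (p : Prop) [Decidable p] (a b : ι),
            (if p then F a b else 0) * y ∈ raisingFil σ F n (r + 1) := by
          intro p _ a b
          split_ifs
          · exact main r ih a b y hy
          · simp
        simp only [add_mul, sub_mul, smul_mul_assoc]
        refine Submodule.add_mem _ (Submodule.add_mem _ (Submodule.sub_mem _ (Submodule.sub_mem _
          (hz _ _ _) (hz _ _ _)) (zsmul_mem (hz _ _ _) _)) (zsmul_mem (hz _ _ _) _)) ?_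
        rw [mul_assoc]
        exact raising_mul_mem k (ih i j hi hj y hy)
      exact hle hx

omit hF in
lemma raisingFil_mono : Monotone (raisingFil σ F n) := monotone_nat_of_le_succ fun _ => le_sup_left

lemma exists_mem_raisingFil (hgen : Algebra.adjoin ℂ (Set.range fun p : ι × ι => F p.1 p.2) = ⊤)
    (x : A) : ∃ r, x ∈ raisingFil σ F n r := by
  have h : ∀ x ∈ Algebra.adjoin ℂ (Set.range fun p : ι × ι => F p.1 p.2),
      ∀ y, (∃ r, y ∈ raisingFil σ F n r) → ∃ r, x * y ∈ raisingFil σ F n r := by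
    intro x hx
    induction hx using Algebra.adjoin_induction with
    | mem x hx =>
      obtain ⟨p, rfl⟩ := hx
      rintro y ⟨r, hy⟩
      exact ⟨r + 1, (lowering_mul_mem hF r).2 _ _ y hy⟩
    | algebraMap c =>
      rintro y ⟨r, hy⟩
      rw [← Algebra.smul_def]
      exact ⟨r, Submodule.smul_mem _ _ hy⟩
    | add a b _ _ ha hb =>
      intro y hy
      obtain ⟨r, hr⟩ := ha y hy
      obtain ⟨s, hs⟩ := hb y hy
      rw [add_mul]
      exact ⟨max r s, Submodule.add_mem _ (raisingFil_mono (le_max_left r s) hr)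
        (raisingFil_mono (le_max_right r s) hs)⟩
    | mul a b _ _ ha hb =>
      intro y hy
      rw [mul_assoc]
      exact ha _ (hb y hy)
  have h1 := h x (by rw [hgen]; trivial) 1 ⟨0, Submodule.mem_sup_left (one_mem (innerAlgebra F n σ))⟩
  rwa [mul_one] at h1

omit hF in
variable (F n) in
/-- The left multiplication by the diagonal entry of the column modulo the ideal. -/
noncomputable def weightOp : Module.End ℂ (A ⧸ (columnIdeal F n).restrictScalars ℂ) :=
  Submodule.mapQ _ _ (LinearMap.mulLeft ℂ (F n n))
    (show _ ≤ Submodule.comap _ _ from fun _ hx => Ideal.mul_mem_left _ _ hx)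

omit hF in
variable (F n) in
/-- The elements of a given weight modulo the ideal. -/
noncomputable def weightSpace (w : ℂ) : Submodule ℂ A :=
  ((weightOp F n).eigenspace w).comap (Submodule.mkQ _)

omit hF in
lemma mem_weightSpace {w : ℂ} {x : A} :
    x ∈ weightSpace F n w ↔ F n n * x - w • x ∈ columnIdeal F n := by
  rw [weightSpace, Submodule.mem_comap, Module.End.mem_eigenspace_iff, weightOp, Submodule.mkQ_apply,
    Submodule.mapQ_apply, ← Submodule.Quotient.mk_smul, Submodule.Quotient.eq]
  rfl

lemma raising_mul_weightSpace (hn : n ≠ σ.ν n) {i : ι} (hi : i ≠ n) {w : ℂ} {x : A}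
    (hx : x ∈ weightSpace F n w) :
    F n i * x ∈ weightSpace F n (w + if i = σ.ν n then 2 else 1) := by
  rw [mem_weightSpace] at hx ⊢
  have h := hF.comm n n n i
  rw [if_pos rfl, if_neg hi.symm, if_neg hn, smul_zero, sub_zero, sub_zero] at h
  have h1 : F n n * (F n i * x) - (w + if i = σ.ν n then (2 : ℂ) else 1) • (F n i * x) =
      F n i * (F n n * x - w • x) := by
    rw [← mul_assoc, eq_add_of_sub_eq h]
    by_cases h2 : i = σ.ν n
    · rw [if_pos h2, if_pos (by rw [h2, σ.ν_ν]), h2, σ.ν_ν, σ.e_mul, one_smul, mul_sub, mul_smul_comm]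
      simp only [add_mul, add_smul, mul_assoc, two_smul]
      abel
    · rw [if_neg h2, if_neg (fun h3 => h2 (by rw [← h3, σ.ν_ν])), mul_sub, mul_smul_comm]
      simp only [add_mul, add_smul, mul_assoc, one_smul, smul_zero, add_zero]
      abel
  rw [h1]
  exact Ideal.mul_mem_left _ _ hx

lemma raisingFil_zero_le : raisingFil σ F n 0 ≤ weightSpace F n 0 := by
  intro x hx
  obtain ⟨a, ha, w, hw, rfl⟩ := Submodule.mem_sup.1 hx
  rw [mem_weightSpace, zero_smul, sub_zero, mul_add]
  exact Ideal.add_mem _ (columnIdeal_mul_mem hF (mem_columnIdeal F n n) ha) (Ideal.mul_mem_left _ _ hw)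

lemma raisingFil_le (hn : n ≠ σ.ν n) (r : ℕ) :
    raisingFil σ F n r ≤ raisingFil σ F n 0 ⊔ ⨆ w : ℕ, weightSpace F n ((w : ℂ) + 1) := by
  induction r with
  | zero => exact le_sup_left
  | succ r ih =>
    refine sup_le ih (iSup_le fun i => ?_)
    rw [Submodule.map_le_iff_le_comap]
    refine ih.trans (sup_le ?_ (iSup_le fun w => ?_))
    · intro x hx
      change F n i * x ∈ raisingFil σ F n 0 ⊔ ⨆ w : ℕ, weightSpace F n ((w : ℂ) + 1)
      by_cases hi : i = n
      · rw [hi]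
        have h := mem_weightSpace.1 (raisingFil_zero_le hF hx)
        rw [zero_smul, sub_zero] at h
        exact Submodule.mem_sup_left (Submodule.mem_sup_right h)
      · have h := raising_mul_weightSpace hF hn hi (raisingFil_zero_le hF hx)
        refine Submodule.mem_sup_right (Submodule.mem_iSup_of_mem (if i = σ.ν n then 1 else 0) ?_)
        convert h using 2
        split_ifs <;> norm_num
    · intro x hx
      change F n i * x ∈ raisingFil σ F n 0 ⊔ ⨆ w : ℕ, weightSpace F n ((w : ℂ) + 1)
      by_cases hi : i = n
      · rw [hi]
        have h := mem_weightSpace.1 hx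
        rw [← sub_add_cancel (F n n * x) (((w : ℂ) + 1) • x)]
        exact Submodule.add_mem _ (Submodule.mem_sup_left (Submodule.mem_sup_right h))
          (Submodule.smul_mem _ _ (Submodule.mem_sup_right (Submodule.mem_iSup_of_mem w hx)))
      · have h := raising_mul_weightSpace hF hn hi hx
        refine Submodule.mem_sup_right (Submodule.mem_iSup_of_mem (w + if i = σ.ν n then 2 else 1) ?_)
        convert h using 2
        split_ifs <;> push_cast <;> ring

/-- An element of weight zero is the sum of an inner element and of an element of the ideal. -/
lemma mem_of_commute_diagonal (hn : n ≠ σ.ν n)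
    (hgen : Algebra.adjoin ℂ (Set.range fun p : ι × ι => F p.1 p.2) = ⊤) {x : A}
    (hx : Commute (F n n) x) : ∃ a ∈ innerAlgebra F n σ, x - a ∈ columnIdeal F n := by
  obtain ⟨r, hr⟩ := exists_mem_raisingFil (n := n) hF hgen x
  obtain ⟨a, ha, b, hb, rfl⟩ := Submodule.mem_sup.1 (raisingFil_le hF hn r hr)
  have h0 : a + b ∈ weightSpace F n 0 := by
    rw [mem_weightSpace, zero_smul, sub_zero, hx.eq]
    exact Ideal.mul_mem_left _ _ (mem_columnIdeal F n n)
  have h1 : b ∈ weightSpace F n 0 := by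
    have := Submodule.sub_mem _ h0 (raisingFil_zero_le hF ha)
    rwa [add_sub_cancel_left] at this
  have h2 : (⨆ w : ℕ, weightSpace F n ((w : ℂ) + 1)) ≤
      (⨆ (μ : ℂ) (_ : μ ≠ 0), (weightOp F n).eigenspace μ).comap (Submodule.mkQ _) := by
    refine iSup_le fun w => Submodule.comap_mono ?_
    exact le_iSup₂_of_le ((w : ℂ) + 1) (Nat.cast_add_one_ne_zero w) le_rfl
  have h3 := Submodule.disjoint_def.1 ((weightOp F n).eigenspaces_iSupIndep 0) _ h1 (h2 hb)
  rw [Submodule.mkQ_apply, Submodule.Quotient.mk_eq_zero] at h3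
  obtain ⟨c, hc, d, hd, rfl⟩ := Submodule.mem_sup.1 ha
  refine ⟨c, hc, ?_⟩
  rw [add_assoc, add_sub_cancel_left]
  exact Ideal.add_mem _ hd h3

end Parabolic

section Projection

attribute [local instance 100] LieRing.ofAssociativeRing

lemma adjoin_range_FU (t : Kind) (N : ℕ) :
    Algebra.adjoin ℂ (Set.range fun p : Idx N × Idx N => FU t p.1 p.2) = ⊤ := by
  rw [eq_top_iff, ← adjoin_range_ι_env (g t N)]
  refine Algebra.adjoin_le ?_
  rintro _ ⟨⟨Z, hZ⟩, rfl⟩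
  induction hZ using LieSubalgebra.lieSpan_induction with
  | mem x hx =>
    obtain ⟨p, rfl⟩ := hx
    exact Algebra.subset_adjoin ⟨p, rfl⟩
  | zero =>
    change UniversalEnvelopingAlgebra.ι ℂ (0 : g t N) ∈ _
    rw [map_zero]
    exact zero_mem _
  | smul c x hx ih =>
    change UniversalEnvelopingAlgebra.ι ℂ (c • (⟨x, hx⟩ : g t N)) ∈ _
    rw [map_smul]
    exact Subalgebra.smul_mem _ ih c
  | add x y hx hy ihx ihy =>
    change UniversalEnvelopingAlgebra.ι ℂ ((⟨x, hx⟩ : g t N) + ⟨y, hy⟩) ∈ _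
    rw [map_add]
    exact add_mem ihx ihy
  | lie x y hx hy ihx ihy =>
    change UniversalEnvelopingAlgebra.ι ℂ ⁅(⟨x, hx⟩ : g t N), (⟨y, hy⟩ : g t N)⁆ ∈ _
    rw [LieHom.map_lie, LieRing.of_associative_ring_bracket]
    exact sub_mem (mul_mem ihx ihy) (mul_mem ihy ihx)

variable {t : Kind} {N : ℕ}

lemma UIncl_FU (i j : Idx N) : UIncl t N (FU t i j) = FU t i.incl j.incl := by
  rw [FU, UIncl, UniversalEnvelopingAlgebra.lift_ι_apply]
  exact congrArg (UniversalEnvelopingAlgebra.ι ℂ) (Subtype.ext (glIncl_Fmat t i j))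

lemma exists_incl {i : Idx (N + 2)} (h1 : i ≠ topIdx N) (h2 : i ≠ (topIdx N).neg) :
    ∃ j : Idx N, i = j.incl := by
  obtain ⟨j | b, rfl⟩ := (splitIdx N).surjective i
  · exact ⟨j, rfl⟩
  · cases b
    · exact absurd rfl h2
    · exact absurd rfl h1

lemma innerAlgebra_FU (h : t = .symplectic → Even (N + 2)) :
    innerAlgebra (fun i j => FU t i j) (topIdx N) (idxSigned t (N + 2) h) = (UIncl t N).range := by
  rw [← Algebra.map_top, ← adjoin_range_FU, AlgHom.map_adjoin, innerAlgebra]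
  congr 1
  ext x
  constructor
  · rintro ⟨i, j, hi, hj, rfl⟩
    obtain ⟨i', rfl⟩ := exists_incl hi.1 hi.2
    obtain ⟨j', rfl⟩ := exists_incl hj.1 hj.2
    exact ⟨_, ⟨(i', j'), rfl⟩, UIncl_FU i' j'⟩
  · rintro ⟨_, ⟨p, rfl⟩, rfl⟩
    exact ⟨p.1.incl, p.2.incl, ⟨incl_ne_topIdx _, incl_ne_topIdx_neg _⟩,
      ⟨incl_ne_topIdx _, incl_ne_topIdx_neg _⟩, UIncl_FU _ _⟩

lemma columnIdeal_FU : columnIdeal (fun i j => FU t i j) (topIdx N) = leftIdeal t (N + 2) := by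
  rw [columnIdeal, leftIdeal]
  congr 1
  ext x
  constructor
  · rintro ⟨i, rfl⟩
    exact ⟨i, topIdx N, by simp [topIdx], rfl⟩
  · rintro ⟨i, j, hj, rfl⟩
    obtain rfl : j = topIdx N := Subtype.ext (hj.trans (by simp [topIdx]))
    exact ⟨i, rfl⟩

lemma leftIdeal_mul_mem (h : t = .symplectic → Even (N + 2)) {w : U t (N + 2)}
    (hw : w ∈ leftIdeal t (N + 2)) (z : U t N) : w * UIncl t N z ∈ leftIdeal t (N + 2) := by
  rw [← columnIdeal_FU] at hw ⊢
  refine columnIdeal_mul_mem (isClassical_FU h) hw ?_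
  rw [innerAlgebra_FU]
  exact ⟨z, rfl⟩

variable (t N) in
/-- The pairs consisting of an element of `U(𝔤_{N+2})` and of an element of `U(𝔤_N)` congruent to it
modulo the left ideal. -/
noncomputable def congrAlg (h : t = .symplectic → Even (N + 2)) : Subalgebra ℂ (U t (N + 2) × U t N) where
  carrier := {p | p.1 - UIncl t N p.2 ∈ leftIdeal t (N + 2)}
  mul_mem' := by
    rintro ⟨x, y⟩ ⟨x', y'⟩ h1 h2
    change x - UIncl t N y ∈ leftIdeal t (N + 2) at h1
    change x' - UIncl t N y' ∈ leftIdeal t (N + 2) at h2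
    change x * x' - UIncl t N (y * y') ∈ leftIdeal t (N + 2)
    have h3 := Ideal.add_mem _ (Ideal.mul_mem_left _ x h2) (leftIdeal_mul_mem h h1 y')
    rwa [mul_sub, sub_mul, ← map_mul, sub_add_sub_cancel] at h3
  add_mem' := by
    rintro ⟨x, y⟩ ⟨x', y'⟩ h1 h2
    change x - UIncl t N y ∈ leftIdeal t (N + 2) at h1
    change x' - UIncl t N y' ∈ leftIdeal t (N + 2) at h2
    change x + x' - UIncl t N (y + y') ∈ leftIdeal t (N + 2)
    rw [map_add, add_sub_add_comm]
    exact Ideal.add_mem _ h1 h2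
  algebraMap_mem' c := by
    change algebraMap ℂ _ c - UIncl t N (algebraMap ℂ _ c) ∈ leftIdeal t (N + 2)
    rw [AlgHom.commutes, sub_self]
    exact zero_mem _

lemma mem_congrAlg {h : t = .symplectic → Even (N + 2)} {p : U t (N + 2) × U t N} :
    p ∈ congrAlg t N h ↔ p.1 - UIncl t N p.2 ∈ leftIdeal t (N + 2) := Iff.rfl

lemma congrAlg_unique {h : t = .symplectic → Even (N + 2)} {x : U t (N + 2)} {y y' : U t N}
    (hy : (x, y) ∈ congrAlg t N h) (hy' : (x, y') ∈ congrAlg t N h) : y = y' := by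
  have h1 := Ideal.sub_mem _ (mem_congrAlg.1 hy') (mem_congrAlg.1 hy)
  rw [sub_sub_sub_cancel_left, ← map_sub] at h1
  exact sub_eq_zero.1 (eq_zero_of_UIncl_mem t N h1)

lemma exists_congrAlg (h : t = .symplectic → Even (N + 2)) {x : U t (N + 2)}
    (hx : Commute (FU t (topIdx N) (topIdx N)) x) : ∃ y, (x, y) ∈ congrAlg t N h := by
  obtain ⟨a, ha, hxa⟩ := mem_of_commute_diagonal (isClassical_FU h) topIdx_ne_neg
    (adjoin_range_FU t (N + 2)) hx
  rw [innerAlgebra_FU] at ha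
  obtain ⟨y, rfl⟩ := ha
  rw [columnIdeal_FU] at hxa
  exact ⟨y, hxa⟩

lemma FU_mem_congrAlg (h : t = .symplectic → Even (N + 2)) (i j : Idx N) :
    (FU t i.incl j.incl, FU t i j) ∈ congrAlg t N h := by
  rw [mem_congrAlg, UIncl_FU, sub_self]
  exact zero_mem _

lemma congrAlg_centralizer (h : t = .symplectic → Even (N + 2)) {M : ℕ} {x : U t (N + 2)}
    (hx : x ∈ centralizerAlg t M (N + 2)) {y : U t N} (hy : (x, y) ∈ congrAlg t N h) :
    y ∈ centralizerAlg t M N := by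
  rw [centralizerAlg, Subalgebra.mem_centralizer_iff] at hx ⊢
  rintro _ ⟨i, j, hi, hj, rfl⟩
  have h1 := (congrAlg t N h).mul_mem (FU_mem_congrAlg h i j) hy
  have h2 := (congrAlg t N h).mul_mem hy (FU_mem_congrAlg h i j)
  rw [Prod.mk_mul_mk, hx _ ⟨i.incl, j.incl, hi, hj, rfl⟩] at h1
  exact congrAlg_unique h1 h2

lemma centralizer_commute_top {M : ℕ} (hMN : M ≤ N) {x : U t (N + 2)}
    (hx : x ∈ centralizerAlg t M (N + 2)) : Commute (FU t (topIdx N) (topIdx N)) x := by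
  rw [centralizerAlg, Subalgebra.mem_centralizer_iff] at hx
  have h : M / 2 + 1 ≤ ((topIdx N : Idx (N + 2)) : ℤ).natAbs := by
    simp only [topIdx]
    omega
  exact hx _ ⟨_, _, h, h, rfl⟩

lemma exists_isProjection (h : t = .symplectic → Even (N + 2)) {M : ℕ} (hMN : M ≤ N) :
    ∃ p, IsProjection t M N p := by
  have h1 : ∀ x : centralizerAlg t M (N + 2), ∃ y : centralizerAlg t M N,
      ((x : U t (N + 2)), (y : U t N)) ∈ congrAlg t N h := fun x => by
    obtain ⟨y, hy⟩ := exists_congrAlg h (centralizer_commute_top hMN x.2)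
    exact ⟨⟨y, congrAlg_centralizer h x.2 hy⟩, hy⟩
  choose f hf using h1
  refine ⟨{ toFun := f
            map_one' := ?_, map_mul' := ?_, map_zero' := ?_, map_add' := ?_, commutes' := ?_ }, hf⟩
  · exact Subtype.ext (congrAlg_unique (hf 1) (congrAlg t N h).one_mem)
  · intro x y
    exact Subtype.ext (congrAlg_unique (hf (x * y)) ((congrAlg t N h).mul_mem (hf x) (hf y)))
  · exact Subtype.ext (congrAlg_unique (hf 0) (congrAlg t N h).zero_mem)
  · intro x y
    exact Subtype.ext (congrAlg_unique (hf (x + y)) ((congrAlg t N h).add_mem (hf x) (hf y)))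
  · intro c
    exact Subtype.ext (congrAlg_unique (hf (algebraMap ℂ _ c)) ((congrAlg t N h).algebraMap_mem c))

lemma IsProjection.unique (h : t = .symplectic → Even (N + 2)) {M : ℕ}
    {p p' : centralizerAlg t M (N + 2) →ₐ[ℂ] centralizerAlg t M N} (hp : IsProjection t M N p)
    (hp' : IsProjection t M N p') : p = p' :=
  AlgHom.ext fun x => Subtype.ext (congrAlg_unique (h := h) (hp x) (hp' x))

end Projection

section InverseModuloColumn

variable {K B : Type*} [CommRing K] [Ring B] [Algebra K B] {ε : ℤ}

/-- The commutation relations with the inverse of the matrix `1 + κ F`. -/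
lemma IsClassical.comm_inverse {ι : Type*} [Fintype ι] [DecidableEq ι] {σ : SignedIndex ε ι}
    {F : ι → ι → B} (hF : IsClassical σ F) {κ : K} {S G : Matrix ι ι B}
    (hS : ∀ i j, S i j = (if i = j then 1 else 0) + κ • F i j) (hSG : S * G = 1) (hGS : G * S = 1)
    (a b i j : ι) : F a b * G i j = G i j * F a b +
      (if j = σ.ν b then (σ.e a * σ.e b) • G i (σ.ν a) else 0) - (if j = a then G i b else 0) -
      (if i = σ.ν a then (σ.e a * σ.e b) • G (σ.ν b) j else 0) + (if i = b then G a j else 0) := by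
  have h1 : (diagonal (fun _ => F a b) + actionMatrix σ B a b) * S =
      S * (diagonal (fun _ => F a b) + actionMatrix σ B a b) := by
    ext i j
    rw [add_mul, mul_add, Matrix.add_apply, Matrix.add_apply, diagonal_mul, mul_diagonal,
      mul_apply, mul_apply]
    exact hF.mul_add_action hS a b i j
  have h2 : (diagonal (fun _ => F a b) + actionMatrix σ B a b) * G =
      G * (diagonal (fun _ => F a b) + actionMatrix σ B a b) := by
    calc _ = G * S * ((diagonal (fun _ => F a b) + actionMatrix σ B a b) * G) := by
          rw [hGS, one_mul]
      _ = G * ((diagonal (fun _ => F a b) + actionMatrix σ B a b) * S) * G := by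
          rw [h1]
          simp only [Matrix.mul_assoc]
      _ = _ := by
          simp only [Matrix.mul_assoc, hSG, Matrix.mul_one]
  have h3 := congrFun (congrFun h2 i) j
  rw [add_mul, mul_add, Matrix.add_apply, Matrix.add_apply, diagonal_mul, mul_diagonal,
    mul_apply, mul_apply] at h3
  simp only [actionMatrix, of_apply, Int.cast_sub, Int.cast_ite, Int.cast_zero, Int.cast_one,
    mul_sub, sub_mul, sum_sub_distrib, ite_mul, mul_ite, zero_mul, mul_zero, mul_one, one_mul,
    sum_ite_eq, sum_ite_eq', mem_univ, if_true, Finset.sum_ite_irrel,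
    sum_const_zero] at h3
  rw [← (Int.cast_commute _ (G i (σ.ν a))).eq] at h3
  simp only [← zsmul_eq_mul] at h3
  rw [eq_sub_of_add_eq h3]
  abel

variable {I : Type*} [Fintype I] [DecidableEq I] {hε : ε * ε = 1} {τ : SignedIndex ε I}
  {F : I ⊕ Bool → I ⊕ Bool → B} (hF : IsClassical (τ.sum (boolIndex ε hε)) F) {κ : K}
  {S G : Matrix (I ⊕ Bool) (I ⊕ Bool) B}
  (hS : ∀ i j, S i j = (if i = j then 1 else 0) + κ • F i j) (hSG : S * G = 1) (hGS : G * S = 1)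
  {J : Ideal B} (hJ : ∀ i, F i (Sum.inr true) ∈ J)

include hS hSG in
lemma inverse_row (i j : I ⊕ Bool) :
    J.mkQ (G i j) + κ • ∑ a, J.mkQ (F i a * G a j) = if i = j then J.mkQ 1 else 0 := by
  have h := congrFun (congrFun hSG i) j
  rw [mul_apply] at h
  simp only [hS, add_mul, ite_mul, one_mul, zero_mul, sum_add_distrib, sum_ite_eq,
    mem_univ, if_true, smul_mul_assoc, ← smul_sum] at h
  have h1 := congrArg J.mkQ h
  rw [map_add, LinearMap.map_smul_of_tower, map_sum] at h1
  rw [h1, one_apply, apply_ite J.mkQ, map_zero]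

include hF hJ in
lemma row_mem (a : I ⊕ Bool) : F (Sum.inr false) a ∈ J := by
  have h := hF.symm ((τ.sum (boolIndex ε hε)).ν a) (Sum.inr true)
  rw [SignedIndex.ν_ν] at h
  have h1 : F (Sum.inr false) a = _ := h
  rw [h1]
  exact neg_mem (zsmul_mem (hJ _) _)

include hF hS hSG hGS hJ in
lemma sum_row (j : I ⊕ Bool) (hj : j ≠ Sum.inr false) :
    ∑ a, J.mkQ (F (Sum.inr false) a * G a j) =
      (((τ.sum (boolIndex ε hε)).e (Sum.inr false) *
        (τ.sum (boolIndex ε hε)).e ((τ.sum (boolIndex ε hε)).ν j) : ℤ) : K) •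
          J.mkQ (G ((τ.sum (boolIndex ε hε)).ν j) (Sum.inr true)) +
      (((Fintype.card (I ⊕ Bool) : ℤ) - ε : ℤ) : K) • J.mkQ (G (Sum.inr false) j) := by
  set σ := τ.sum (boolIndex ε hε) with hσ
  have h0 : ∀ a, J.mkQ (G a j * F (Sum.inr false) a) = 0 := fun a =>
    (Submodule.Quotient.mk_eq_zero _).2 (Ideal.mul_mem_left _ _ (row_mem hF hJ a))
  have q1 : ∀ a, (j = σ.ν a) = (a = σ.ν j) := fun a => propext σ.eq_ν_iff
  have q2 : ∀ a, (a = σ.ν (Sum.inr false)) = (a = Sum.inr true) := fun a => rfl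
  simp only [hF.comm_inverse hS hSG hGS, if_neg hj, sub_zero, map_add, map_sub, h0, zero_add, q1, q2,
    sum_add_distrib, sum_sub_distrib, if_true, apply_ite J.mkQ, map_zero, sum_ite_eq',
    mem_univ, Finset.sum_const, Finset.card_univ, map_zsmul]
  have e1 : σ.e (Sum.inr false) * σ.e (Sum.inr true) = ε := by
    rw [hσ]
    simp [SignedIndex.sum, boolIndex]
  have e2 : σ.ν (Sum.inr true) = Sum.inr false := rfl
  have e3 : σ.ν (Sum.inr false) = Sum.inr true := rfl
  rw [e1, e2, e3, Int.cast_smul_eq_zsmul, Int.cast_smul_eq_zsmul, sub_smul, natCast_zsmul]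
  abel

variable (hκ : ∀ z : ℤ, IsUnit (1 + (z : K) * κ))

include hF hS hSG hGS hJ hκ in
lemma inverse_corner_mem : J.mkQ (G (Sum.inr false) (Sum.inr true)) = 0 := by
  have h1 := inverse_row (J := J) hS hSG (Sum.inr false) (Sum.inr true)
  rw [if_neg (by simp), sum_row hF hS hSG hGS hJ _ (by simp)] at h1
  have e3 : (τ.sum (boolIndex ε hε)).ν (Sum.inr true) = Sum.inr false := rfl
  rw [e3, SignedIndex.e_mul] at h1
  refine (hκ ((Fintype.card (I ⊕ Bool) : ℤ) - ε + 1)).smul_eq_zero.1 (Eq.trans ?_ h1)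
  push_cast
  module

variable {w : K} (hw : w * (1 + κ) = 1) {P : Matrix I I B}
  (hP : P * (Matrix.of fun i j => (if i = j then 1 else 0) + (w * κ) • F (Sum.inl i) (Sum.inl j)) = 1)

include hw hP in
lemma eq_sum_of_inverse {Q : Type*} [AddCommGroup Q] [Module B Q] [Module K Q] [IsScalarTower K B Q]
    {x y : I → Q} (h : ∀ i, (1 + κ) • x i + κ • ∑ a, F (Sum.inl i) (Sum.inl a) • x a = (1 + κ) • y i)
    (k : I) : x k = ∑ i, P k i • y i := by
  have h1 : ∀ i, y i = x i + (w * κ) • ∑ a, F (Sum.inl i) (Sum.inl a) • x a := fun i => by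
    have := congrArg (w • ·) (h i)
    simp only [smul_add, smul_smul, hw, one_smul] at this
    exact this.symm
  have h2 : ∀ i, y i = ∑ a, ((if i = a then (1 : B) else 0) + (w * κ) • F (Sum.inl i) (Sum.inl a)) • x a := by
    intro i
    simp only [h1, add_smul, ite_smul, one_smul, zero_smul, sum_add_distrib, sum_ite_eq,
      mem_univ, if_true, smul_sum, smul_assoc]
  simp only [h2, smul_sum, smul_smul]
  rw [sum_comm]
  simp only [← Finset.sum_smul]
  have h3 : ∀ a, ∑ i, P k i * ((if i = a then (1 : B) else 0) + (w * κ) • F (Sum.inl i) (Sum.inl a)) =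
      if k = a then 1 else 0 := fun a => by
    have := congrFun (congrFun hP k) a
    rw [mul_apply, one_apply] at this
    exact this
  simp only [h3, ite_smul, one_smul, zero_smul, sum_ite_eq, mem_univ, if_true]

include hF hS hSG hGS hJ hκ in
lemma sum_inner_row (i : I) (j : I ⊕ Bool) (hj : J.mkQ (G (Sum.inr false) j) = 0)
    (hj' : j ≠ Sum.inr false) :
    (1 + κ) • J.mkQ (G (Sum.inl i) j) + κ • ∑ a, F (Sum.inl i) (Sum.inl a) • J.mkQ (G (Sum.inl a) j) =
      if Sum.inl i = j then J.mkQ 1 + κ • J.mkQ (G (Sum.inr true) (Sum.inr true)) else 0 := by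
  have h1 := inverse_row (J := J) hS hSG (Sum.inl i) j
  have h0 : J.mkQ (G (Sum.inr true) j * F (Sum.inl i) (Sum.inr true)) = 0 :=
    (Submodule.Quotient.mk_eq_zero _).2 (Ideal.mul_mem_left _ _ (hJ _))
  have e1 : (τ.sum (boolIndex ε hε)).ν (Sum.inl i) = Sum.inl (τ.ν i) := rfl
  have e2 : (τ.sum (boolIndex ε hε)).ν (Sum.inr true) = Sum.inr false := rfl
  have hm : ∀ a b : B, J.mkQ (a * b) = a • J.mkQ b := fun a b => by
    rw [← smul_eq_mul, map_smul]
  rw [Fintype.sum_sum_type, Fintype.sum_bool, hF.comm_inverse hS hSG hGS _ (Sum.inr true), e1, e2,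
    if_neg hj', if_neg (show ¬Sum.inr true = Sum.inl (τ.ν i) by simp), if_pos rfl, map_add, map_sub,
    map_sub, map_add, h0, hm _ (G (Sum.inr false) j), hj] at h1
  simp only [hm, smul_zero, map_zero, add_zero, sub_zero, zero_sub, apply_ite J.mkQ] at h1
  by_cases h : Sum.inl i = j
  · rw [if_pos h, if_pos h.symm] at h1
    rw [if_pos h, ← h1]
    module
  · rw [if_neg h, if_neg (Ne.symm h)] at h1
    rw [if_neg h, ← h1]
    module

include hF hS hSG hGS hJ hκ hw hP in
lemma inverse_column_mem (i : I) : J.mkQ (G (Sum.inl i) (Sum.inr true)) = 0 := by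
  rw [eq_sum_of_inverse hw hP (x := fun i => J.mkQ (G (Sum.inl i) (Sum.inr true))) (y := fun _ => 0)
    (fun i => ?_) i]
  · simp
  · rw [sum_inner_row hF hS hSG hGS hJ hκ i _ (inverse_corner_mem hF hS hSG hGS hJ hκ) (by simp),
      if_neg (by simp), smul_zero]

include hF hS hSG hGS hJ hκ hw hP in
lemma inverse_row_mem (j : I) : J.mkQ (G (Sum.inr false) (Sum.inl j)) = 0 := by
  have h1 := inverse_row (J := J) hS hSG (Sum.inr false) (Sum.inl j)
  rw [if_neg (by simp), sum_row hF hS hSG hGS hJ _ (by simp)] at h1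
  have e3 : (τ.sum (boolIndex ε hε)).ν (Sum.inl j) = Sum.inl (τ.ν j) := rfl
  rw [e3, inverse_column_mem hF hS hSG hGS hJ hκ hw hP, smul_zero, zero_add] at h1
  refine (hκ ((Fintype.card (I ⊕ Bool) : ℤ) - ε)).smul_eq_zero.1 (Eq.trans ?_ h1)
  module

include hF hS hSG hGS hJ hκ hw hP in
lemma inverse_diagonal : J.mkQ (G (Sum.inr true) (Sum.inr true)) = J.mkQ 1 := by
  have h1 := inverse_row (J := J) hS hSG (Sum.inr true) (Sum.inr true)
  have h0 : J.mkQ (G (Sum.inr true) (Sum.inr true) * F (Sum.inr true) (Sum.inr true)) = 0 :=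
    (Submodule.Quotient.mk_eq_zero _).2 (Ideal.mul_mem_left _ _ (hJ _))
  have e2 : (τ.sum (boolIndex ε hε)).ν (Sum.inr true) = Sum.inr false := rfl
  have hm : ∀ a b : B, J.mkQ (a * b) = a • J.mkQ b := fun a b => by
    rw [← smul_eq_mul, map_smul]
  rw [Fintype.sum_sum_type, Fintype.sum_bool, hF.comm_inverse hS hSG hGS _ (Sum.inr true), e2,
    if_neg (by simp), if_pos rfl, if_neg (by simp), if_pos rfl, map_add, map_sub, map_sub, map_add, h0,
    hm _ (G (Sum.inr false) _), inverse_corner_mem hF hS hSG hGS hJ hκ] at h1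
  simpa [hm, inverse_column_mem hF hS hSG hGS hJ hκ hw hP] using h1

include hF hS hSG hGS hJ hκ hw hP in
/-- The inner block of the inverse of `1 + κ F` modulo the left ideal generated by the last column. -/
lemma inverse_sub_mem (i j : I) : G (Sum.inl i) (Sum.inl j) - P i j ∈ J := by
  rw [← Submodule.Quotient.eq]
  change J.mkQ _ = J.mkQ _
  have h := eq_sum_of_inverse hw hP (x := fun i => J.mkQ (G (Sum.inl i) (Sum.inl j)))
    (y := fun i => if i = j then J.mkQ 1 else 0) (fun i => by
      rw [sum_inner_row hF hS hSG hGS hJ hκ i _ (inverse_row_mem hF hS hSG hGS hJ hκ hw hP j) (by simp),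
        inverse_diagonal hF hS hSG hGS hJ hκ hw hP]
      simp only [Sum.inl.injEq]
      split_ifs
      · module
      · rw [smul_zero]) i
  rw [h]
  simp only [smul_ite, smul_zero, sum_ite_eq', mem_univ, if_true]
  rw [← map_smul, smul_eq_mul, mul_one]

end InverseModuloColumn

section Lifting

open PowerSeries

attribute [local instance 50] seriesAlgebra

variable {A B : Type*} [Ring A] [Algebra ℂ A] [Ring B] [Algebra ℂ B] (R : Subalgebra ℂ (A × B))

/-- The first projection of a subalgebra of a product. -/
def fstHom : R →ₐ[ℂ] A := (AlgHom.fst ℂ A B).comp R.val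

/-- The second projection of a subalgebra of a product. -/
def sndHom : R →ₐ[ℂ] B := (AlgHom.snd ℂ A B).comp R.val

/-- The first projection of series. -/
noncomputable def fstSeries : R⟦X⟧ →+* A⟦X⟧ := PowerSeries.map (fstHom R : R →+* A)

/-- The second projection of series. -/
noncomputable def sndSeries : R⟦X⟧ →+* B⟦X⟧ := PowerSeries.map (sndHom R : R →+* B)

variable {R}

lemma exists_series_lift {a : A⟦X⟧} {b : B⟦X⟧} (h : ∀ n, (coeff n a, coeff n b) ∈ R) :
    ∃ c : R⟦X⟧, fstSeries R c = a ∧ sndSeries R c = b :=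
  ⟨PowerSeries.mk fun n => ⟨_, h n⟩, by ext n; rw [fstSeries, coeff_map, coeff_mk]; rfl,
    by ext n; rw [sndSeries, coeff_map, coeff_mk]; rfl⟩

lemma coeff_mem_of_lift (c : R⟦X⟧) (n : ℕ) : (coeff n (fstSeries R c), coeff n (sndSeries R c)) ∈ R := by
  rw [fstSeries, sndSeries, coeff_map, coeff_map]
  exact (coeff n c).2

lemma constantCoeff_lift {c : R⟦X⟧} {p : Prop} [Decidable p]
    (h1 : constantCoeff (fstSeries R c) = if p then 1 else 0)
    (h2 : constantCoeff (sndSeries R c) = if p then 1 else 0) :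
    constantCoeff c = if p then 1 else 0 := by
  rw [← coeff_zero_eq_constantCoeff_apply] at *
  rw [fstSeries, coeff_map] at h1
  rw [sndSeries, coeff_map] at h2
  refine Subtype.ext (Prod.ext ?_ ?_)
  · refine Eq.trans h1 ?_
    split_ifs <;> rfl
  · refine Eq.trans h2 ?_
    split_ifs <;> rfl

lemma IsStep.const {J : Type*} [Fintype J] [DecidableEq J] {ε : ℤ}
    {H : Matrix (J ⊕ Bool) (J ⊕ Bool) A⟦X⟧} {g g' : A⟦X⟧} {H' : Matrix J J A⟦X⟧}
    (h : IsStep ε H g H' g') (hH : ∀ i j, constantCoeff (H i j) = if i = j then 1 else 0)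
    (hg : constantCoeff g = 1) :
    (∀ i j, constantCoeff (H' i j) = if i = j then 1 else 0) ∧ constantCoeff g' = 1 := by
  obtain ⟨γ, β, h1, -, -, -, h5, h6⟩ := h
  have hγ : constantCoeff γ = 1 := by
    have := congrArg constantCoeff h1
    rwa [map_mul, hg, one_mul, map_one] at this
  have hg' : constantCoeff g' = 1 := by
    rw [h5, map_mul, hγ, mul_one]
    simp [stepDet, sdet, toBlocks₂₂, opposite, constantCoeff_shiftHom, constantCoeff_reflectHom, hH]
  refine ⟨fun i j => ?_, hg'⟩
  rw [h6, map_mul, constantCoeff_shiftHom, map_mul, hγ, hg', constantCoeff_schur hH, one_mul, one_mul]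

lemma fstSeries_shiftHom (c : ℂ) (a : R⟦X⟧) :
    fstSeries R (shiftHom R c a) = shiftHom A c (fstSeries R a) :=
  map_shiftHom (fstHom R : R →+* A) (fstHom R).commutes c a

lemma sndSeries_shiftHom (c : ℂ) (a : R⟦X⟧) :
    sndSeries R (shiftHom R c a) = shiftHom B c (sndSeries R a) :=
  map_shiftHom (sndHom R : R →+* B) (sndHom R).commutes c a

section Step

variable {J : Type*} [Fintype J] [DecidableEq J] {ε : ℤ}

/-- A step of the elimination over the second factor lifts to the subalgebra. -/
lemma IsStep.exists_lift {L : Matrix (J ⊕ Bool) (J ⊕ Bool) R⟦X⟧} {l : R⟦X⟧}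
    (hL : ∀ i j, constantCoeff (L i j) = if i = j then 1 else 0) (hl : constantCoeff l = 1)
    {H' : Matrix J J B⟦X⟧} {g' : B⟦X⟧}
    (hs : IsStep ε (L.map (sndSeries R)) (sndSeries R l) H' g') :
    ∃ (L' : Matrix J J R⟦X⟧) (l' : R⟦X⟧),
      IsStep ε (L.map (fstSeries R)) (fstSeries R l) (L'.map (fstSeries R)) (fstSeries R l') ∧
      L'.map (sndSeries R) = H' ∧ sndSeries R l' = g' ∧
      (∀ i j, constantCoeff (L' i j) = if i = j then 1 else 0) ∧ constantCoeff l' = 1 := by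
  obtain ⟨L', l', h⟩ := exists_isStep (ε := ε) hL hl
  obtain ⟨h1, h2⟩ := (h.map (sndHom R)).unique hs
  obtain ⟨h3, h4⟩ := h.const hL hl
  exact ⟨L', l', h.map (fstHom R), h1, h2, h3, h4⟩

/-- The lift of a first step of the elimination from the lifts of the Schur complement and of the
factor. -/
lemma exists_isStep_lift {S : Matrix (J ⊕ Bool) (J ⊕ Bool) A⟦X⟧} {β : Matrix Bool Bool A⟦X⟧}
    (h1 : S.toBlocks₂₂ * β = 1) (h2 : β * S.toBlocks₂₂ = 1) {V : Matrix J J R⟦X⟧}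
    (hV : V.map (fstSeries R) = schur S β) {T : Matrix J J B⟦X⟧}
    (hV' : V.map (sndSeries R) = T.map (shiftHom B 1)) {l : R⟦X⟧} (hl : fstSeries R l = stepDet ε S)
    (hl' : sndSeries R l = 1) :
    ∃ L : Matrix J J R⟦X⟧, IsStep ε S 1 (L.map (fstSeries R)) (fstSeries R l) ∧
      L.map (sndSeries R) = T := by
  refine ⟨Matrix.of fun i j => l * shiftHom R (-1) (V i j), ⟨1, β, one_mul 1, one_mul 1, h1, h2, ?_,
    fun i j => ?_⟩, ?_⟩
  · rw [hl, mul_one]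
  · rw [map_apply, of_apply, map_mul, one_mul, ← hV, map_apply, fstSeries_shiftHom]
  · ext i j : 1
    rw [map_apply, of_apply, map_mul, hl', one_mul, sndSeries_shiftHom,
      ← map_apply (f := sndSeries R), hV', map_apply, shiftHom_shiftHom, neg_add_cancel,
      shiftHom_zero]

end Step

lemma constantCoeff_lift_one {c : R⟦X⟧} (h1 : constantCoeff (fstSeries R c) = 1)
    (h2 : constantCoeff (sndSeries R c) = 1) : constantCoeff c = 1 := by
  have h := constantCoeff_lift (c := c) (p := True) (by rw [h1, if_pos trivial])
    (by rw [h2, if_pos trivial])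
  rwa [if_pos trivial] at h

/-- The lift of the inverse of a matrix from a lift of the matrix. -/
lemma exists_inverse_lift {J : Type*} [Fintype J] [DecidableEq J] {G G' : Matrix J J A⟦X⟧}
    {T T' : Matrix J J B⟦X⟧}
    (hG : ∀ i j, constantCoeff (G i j) = if i = j then 1 else 0)
    (hT : ∀ i j, constantCoeff (T i j) = if i = j then 1 else 0)
    (hGT : ∀ i j n, (coeff n (G i j), coeff n (T i j)) ∈ R) (hG' : G * G' = 1) (hT' : T * T' = 1) :
    ∃ V : Matrix J J R⟦X⟧, V.map (fstSeries R) = G' ∧ V.map (sndSeries R) = T' := by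
  have hL := fun i j => exists_series_lift (hGT i j)
  choose L hL1 hL2 using hL
  obtain ⟨V, hLV, hVL, -⟩ := exists_inverse (S := Matrix.of L) fun i j =>
    constantCoeff_lift ((congrArg _ (hL1 i j)).trans (hG i j)) ((congrArg _ (hL2 i j)).trans (hT i j))
  refine ⟨V, ?_, ?_⟩
  · have e1 := map_mul_eq_one (fstSeries R) hVL
    have e2 : (Matrix.of L).map (fstSeries R) = G := Matrix.ext hL1
    rw [e2] at e1
    exact left_inv_eq_right_inv e1 hG'
  · have e1 := map_mul_eq_one (sndSeries R) hVL
    have e2 : (Matrix.of L).map (sndSeries R) = T := Matrix.ext hL2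
    rw [e2] at e1
    exact left_inv_eq_right_inv e1 hT'

/-- The series with coefficients in a left ideal. -/
def seriesIdeal (I : Ideal A) : Ideal A⟦X⟧ where
  carrier := {a | ∀ n, coeff n a ∈ I}
  add_mem' ha hb n := by
    rw [map_add]
    exact I.add_mem (ha n) (hb n)
  zero_mem' n := by
    rw [map_zero]
    exact I.zero_mem
  smul_mem' c a ha n := by
    rw [smul_eq_mul, coeff_mul]
    exact sum_mem fun p _ => I.mul_mem_left _ (ha _)

lemma smul_C_mem_seriesIdeal {I : Ideal A} {x : A} (hx : x ∈ I) (f : ℂ⟦X⟧) :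
    f • C x ∈ seriesIdeal I := by
  rw [← toSeries_mul]
  refine Ideal.mul_mem_left _ _ fun n => ?_
  rw [coeff_C]
  split_ifs
  · exact hx
  · exact I.zero_mem

lemma constantCoeff_classicalMatrix {ε : ℤ} {ι : Type*} [DecidableEq ι] (F : ι → ι → A) (i j : ι) :
    constantCoeff (classicalMatrix ε F i j) = if i = j then 1 else 0 := by
  rw [← coeff_zero_eq_constantCoeff_apply, coeff_classicalMatrix, coeff_zero_eq_constantCoeff_apply,
    constantCoeff_invShift]
  simp

lemma shiftHom_invShift (b c : ℂ) : shiftHom ℂ b (invShift c) = invShift (b + c) := by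
  rw [← shiftHom_complex_X, shiftHom_shiftHom_X, shiftHom_complex_X]

lemma exists_inv_one_add_invShift (c : ℂ) :
    ∃ w : ℂ⟦X⟧, w * (1 + invShift c) = 1 ∧ w * invShift c = invShift (1 + c) := by
  have hu : IsUnit (1 + invShift c) := by
    rw [isUnit_iff_constantCoeff, map_add, constantCoeff_invShift]
    simp
  obtain ⟨w, hw⟩ := hu.exists_left_inv
  refine ⟨w, hw, mul_left_cancel₀ (one_add_mul_ne_zero (1 + c))
    (mul_left_cancel₀ (one_add_mul_ne_zero c) ?_)⟩
  have h1 := one_add_mul_invShift c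
  have h2 := one_add_mul_invShift (1 + c)
  rw [map_add, map_one] at h2 ⊢
  linear_combination ((1 + (1 + C c) * X) * w - X * w) * h1 - (1 + C c * X) * h2 + X * (1 + C c * X) * hw

end Lifting

section Compatibility

open PowerSeries

attribute [local instance 50] seriesAlgebra

lemma IsClassical.submatrix {ε : ℤ} {ι ι' A : Type*} [DecidableEq ι] [DecidableEq ι'] [Ring A]
    {σ : SignedIndex ε ι} {F : ι → ι → A} (hF : IsClassical σ F) {σ' : SignedIndex ε ι'} (f : ι' ≃ ι)
    (hν : ∀ i, f (σ'.ν i) = σ.ν (f i)) (he : ∀ i, σ'.e i = σ.e (f i)) :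
    IsClassical σ' fun i j => F (f i) (f j) where
  symm i j := by rw [hν, hν, hF.symm, he, he]
  comm i j k l := by
    have h := hF.comm (f i) (f j) (f k) (f l)
    simp only [← hν, ← he, f.apply_eq_iff_eq] at h
    exact h

section Entries

variable (t : Kind) (N : ℕ)

/-- The generators of the larger algebra, the two extreme indices being split off. -/
noncomputable def splitF (i j : Idx N ⊕ Bool) : (U t (N + 2))⟦X⟧ := C (FU t (splitIdx N i) (splitIdx N j))

/-- The matrix `F(u)` of the larger algebra, the two extreme indices being split off. -/
noncomputable def splitS : Matrix (Idx N ⊕ Bool) (Idx N ⊕ Bool) (U t (N + 2))⟦X⟧ :=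
  (fMatrix t (N + 2)).submatrix (splitIdx N) (splitIdx N)

variable {t N}

lemma isClassical_splitF (h : t = .symplectic → Even N) (h₂ : t = .symplectic → Even (N + 2)) :
    IsClassical ((idxSigned t N h).sum (boolIndex t.sgn t.sgn_mul_sgn)) (splitF t N) :=
  ((isClassical_FU h₂).submatrix (splitIdx N) (splitIdx_ν h h₂) (splitIdx_e h h₂)).map C

lemma splitS_apply (i j : Idx N ⊕ Bool) :
    splitS t N i j = (if i = j then 1 else 0) + invShift ((t.sgn : ℂ) / 2) • splitF t N i j := by
  rw [splitS, submatrix_apply, fMatrix_eq, classicalMatrix, of_apply]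
  simp only [(splitIdx N).apply_eq_iff_eq]
  rfl

lemma constantCoeff_splitS (i j : Idx N ⊕ Bool) :
    constantCoeff (splitS t N i j) = if i = j then 1 else 0 := by
  rw [splitS, submatrix_apply, fMatrix_eq, constantCoeff_classicalMatrix]
  simp only [(splitIdx N).apply_eq_iff_eq]

lemma FU_top_mem (i : Idx (N + 2)) : FU t i (topIdx N) ∈ leftIdeal t (N + 2) :=
  Ideal.subset_span ⟨i, topIdx N, by simp [topIdx], rfl⟩

lemma smul_splitF_mem (i : Idx N ⊕ Bool) (f : ℂ⟦X⟧) :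
    f • splitF t N i (Sum.inr true) ∈ seriesIdeal (leftIdeal t (N + 2)) :=
  smul_C_mem_seriesIdeal (FU_top_mem _) f

lemma shiftHom_fMatrix (i j : Idx N) : shiftHom _ 1 (fMatrix t N i j) =
    (if i = j then 1 else 0) + invShift (1 + (t.sgn : ℂ) / 2) • C (FU t i j) := by
  rw [fMatrix_eq, classicalMatrix, of_apply, map_add, shiftHom_smul, shiftHom_invShift, shiftHom_C,
    apply_ite (shiftHom _ 1), map_one, map_zero]

/-- The canonical homomorphism on series. -/
noncomputable def inclSeries (t : Kind) (N : ℕ) : (U t N)⟦X⟧ →+* (U t (N + 2))⟦X⟧ :=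
  PowerSeries.map (UIncl t N : U t N →+* U t (N + 2))

lemma inclSeries_shiftHom_fMatrix (i j : Idx N) : inclSeries t N (shiftHom _ 1 (fMatrix t N i j)) =
    (if i = j then 1 else 0) + invShift (1 + (t.sgn : ℂ) / 2) • splitF t N (Sum.inl i) (Sum.inl j) := by
  rw [shiftHom_fMatrix, map_add, apply_ite (inclSeries t N), map_one, map_zero, inclSeries,
    map_series_smul (UIncl t N : U t N →+* U t (N + 2)) (UIncl t N).commutes, map_C]
  congr 3
  exact UIncl_FU i j

lemma inverse_splitS_mem (h : t = .symplectic → Even N) (h₂ : t = .symplectic → Even (N + 2))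
    {G : Matrix (Idx N ⊕ Bool) (Idx N ⊕ Bool) (U t (N + 2))⟦X⟧} (hSG : splitS t N * G = 1)
    (hGS : G * splitS t N = 1) {Ψ : Matrix (Idx N) (Idx N) (U t N)⟦X⟧}
    (hΨ : Ψ * (fMatrix t N).map (shiftHom _ 1) = 1) (i j : Idx N) :
    G (Sum.inl i) (Sum.inl j) - inclSeries t N (Ψ i j) ∈ seriesIdeal (leftIdeal t (N + 2)) := by
  obtain ⟨w, hw, hwκ⟩ := exists_inv_one_add_invShift ((t.sgn : ℂ) / 2)
  have hP : Ψ.map (inclSeries t N) * (Matrix.of fun i j => (if i = j then 1 else 0) +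
      (w * invShift ((t.sgn : ℂ) / 2)) • splitF t N (Sum.inl i) (Sum.inl j)) = 1 := by
    rw [← map_mul_eq_one (inclSeries t N) hΨ]
    congr 1
    ext i j : 1
    rw [of_apply, map_apply, map_apply, inclSeries_shiftHom_fMatrix, hwκ]
  refine inverse_sub_mem (isClassical_splitF h h₂) splitS_apply hSG hGS (fun i => ?_) (fun z => ?_) hw hP i j
  · have h1 := smul_splitF_mem (t := t) i 1
    rwa [one_smul] at h1
  · rw [isUnit_iff_constantCoeff, map_add, map_mul, constantCoeff_invShift]
    simp

lemma stepDet_splitS_sub_mem : stepDet t.sgn (splitS t N) - 1 ∈ seriesIdeal (leftIdeal t (N + 2)) := by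
  have m2 : opposite (U t (N + 2)) 1 (splitS t N (Sum.inr true) (Sum.inr true)) =
      1 + opposite ℂ 1 (invShift ((t.sgn : ℂ) / 2)) • splitF t N (Sum.inr true) (Sum.inr true) := by
    rw [splitS_apply, if_pos rfl, map_add, map_one, opposite_smul]
    congr 2
    rw [splitF, opposite, RingHom.comp_apply, reflectHom_C, shiftHom_C]
  have m3 : splitS t N (Sum.inr true) (Sum.inr true) - 1 ∈ seriesIdeal (leftIdeal t (N + 2)) := by
    rw [splitS_apply, if_pos rfl, add_sub_cancel_left]
    exact smul_splitF_mem _ _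
  have m4 : splitS t N (Sum.inr false) (Sum.inr true) ∈ seriesIdeal (leftIdeal t (N + 2)) := by
    rw [splitS_apply, if_neg (by simp), zero_add]
    exact smul_splitF_mem _ _
  have m5 : opposite (U t (N + 2)) 1 (splitS t N (Sum.inr true) (Sum.inr true)) - 1 ∈
      seriesIdeal (leftIdeal t (N + 2)) := by
    rw [m2, add_sub_cancel_left]
    exact smul_splitF_mem _ _
  have m6 := sub_mem (add_mem (Ideal.mul_mem_left _
    (opposite (U t (N + 2)) 1 (splitS t N (Sum.inr true) (Sum.inr true))) m3) m5)
    (zsmul_mem (Ideal.mul_mem_left _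
      (opposite (U t (N + 2)) 1 (splitS t N (Sum.inr true) (Sum.inr false))) m4) t.sgn)
  rw [mul_sub, mul_one, sub_add_sub_cancel, sub_right_comm] at m6
  exact m6

lemma mem_congrAlg_of_sub_mem {h₂ : t = .symplectic → Even (N + 2)} {a : (U t (N + 2))⟦X⟧}
    {b : (U t N)⟦X⟧} (hab : a - inclSeries t N b ∈ seriesIdeal (leftIdeal t (N + 2))) (n : ℕ) :
    (coeff n a, coeff n b) ∈ congrAlg t N h₂ := by
  have h1 := hab n
  rw [map_sub, inclSeries, coeff_map] at h1
  exact h1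

lemma exists_lift_schur (h : t = .symplectic → Even N) (h₂ : t = .symplectic → Even (N + 2))
    {β : Matrix Bool Bool (U t (N + 2))⟦X⟧} (hβ : (splitS t N).toBlocks₂₂ * β = 1) :
    ∃ V : Matrix (Idx N) (Idx N) (congrAlg t N h₂)⟦X⟧,
      V.map (fstSeries (congrAlg t N h₂)) = schur (splitS t N) β ∧
      V.map (sndSeries (congrAlg t N h₂)) = (fMatrix t N).map (shiftHom _ 1) := by
  obtain ⟨G, hSG, hGS, hG0⟩ := exists_inverse (constantCoeff_splitS (t := t) (N := N))
  have hΦ0 : ∀ i j, constantCoeff ((fMatrix t N).map (shiftHom _ 1) i j) = if i = j then 1 else 0 :=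
    fun i j => by
      rw [map_apply, constantCoeff_shiftHom, fMatrix_eq, constantCoeff_classicalMatrix]
  obtain ⟨Ψ, hΦΨ, hΨΦ, hΨ0⟩ := exists_inverse hΦ0
  refine exists_inverse_lift (G := G.toBlocks₁₁) (T := Ψ) (fun i j => ?_) hΨ0
    (fun i j => mem_congrAlg_of_sub_mem (inverse_splitS_mem h h₂ hSG hGS hΨΦ i j))
    (mul_schur hGS hβ) hΨΦ
  refine (hG0 _ _).trans ?_
  simp only [Sum.inl.injEq]

end Entries

variable {t : Kind} {N : ℕ} (h : t = .symplectic → Even N) (h₂ : t = .symplectic → Even (N + 2))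

include h in
/-- The first step of the elimination for `F(u)` is congruent to the matrix `F(u)` of the smaller
algebra. -/
lemma exists_lift_fMatrix : ∃ (H : Matrix (Idx N) (Idx N) (congrAlg t N h₂)⟦X⟧)
    (g : (congrAlg t N h₂)⟦X⟧),
    IsStep t.sgn (splitS t N) 1 (H.map (fstSeries (congrAlg t N h₂))) (fstSeries (congrAlg t N h₂) g) ∧
    H.map (sndSeries (congrAlg t N h₂)) = fMatrix t N ∧ sndSeries (congrAlg t N h₂) g = 1 := by
  obtain ⟨β, h3, h4, -⟩ := exists_inverse (S := (splitS t N).toBlocks₂₂) fun x y => by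
    have := constantCoeff_splitS (t := t) (N := N) (.inr x) (.inr y)
    simpa only [toBlocks₂₂, of_apply, Sum.inr.injEq] using this
  obtain ⟨V, hV1, hV2⟩ := exists_lift_schur h h₂ h3
  obtain ⟨g, hg1, hg2⟩ := exists_series_lift (mem_congrAlg_of_sub_mem (h₂ := h₂) (b := 1) (by
    rw [map_one]
    exact stepDet_splitS_sub_mem (t := t) (N := N)))
  obtain ⟨L, hL1, hL2⟩ := exists_isStep_lift (ε := t.sgn) h3 h4 hV1 hV2 hg1 hg2
  exact ⟨L, g, hL1, hL2, hg2⟩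

include h in
/-- The elimination for the smaller algebra lifts to the elimination for the larger one. -/
lemma Reduces.exists_lift {d q : ℕ} {H : Matrix (Idx q) (Idx q) (U t N)⟦X⟧} {g : (U t N)⟦X⟧}
    (hr : Reduces t (fMatrix t N) d q H g) :
    ∃ (L : Matrix (Idx q) (Idx q) (congrAlg t N h₂)⟦X⟧) (l : (congrAlg t N h₂)⟦X⟧),
      Reduces t (fMatrix t (N + 2)) (d + 1) q (L.map (fstSeries (congrAlg t N h₂)))
        (fstSeries (congrAlg t N h₂) l) ∧
      L.map (sndSeries (congrAlg t N h₂)) = H ∧ sndSeries (congrAlg t N h₂) l = g ∧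
      (∀ i j, constantCoeff (L i j) = if i = j then 1 else 0) ∧ constantCoeff l = 1 := by
  induction hr with
  | refl =>
    obtain ⟨L, l, h1, h2, h3⟩ := exists_lift_fMatrix h h₂
    obtain ⟨h4, h5⟩ := h1.const constantCoeff_splitS (map_one _)
    refine ⟨L, l, .step .refl h1, h2, h3, fun i j => constantCoeff_lift (h4 i j) ?_,
      constantCoeff_lift_one h5 (by rw [h3, map_one])⟩
    rw [← map_apply (f := sndSeries (congrAlg t N h₂)), h2, fMatrix_eq,
      constantCoeff_classicalMatrix]
  | @step d q H g H' g' hr hs ih =>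
    obtain ⟨L, l, h1, rfl, rfl, h4, h5⟩ := ih
    have h4' : ∀ i j, constantCoeff (L (splitIdx q i) (splitIdx q j)) = if i = j then 1 else 0 :=
      fun i j => (h4 _ _).trans (by simp only [(splitIdx q).apply_eq_iff_eq])
    obtain ⟨L', l', h6, h7⟩ := IsStep.exists_lift (R := congrAlg t N h₂)
      (L := L.submatrix (splitIdx q) (splitIdx q)) h4' h5 hs
    exact ⟨L', l', .step h1 h6, h7⟩

/-- The homomorphisms `ψ_N` are compatible with the projections `π_N`. -/
lemma IsProjection.comp_psi {M k : ℕ} (hM : t = .symplectic → Even M)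
    {p : centralizerAlg t M (M + 2 * k + 2) →ₐ[ℂ] centralizerAlg t M (M + 2 * k)}
    (hp : IsProjection t M (M + 2 * k) p)
    {ψ' : Y t M →ₐ[ℂ] centralizerAlg t M (M + 2 * (k + 1))} (hψ' : IsPsi t M (k + 1) ψ')
    {ψ : Y t M →ₐ[ℂ] centralizerAlg t M (M + 2 * k)} (hψ : IsPsi t M k ψ) : p.comp ψ' = ψ := by
  have h₂ : t = .symplectic → Even (M + 2 * k + 2) := even_add hM (k + 1)
  obtain ⟨H, g, hr⟩ := exists_psi_reduces hM k
  obtain ⟨L, l, h1, h2, -⟩ := hr.exists_lift (even_add hM k) h₂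
  refine AlgHom.ext_of_adjoin_eq_top (adjoin_coeff_sSeries t M) ?_
  rintro _ ⟨i, j, r, rfl⟩
  refine Subtype.ext (congrAlg_unique (h := h₂) (hp _) ?_)
  have h3 : (ψ' (coeff r (sSeries t i j)) : U t (M + 2 * (k + 1))) =
      coeff r (L.map (fstSeries (congrAlg t (M + 2 * k) h₂)) i j) := by
    rw [hψ'.coeff_eq]
    exact congrArg (coeff r) (Reduces.psiSeries_eq hM (k + 1) h1 i j)
  have h4 : (ψ (coeff r (sSeries t i j)) : U t (M + 2 * k)) =
      coeff r (L.map (sndSeries (congrAlg t (M + 2 * k) h₂)) i j) := by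
    rw [hψ.coeff_eq, h2]
    exact congrArg (coeff r) (Reduces.psiSeries_eq hM k hr i j)
  have h5 := coeff_mem_of_lift (L i j) r
  rw [h4]
  exact (congrArg (fun x => (x, _) ∈ congrAlg t (M + 2 * k) h₂) h3).mpr h5

end Compatibility

section Limit

variable {t : Kind} {M : ℕ}

lemma mem_olshanskiAlg
    {p : ∀ k : ℕ, centralizerAlg t M (M + 2 * k + 2) →ₐ[ℂ] centralizerAlg t M (M + 2 * k)}
    {a : ∀ k : ℕ, centralizerAlg t M (M + 2 * k)} : a ∈ olshanskiAlg t M p ↔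
      (∀ k, p k (a (k + 1)) = a k) ∧ ∃ d, ∀ k, (a k : U t (M + 2 * k)) ∈ UFil t _ d := Iff.rfl

/-- The homomorphism to the projective limit. -/
lemma exists_limit_hom
    {p : ∀ k : ℕ, centralizerAlg t M (M + 2 * k + 2) →ₐ[ℂ] centralizerAlg t M (M + 2 * k)}
    {ψ : ∀ k : ℕ, Y t M →ₐ[ℂ] centralizerAlg t M (M + 2 * k)} (hψ : ∀ k, IsPsi t M k (ψ k))
    (hc : ∀ k, (p k).comp (ψ (k + 1)) = ψ k) :
    ∃ Ψ : Y t M →ₐ[ℂ] olshanskiAlg t M p,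
      ∀ y k, (Ψ y : ∀ k : ℕ, centralizerAlg t M (M + 2 * k)) k = ψ k y := by
  have hm : ∀ y, (AlgHom.pi ψ : Y t M →ₐ[ℂ] ∀ k : ℕ, centralizerAlg t M (M + 2 * k)) y ∈
      olshanskiAlg t M p := fun y =>
    mem_olshanskiAlg.2 ⟨fun k => AlgHom.congr_fun (hc k) y, IsPsi.bounded hψ y⟩
  exact ⟨(AlgHom.pi ψ).codRestrict _ hm, fun y k => rfl⟩

end Limit

end TwistedYangian

theorem proposition5p1 (t : TwistedYangian.Kind) (M : ℕ)
    (hM : t = TwistedYangian.Kind.symplectic → Even M) :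
    ∃ (π : ∀ k : ℕ, TwistedYangian.centralizerAlg t M (M + 2 * k + 2) →ₐ[ℂ]
          TwistedYangian.centralizerAlg t M (M + 2 * k))
      (ψ : ∀ k : ℕ, TwistedYangian.Y t M →ₐ[ℂ] TwistedYangian.centralizerAlg t M (M + 2 * k))
      (Ψ : TwistedYangian.Y t M →ₐ[ℂ] TwistedYangian.olshanskiAlg t M π),
      (∀ k π', TwistedYangian.IsProjection t M (M + 2 * k) π' ↔ π' = π k) ∧
      (∀ k ψ', TwistedYangian.IsPsi t M k ψ' ↔ ψ' = ψ k) ∧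
      (∀ k, (π k).comp (ψ (k + 1)) = ψ k) ∧
      (∀ y k, (Ψ y : ∀ k : ℕ, TwistedYangian.centralizerAlg t M (M + 2 * k)) k = ψ k y) := by
  have hN : ∀ k, t = .symplectic → Even (M + 2 * k + 2) := fun k =>
    TwistedYangian.even_add hM (k + 1)
  choose π hπ using fun k =>
    TwistedYangian.exists_isProjection (hN k) (show M ≤ M + 2 * k from Nat.le_add_right _ _)
  choose ψ hψ using fun k => TwistedYangian.exists_isPsi hM k
  have hc : ∀ k, (π k).comp (ψ (k + 1)) = ψ k := fun k => (hπ k).comp_psi hM (hψ (k + 1)) (hψ k)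
  obtain ⟨Ψ, hΨ⟩ := TwistedYangian.exists_limit_hom hψ hc
  refine ⟨π, ψ, Ψ, fun k π' => ⟨fun h => h.unique (hN k) (hπ k), ?_⟩,
    fun k ψ' => ⟨fun h => TwistedYangian.IsPsi.unique k (hψ k) h, ?_⟩, hc, hΨ⟩
  · rintro rfl
    exact hπ k
  · rintro rfl
    exact hψ k
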